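/- Let $M$ be a smooth 3-manifold without boundary (Hausdorff, second countable, not necessarily compact) with an orientation, and let $(\xi,\eta)$ be a bi-contact structure on $M$: $\xi=\ker\alpha$ and $\eta=\ker\beta$ for smooth global contact forms $\alpha,\beta$, the planes $\xi_x,\eta_x$ are transverse at every point $x$, and one of $\xi,\eta$ is a positive and the other a negative contact structure. Let $X$ be a smooth vector field spanning the line field $\xi\cap\eta$. Let $K\subset M$ be a smoothly embedded circle which is Legendrian for $\xi$ (tangent to $\xi$) and transverse to $\eta$. Then there is an embedded annulus $C\cong S^1\times[-\varepsilon,\varepsilon]$ in $M$ with core $K$, together with a flow box $\Lambda\cong S^1\times(-\varepsilon_1,\varepsilon_1)\times(-\tau,\tau)$, $\varepsilon_1>\varepsilon$, with coordinates $(s,w,t)$, $C=\{|w|\le\varepsilon,\ t=0\}$ and $X=\partial_t$ (so $C$ is transverse to the flow of $X$), such that $(\partial_w,\partial_s,\partial_t)$ is positively oriented, $\partial_w$ is transverse to $\xi$ along $K$ (so the framing of $K$ given by $C$ is the contact framing of $\xi$), and the following holds. Let $q$ be any integer with $q\ge 0$ if $\eta$ is positive, and with $q\le 0$ if $\eta$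 is negative. Let $g:\mathbb R\to[0,2\pi]$ be any smooth non-decreasing function which is $0$ on $(-\infty,-1]$ and $2\pi$ on $[1,\infty)$, and let $F(s,w)=(s+q\,g(w/\varepsilon),w)$, $s\in\mathbb R/2\pi\mathbb Z$. Cut $M$ along $C$ and glue the side $t\le 0$ of $C$ to the side $t\ge 0$ by the shear $F$. This gives a smooth 3-manifold $\tilde M$, which contains a copy of $M\setminus C$ and carries an orientation and a smooth vector field $\tilde X$ that extend those of $M\setminus C$. Moreover: 1. $\tilde M$ is the result of $(1,q)$-Dehn surgery on $M$ along $K$ with respect to the contact framing of $\xi$, i.e. the meridian of the new solid torus is glued to $\mu+q\lambda$, where $\mu$ is the meridian of $K$, $\lambda$ the push-off of $K$ transverse to $\xi$, and $\mu\cdot\lambda=1$. 2. $\tilde M$ carries a bi-contact structure $(\tilde\xi,\tilde\eta)$ with $\tilde\xi\cap\tilde\eta$ spanned by $\tilde X$, such that $\tilde\xi=\xi$ and $\tilde\eta=\eta$ outside $\Lambda$, and $\tilde\eta$ has the same sign as $\eta$ (hence $\tilde\xi$ has the same sign as $\xi$). 3. If $M$ is compact, then $\tilde M$ is compact and the flow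 $\phi^t$ of $\tilde X$ is projectively Anosov: there are a $D\phi^t$-invariant splitting $T\tilde M/\langle\tilde X\rangle=\mathcal E^u\oplus\mathcal E^s$ into line bundles and constants $A,B>0$ such that, for the quotient norm of a Riemannian metric on $\tilde M$, $$\frac{\|D\phi^t v^u\|}{\|D\phi^t v^s\|}\ \ge\ Ae^{Bt}\,\frac{\|v^u\|}{\|v^s\|}\qquad\text{for all } t\ge 0,\ x\in\tilde M \text{ and nonzero } v^u\in\mathcal E^u_x,\ v^s\in\mathcal E^s_x .$$ -/

import Mathlib

open scoped Manifold ContDiff Bundle Topology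

universe u

noncomputable section

/-! ### One-forms, orientations and contact forms on a 3-manifold -/

section Contact

variable {M : Type u} [TopologicalSpace M] [ChartedSpace (EuclideanSpace ℝ (Fin 3)) M]

/-- Smoothness of a vector field, as a section of the tangent bundle. -/
def IsSmoothVectorField [IsManifold (𝓡 3) ∞ M]
    (X : ∀ x : M, TangentSpace (𝓡 3) x) : Prop :=
  ContMDiff (𝓡 3) (𝓡 3).tangent ∞ (fun x => (⟨x, X x⟩ : TangentBundle (𝓡 3) M))

/-- Smoothness of a 1-form, as a section of the cotangent bundle. -/
def IsSmoothOneForm [IsManifold (𝓡 3) ∞ M]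
    (α : ∀ x : M, TangentSpace (𝓡 3) x →L[ℝ] ℝ) : Prop :=
  ContMDiff (𝓡 3) ((𝓡 3).prod 𝓘(ℝ, EuclideanSpace ℝ (Fin 3) →L[ℝ] ℝ)) ∞
    (fun x => Bundle.TotalSpace.mk' (EuclideanSpace ℝ (Fin 3) →L[ℝ] ℝ)
      (E := fun x : M => TangentSpace (𝓡 3) x →L[ℝ] Bundle.Trivial M ℝ x) x (α x))

/-- The 1-form `α` written in the preferred chart at `x`: its pull-back to the model space
`ℝ³` by the inverse of the chart. -/
def oneFormInChart (α : ∀ x : M, TangentSpace (𝓡 3) x →L[ℝ] ℝ) (x : M)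
    (y : EuclideanSpace ℝ (Fin 3)) : EuclideanSpace ℝ (Fin 3) →L[ℝ] ℝ :=
  (α ((extChartAt (𝓡 3) x).symm y)).comp
    (mfderiv 𝓘(ℝ, EuclideanSpace ℝ (Fin 3)) (𝓡 3) (extChartAt (𝓡 3) x).symm y)

/-- The exterior derivative `dα` at `x`, computed in the preferred chart at `x` by
`dα(u, v) = (D_u α)(v) - (D_v α)(u)`. -/
def oneFormExtDeriv (α : ∀ x : M, TangentSpace (𝓡 3) x →L[ℝ] ℝ) (x : M)
    (u v : TangentSpace (𝓡 3) x) : ℝ :=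
  let D := fderiv ℝ (oneFormInChart α x) (extChartAt (𝓡 3) x x)
  let e := mfderiv (𝓡 3) 𝓘(ℝ, EuclideanSpace ℝ (Fin 3)) (extChartAt (𝓡 3) x) x
  D (e u) (e v) - D (e v) (e u)

/-- The 3-form `α ∧ dα` at `x`, evaluated on three tangent vectors. -/
def contactVolume (α : ∀ x : M, TangentSpace (𝓡 3) x →L[ℝ] ℝ) (x : M)
    (u v w : TangentSpace (𝓡 3) x) : ℝ :=
  α x u * oneFormExtDeriv α x v w + α x v * oneFormExtDeriv α x w u
    + α x w * oneFormExtDeriv α x u v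

/-- `(u, v, w)` is a positively oriented basis of the tangent space at `x`. -/
def IsPositiveTriple (o : ∀ x : M, Orientation ℝ (TangentSpace (𝓡 3) x) (Fin 3)) (x : M)
    (u v w : TangentSpace (𝓡 3) x) : Prop :=
  ∃ b : Module.Basis (Fin 3) ℝ (TangentSpace (𝓡 3) x),
    b.orientation = o x ∧ b 0 = u ∧ b 1 = v ∧ b 2 = w

/-- `ker α` is a positive contact structure, with contact form `α`: the form `α ∧ dα` is a
positive volume form. (As `α` is smooth, this makes the family `o` of orientations of the
tangent spaces continuous.) -/
def IsPositiveContactForm [IsManifold (𝓡 3) ∞ M]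
    (o : ∀ x : M, Orientation ℝ (TangentSpace (𝓡 3) x) (Fin 3))
    (α : ∀ x : M, TangentSpace (𝓡 3) x →L[ℝ] ℝ) : Prop :=
  IsSmoothOneForm α ∧
    ∀ (x : M) (u v w : TangentSpace (𝓡 3) x),
      IsPositiveTriple o x u v w → 0 < contactVolume α x u v w

/-- `ker α` is a negative contact structure, with contact form `α`. -/
def IsNegativeContactForm [IsManifold (𝓡 3) ∞ M]
    (o : ∀ x : M, Orientation ℝ (TangentSpace (𝓡 3) x) (Fin 3))
    (α : ∀ x : M, TangentSpace (𝓡 3) x →L[ℝ] ℝ) : Prop :=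
  IsSmoothOneForm α ∧
    ∀ (x : M) (u v w : TangentSpace (𝓡 3) x),
      IsPositiveTriple o x u v w → contactVolume α x u v w < 0

/-- `(ker α, ker β)` is a bi-contact structure with defining contact forms `α`, `β`: two
contact structures of opposite signs which are transverse to each other at every point. -/
def IsBiContact [IsManifold (𝓡 3) ∞ M]
    (o : ∀ x : M, Orientation ℝ (TangentSpace (𝓡 3) x) (Fin 3))
    (α β : ∀ x : M, TangentSpace (𝓡 3) x →L[ℝ] ℝ) : Prop :=
  ((IsNegativeContactForm o α ∧ IsPositiveContactForm o β) ∨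
    (IsPositiveContactForm o α ∧ IsNegativeContactForm o β)) ∧
  ∀ x : M, LinearIndependent ℝ ![α x, β x]

/-- `X` is a smooth vector field which spans the line field `ker α ∩ ker β`; its flow is the
flow defined by the bi-contact structure (unique up to reparametrization). -/
def IsDefinedBy [IsManifold (𝓡 3) ∞ M] (X : ∀ x : M, TangentSpace (𝓡 3) x)
    (α β : ∀ x : M, TangentSpace (𝓡 3) x →L[ℝ] ℝ) : Prop :=
  IsSmoothVectorField X ∧ ∀ x : M, X x ≠ 0 ∧ α x (X x) = 0 ∧ β x (X x) = 0

/-- `K` is a knot, i.e. a smoothly embedded circle, which is Legendrian for `ker α` and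
transverse to `ker β`. (A transverse curve is immersed; the circle being compact, an
injective immersion is an embedding.) -/
def IsLegendrianTransverseKnot (α β : ∀ x : M, TangentSpace (𝓡 3) x →L[ℝ] ℝ)
    (K : Circle → M) : Prop :=
  ContMDiff (𝓡 1) (𝓡 3) ∞ K ∧ Function.Injective K ∧
    (∀ (z : Circle) (v : TangentSpace (𝓡 1) z), α (K z) (mfderiv (𝓡 1) (𝓡 3) K z v) = 0) ∧
    (∀ (z : Circle) (v : TangentSpace (𝓡 1) z), v ≠ 0 →
      β (K z) (mfderiv (𝓡 1) (𝓡 3) K z v) ≠ 0)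

end Contact

/-! ### Projectively Anosov flows -/

section ProjectivelyAnosov

variable {M : Type u} [TopologicalSpace M] [ChartedSpace (EuclideanSpace ℝ (Fin 3)) M]
  [IsManifold (𝓡 3) ∞ M]

/-- The norm of the class of `v` in the quotient `T_x M / ⟨X⟩`, induced by the metric `g`. -/
def quotientNorm
    (g : Bundle.ContMDiffRiemannianMetric (𝓡 3) ∞ (EuclideanSpace ℝ (Fin 3))
      (fun x : M => TangentSpace (𝓡 3) x))
    (X : ∀ x : M, TangentSpace (𝓡 3) x) (x : M) (v : TangentSpace (𝓡 3) x) : ℝ :=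
  ⨅ c : ℝ, Real.sqrt (g.inner x (v + c • X x) (v + c • X x))

/-- The vector field `X` generates a projectively Anosov flow `φ`: there is a splitting of
`TM / ⟨X⟩` into two line bundles, invariant under `Dφ`, the first of which dominates the
second one. The line bundles are given by their preimages `Eu`, `Es` in `TM`, which are
invariant plane fields that intersect in `⟨X⟩`. (To be used for compact `M`.) -/
def IsProjectivelyAnosov (X : ∀ x : M, TangentSpace (𝓡 3) x) : Prop :=
  ∃ φ : ℝ → M → M,
    ContMDiff (𝓘(ℝ, ℝ).prod (𝓡 3)) (𝓡 3) 1 (fun p : ℝ × M => φ p.1 p.2) ∧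
    (∀ x, φ 0 x = x) ∧
    (∀ x, IsMIntegralCurve (fun t => φ t x) X) ∧
    ∃ (Eu Es : ∀ x : M, Submodule ℝ (TangentSpace (𝓡 3) x))
      (g : Bundle.ContMDiffRiemannianMetric (𝓡 3) ∞ (EuclideanSpace ℝ (Fin 3))
        (fun x : M => TangentSpace (𝓡 3) x))
      (A B : ℝ), 0 < A ∧ 0 < B ∧
      (∀ x, Module.finrank ℝ (Eu x) = 2 ∧ Module.finrank ℝ (Es x) = 2 ∧
        Eu x ⊓ Es x = Submodule.span ℝ {X x}) ∧
      (∀ (t : ℝ) (x : M), ∀ v ∈ Eu x, mfderiv (𝓡 3) (𝓡 3) (φ t) x v ∈ Eu (φ t x)) ∧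
      (∀ (t : ℝ) (x : M), ∀ v ∈ Es x, mfderiv (𝓡 3) (𝓡 3) (φ t) x v ∈ Es (φ t x)) ∧
      (∀ (t : ℝ) (x : M), 0 ≤ t → ∀ v ∈ Eu x, ∀ w ∈ Es x,
        v ∉ Submodule.span ℝ {X x} → w ∉ Submodule.span ℝ {X x} →
        A * Real.exp (B * t) * (quotientNorm g X x v / quotientNorm g X x w) ≤
          quotientNorm g X (φ t x) (mfderiv (𝓡 3) (𝓡 3) (φ t) x v) /
            quotientNorm g X (φ t x) (mfderiv (𝓡 3) (𝓡 3) (φ t) x w))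

end ProjectivelyAnosov

/-! ### Surgeries -/

section Surgery

variable {M : Type u} [TopologicalSpace M] [ChartedSpace (EuclideanSpace ℝ (Fin 3)) M]
  {M' : Type u} [TopologicalSpace M'] [ChartedSpace (EuclideanSpace ℝ (Fin 3)) M']

/-- Smooth open embeddings, defined on an open set `source`, of `S¹ × ℝ × ℝ` in a 3-manifold. -/
abbrev AnnulusBox (M : Type u) [TopologicalSpace M]
    [ChartedSpace (EuclideanSpace ℝ (Fin 3)) M] :=
  PartialDiffeomorph ((𝓡 1).prod (𝓘(ℝ, ℝ).prod 𝓘(ℝ, ℝ))) (𝓡 3) (Circle × ℝ × ℝ) M ∞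

/-- Smooth open embeddings, defined on an open set `source`, of `S¹ × ℂ` in a 3-manifold. -/
abbrev SolidTorus (M : Type u) [TopologicalSpace M]
    [ChartedSpace (EuclideanSpace ℝ (Fin 3)) M] :=
  PartialDiffeomorph ((𝓡 1).prod 𝓘(ℝ, ℂ)) (𝓡 3) (Circle × ℂ) M ∞

/-- Smooth open embeddings, defined on an open set `source`, of `M` in `M'`. -/
abbrev PartialDiffeo3 (M : Type u) [TopologicalSpace M]
    [ChartedSpace (EuclideanSpace ℝ (Fin 3)) M] (M' : Type u) [TopologicalSpace M']
    [ChartedSpace (EuclideanSpace ℝ (Fin 3)) M'] :=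
  PartialDiffeomorph (𝓡 3) (𝓡 3) M M' ∞

/-- `j` maps positive bases to positive bases. -/
def PreservesOrientation (j : PartialDiffeo3 M M')
    (o : ∀ x : M, Orientation ℝ (TangentSpace (𝓡 3) x) (Fin 3))
    (o' : ∀ x : M', Orientation ℝ (TangentSpace (𝓡 3) x) (Fin 3)) : Prop :=
  ∀ x ∈ j.source, ∀ u v w : TangentSpace (𝓡 3) x, IsPositiveTriple o x u v w →
    IsPositiveTriple o' (j x) (mfderiv (𝓡 3) (𝓡 3) j x u) (mfderiv (𝓡 3) (𝓡 3) j x v)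
      (mfderiv (𝓡 3) (𝓡 3) j x w)

/-- `Φ` in the coordinates `(s, w, t)`, where `s` is the angle on the circle. -/
def AnnulusBox.coord (Φ : AnnulusBox M) (p : ℝ × ℝ × ℝ) : M :=
  Φ (Circle.exp p.1, p.2.1, p.2.2)

/-- The image under `DΦ` of the vector `v` in the coordinates `(s, w, t)`. -/
def AnnulusBox.vec (Φ : AnnulusBox M) (p v : ℝ × ℝ × ℝ) : TangentSpace (𝓡 3) (Φ.coord p) :=
  mfderiv 𝓘(ℝ, ℝ × ℝ × ℝ) (𝓡 3) Φ.coord p v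

/-- The closed annulus `C = S¹ × [-ε, ε] × {0}` in the box `Φ`. -/
def AnnulusBox.annulus (Φ : AnnulusBox M) (ε : ℝ) : Set M :=
  Φ '' {p : Circle × ℝ × ℝ | |p.2.1| ≤ ε ∧ p.2.2 = 0}

/-- `Φ`, with coordinates `(z, w, t) ∈ S¹ × (-ε₁, ε₁) × (-τ, τ)`, is a flow box of `X` around the
annulus `C = {|w| ≤ ε, t = 0}`: the parameter `t` is the time of the flow, so that `C` is
transverse to the flow. The core of `C` is `K`, the framing of `K` given by `C` is the contact
framing of `ker α` (the direction `∂_w` of the push-off of `K` in `C` is transverse to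
`ker α` along `K`), and `(∂_w, ∂_s, ∂_t)` is a positive frame. -/
structure IsSurgeryFlowBox (o : ∀ x : M, Orientation ℝ (TangentSpace (𝓡 3) x) (Fin 3))
    (α : ∀ x : M, TangentSpace (𝓡 3) x →L[ℝ] ℝ) (X : ∀ x : M, TangentSpace (𝓡 3) x)
    (K : Circle → M) (Φ : AnnulusBox M) (ε ε₁ τ : ℝ) : Prop where
  pos : 0 < ε
  lt : ε < ε₁
  time_pos : 0 < τ
  source_eq : Φ.source = {p : Circle × ℝ × ℝ | |p.2.1| < ε₁ ∧ |p.2.2| < τ}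
  core : ∀ z : Circle, Φ (z, 0, 0) = K z
  flow : ∀ s w t : ℝ, |w| < ε₁ → |t| < τ →
    Φ.vec (s, w, t) (0, 0, 1) = X (Φ.coord (s, w, t))
  oriented : ∀ s w t : ℝ, |w| < ε₁ → |t| < τ →
    IsPositiveTriple o (Φ.coord (s, w, t))
      (Φ.vec (s, w, t) (0, 1, 0)) (Φ.vec (s, w, t) (1, 0, 0)) (Φ.vec (s, w, t) (0, 0, 1))
  contact_framing : ∀ s : ℝ, α (Φ.coord (s, 0, 0)) (Φ.vec (s, 0, 0) (0, 1, 0)) ≠ 0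

/-- The profile of a shear: a smooth non-decreasing function which is `0` on `(-∞, -1]` and
`2π` on `[1, ∞)`. -/
def IsShearProfile (g : ℝ → ℝ) : Prop :=
  ContDiff ℝ ∞ g ∧ Monotone g ∧ (∀ v ≤ -1, g v = 0) ∧ (∀ v, 1 ≤ v → g v = 2 * Real.pi)

/-- The shear `F : (s, w) ↦ (s + q g(w / ε), w)`, written on `S¹ × ℝ`. -/
def shear (q : ℤ) (g : ℝ → ℝ) (ε : ℝ) (p : Circle × ℝ) : Circle × ℝ :=
  (Circle.exp (q * g (p.2 / ε)) * p.1, p.2)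

/-- `M'` is obtained from `M` by cutting along the annulus `C = {|w| ≤ ε, t = 0}` of the box `Φ`
and gluing the side of `C` from which the flow arrives (`t ≤ 0`) to the side from which it leaves
(`t ≥ 0`) by the shear `F`. That is, `M'` is the union of a copy `j` of `M \ C` and of a copy `Ψ`
of the box, glued along the box minus `C` by the identity where `t < 0` and by
`(z, w, t) ↦ (F(z, w), t)` where `t > 0`; where `|w| > ε` the shear is the identity and both
formulas agree. -/
structure IsShearSurgery (Φ : AnnulusBox M) (ε : ℝ) (q : ℤ) (g : ℝ → ℝ)
    (j : PartialDiffeo3 M M') (Ψ : AnnulusBox M') : Prop where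
  source_eq : j.source = (Φ.annulus ε)ᶜ
  box_source_eq : Ψ.source = Φ.source
  cover : j.target ∪ Ψ.target = Set.univ
  glue_neg : ∀ p ∈ Φ.source, p.2.2 < 0 → Ψ p = j (Φ p)
  glue_pos : ∀ p ∈ Φ.source, 0 < p.2.2 →
    Ψ p = j (Φ ((shear q g ε (p.1, p.2.1)).1, (shear q g ε (p.1, p.2.1)).2, p.2.2))
  glue_side : ∀ p ∈ Φ.source, ε < |p.2.1| → Ψ p = j (Φ p)

/-- `N` in the coordinates `(s, y)`, where `s` is the angle on the circle. -/
def SolidTorus.coord (N : SolidTorus M) (p : ℝ × ℂ) : M :=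
  N (Circle.exp p.1, p.2)

/-- The image under `DN` of the vector `v` in the coordinates `(s, y)`. -/
def SolidTorus.vec (N : SolidTorus M) (p v : ℝ × ℂ) : TangentSpace (𝓡 3) (N.coord p) :=
  mfderiv 𝓘(ℝ, ℝ × ℂ) (𝓡 3) N.coord p v

/-- `M'` is obtained from `M` by `(1, q)`-Dehn surgery along `K`, with respect to the contact
framing given by `ker α`. Here `N` is a tubular neighbourhood `S¹ × D²` of `K`, positively
oriented, in which the longitude `λ = S¹ × {r}` is a push-off of `K` transverse to `ker α`. The
meridian `μ = {z} × ∂D²_r` of `K` is oriented anticlockwise, so that `μ ∩ λ = 1`. Now `M'` is the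
union of a copy `j` of `M \ K` and of a solid torus `P`, glued along the complement of the core by
`(z, r u) ↦ N (z u ^ q, r u)`, `u ∈ S¹`, which sends the meridian of the solid torus to
`μ + q λ`. -/
def IsContactFramedDehnSurgery (o : ∀ x : M, Orientation ℝ (TangentSpace (𝓡 3) x) (Fin 3))
    (α : ∀ x : M, TangentSpace (𝓡 3) x →L[ℝ] ℝ) (K : Circle → M) (q : ℤ)
    (o' : ∀ x : M', Orientation ℝ (TangentSpace (𝓡 3) x) (Fin 3)) : Prop :=
  ∃ (N : SolidTorus M) (j : PartialDiffeo3 M M') (P : SolidTorus M'),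
    N.source = {p : Circle × ℂ | ‖p.2‖ < 1} ∧
    (∀ z : Circle, N (z, 0) = K z) ∧
    (∀ (s : ℝ) (y : ℂ), ‖y‖ < 1 → IsPositiveTriple o (N.coord (s, y))
      (N.vec (s, y) (1, 0)) (N.vec (s, y) (0, 1)) (N.vec (s, y) (0, Complex.I))) ∧
    (∀ s : ℝ, α (N.coord (s, 0)) (N.vec (s, 0) (0, 1)) ≠ 0) ∧
    j.source = (Set.range K)ᶜ ∧ PreservesOrientation j o o' ∧
    P.source = {p : Circle × ℂ | ‖p.2‖ < 1} ∧
    j.target ∪ P.target = Set.univ ∧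
    ∀ (z u : Circle) (r : ℝ), 0 < r → r < 1 →
      P (z, (r : ℂ) * (u : ℂ)) = j (N (z * u ^ q, (r : ℂ) * (u : ℂ)))

end Surgery

end

noncomputable section

set_option linter.unusedSectionVars false

/-! ### Smooth local flows in Banach spaces -/

section BanachFlow

set_option synthInstance.maxHeartbeats 200000

/-- The inverse function theorem, with a local inverse which is smooth on its whole domain. -/
theorem exists_smooth_openPartialHomeomorph {E F : Type*} [NormedAddCommGroup E] [NormedSpace ℝ E]
    [CompleteSpace E] [NormedAddCommGroup F] [NormedSpace ℝ F] {f : E → F} {U : Set E}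
    (hU : IsOpen U) (hf : ContDiffOn ℝ ∞ f U) {p : E} (hp : p ∈ U) (f' : E ≃L[ℝ] F)
    (hf' : HasFDerivAt f (f' : E →L[ℝ] F) p) :
    ∃ e : OpenPartialHomeomorph E F, p ∈ e.source ∧ e.source ⊆ U ∧ (∀ x, e x = f x) ∧
      ContDiffOn ℝ ∞ e.symm e.target := by
  have hfp : ContDiffAt ℝ ∞ f p := hf.contDiffAt (hU.mem_nhds hp)
  have hs : HasStrictFDerivAt f (f' : E →L[ℝ] F) p := hfp.hasStrictFDerivAt' hf' (by simp)
  let e₀ := hs.toOpenPartialHomeomorph f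
  have hd : ContinuousOn (fderiv ℝ f) U :=
    hf.continuousOn_fderiv_of_isOpen hU (by simp)
  have hnhds : {x | x ∈ U ∧ ∃ A : E ≃L[ℝ] F, (A : E →L[ℝ] F) = fderiv ℝ f x} ∈ 𝓝 p := by
    have h1 : Set.range ((↑) : (E ≃L[ℝ] F) → E →L[ℝ] F) ∈ 𝓝 (fderiv ℝ f p) := by
      rw [hf'.fderiv]; exact ContinuousLinearEquiv.nhds f'
    filter_upwards [hU.mem_nhds hp, (hd.continuousAt (hU.mem_nhds hp)) h1] with x hx hx'
    exact ⟨hx, hx'⟩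
  obtain ⟨V, hVs, hV, hpV⟩ := mem_nhds_iff.1 hnhds
  refine ⟨e₀.restrOpen V hV, ⟨hs.mem_toOpenPartialHomeomorph_source, hpV⟩,
    fun x hx => (hVs hx.2).1, fun x => rfl, ?_⟩
  intro y hy
  have hy1 : y ∈ e₀.target := hy.1
  have hy2 : e₀.symm y ∈ V := ((e₀.restrOpen V hV).map_target hy).2
  obtain ⟨hyU, A, hA⟩ := hVs hy2
  have hfy : ContDiffAt ℝ ∞ f (e₀.symm y) := hf.contDiffAt (hU.mem_nhds hyU)
  have : ContDiffAt ℝ ∞ e₀.symm y := by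
    refine e₀.contDiffAt_symm hy1 (f₀' := A) ?_ hfy
    rw [hA]
    exact (hfy.differentiableAt (by simp)).hasFDerivAt
  exact this.contDiffWithinAt

abbrev unitI : Set ℝ := Set.Icc (0 : ℝ) 1

variable {E F : Type u} [NormedAddCommGroup E] [NormedSpace ℝ E]
  [NormedAddCommGroup F] [NormedSpace ℝ F]

/-- Pointwise application of a bilinear map to two paths. -/
def pathBilin {G : Type*} [NormedAddCommGroup G] [NormedSpace ℝ G] (B : G →L[ℝ] E →L[ℝ] F)
    (A : C(unitI, G)) : C(unitI, E) →L[ℝ] C(unitI, F) :=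
  LinearMap.mkContinuous
    { toFun := fun h => ⟨fun t => B (A t) (h t), by fun_prop⟩
      map_add' := fun _ _ => by ext; simp
      map_smul' := fun _ _ => by ext; simp } (‖B‖ * ‖A‖)
    (fun h => by
      have hB := B.opNorm_nonneg
      refine (ContinuousMap.norm_le _ (by positivity)).2 fun t => ?_
      refine (B.le_opNorm₂ _ _).trans ?_
      exact mul_le_mul (mul_le_mul_of_nonneg_left (A.norm_coe_le_norm t) hB)
        (h.norm_coe_le_norm t) (norm_nonneg _) (by positivity))

theorem pathBilin_apply {G : Type*} [NormedAddCommGroup G] [NormedSpace ℝ G]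
    (B : G →L[ℝ] E →L[ℝ] F) (A : C(unitI, G)) (h : C(unitI, E)) (t : unitI) :
    pathBilin B A h t = B (A t) (h t) := rfl

theorem isBoundedLinearMap_pathBilin {G : Type*} [NormedAddCommGroup G] [NormedSpace ℝ G]
    (B : G →L[ℝ] E →L[ℝ] F) : IsBoundedLinearMap ℝ (pathBilin B) :=
  IsLinearMap.with_bound
    ⟨fun A A' => by ext; simp [pathBilin_apply], fun c A => by ext; simp [pathBilin_apply]⟩ ‖B‖
    fun A => LinearMap.mkContinuous_norm_le _
      (mul_nonneg B.opNorm_nonneg (norm_nonneg A)) _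

theorem contDiff_pathBilin {G : Type*} [NormedAddCommGroup G] [NormedSpace ℝ G]
    (n : WithTop ℕ∞) (B : G →L[ℝ] E →L[ℝ] F) : ContDiff ℝ n (pathBilin B) :=
  IsBoundedLinearMap.contDiff (𝕜 := ℝ) (E := C(unitI, G)) (F := C(unitI, E) →L[ℝ] C(unitI, F))
    (isBoundedLinearMap_pathBilin B)

theorem hasFDerivAt_postcomp {G : Type*} [NormedAddCommGroup G] [NormedSpace ℝ G]
    (B : G →L[ℝ] E →L[ℝ] F) (f : C(E, F)) (D : C(E, G)) (hf : ∀ x, HasFDerivAt f (B (D x)) x)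
    (γ : C(unitI, E)) :
    HasFDerivAt (fun γ : C(unitI, E) => f.comp γ) (pathBilin B (D.comp γ)) γ := by
  rw [hasFDerivAt_iff_isLittleO_nhds_zero, Asymptotics.isLittleO_iff]
  intro c hc
  have hcont : Continuous fun γ : C(unitI, E) => D.comp γ := ContinuousMap.continuous_postcomp D
  obtain ⟨c', hc', hcc'⟩ : ∃ c' > 0, ‖B‖ * c' ≤ c :=
    ⟨c / (‖B‖ + 1), by positivity, by
      rw [mul_div_assoc']
      exact div_le_of_le_mul₀ (by positivity) hc.le (by nlinarith [norm_nonneg B])⟩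
  obtain ⟨δ, hδ, h⟩ := Metric.continuousAt_iff.1 (hcont.continuousAt (x := γ)) c' hc'
  filter_upwards [Metric.ball_mem_nhds (0 : C(unitI, E)) hδ] with h₀ hh₀
  refine (ContinuousMap.norm_le _ (by positivity)).2 fun t => ?_
  have key : ‖f (γ t + h₀ t) - f (γ t) - (B (D (γ t))) ((γ t + h₀ t) - γ t)‖
      ≤ c * ‖(γ t + h₀ t) - γ t‖ := by
    refine (convex_segment (γ t) (γ t + h₀ t)).norm_image_sub_le_of_norm_hasFDerivWithin_le'
      (f' := fun x => B (D x)) (fun x _ => ?_) (fun x hx => ?_) (left_mem_segment _ _ _)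
      (right_mem_segment _ _ _)
    · exact (hf x).hasFDerivWithinAt
    · rw [segment_eq_image'] at hx
      obtain ⟨θ, hθ, rfl⟩ := hx
      have h1 : dist (γ + θ • h₀) γ < δ := by
        rw [dist_eq_norm, add_sub_cancel_left, norm_smul, Real.norm_eq_abs, abs_of_nonneg hθ.1]
        rw [mem_ball_zero_iff] at hh₀
        exact (mul_le_of_le_one_left (norm_nonneg _) hθ.2).trans_lt hh₀
      have h2 := (ContinuousMap.dist_apply_le_dist (f := D.comp (γ + θ • h₀)) (g := D.comp γ) t).trans
        (h h1).le
      rw [dist_eq_norm] at h2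
      rw [← map_sub]
      refine (B.le_opNorm _).trans (le_trans (mul_le_mul_of_nonneg_left ?_ (norm_nonneg _)) hcc')
      simpa using h2
  simp only [add_sub_cancel_left] at key
  exact key.trans (mul_le_mul_of_nonneg_left (h₀.norm_coe_le_norm t) hc.le)

theorem contDiff_postcomp_nat (n : ℕ) : ∀ {F : Type u} [NormedAddCommGroup F] [NormedSpace ℝ F]
    (f : C(E, F)) (_ : ContDiff ℝ n f),
    ContDiff ℝ n (fun γ : C(unitI, E) => f.comp γ) := by
  induction n with
  | zero =>
    intro F _ _ f hf
    exact contDiff_zero.2 (ContinuousMap.continuous_postcomp _)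
  | succ n ih =>
    intro F _ _ f hf
    have hf1 : ContDiff ℝ 1 f := hf.of_le (by simp)
    have hd : ContDiff ℝ n (fderiv ℝ f) := hf.fderiv_right (by simp)
    let D : C(E, E →L[ℝ] F) := ⟨fderiv ℝ f, hd.continuous⟩
    have h2 := (contDiff_pathBilin (E := E) (F := F) n
      (ContinuousLinearMap.id ℝ (E →L[ℝ] F))).comp (ih D hd)
    refine contDiff_succ_iff_hasFDerivAt.2 ⟨_, h2, fun γ =>
      hasFDerivAt_postcomp (ContinuousLinearMap.id ℝ (E →L[ℝ] F)) f D (fun x => ?_) γ⟩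
    exact ((hf1.differentiable one_ne_zero) x).hasFDerivAt

theorem contDiff_postcomp {f : E → F} (hf : ContDiff ℝ ∞ f) :
    ContDiff ℝ ∞ (fun γ : C(unitI, E) => (⟨f, hf.continuous⟩ : C(E, F)).comp γ) :=
  contDiff_infty.2 fun n => contDiff_postcomp_nat n _ (hf.of_le (mod_cast le_top))

/-- Integration of a path from `0`. -/
def pathIntegral : C(unitI, E) →L[ℝ] C(unitI, E) :=
  LinearMap.mkContinuous
    { toFun := fun g => ⟨fun t => ∫ s in (0 : ℝ)..t, Set.IccExtend (zero_le_one' ℝ) g s, by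
        have : Continuous fun t : ℝ => ∫ s in (0 : ℝ)..t, Set.IccExtend (zero_le_one' ℝ) g s :=
          intervalIntegral.continuous_primitive
            (fun a b => (g.continuous.Icc_extend').intervalIntegrable a b) 0
        exact this.comp continuous_subtype_val⟩
      map_add' := fun g h => by
        ext t
        simp only [ContinuousMap.coe_mk, ContinuousMap.add_apply]
        rw [← intervalIntegral.integral_add (g.continuous.Icc_extend'.intervalIntegrable _ _)
          (h.continuous.Icc_extend'.intervalIntegrable _ _)]
        rfl
      map_smul' := fun c g => by
        ext t
        simp only [ContinuousMap.coe_mk, ContinuousMap.smul_apply, RingHom.id_apply]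
        rw [← intervalIntegral.integral_smul]
        rfl } 1 fun g => by
    rw [one_mul]
    refine (ContinuousMap.norm_le _ (norm_nonneg _)).2 fun t => ?_
    have h := intervalIntegral.norm_integral_le_of_norm_le_const (a := (0 : ℝ)) (b := t)
      (f := Set.IccExtend (zero_le_one' ℝ) g) (C := ‖g‖) (fun x _ => g.norm_coe_le_norm _)
    refine h.trans ?_
    rw [sub_zero, abs_of_nonneg t.2.1]
    exact mul_le_of_le_one_right (norm_nonneg _) t.2.2

theorem pathIntegral_apply (g : C(unitI, E)) (t : unitI) :
    pathIntegral g t = ∫ s in (0 : ℝ)..t, Set.IccExtend (zero_le_one' ℝ) g s := rfl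

/-- The defect of `γ` as a solution of `γ' = l f(γ)`, `γ 0 = x`. -/
def flowDefect (f : C(E, E)) (p : E × ℝ × C(unitI, E)) : C(unitI, E) :=
  p.2.2 - ContinuousMap.const unitI p.1 - p.2.1 • pathIntegral (f.comp p.2.2)

theorem hasDerivAt_of_flowDefect_eq_zero [CompleteSpace E] {f : C(E, E)} {x : E} {l : ℝ} {γ : C(unitI, E)}
    (h : flowDefect f (x, l, γ) = 0) {m : ℝ} (hm : m ∈ Set.Ioo (0 : ℝ) 1) :
    HasDerivAt (Set.IccExtend (zero_le_one' ℝ) γ) (l • f (Set.IccExtend (zero_le_one' ℝ) γ m)) m := by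
  have hc : Continuous fun s => f (Set.IccExtend (zero_le_one' ℝ) γ s) :=
    f.continuous.comp γ.continuous.Icc_extend'
  have h1 : HasDerivAt (fun t => x + l • ∫ s in (0 : ℝ)..t, f (Set.IccExtend (zero_le_one' ℝ) γ s))
      (l • f (Set.IccExtend (zero_le_one' ℝ) γ m)) m :=
    ((intervalIntegral.integral_hasDerivAt_right (hc.intervalIntegrable _ _)
      (hc.stronglyMeasurableAtFilter _ _) hc.continuousAt).const_smul l).const_add x
  refine h1.congr_of_eventuallyEq ?_
  filter_upwards [Ioo_mem_nhds hm.1 hm.2] with t ht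
  have h2 : γ ⟨t, ht.1.le, ht.2.le⟩ - x - l • pathIntegral (f.comp γ) ⟨t, ht.1.le, ht.2.le⟩ = 0 :=
    DFunLike.congr_fun h ⟨t, ht.1.le, ht.2.le⟩
  rw [Set.IccExtend_of_mem _ _ ⟨ht.1.le, ht.2.le⟩]
  rw [pathIntegral_apply] at h2
  rw [sub_sub, sub_eq_zero] at h2
  exact h2

theorem flowDefect_rescale {f : C(E, E)} {x : E} {l : ℝ} {γ : C(unitI, E)}
    (h : flowDefect f (x, l, γ) = 0) (m : unitI) :
    flowDefect f (x, m * l, ⟨fun s => γ (m * s), by fun_prop⟩) = 0 := by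
  ext t
  have h2 : γ (m * t) - x - l • pathIntegral (f.comp γ) (m * t) = 0 :=
    DFunLike.congr_fun h (m * t)
  rw [pathIntegral_apply] at h2
  simp only [flowDefect, ContinuousMap.sub_apply, ContinuousMap.const_apply,
    ContinuousMap.smul_apply, pathIntegral_apply, ContinuousMap.coe_mk, ContinuousMap.zero_apply]
  rw [← h2, mul_comm (m : ℝ) l, mul_smul]
  congr 2
  have h3 := intervalIntegral.smul_integral_comp_mul_left (a := 0) (b := (t : ℝ))
    (Set.IccExtend (zero_le_one' ℝ) (f.comp γ)) (m : ℝ)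
  rw [mul_zero] at h3
  rw [show ((m * t : unitI) : ℝ) = m * t from rfl, ← h3]
  congr 1
  refine intervalIntegral.integral_congr fun s hs => ?_
  rw [Set.uIcc_of_le t.2.1] at hs
  have hs' : s ∈ unitI := ⟨hs.1, hs.2.trans t.2.2⟩
  have hms : (m : ℝ) * s ∈ unitI := (m * ⟨s, hs'⟩ : unitI).2
  simp only [Set.IccExtend_of_mem _ _ hs', Set.IccExtend_of_mem _ _ hms]
  rfl

/-- A smooth vector field on a Banach space has a smooth local flow. -/
theorem exists_smooth_local_flow [CompleteSpace E] {f : E → E} (hf : ContDiff ℝ ∞ f) (x₀ : E) :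
    ∃ φ : ℝ × E → E, ∃ ε > 0, ContDiffOn ℝ ∞ φ (Metric.ball 0 ε ×ˢ Metric.ball x₀ ε) ∧
      (∀ x ∈ Metric.ball x₀ ε, φ (0, x) = x) ∧
      ∀ t ∈ Metric.ball (0 : ℝ) ε, ∀ x ∈ Metric.ball x₀ ε,
        HasDerivAt (fun t => φ (t, x)) (f (φ (t, x))) t := by
  let fc : C(E, E) := ⟨f, hf.continuous⟩
  let c₀ : C(unitI, E) := ContinuousMap.const unitI x₀
  let constL : E →L[ℝ] C(unitI, E) :=
    LinearMap.mkContinuous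
      { toFun := fun x => ContinuousMap.const unitI x
        map_add' := fun _ _ => rfl
        map_smul' := fun _ _ => rfl } 1 fun x => by
      rw [one_mul]
      exact (ContinuousMap.norm_le _ (norm_nonneg _)).2 fun t => le_rfl
  have hG : ContDiff ℝ ∞ (flowDefect fc) := by
    have h1 : ContDiff ℝ ∞ fun p : E × ℝ × C(unitI, E) => fc.comp p.2.2 :=
      (contDiff_postcomp hf).comp (contDiff_snd.comp contDiff_snd)
    have h2 : ContDiff ℝ ∞ fun p : E × ℝ × C(unitI, E) => constL p.1 :=
      constL.contDiff.comp contDiff_fst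
    have h3 : ContDiff ℝ ∞ fun p : E × ℝ × C(unitI, E) => pathIntegral (fc.comp p.2.2) :=
      (pathIntegral (E := E)).contDiff.comp h1
    exact ((contDiff_snd.comp contDiff_snd).sub h2).sub
      ((contDiff_fst.comp contDiff_snd).smul h3)
  let H : E × ℝ × C(unitI, E) → E × ℝ × C(unitI, E) := fun p => (p.1, p.2.1, flowDefect fc p)
  have hH : ContDiff ℝ ∞ H := contDiff_fst.prodMk ((contDiff_fst.comp contDiff_snd).prodMk hG)
  let p₀ : E × ℝ × C(unitI, E) := (x₀, 0, c₀)
  let b := pathIntegral (fc.comp c₀)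
  let L : (E × ℝ × C(unitI, E)) ≃L[ℝ] (E × ℝ × C(unitI, E)) :=
    { toFun := fun p => (p.1, p.2.1, p.2.2 - constL p.1 - p.2.1 • b)
      invFun := fun p => (p.1, p.2.1, p.2.2 + constL p.1 + p.2.1 • b)
      map_add' := fun p q => by
        simp only [Prod.fst_add, Prod.snd_add, map_add, add_smul, Prod.mk_add_mk]
        congr 2; abel
      map_smul' := fun c p => by
        simp only [Prod.smul_fst, Prod.smul_snd, map_smul, RingHom.id_apply, Prod.smul_mk,
          smul_sub, smul_assoc]
      left_inv := fun p => Prod.ext rfl (Prod.ext rfl (by simp only []; abel))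
      right_inv := fun p => Prod.ext rfl (Prod.ext rfl (by simp only []; abel))
      continuous_toFun := by fun_prop
      continuous_invFun := by fun_prop }
  have hL : HasFDerivAt H (L : (E × ℝ × C(unitI, E)) →L[ℝ] (E × ℝ × C(unitI, E))) p₀ := by
    have hcomp : HasFDerivAt (fun p : E × ℝ × C(unitI, E) => pathIntegral (fc.comp p.2.2))
        (fderiv ℝ (fun p : E × ℝ × C(unitI, E) => pathIntegral (fc.comp p.2.2)) p₀) p₀ := by
      have h1 : ContDiff ℝ ∞ fun p : E × ℝ × C(unitI, E) => fc.comp p.2.2 :=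
        (contDiff_postcomp hf).comp (contDiff_snd.comp contDiff_snd)
      exact (((pathIntegral (E := E)).contDiff.comp h1).differentiable (by simp) p₀).hasFDerivAt
    have hl : HasFDerivAt (fun p : E × ℝ × C(unitI, E) => p.2.1)
        ((ContinuousLinearMap.fst ℝ ℝ C(unitI, E)).comp
          (ContinuousLinearMap.snd ℝ E (ℝ × C(unitI, E)))) p₀ :=
      ((ContinuousLinearMap.fst ℝ ℝ C(unitI, E)).comp
          (ContinuousLinearMap.snd ℝ E (ℝ × C(unitI, E)))).hasFDerivAt
    have hg : HasFDerivAt (fun p : E × ℝ × C(unitI, E) => p.2.2)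
        ((ContinuousLinearMap.snd ℝ ℝ C(unitI, E)).comp
          (ContinuousLinearMap.snd ℝ E (ℝ × C(unitI, E)))) p₀ :=
      ((ContinuousLinearMap.snd ℝ ℝ C(unitI, E)).comp
          (ContinuousLinearMap.snd ℝ E (ℝ × C(unitI, E)))).hasFDerivAt
    have hx : HasFDerivAt (fun p : E × ℝ × C(unitI, E) => constL p.1)
        (constL.comp (ContinuousLinearMap.fst ℝ E (ℝ × C(unitI, E)))) p₀ :=
      (constL.comp (ContinuousLinearMap.fst ℝ E (ℝ × C(unitI, E)))).hasFDerivAt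
    have := (ContinuousLinearMap.hasFDerivAt (x := p₀)
      (ContinuousLinearMap.fst ℝ E (ℝ × C(unitI, E)))).prodMk
      (hl.prodMk ((hg.sub hx).sub (hl.smul hcomp)))
    refine this.congr_fderiv ?_
    ext p <;> simp [L, p₀, b]
  obtain ⟨e, hpe, -, heH, hesymm⟩ :=
    exists_smooth_openPartialHomeomorph isOpen_univ hH.contDiffOn (Set.mem_univ p₀) L hL
  have hHp : H p₀ = (x₀, 0, 0) := by
    simp only [H, p₀, flowDefect, zero_smul, sub_zero]
    simp [c₀]
  -- choose a ball in the source
  obtain ⟨r, hr, hrs⟩ := Metric.mem_nhds_iff.1 (e.open_source.mem_nhds hpe)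
  have het : (x₀, (0 : ℝ), (0 : C(unitI, E))) ∈ e.target := by
    rw [← hHp, ← heH]; exact e.map_source hpe
  have hes : e.symm (x₀, 0, 0) = p₀ := by rw [← hHp, ← heH]; exact e.left_inv hpe
  have hnear : ∀ᶠ q : ℝ × E in 𝓝 (0, x₀), (q.2, q.1, (0 : C(unitI, E))) ∈ e.target ∧
      e.symm (q.2, q.1, 0) ∈ Metric.ball p₀ r := by
    have hcont : Continuous fun q : ℝ × E => (q.2, q.1, (0 : C(unitI, E))) := by fun_prop
    have h1 := hcont.continuousAt.preimage_mem_nhds (x := ((0 : ℝ), x₀))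
      (e.open_target.mem_nhds het)
    have h2 : ContinuousAt (fun q : ℝ × E => e.symm (q.2, q.1, (0 : C(unitI, E)))) (0, x₀) :=
      ContinuousAt.comp (f := fun q : ℝ × E => (q.2, q.1, (0 : C(unitI, E))))
        (e.symm.continuousAt het) hcont.continuousAt
    have h3 := h2.preimage_mem_nhds (Metric.ball_mem_nhds _ hr)
    rw [hes] at h3
    filter_upwards [h1, h3] with q hq1 hq2
    exact ⟨hq1, hq2⟩
  obtain ⟨ε, hε, hball⟩ := Metric.mem_nhds_iff.1 hnear
  let Γ : ℝ → E → C(unitI, E) := fun l x => (e.symm (x, l, 0)).2.2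
  have hq : ∀ l ∈ Metric.ball (0 : ℝ) ε, ∀ x ∈ Metric.ball x₀ ε,
      (x, l, (0 : C(unitI, E))) ∈ e.target ∧ e.symm (x, l, 0) = (x, l, Γ l x) ∧
      (x, l, Γ l x) ∈ Metric.ball p₀ r ∧ flowDefect fc (x, l, Γ l x) = 0 := by
    intro l hl x hx
    have hm : (l, x) ∈ Metric.ball ((0 : ℝ), x₀) ε := by
      rw [← ball_prod_same]; exact ⟨hl, hx⟩
    obtain ⟨h1, h2⟩ := hball hm
    have h3 : H (e.symm (x, l, 0)) = (x, l, 0) := by rw [← heH]; exact e.right_inv h1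
    have h4 : e.symm (x, l, 0) = (x, l, Γ l x) := by
      have := congrArg Prod.fst h3
      have h' := congrArg (fun z => z.2.1) h3
      exact Prod.ext this (Prod.ext h' rfl)
    refine ⟨h1, h4, ?_, ?_⟩
    · rw [← h4]; exact h2
    · have := congrArg (fun z => z.2.2) h3
      rw [h4] at this
      exact this
  have hscale : ∀ l ∈ Metric.ball (0 : ℝ) ε, ∀ x ∈ Metric.ball x₀ ε, ∀ m s : unitI,
      Γ (m * l) x s = Γ l x (m * s) := by
    intro l hl x hx m s
    obtain ⟨h1, h2, h3, h4⟩ := hq l hl x hx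
    have hml : (m : ℝ) * l ∈ Metric.ball (0 : ℝ) ε := by
      rw [mem_ball_zero_iff, norm_mul, Real.norm_eq_abs, abs_of_nonneg m.2.1] at *
      exact (mul_le_of_le_one_left (norm_nonneg _) m.2.2).trans_lt hl
    obtain ⟨g1, g2, g3, g4⟩ := hq _ hml x hx
    have h5 := flowDefect_rescale h4 m
    set η : C(unitI, E) := ⟨fun s => Γ l x (m * s), by fun_prop⟩ with hη
    have hηb : (x, (m : ℝ) * l, η) ∈ Metric.ball p₀ r := by
      simp only [Metric.mem_ball, Prod.dist_eq, max_lt_iff, p₀] at h3 g3 ⊢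
      refine ⟨h3.1, g3.2.1, lt_of_le_of_lt ?_ h3.2.2⟩
      refine (ContinuousMap.dist_le dist_nonneg).2 fun t => ?_
      exact ContinuousMap.dist_apply_le_dist (f := Γ l x) (g := c₀) (m * t)
    have h6 : (x, (m : ℝ) * l, η) = (x, (m : ℝ) * l, Γ (m * l) x) := by
      refine e.injOn (hrs hηb) (hrs g3) ?_
      rw [heH, heH]
      simp only [H, h5, g4]
    have h7 : η = Γ (m * l) x := congrArg (fun z => z.2.2) h6
    rw [← h7, hη]; rfl
  let one : unitI := ⟨1, zero_le_one, le_rfl⟩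
  let φ : ℝ × E → E := fun q => Γ q.1 q.2 one
  have hφ : ContDiffOn ℝ ∞ φ (Metric.ball 0 ε ×ˢ Metric.ball x₀ ε) := by
    have h1 : ContDiffOn ℝ ∞ (fun q : ℝ × E => e.symm (q.2, q.1, (0 : C(unitI, E))))
        (Metric.ball 0 ε ×ˢ Metric.ball x₀ ε) :=
      hesymm.comp (contDiff_snd.prodMk (contDiff_fst.prodMk contDiff_const)).contDiffOn
        fun q hq' => (hq q.1 hq'.1 q.2 hq'.2).1
    exact (ContinuousMap.evalCLM ℝ one).contDiff.comp_contDiffOn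
      ((contDiff_snd.comp contDiff_snd).comp_contDiffOn h1)
  have hφ0 : ∀ x ∈ Metric.ball x₀ ε, φ (0, x) = x := by
    intro x hx
    obtain ⟨-, -, -, h⟩ := hq 0 (Metric.mem_ball_self hε) x hx
    have h1 := DFunLike.congr_fun h one
    simp only [flowDefect, zero_smul, sub_zero, ContinuousMap.sub_apply, ContinuousMap.const_apply,
      ContinuousMap.zero_apply, sub_eq_zero] at h1
    exact h1
  have hne : ∀ t ∈ Metric.ball (0 : ℝ) ε, t ≠ 0 → ∀ x ∈ Metric.ball x₀ ε,
      HasDerivAt (fun t => φ (t, x)) (f (φ (t, x))) t := by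
    intro t ht ht0 x hx
    rw [mem_ball_zero_iff, Real.norm_eq_abs] at ht
    obtain ⟨k, hk1, hk2⟩ : ∃ k : ℝ, 1 < k ∧ k * |t| < ε := by
      obtain ⟨d, hd1, hd2⟩ := exists_between ht
      have htp : 0 < |t| := abs_pos.2 ht0
      exact ⟨d / |t|, (one_lt_div htp).2 hd1, by rwa [div_mul_cancel₀ _ htp.ne']⟩
    have hk0 : 0 < k := zero_lt_one.trans hk1
    set l := k * t with hl
    have hl0 : l ≠ 0 := mul_ne_zero hk0.ne' ht0
    have hlb : l ∈ Metric.ball (0 : ℝ) ε := by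
      rw [mem_ball_zero_iff, Real.norm_eq_abs, hl, abs_mul, abs_of_pos hk0]; exact hk2
    have hmem : t / l ∈ Set.Ioo (0 : ℝ) 1 := by
      have : t / l = k⁻¹ := by rw [hl]; field_simp
      rw [this]; exact ⟨inv_pos.2 hk0, inv_lt_one_of_one_lt₀ hk1⟩
    obtain ⟨-, -, -, h4⟩ := hq l hlb x hx
    have hform : ∀ t', t' / l ∈ Set.Ioo (0 : ℝ) 1 →
        φ (t', x) = Set.IccExtend (zero_le_one' ℝ) (Γ l x) (t' / l) := by
      intro t' ht'
      have := hscale l hlb x hx ⟨t' / l, ht'.1.le, ht'.2.le⟩ one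
      rw [Set.IccExtend_of_mem _ _ ⟨ht'.1.le, ht'.2.le⟩]
      simp only [div_mul_cancel₀ _ hl0] at this
      simp only [φ]
      rw [this]
      congr 1
      exact mul_one _
    have hd := hasDerivAt_of_flowDefect_eq_zero h4 hmem
    have hdiv : HasDerivAt (fun t' : ℝ => t' / l) (1 / l) t := (hasDerivAt_id t).div_const l
    have hcomp := HasDerivAt.scomp t hd hdiv
    rw [← hform t hmem, smul_smul, one_div, inv_mul_cancel₀ hl0, one_smul] at hcomp
    refine hcomp.congr_of_eventuallyEq ?_
    have : ∀ᶠ t' in 𝓝 t, t' / l ∈ Set.Ioo (0 : ℝ) 1 :=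
      hdiv.continuousAt.eventually_mem (Ioo_mem_nhds hmem.1 hmem.2)
    filter_upwards [this] with t' ht'
    exact hform t' ht'
  refine ⟨φ, ε, hε, hφ, hφ0, fun t ht x hx => ?_⟩
  by_cases ht0 : t = 0
  swap
  · exact hne t ht ht0 x hx
  subst ht0
  have hsm : ContDiffOn ℝ ∞ (fun t => φ (t, x)) (Metric.ball 0 ε) :=
    hφ.comp (contDiff_id.prodMk contDiff_const).contDiffOn fun t ht => ⟨ht, hx⟩
  have hsm0 := hsm.contDiffAt (Metric.isOpen_ball.mem_nhds ht)
  have hdc : ContinuousAt (deriv fun t => φ (t, x)) 0 :=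
    (hsm.continuousOn_deriv_of_isOpen Metric.isOpen_ball (by simp)).continuousAt
      (Metric.isOpen_ball.mem_nhds ht)
  have hfc : ContinuousAt (fun t => f (φ (t, x))) 0 :=
    hf.continuous.continuousAt.comp hsm0.continuousAt
  have heq : deriv (fun t => φ (t, x)) 0 = f (φ (0, x)) := by
    refine tendsto_nhds_unique (l := 𝓝[≠] (0 : ℝ)) (hdc.tendsto.mono_left nhdsWithin_le_nhds) ?_
    refine (hfc.tendsto.mono_left nhdsWithin_le_nhds).congr' ?_
    filter_upwards [nhdsWithin_le_nhds (Metric.isOpen_ball.mem_nhds ht), self_mem_nhdsWithin]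
      with t' h1 h2
    exact (hne t' h1 h2 x hx).deriv.symm
  rw [← heq]
  exact (hsm0.differentiableAt (by simp)).hasDerivAt

end BanachFlow

/-! ### Smooth vectors along maps, and smooth one-forms -/

section Tangent

abbrev E3 : Type := EuclideanSpace ℝ (Fin 3)

theorem contDiffAt_clm_apply {D E F : Type*} [NormedAddCommGroup D] [NormedSpace ℝ D]
    [NormedAddCommGroup E] [NormedSpace ℝ E] [NormedAddCommGroup F] [NormedSpace ℝ F]
    {n : WithTop ℕ∞} {f : D → E →L[ℝ] F} {x : D} [FiniteDimensional ℝ E] :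
    ContDiffAt ℝ n f x ↔ ∀ y, ContDiffAt ℝ n (fun x => f x y) x := by
  refine ⟨fun h y => h.clm_apply contDiffAt_const, fun h => ?_⟩
  let d := Module.finrank ℝ E
  have hd : d = Module.finrank ℝ (Fin d → ℝ) := (Module.finrank_fin_fun ℝ).symm
  let e₁ := ContinuousLinearEquiv.ofFinrankEq hd
  let e₂ := (e₁.arrowCongr (1 : F ≃L[ℝ] F)).trans (ContinuousLinearEquiv.piRing (Fin d))
  rw [← Function.id_comp f, ← e₂.symm_comp_self]
  exact e₂.symm.contDiff.contDiffAt.comp x (contDiffAt_pi.mpr fun i => h _)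

section General

variable {E : Type*} [NormedAddCommGroup E] [NormedSpace ℝ E] {H : Type*} [TopologicalSpace H]
  {I : ModelWithCorners ℝ E H} {M : Type*} [TopologicalSpace M] [ChartedSpace H M]
  [IsManifold I ∞ M]
  {E' : Type*} [NormedAddCommGroup E'] [NormedSpace ℝ E'] {H' : Type*} [TopologicalSpace H']
  {I' : ModelWithCorners ℝ E' H'} {M' : Type*} [TopologicalSpace M'] [ChartedSpace H' M']
  [IsManifold I' ∞ M']
  {F : Type*} [NormedAddCommGroup F] [NormedSpace ℝ F] {G : Type*} [TopologicalSpace G]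
  {J : ModelWithCorners ℝ F G} {N : Type*} [TopologicalSpace N] [ChartedSpace G N]
  [IsManifold J ∞ N]
  {E₀ : Type*} [NormedAddCommGroup E₀] [NormedSpace ℝ E₀]

/-- The image under `Dh` of a smooth field of vectors along `b` is smooth along `h ∘ b`. -/
theorem ContMDiffAt.mfderiv_along {b : N → M} {V : ∀ n, TangentSpace I (b n)} {h : M → M'} {n₀ : N}
    (hV : ContMDiffAt J I.tangent ∞ (fun n => (⟨b n, V n⟩ : TangentBundle I M)) n₀)
    (hh : ContMDiffAt I I' ∞ h (b n₀)) :
    ContMDiffAt J I'.tangent ∞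
      (fun n => (⟨h (b n), mfderiv I I' h (b n) (V n)⟩ : TangentBundle I' M')) n₀ := by
  have hb : ContMDiffAt J I ∞ b n₀ := (Bundle.contMDiffAt_totalSpace.1 hV).1
  refine ContMDiffAt.clm_apply_of_inCoordinates (IB₂ := I')
    (E₁ := (TangentSpace I : M → Type _)) (E₂ := (TangentSpace I' : M' → Type _))
    (b₁ := b) (b₂ := fun n => h (b n)) (ϕ := fun n => mfderiv I I' h (b n)) ?_ hV
    (hh.comp n₀ hb)
  have := ContMDiffAt.mfderiv (J := J) (n := ∞) (m := ∞) (fun _ : N => h) b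
    (x₀ := n₀) (hh.comp (n₀, b n₀) contMDiffAt_snd) hb (by simp)
  exact this

theorem ContMDiffAt.mk_tangentBundle {b v : N → E₀} {n₀ : N} (hb : ContMDiffAt J 𝓘(ℝ, E₀) ∞ b n₀)
    (hv : ContMDiffAt J 𝓘(ℝ, E₀) ∞ v n₀) :
    ContMDiffAt J 𝓘(ℝ, E₀).tangent ∞ (fun n => (⟨b n, v n⟩ : TangentBundle 𝓘(ℝ, E₀) E₀)) n₀ := by
  rw [Bundle.contMDiffAt_totalSpace]
  exact ⟨hb, by simpa using hv⟩

theorem ContMDiffAt.snd_tangentBundle {b v : N → E₀} {n₀ : N}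
    (h : ContMDiffAt J 𝓘(ℝ, E₀).tangent ∞ (fun n => (⟨b n, v n⟩ : TangentBundle 𝓘(ℝ, E₀) E₀)) n₀) :
    ContMDiffAt J 𝓘(ℝ, E₀) ∞ v n₀ :=
  (contMDiff_snd_tangentBundle_modelSpace (n := ∞) E₀ 𝓘(ℝ, E₀)).contMDiffAt.comp n₀ h

/-- A smooth map from a vector space applied to smooth vectors. -/
theorem ContMDiffAt.mfderiv_vector {c : E₀ → M} {b v : N → E₀} {n₀ : N}
    (hc : ContMDiffAt 𝓘(ℝ, E₀) I ∞ c (b n₀)) (hb : ContMDiffAt J 𝓘(ℝ, E₀) ∞ b n₀)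
    (hv : ContMDiffAt J 𝓘(ℝ, E₀) ∞ v n₀) :
    ContMDiffAt J I.tangent ∞
      (fun n => (⟨c (b n), mfderiv 𝓘(ℝ, E₀) I c (b n) (v n)⟩ : TangentBundle I M)) n₀ :=
  (hb.mk_tangentBundle hv).mfderiv_along (b := b) (V := v) hc

/-- The differential of a vector valued map, applied to a smooth field of vectors. -/
theorem ContMDiffAt.mfderiv_apply_vector {b : N → M} {V : ∀ n, TangentSpace I (b n)} {h : M → E₀}
    {n₀ : N} (hV : ContMDiffAt J I.tangent ∞ (fun n => (⟨b n, V n⟩ : TangentBundle I M)) n₀)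
    (hh : ContMDiffAt I 𝓘(ℝ, E₀) ∞ h (b n₀)) :
    ContMDiffAt J 𝓘(ℝ, E₀) ∞ (fun n => (mfderiv I 𝓘(ℝ, E₀) h (b n) (V n) : E₀)) n₀ :=
  (hV.mfderiv_along hh).snd_tangentBundle

end General

variable {M : Type*} [TopologicalSpace M] [ChartedSpace E3 M] [IsManifold (𝓡 3) ∞ M]
  {F : Type*} [NormedAddCommGroup F] [NormedSpace ℝ F] {G : Type*} [TopologicalSpace G]
  {J : ModelWithCorners ℝ F G} {N : Type*} [TopologicalSpace N] [ChartedSpace G N]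
  [IsManifold J ∞ N]
  {E₀ : Type*} [NormedAddCommGroup E₀] [NormedSpace ℝ E₀]

/-- Smoothness of a 1-form near a point. -/
def IsSmoothOneFormAt (α : ∀ x : M, TangentSpace (𝓡 3) x →L[ℝ] ℝ) (x : M) : Prop :=
  ContMDiffAt (𝓡 3) ((𝓡 3).prod 𝓘(ℝ, E3 →L[ℝ] ℝ)) ∞
    (fun x => Bundle.TotalSpace.mk' (E3 →L[ℝ] ℝ)
      (E := fun x : M => TangentSpace (𝓡 3) x →L[ℝ] Bundle.Trivial M ℝ x) x (α x)) x

/-- Smoothness of a vector field near a point. -/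
def IsSmoothVectorFieldAt (X : ∀ x : M, TangentSpace (𝓡 3) x) (x : M) : Prop :=
  ContMDiffAt (𝓡 3) (𝓡 3).tangent ∞ (fun x => (⟨x, X x⟩ : TangentBundle (𝓡 3) M)) x

/-- The value of a smooth one-form on a smooth field of vectors along a map. -/
theorem IsSmoothOneFormAt.apply_along {α : ∀ x : M, TangentSpace (𝓡 3) x →L[ℝ] ℝ} {b : N → M}
    {V : ∀ n, TangentSpace (𝓡 3) (b n)} {n₀ : N} (hα : IsSmoothOneFormAt α (b n₀))
    (hV : ContMDiffAt J (𝓡 3).tangent ∞ (fun n => (⟨b n, V n⟩ : TangentBundle (𝓡 3) M)) n₀) :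
    ContMDiffAt J 𝓘(ℝ, ℝ) ∞ (fun n => α (b n) (V n)) n₀ := by
  have hb : ContMDiffAt J (𝓡 3) ∞ b n₀ := (Bundle.contMDiffAt_totalSpace.1 hV).1
  have h1 : ContMDiffAt J ((𝓡 3).prod 𝓘(ℝ, ℝ)) ∞
      (fun n => (⟨b n, α (b n) (V n)⟩ : Bundle.TotalSpace ℝ (Bundle.Trivial M ℝ))) n₀ :=
    ContMDiffAt.clm_bundle_apply (E₁ := (TangentSpace (𝓡 3) : M → Type _))
      (E₂ := Bundle.Trivial M ℝ) (b := b) (ϕ := fun n => α (b n)) (hα.comp n₀ hb) hV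
  exact (Bundle.contMDiffAt_totalSpace.1 h1).2

theorem extChartAt_symm_contMDiffAt {x₀ : M} {y : E3} (hy : y ∈ (extChartAt (𝓡 3) x₀).target) :
    ContMDiffAt 𝓘(ℝ, E3) (𝓡 3) ∞ (extChartAt (𝓡 3) x₀).symm y :=
  (contMDiffOn_extChartAt_symm x₀).contMDiffAt ((isOpen_extChartAt_target x₀).mem_nhds hy)

theorem extChartAt_contMDiffAt {x₀ x : M} (hx : x ∈ (extChartAt (𝓡 3) x₀).source) :
    ContMDiffAt (𝓡 3) 𝓘(ℝ, E3) ∞ (extChartAt (𝓡 3) x₀) x :=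
  contMDiffAt_extChartAt' (by rwa [extChartAt_source] at hx)

/-- The vector field which is constant in the preferred chart at `x₀`. -/
def chartConst (x₀ : M) (v : E3) (x : M) : TangentSpace (𝓡 3) x :=
  (Bundle.Trivialization.symmL ℝ
    (trivializationAt E3 (TangentSpace (𝓡 3)) x₀) x) v

theorem chartConst_eq {x₀ x : M} (hx : x ∈ (extChartAt (𝓡 3) x₀).source) (v : E3) :
    chartConst x₀ v x =
      (mfderiv 𝓘(ℝ, E3) (𝓡 3) (extChartAt (𝓡 3) x₀).symm (extChartAt (𝓡 3) x₀ x) v : E3) := by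
  rw [extChartAt_source] at hx
  rw [chartConst, TangentBundle.symmL_trivializationAt hx]
  rw [ModelWithCorners.range_eq_univ, mfderivWithin_univ]
  rfl

theorem isSmoothVectorFieldAt_chartConst {x₀ x : M} (hx : x ∈ (extChartAt (𝓡 3) x₀).source)
    (v : E3) : IsSmoothVectorFieldAt (chartConst x₀ v) x := by
  have h1 : ContMDiffAt (𝓡 3) (𝓡 3).tangent ∞ (fun x => (⟨(extChartAt (𝓡 3) x₀).symm
      (extChartAt (𝓡 3) x₀ x), mfderiv 𝓘(ℝ, E3) (𝓡 3) (extChartAt (𝓡 3) x₀).symm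
        (extChartAt (𝓡 3) x₀ x) v⟩ : TangentBundle (𝓡 3) M)) x :=
    ContMDiffAt.mfderiv_vector
      (extChartAt_symm_contMDiffAt ((extChartAt (𝓡 3) x₀).map_source hx))
      (extChartAt_contMDiffAt hx) contMDiffAt_const
  refine h1.congr_of_eventuallyEq ?_
  filter_upwards [(isOpen_extChartAt_source (I := 𝓡 3) x₀).mem_nhds hx] with y hy
  rw [chartConst_eq hy]
  generalize hz : mfderiv 𝓘(ℝ, E3) (𝓡 3) (extChartAt (𝓡 3) x₀).symm
    (extChartAt (𝓡 3) x₀ y) v = z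
  clear hz
  have hl := (extChartAt (𝓡 3) x₀).left_inv hy
  revert z
  rw [hl]
  intro z; rfl

/-- A one-form is smooth if its values on the chart-constant vector fields are. -/
theorem isSmoothOneFormAt_of_chartConst {α : ∀ x : M, TangentSpace (𝓡 3) x →L[ℝ] ℝ} {x₀ : M}
    (h : ∀ v, ContMDiffAt (𝓡 3) 𝓘(ℝ, ℝ) ∞ (fun x => α x (chartConst x₀ v x)) x₀) :
    IsSmoothOneFormAt α x₀ := by
  rw [IsSmoothOneFormAt, contMDiffAt_hom_bundle]
  refine ⟨contMDiffAt_id, ?_⟩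
  have key : ContMDiffAt (𝓡 3) 𝓘(ℝ, E3 →L[ℝ] ℝ) ∞
      (fun x => (α x).comp (Bundle.Trivialization.symmL ℝ
        (trivializationAt E3 (TangentSpace (𝓡 3)) x₀) x)) x₀ := by
    rw [contMDiffAt_iff_of_mem_source (mem_chart_source _ x₀) (mem_chart_source _ _)]
    rw [ModelWithCorners.range_eq_univ, contDiffWithinAt_univ]
    have h' : ∀ v, ContDiffAt ℝ ∞ (fun y => α ((extChartAt (𝓡 3) x₀).symm y)
        (chartConst x₀ v ((extChartAt (𝓡 3) x₀).symm y))) (extChartAt (𝓡 3) x₀ x₀) := by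
      intro v
      rw [← contMDiffAt_iff_contDiffAt]
      refine ContMDiffAt.comp_of_eq (h v) (extChartAt_symm_contMDiffAt (mem_extChartAt_target x₀))
        (extChartAt_to_inv x₀)
    refine ⟨?_, ?_⟩
    · have : ∀ v, ContinuousAt (fun x => α x (chartConst x₀ v x)) x₀ := fun v => (h v).continuousAt
      exact continuousAt_clm_apply.2 this
    · exact contDiffAt_clm_apply.2 h'
  refine key.congr_of_eventuallyEq ?_
  refine Filter.Eventually.of_forall fun x => ?_
  simp only [ContinuousLinearMap.inCoordinates, Bundle.Trivial.fiberBundle_trivializationAt',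
    Bundle.Trivial.continuousLinearMapAt_trivialization]
  rfl

/-- If the pull-back of a 1-form by a local diffeomorphism is smooth, so is the 1-form. -/
theorem isSmoothOneFormAt_of_pullback {α : ∀ x : M, TangentSpace (𝓡 3) x →L[ℝ] ℝ}
    [FiniteDimensional ℝ E₀] {c : E₀ → M} {d : M → E₀} {p : E₀}
    (hc : ContMDiffAt 𝓘(ℝ, E₀) (𝓡 3) ∞ c p) (hd : ContMDiffAt (𝓡 3) 𝓘(ℝ, E₀) ∞ d (c p))
    (hdp : d (c p) = p) (hcd : ∀ᶠ x in 𝓝 (c p), c (d x) = x) {A : E₀ → E₀ →L[ℝ] ℝ}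
    (hA : ContDiffAt ℝ ∞ A p)
    (hAα : ∀ᶠ q in 𝓝 p, ∀ v : E₀, α (c q) (mfderiv 𝓘(ℝ, E₀) (𝓡 3) c q v) = A q v) :
    IsSmoothOneFormAt α (c p) := by
  refine isSmoothOneFormAt_of_chartConst fun v => ?_
  set V := chartConst (c p) v
  have hV : IsSmoothVectorFieldAt V (c p) :=
    isSmoothVectorFieldAt_chartConst (mem_extChartAt_source (c p)) v
  have h1 : ContMDiffAt (𝓡 3) 𝓘(ℝ, E₀) ∞ (fun x => (mfderiv (𝓡 3) 𝓘(ℝ, E₀) d x (V x) : E₀)) (c p) :=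
    ContMDiffAt.mfderiv_apply_vector (b := id) hV hd
  have h2 : ContMDiffAt (𝓡 3) 𝓘(ℝ, E₀ →L[ℝ] ℝ) ∞ (fun x => A (d x)) (c p) :=
    ContMDiffAt.comp_of_eq hA.contMDiffAt hd hdp
  have h3 : ContMDiffAt (𝓡 3) 𝓘(ℝ, ℝ) ∞
      (fun x => A (d x) (mfderiv (𝓡 3) 𝓘(ℝ, E₀) d x (V x) : E₀)) (c p) := h2.clm_apply h1
  refine h3.congr_of_eventuallyEq ?_
  have hdc : Filter.Tendsto d (𝓝 (c p)) (𝓝 p) := by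
    have := hd.continuousAt; rwa [ContinuousAt, hdp] at this
  have hcs : ∀ᶠ q in 𝓝 p, ContMDiffAt 𝓘(ℝ, E₀) (𝓡 3) 1 c q :=
    (contMDiffAt_iff_contMDiffAt_nhds (by simp)).1 (hc.of_le (n := ∞) (m := 1) (by simp))
  have hds : ∀ᶠ x in 𝓝 (c p), ContMDiffAt (𝓡 3) 𝓘(ℝ, E₀) 1 d x :=
    (contMDiffAt_iff_contMDiffAt_nhds (by simp)).1 (hd.of_le (n := ∞) (m := 1) (by simp))
  filter_upwards [hdc.eventually hAα, hdc.eventually hcs, hds, hcd.eventually_nhds] with x h4 h5 h6 h7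
  have hx : c (d x) = x := h7.self_of_nhds
  refine Eq.trans ?_ (h4 _)
  have hcomp : HasMFDerivAt (𝓡 3) (𝓡 3) (c ∘ d) x
      ((mfderiv 𝓘(ℝ, E₀) (𝓡 3) c (d x)).comp (mfderiv (𝓡 3) 𝓘(ℝ, E₀) d x)) :=
    HasMFDerivAt.comp x (h5.mdifferentiableAt (by simp)).hasMFDerivAt
      (h6.mdifferentiableAt (by simp)).hasMFDerivAt
  have hid : HasMFDerivAt (𝓡 3) (𝓡 3) (c ∘ d) x (ContinuousLinearMap.id ℝ (TangentSpace (𝓡 3) x)) :=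
    (hasMFDerivAt_id x).congr_of_eventuallyEq (by filter_upwards [h7] with y hy using hy)
  have := hasMFDerivAt_unique hcomp hid
  have h8 : mfderiv 𝓘(ℝ, E₀) (𝓡 3) c (d x) (mfderiv (𝓡 3) 𝓘(ℝ, E₀) d x (V x)) = (V x : E3) :=
    congrArg (fun L : E3 →L[ℝ] E3 => L (V x)) this
  rw [h8, hx]

end Tangent

/-! ### Exterior derivatives, contact volumes and orientations -/

section FormCalculus

variable {M : Type u} [TopologicalSpace M] [ChartedSpace E3 M] [IsManifold (𝓡 3) ∞ M]
  {E₀ : Type*} [NormedAddCommGroup E₀] [NormedSpace ℝ E₀]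

/-- The pull-back of a one-form to a normed space. -/
def pullbackForm (α : ∀ x : M, TangentSpace (𝓡 3) x →L[ℝ] ℝ) (c : E₀ → M) (p : E₀) :
    E₀ →L[ℝ] ℝ :=
  (α (c p)).comp (mfderiv 𝓘(ℝ, E₀) (𝓡 3) c p)

/-- The exterior derivative of a one-form on a normed space. -/
def extD (A : E₀ → E₀ →L[ℝ] ℝ) (p u v : E₀) : ℝ := fderiv ℝ A p u v - fderiv ℝ A p v u

theorem contDiffAt_pullbackForm [FiniteDimensional ℝ E₀]
    {α : ∀ x : M, TangentSpace (𝓡 3) x →L[ℝ] ℝ} {c : E₀ → M} {p : E₀}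
    (hα : IsSmoothOneFormAt α (c p)) (hc : ContMDiffAt 𝓘(ℝ, E₀) (𝓡 3) ∞ c p) :
    ContDiffAt ℝ ∞ (pullbackForm α c) p := by
  rw [contDiffAt_clm_apply]
  intro v
  have h1 : ContMDiffAt 𝓘(ℝ, E₀) (𝓡 3).tangent ∞
      (fun q => (⟨c q, mfderiv 𝓘(ℝ, E₀) (𝓡 3) c q v⟩ : TangentBundle (𝓡 3) M)) p :=
    ContMDiffAt.mfderiv_vector (b := id) hc contMDiffAt_id contMDiffAt_const
  exact (IsSmoothOneFormAt.apply_along (b := c) hα h1).contDiffAt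

theorem contMDiffAt_nhds_one {E' : Type*} [NormedAddCommGroup E'] [NormedSpace ℝ E'] {H' : Type*}
    [TopologicalSpace H'] {I' : ModelWithCorners ℝ E' H'} {N : Type*} [TopologicalSpace N]
    [ChartedSpace H' N] [IsManifold I' ∞ N] {F : Type*} [NormedAddCommGroup F] [NormedSpace ℝ F]
    {G : Type*} [TopologicalSpace G] {J : ModelWithCorners ℝ F G} {N' : Type*}
    [TopologicalSpace N'] [ChartedSpace G N'] [IsManifold J ∞ N'] {f : N → N'} {x : N}
    (h : ContMDiffAt I' J ∞ f x) : ∀ᶠ y in 𝓝 x, MDifferentiableAt I' J f y := by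
  have := (contMDiffAt_iff_contMDiffAt_nhds (by simp)).1 (h.of_le (n := ∞) (m := 1) (by simp))
  filter_upwards [this] with y hy using hy.mdifferentiableAt (by simp)

theorem oneFormInChart_eq_pullbackForm (α : ∀ x : M, TangentSpace (𝓡 3) x →L[ℝ] ℝ) (x : M) :
    oneFormInChart α x = pullbackForm α (extChartAt (𝓡 3) x).symm := rfl

/-- The exterior derivative commutes with pull-back. -/
theorem extD_pullbackForm [FiniteDimensional ℝ E₀]
    {α : ∀ x : M, TangentSpace (𝓡 3) x →L[ℝ] ℝ} {c : E₀ → M} {p : E₀}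
    (hα : IsSmoothOneFormAt α (c p)) (hc : ContMDiffAt 𝓘(ℝ, E₀) (𝓡 3) ∞ c p) (u v : E₀) :
    extD (pullbackForm α c) p u v = oneFormExtDeriv α (c p) (mfderiv 𝓘(ℝ, E₀) (𝓡 3) c p u)
      (mfderiv 𝓘(ℝ, E₀) (𝓡 3) c p v) := by
  set d := extChartAt (𝓡 3) (c p) with hd
  set ψ : E₀ → E3 := fun q => d (c q) with hψ
  have hψm : ContMDiffAt 𝓘(ℝ, E₀) 𝓘(ℝ, E3) ∞ ψ p :=
    (extChartAt_contMDiffAt (mem_extChartAt_source (c p))).comp p hc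
  have hψs : ContDiffAt ℝ ∞ ψ p := hψm.contDiffAt
  have hds : ContMDiffAt 𝓘(ℝ, E3) (𝓡 3) ∞ d.symm (ψ p) :=
    extChartAt_symm_contMDiffAt (mem_extChartAt_target (c p))
  have hdψ : d.symm (ψ p) = c p := extChartAt_to_inv (c p)
  set B := pullbackForm α d.symm with hB
  have hBs : ContDiffAt ℝ ∞ B (ψ p) := contDiffAt_pullbackForm (by rw [hdψ]; exact hα) hds
  have hψd : DifferentiableAt ℝ ψ p := hψs.differentiableAt (by simp)
  -- the derivative of `c` through the chart
  have hnear : ∀ᶠ q in 𝓝 p, pullbackForm α c q = (B (ψ q)).comp (fderiv ℝ ψ q) := by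
    have hsrc : ∀ᶠ q in 𝓝 p, c q ∈ d.source :=
      hc.continuousAt.preimage_mem_nhds (extChartAt_source_mem_nhds (c p))
    filter_upwards [hsrc.eventually_nhds, contMDiffAt_nhds_one hψm,
      hψm.continuousAt.eventually (contMDiffAt_nhds_one hds)] with q h1 h2 h3
    have hcomp : HasMFDerivAt 𝓘(ℝ, E₀) (𝓡 3) (d.symm ∘ ψ) q
        ((mfderiv 𝓘(ℝ, E3) (𝓡 3) d.symm (ψ q)).comp (mfderiv 𝓘(ℝ, E₀) 𝓘(ℝ, E3) ψ q)) :=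
      HasMFDerivAt.comp q h3.hasMFDerivAt h2.hasMFDerivAt
    have hcq : HasMFDerivAt 𝓘(ℝ, E₀) (𝓡 3) c q
        ((mfderiv 𝓘(ℝ, E3) (𝓡 3) d.symm (ψ q)).comp (mfderiv 𝓘(ℝ, E₀) 𝓘(ℝ, E3) ψ q)) := by
      refine hcomp.congr_of_eventuallyEq ?_
      filter_upwards [h1] with y hy using (d.left_inv hy).symm
    have hl : d.symm (ψ q) = c q := d.left_inv h1.self_of_nhds
    ext w
    have e1 : pullbackForm α c q w = α (c q) (mfderiv 𝓘(ℝ, E3) (𝓡 3) d.symm (ψ q)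
        (mfderiv 𝓘(ℝ, E₀) 𝓘(ℝ, E3) ψ q w)) := by
      rw [pullbackForm, hcq.mfderiv]; rfl
    rw [e1, ← hl, mfderiv_eq_fderiv]
    rfl
  have hd2 : DifferentiableAt ℝ (fderiv ℝ ψ) p :=
    (hψs.fderiv_right (m := 1) (by norm_cast)).differentiableAt (by simp)
  have hfd : ∀ u v : E₀, fderiv ℝ (pullbackForm α c) p u v =
      fderiv ℝ B (ψ p) (fderiv ℝ ψ p u) (fderiv ℝ ψ p v) + B (ψ p) (fderiv ℝ (fderiv ℝ ψ) p u v) := by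
    intro u v
    rw [Filter.EventuallyEq.fderiv_eq hnear]
    have h1 : HasFDerivAt (fun q => B (ψ q)) ((fderiv ℝ B (ψ p)).comp (fderiv ℝ ψ p)) p :=
      ((hBs.differentiableAt (by simp)).hasFDerivAt).comp p hψd.hasFDerivAt
    rw [(h1.clm_comp hd2.hasFDerivAt).fderiv]
    simp [add_comm]
  have hsymm : fderiv ℝ (fderiv ℝ ψ) p u v = fderiv ℝ (fderiv ℝ ψ) p v u :=
    (hψs.isSymmSndFDerivAt (by simp only [minSmoothness_of_isRCLikeNormedField]; exact WithTop.coe_le_coe.2 le_top)) u v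
  have hmf : ∀ u : E₀, (mfderiv (𝓡 3) 𝓘(ℝ, E3) d (c p) (mfderiv 𝓘(ℝ, E₀) (𝓡 3) c p u) : E3)
      = fderiv ℝ ψ p u := by
    intro u
    have hcomp : HasMFDerivAt 𝓘(ℝ, E₀) 𝓘(ℝ, E3) ψ p
        ((mfderiv (𝓡 3) 𝓘(ℝ, E3) d (c p)).comp (mfderiv 𝓘(ℝ, E₀) (𝓡 3) c p)) :=
      HasMFDerivAt.comp p
        ((extChartAt_contMDiffAt (mem_extChartAt_source (c p))).mdifferentiableAt
          (by simp)).hasMFDerivAt (hc.mdifferentiableAt (by simp)).hasMFDerivAt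
    have := hcomp.mfderiv
    rw [mfderiv_eq_fderiv] at this
    rw [this]; rfl
  rw [extD, hfd, hfd, hsymm, add_sub_add_right_eq_sub]
  unfold oneFormExtDeriv
  rw [oneFormInChart_eq_pullbackForm]
  rw [← hmf u, ← hmf v]

theorem exists_oneFormExtDeriv_eq (α : ∀ x : M, TangentSpace (𝓡 3) x →L[ℝ] ℝ) (x : M) :
    ∃ (D : E3 →L[ℝ] E3 →L[ℝ] ℝ) (e : TangentSpace (𝓡 3) x →L[ℝ] E3), ∀ u v,
      oneFormExtDeriv α x u v = D (e u) (e v) - D (e v) (e u) :=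
  ⟨fderiv ℝ (oneFormInChart α x) (extChartAt (𝓡 3) x x),
    mfderiv (𝓡 3) 𝓘(ℝ, E3) (extChartAt (𝓡 3) x) x, fun _ _ => rfl⟩

theorem oneFormExtDeriv_add_left (α : ∀ x : M, TangentSpace (𝓡 3) x →L[ℝ] ℝ) (x : M)
    (u u' v : TangentSpace (𝓡 3) x) :
    oneFormExtDeriv α x (u + u') v = oneFormExtDeriv α x u v + oneFormExtDeriv α x u' v := by
  obtain ⟨D, e, h⟩ := exists_oneFormExtDeriv_eq α x
  simp only [h, map_add, add_apply]; ring

theorem oneFormExtDeriv_smul_left (α : ∀ x : M, TangentSpace (𝓡 3) x →L[ℝ] ℝ) (x : M) (c : ℝ)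
    (u v : TangentSpace (𝓡 3) x) :
    oneFormExtDeriv α x (c • u) v = c * oneFormExtDeriv α x u v := by
  obtain ⟨D, e, h⟩ := exists_oneFormExtDeriv_eq α x
  simp only [h, map_smul, smul_apply, smul_eq_mul]; ring

theorem oneFormExtDeriv_swap (α : ∀ x : M, TangentSpace (𝓡 3) x →L[ℝ] ℝ) (x : M)
    (u v : TangentSpace (𝓡 3) x) : oneFormExtDeriv α x u v = - oneFormExtDeriv α x v u := by
  obtain ⟨D, e, h⟩ := exists_oneFormExtDeriv_eq α x
  simp only [h]; ring

theorem oneFormExtDeriv_self (α : ∀ x : M, TangentSpace (𝓡 3) x →L[ℝ] ℝ) (x : M)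
    (u : TangentSpace (𝓡 3) x) : oneFormExtDeriv α x u u = 0 := by
  obtain ⟨D, e, h⟩ := exists_oneFormExtDeriv_eq α x
  simp only [h]; ring

theorem oneFormExtDeriv_add_right (α : ∀ x : M, TangentSpace (𝓡 3) x →L[ℝ] ℝ) (x : M)
    (u v v' : TangentSpace (𝓡 3) x) :
    oneFormExtDeriv α x u (v + v') = oneFormExtDeriv α x u v + oneFormExtDeriv α x u v' := by
  obtain ⟨D, e, h⟩ := exists_oneFormExtDeriv_eq α x
  simp only [h, map_add, add_apply]; ring

theorem oneFormExtDeriv_smul_right (α : ∀ x : M, TangentSpace (𝓡 3) x →L[ℝ] ℝ) (x : M) (c : ℝ)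
    (u v : TangentSpace (𝓡 3) x) :
    oneFormExtDeriv α x u (c • v) = c * oneFormExtDeriv α x u v := by
  obtain ⟨D, e, h⟩ := exists_oneFormExtDeriv_eq α x
  simp only [h, map_smul, smul_apply, smul_eq_mul]; ring

/-- The contact volume is multiplied by the determinant under a linear change of frame. -/
theorem contactVolume_matrix (α : ∀ x : M, TangentSpace (𝓡 3) x →L[ℝ] ℝ) (x : M)
    (P : Matrix (Fin 3) (Fin 3) ℝ) (u v w : TangentSpace (𝓡 3) x) :
    contactVolume α x (P 0 0 • u + P 0 1 • v + P 0 2 • w) (P 1 0 • u + P 1 1 • v + P 1 2 • w)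
      (P 2 0 • u + P 2 1 • v + P 2 2 • w) = P.det * contactVolume α x u v w := by
  simp only [contactVolume, oneFormExtDeriv_add_left, oneFormExtDeriv_add_right,
    oneFormExtDeriv_smul_left, oneFormExtDeriv_smul_right, map_add, map_smul, smul_eq_mul,
    oneFormExtDeriv_self, Matrix.det_fin_three]
  rw [oneFormExtDeriv_swap α x v u, oneFormExtDeriv_swap α x w v, oneFormExtDeriv_swap α x u w]
  ring

variable {o : ∀ x : M, Orientation ℝ (TangentSpace (𝓡 3) x) (Fin 3)}

theorem finrank_tangentSpace (x : M) : Module.finrank ℝ (TangentSpace (𝓡 3) x) = 3 :=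
  finrank_euclideanSpace_fin (𝕜 := ℝ) (n := 3)

instance (x : M) : FiniteDimensional ℝ (TangentSpace (𝓡 3) x) :=
  inferInstanceAs (FiniteDimensional ℝ E3)

theorem IsPositiveTriple.of_matrix {x : M} {u v w u' v' w' : TangentSpace (𝓡 3) x}
    (h : IsPositiveTriple o x u v w) (P : Matrix (Fin 3) (Fin 3) ℝ) (hP : 0 < P.det)
    (hu : u' = P 0 0 • u + P 0 1 • v + P 0 2 • w) (hv : v' = P 1 0 • u + P 1 1 • v + P 1 2 • w)
    (hw : w' = P 2 0 • u + P 2 1 • v + P 2 2 • w) : IsPositiveTriple o x u' v' w' := by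
  obtain ⟨b, hb, rfl, rfl, rfl⟩ := h
  let f : Fin 3 → TangentSpace (𝓡 3) x := ![u', v', w']
  have hf : b.toMatrix f = P.transpose := by
    ext i j
    rw [Module.Basis.toMatrix_apply, Matrix.transpose_apply]
    fin_cases j <;> fin_cases i <;>
      simp [f, hu, hv, hw]
  have hdet : b.det f = P.det := by rw [Module.Basis.det_apply, hf, Matrix.det_transpose]
  have hli : LinearIndependent ℝ f ∧ Submodule.span ℝ (Set.range f) = ⊤ :=
    (Module.Basis.is_basis_iff_det b).2 (by rw [hdet]; exact isUnit_iff_ne_zero.2 hP.ne')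
  let b' := Module.Basis.mk hli.1 hli.2.ge
  have hb' : ⇑b' = f := Module.Basis.coe_mk _ _
  refine ⟨b', ?_, ?_, ?_, ?_⟩
  · rw [← hb]
    refine ((Module.Basis.orientation_eq_iff_det_pos b b').2 ?_).symm
    rw [hb', hdet]; exact hP
  all_goals rw [hb']; rfl

theorem IsPositiveTriple.exists_matrix {x : M} {u v w u' v' w' : TangentSpace (𝓡 3) x}
    (h : IsPositiveTriple o x u v w) (h' : IsPositiveTriple o x u' v' w') :
    ∃ P : Matrix (Fin 3) (Fin 3) ℝ, 0 < P.det ∧ u' = P 0 0 • u + P 0 1 • v + P 0 2 • w ∧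
      v' = P 1 0 • u + P 1 1 • v + P 1 2 • w ∧ w' = P 2 0 • u + P 2 1 • v + P 2 2 • w := by
  obtain ⟨b, hb, rfl, rfl, rfl⟩ := h
  obtain ⟨b', hb', rfl, rfl, rfl⟩ := h'
  have hdet := (Module.Basis.orientation_eq_iff_det_pos b b').1 (hb.trans hb'.symm)
  refine ⟨(b.toMatrix b').transpose, ?_, ?_, ?_, ?_⟩
  · rw [Matrix.det_transpose, ← Module.Basis.det_apply]; exact hdet
  all_goals
    refine (b.sum_repr _).symm.trans ?_
    rw [Fin.sum_univ_three]; rfl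

theorem isPositiveTriple_or {x : M} {u v w : TangentSpace (𝓡 3) x}
    (h : LinearIndependent ℝ ![u, v, w]) :
    IsPositiveTriple o x u v w ∨ IsPositiveTriple o x v u w := by
  have h' : LinearIndependent ℝ ![v, u, w] := by
    have h2 : ![v, u, w] = ![u, v, w] ∘ (Equiv.swap (0 : Fin 3) 1) := by
      ext i; fin_cases i <;> rfl
    rw [h2]; exact h.comp _ (Equiv.injective _)
  have hc : Fintype.card (Fin 3) = Module.finrank ℝ (TangentSpace (𝓡 3) x) := by
    rw [finrank_tangentSpace]; rfl
  let b := basisOfLinearIndependentOfCardEqFinrank h hc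
  let b' := basisOfLinearIndependentOfCardEqFinrank h' hc
  have hb : ⇑b = ![u, v, w] := coe_basisOfLinearIndependentOfCardEqFinrank _ _
  have hb' : ⇑b' = ![v, u, w] := coe_basisOfLinearIndependentOfCardEqFinrank _ _
  rcases Module.Basis.orientation_eq_or_eq_neg b (o x) with h1 | h1
  · left; exact ⟨b, h1.symm, by rw [hb]; rfl, by rw [hb]; rfl, by rw [hb]; rfl⟩
  · right
    refine ⟨b', ?_, by rw [hb']; rfl, by rw [hb']; rfl, by rw [hb']; rfl⟩
    rw [h1]
    have hne : b'.orientation ≠ b.orientation := by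
      intro he
      have hp := (Module.Basis.orientation_eq_iff_det_pos b b').1 he.symm
      have h2 : ⇑b' = ⇑b ∘ (Equiv.swap (0 : Fin 3) 1) := by
        rw [hb, hb']; ext i; fin_cases i <;> rfl
      rw [h2, AlternatingMap.map_swap _ _ (by decide), b.det_self] at hp
      norm_num at hp
    rcases Module.Basis.orientation_eq_or_eq_neg b b'.orientation with h3 | h3
    · exact absurd h3 hne
    · exact h3

/-- A linear map which sends one positive triple to a positive triple preserves orientations. -/
theorem IsPositiveTriple.map_of_one {M' : Type u} [TopologicalSpace M'] [ChartedSpace E3 M']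
    [IsManifold (𝓡 3) ∞ M'] {o' : ∀ x : M', Orientation ℝ (TangentSpace (𝓡 3) x) (Fin 3)}
    {x : M} {x' : M'} (f : TangentSpace (𝓡 3) x →L[ℝ] TangentSpace (𝓡 3) x')
    {u v w : TangentSpace (𝓡 3) x}
    (h : IsPositiveTriple o x u v w) (hf : IsPositiveTriple o' x' (f u) (f v) (f w))
    {u' v' w' : TangentSpace (𝓡 3) x} (h' : IsPositiveTriple o x u' v' w') :
    IsPositiveTriple o' x' (f u') (f v') (f w') := by
  obtain ⟨P, hP, rfl, rfl, rfl⟩ := h.exists_matrix h'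
  exact hf.of_matrix P hP (by simp) (by simp) (by simp)

/-- The contact condition of sign `s` at a point. -/
def IsContactAt (o : ∀ x : M, Orientation ℝ (TangentSpace (𝓡 3) x) (Fin 3)) (s : ℝ)
    (α : ∀ x : M, TangentSpace (𝓡 3) x →L[ℝ] ℝ) (x : M) : Prop :=
  ∀ u v w : TangentSpace (𝓡 3) x, IsPositiveTriple o x u v w → 0 < s * contactVolume α x u v w

theorem isContactAt_of_one {s : ℝ} {α : ∀ x : M, TangentSpace (𝓡 3) x →L[ℝ] ℝ} {x : M}
    {u v w : TangentSpace (𝓡 3) x} (h : IsPositiveTriple o x u v w)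
    (hs : 0 < s * contactVolume α x u v w) : IsContactAt o s α x := by
  intro u' v' w' h'
  obtain ⟨P, hP, rfl, rfl, rfl⟩ := h.exists_matrix h'
  rw [contactVolume_matrix, mul_left_comm]
  exact mul_pos hP hs

theorem exists_isPositiveTriple (o : ∀ x : M, Orientation ℝ (TangentSpace (𝓡 3) x) (Fin 3))
    (x : M) : ∃ u v w, IsPositiveTriple o x u v w := by
  have b := Module.finBasisOfFinrankEq ℝ (TangentSpace (𝓡 3) x) (finrank_tangentSpace x)
  have h : LinearIndependent ℝ ![b 0, b 1, b 2] := by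
    have : ![b 0, b 1, b 2] = ⇑b := by ext i; fin_cases i <;> rfl
    rw [this]; exact b.linearIndependent
  rcases isPositiveTriple_or (o := o) h with h | h
  exacts [⟨_, _, _, h⟩, ⟨_, _, _, h⟩]

theorem IsContactAt.isPositiveTriple {s : ℝ} {α : ∀ x : M, TangentSpace (𝓡 3) x →L[ℝ] ℝ} {x : M}
    (hα : IsContactAt o s α x) {u v w : TangentSpace (𝓡 3) x}
    (h : 0 < s * contactVolume α x u v w) : IsPositiveTriple o x u v w := by
  obtain ⟨_, _, _, B, hB, rfl, rfl, rfl⟩ := exists_isPositiveTriple o x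
  let P : Matrix (Fin 3) (Fin 3) ℝ := Matrix.of ![B.repr u, B.repr v, B.repr w]
  have hu : u = P 0 0 • B 0 + P 0 1 • B 1 + P 0 2 • B 2 := by
    rw [← Fin.sum_univ_three (fun i => P 0 i • B i)]; exact (B.sum_repr u).symm
  have hv : v = P 1 0 • B 0 + P 1 1 • B 1 + P 1 2 • B 2 := by
    rw [← Fin.sum_univ_three (fun i => P 1 i • B i)]; exact (B.sum_repr v).symm
  have hw : w = P 2 0 • B 0 + P 2 1 • B 1 + P 2 2 • B 2 := by
    rw [← Fin.sum_univ_three (fun i => P 2 i • B i)]; exact (B.sum_repr w).symm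
  have hBp : IsPositiveTriple o x (B 0) (B 1) (B 2) := ⟨B, hB, rfl, rfl, rfl⟩
  refine hBp.of_matrix P ?_ hu hv hw
  have h1 := hα _ _ _ hBp
  rw [hu, hv, hw, contactVolume_matrix, mul_left_comm] at h
  exact (pos_iff_pos_of_mul_pos h).2 h1

theorem isPositiveContactForm_iff {α : ∀ x : M, TangentSpace (𝓡 3) x →L[ℝ] ℝ} :
    IsPositiveContactForm o α ↔ IsSmoothOneForm α ∧ ∀ x, IsContactAt o 1 α x := by
  simp only [IsPositiveContactForm, IsContactAt, one_mul]

theorem isNegativeContactForm_iff {α : ∀ x : M, TangentSpace (𝓡 3) x →L[ℝ] ℝ} :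
    IsNegativeContactForm o α ↔ IsSmoothOneForm α ∧ ∀ x, IsContactAt o (-1) α x := by
  simp only [IsNegativeContactForm, IsContactAt, neg_mul, one_mul, Left.neg_pos_iff]

theorem isSmoothOneForm_iff {α : ∀ x : M, TangentSpace (𝓡 3) x →L[ℝ] ℝ} :
    IsSmoothOneForm α ↔ ∀ x, IsSmoothOneFormAt α x := Iff.rfl

abbrev vecS : ℝ × ℝ × ℝ := (1, 0, 0)
abbrev vecW : ℝ × ℝ × ℝ := (0, 1, 0)
abbrev vecT : ℝ × ℝ × ℝ := (0, 0, 1)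

theorem vec_eq (v : ℝ × ℝ × ℝ) : v = v.1 • vecS + v.2.1 • vecW + v.2.2 • vecT := by
  ext <;> simp

/-- The contact volume of a form without `dt` component. -/
theorem contactVolume_coord {α : ∀ x : M, TangentSpace (𝓡 3) x →L[ℝ] ℝ} {c : ℝ × ℝ × ℝ → M}
    {p : ℝ × ℝ × ℝ} {A : ℝ × ℝ × ℝ → ℝ × ℝ × ℝ →L[ℝ] ℝ} (hα : IsSmoothOneFormAt α (c p))
    (hc : ContMDiffAt 𝓘(ℝ, ℝ × ℝ × ℝ) (𝓡 3) ∞ c p) (hA : pullbackForm α c =ᶠ[𝓝 p] A)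
    (ht : ∀ᶠ q in 𝓝 p, A q vecT = 0) :
    contactVolume α (c p) (mfderiv 𝓘(ℝ, ℝ × ℝ × ℝ) (𝓡 3) c p vecW)
      (mfderiv 𝓘(ℝ, ℝ × ℝ × ℝ) (𝓡 3) c p vecS) (mfderiv 𝓘(ℝ, ℝ × ℝ × ℝ) (𝓡 3) c p vecT) =
    A p vecS * fderiv ℝ (fun q => A q vecW) p vecT -
      A p vecW * fderiv ℝ (fun q => A q vecS) p vecT := by
  have hsm := contDiffAt_pullbackForm hα hc
  have hAs : ContDiffAt ℝ ∞ A p := hsm.congr_of_eventuallyEq hA.symm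
  have hAd : DifferentiableAt ℝ A p := hAs.differentiableAt (by simp)
  have hfd : ∀ u v, fderiv ℝ A p u v = fderiv ℝ (fun q => A q v) p u := by
    intro u v
    rw [(hAd.hasFDerivAt.clm_apply (hasFDerivAt_const v p)).fderiv]; simp
  have hpt : ∀ v : ℝ × ℝ × ℝ, α (c p) (mfderiv 𝓘(ℝ, ℝ × ℝ × ℝ) (𝓡 3) c p v) = A p v := fun v =>
    congrArg (fun L : ℝ × ℝ × ℝ →L[ℝ] ℝ => L v) hA.self_of_nhds
  have ht0 : fderiv ℝ (fun q => A q vecT) p = 0 := by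
    have : (fun q => A q vecT) =ᶠ[𝓝 p] fun _ => (0 : ℝ) := ht
    rw [this.fderiv_eq]; simp
  have hext : ∀ u v : ℝ × ℝ × ℝ, oneFormExtDeriv α (c p) (mfderiv 𝓘(ℝ, ℝ × ℝ × ℝ) (𝓡 3) c p u)
      (mfderiv 𝓘(ℝ, ℝ × ℝ × ℝ) (𝓡 3) c p v) =
      fderiv ℝ (fun q => A q v) p u - fderiv ℝ (fun q => A q u) p v := fun u v =>
    (extD_pullbackForm hα hc u v).symm.trans (by rw [extD, hA.fderiv_eq, hfd, hfd])
  have h1 := hpt vecW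
  have h2 := hpt vecS
  have h3 := (hpt vecT).trans ht.self_of_nhds
  have h4 := hext vecS vecT
  have h5 := hext vecT vecW
  have h6 := hext vecW vecS
  rw [ht0, zero_apply] at h4 h5
  unfold contactVolume
  rw [h1, h2, h3, h4, h5, h6]
  ring

end FormCalculus

/-! ### The flow of a compactly supported vector field -/

section Flow

variable {M : Type u} [TopologicalSpace M] [ChartedSpace E3 M] [IsManifold (𝓡 3) ∞ M]

theorem mfderiv_extChartAt_symm_mfderiv {x₀ : M} {y : E3}
    (hy : y ∈ (extChartAt (𝓡 3) x₀).target)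
    (v : TangentSpace (𝓡 3) ((extChartAt (𝓡 3) x₀).symm y)) :
    (mfderiv 𝓘(ℝ, E3) (𝓡 3) (extChartAt (𝓡 3) x₀).symm y
      (mfderiv (𝓡 3) 𝓘(ℝ, E3) (extChartAt (𝓡 3) x₀) ((extChartAt (𝓡 3) x₀).symm y) v : E3)) = v := by
  have := mfderivWithin_extChartAt_symm_comp_mfderiv_extChartAt (I := 𝓡 3) hy
  rw [ModelWithCorners.range_eq_univ, mfderivWithin_univ] at this
  exact congrArg (fun L : E3 →L[ℝ] E3 => L v) this

/-- A smooth local flow near a point. -/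
theorem exists_local_flow {X : ∀ x : M, TangentSpace (𝓡 3) x} (hX : IsSmoothVectorField X)
    (x₀ : M) : ∃ ψ : ℝ × M → M, ∃ ε > 0, ∃ U : Set M, IsOpen U ∧ x₀ ∈ U ∧
      (∀ t ∈ Set.Ioo (-ε) ε, ∀ x ∈ U,
        ContMDiffAt (𝓘(ℝ, ℝ).prod (𝓡 3)) (𝓡 3) ∞ ψ (t, x)) ∧
      (∀ x ∈ U, ψ (0, x) = x) ∧
      ∀ x ∈ U, IsMIntegralCurveOn (fun t => ψ (t, x)) X (Set.Ioo (-ε) ε) := by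
  set e := extChartAt (𝓡 3) x₀ with he
  set y₀ : E3 := e x₀
  let f : E3 → E3 := fun y => (mfderiv (𝓡 3) 𝓘(ℝ, E3) e (e.symm y) (X (e.symm y)) : E3)
  have hopen : IsOpen e.target := isOpen_extChartAt_target x₀
  have hf : ∀ y ∈ e.target, ContDiffAt ℝ ∞ f y := by
    intro y hy
    have hes : ContMDiffAt 𝓘(ℝ, E3) (𝓡 3) ∞ e.symm y := extChartAt_symm_contMDiffAt hy
    have h1 : ContMDiffAt 𝓘(ℝ, E3) (𝓡 3).tangent ∞
        (fun y => (⟨e.symm y, X (e.symm y)⟩ : TangentBundle (𝓡 3) M)) y :=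
      (hX.contMDiffAt (x := e.symm y)).comp y hes
    exact (ContMDiffAt.mfderiv_apply_vector (b := e.symm) h1
      (extChartAt_contMDiffAt (e.map_target hy))).contDiffAt
  have hy₀ : y₀ ∈ e.target := mem_extChartAt_target x₀
  obtain ⟨r, hr, hrs⟩ := Metric.nhds_basis_closedBall.mem_iff.1 (hopen.mem_nhds hy₀)
  let χ : ContDiffBump y₀ := ⟨r / 2, r, half_pos hr, half_lt_self hr⟩
  let F : E3 → E3 := fun y => χ y • f y
  have hF : ContDiff ℝ ∞ F := by
    rw [contDiff_iff_contDiffAt]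
    intro y
    by_cases hy : y ∈ e.target
    · exact χ.contDiffAt.smul (hf y hy)
    · have : y ∉ tsupport χ := by
        rw [χ.tsupport_eq]; exact fun h => hy (hrs h)
      rw [notMem_tsupport_iff_eventuallyEq] at this
      refine (contDiffAt_const (c := (0 : E3))).congr_of_eventuallyEq ?_
      filter_upwards [this] with z hz
      simp only [F, hz, Pi.zero_apply, zero_smul]
  obtain ⟨φ, ε, hε, hφ, hφ0, hφd⟩ := exists_smooth_local_flow hF y₀
  have hφat : ∀ t ∈ Metric.ball (0 : ℝ) ε, ∀ y ∈ Metric.ball y₀ ε, ContDiffAt ℝ ∞ φ (t, y) :=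
    fun t ht y hy => hφ.contDiffAt ((Metric.isOpen_ball.prod Metric.isOpen_ball).mem_nhds ⟨ht, hy⟩)
  have hmem : ∀ᶠ p in 𝓝 ((0 : ℝ), y₀), φ p ∈ Metric.ball y₀ (r / 2) := by
    refine (hφat 0 (Metric.mem_ball_self hε) y₀ (Metric.mem_ball_self hε)).continuousAt ?_
    rw [hφ0 y₀ (Metric.mem_ball_self hε)]
    exact Metric.ball_mem_nhds _ (half_pos hr)
  obtain ⟨δ, hδ, hδs⟩ := Metric.eventually_nhds_iff_ball.1 hmem
  set ε' := min ε δ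
  have hε' : 0 < ε' := lt_min hε hδ
  have hin : ∀ t ∈ Set.Ioo (-ε') ε', ∀ y ∈ Metric.ball y₀ ε', φ (t, y) ∈ Metric.ball y₀ (r / 2) := by
    intro t ht y hy
    refine hδs _ ?_
    rw [← ball_prod_same]
    refine ⟨?_, Metric.ball_subset_ball (min_le_right _ _) hy⟩
    have : t ∈ Metric.ball (0 : ℝ) ε' := by simpa [Real.ball_eq_Ioo] using ht
    exact Metric.ball_subset_ball (min_le_right _ _) this
  have hball : ∀ t ∈ Set.Ioo (-ε') ε', t ∈ Metric.ball (0 : ℝ) ε := by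
    intro t ht
    have : t ∈ Metric.ball (0 : ℝ) ε' := by simpa [Real.ball_eq_Ioo] using ht
    exact Metric.ball_subset_ball (min_le_left _ _) this
  have htar : Metric.ball y₀ (r / 2) ⊆ e.target := fun y hy =>
    hrs (Metric.ball_subset_closedBall (Metric.ball_subset_ball (half_le_self hr.le) hy))
  refine ⟨fun p => e.symm (φ (p.1, e p.2)), ε', hε', e.source ∩ e ⁻¹' Metric.ball y₀ ε',
    ?_, ?_, ?_, ?_, ?_⟩
  · exact (continuousOn_extChartAt x₀).isOpen_inter_preimage (isOpen_extChartAt_source x₀)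
      Metric.isOpen_ball
  · exact ⟨mem_extChartAt_source x₀, Metric.mem_ball_self hε'⟩
  · rintro t ht x ⟨hx, hx'⟩
    have h1 : ContMDiffAt (𝓘(ℝ, ℝ).prod (𝓡 3)) 𝓘(ℝ, ℝ × E3) ∞
        (fun p : ℝ × M => (p.1, e p.2)) (t, x) :=
      contMDiffAt_fst.prodMk_space ((extChartAt_contMDiffAt hx).comp (t, x) contMDiffAt_snd)
    have h2 : ContMDiffAt (𝓘(ℝ, ℝ).prod (𝓡 3)) 𝓘(ℝ, E3) ∞
        (fun p : ℝ × M => φ (p.1, e p.2)) (t, x) :=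
      (hφat t (hball t ht) (e x)
        (Metric.ball_subset_ball (min_le_left _ _) hx')).contMDiffAt.comp (t, x) h1
    exact (extChartAt_symm_contMDiffAt (htar (hin t ht _ hx'))).comp (t, x) h2
  · rintro x ⟨hx, hx'⟩
    show e.symm (φ (0, e x)) = x
    rw [hφ0 _ (Metric.ball_subset_ball (min_le_left _ _) hx'), e.left_inv hx]
  · rintro x ⟨hx, hx'⟩ t ht
    have hy := hin t ht _ hx'
    set y := φ (t, e x) with hyd
    have h1 : HasMFDerivAt 𝓘(ℝ, ℝ) 𝓘(ℝ, E3) (fun t => φ (t, e x)) t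
        (ContinuousLinearMap.toSpanSingleton ℝ (F y)) :=
      (hφd t (hball t ht) (e x)
        (Metric.ball_subset_ball (min_le_left _ _) hx')).hasFDerivAt.hasMFDerivAt
    have h2 : HasMFDerivAt 𝓘(ℝ, E3) (𝓡 3) e.symm y (mfderiv 𝓘(ℝ, E3) (𝓡 3) e.symm y) :=
      ((extChartAt_symm_contMDiffAt (htar hy)).mdifferentiableAt (by simp)).hasMFDerivAt
    have h3 := HasMFDerivAt.comp t h2 h1
    refine HasMFDerivAt.hasMFDerivWithinAt ?_
    refine h3.congr_mfderiv ?_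
    have hFy : F y = f y := by
      simp only [F]
      rw [χ.one_of_mem_closedBall (Metric.ball_subset_closedBall hy), one_smul]
    have h4 : (mfderiv 𝓘(ℝ, E3) (𝓡 3) e.symm y (f y)) = X (e.symm y) :=
      mfderiv_extChartAt_symm_mfderiv (htar hy) _
    refine ContinuousLinearMap.ext_ring ?_
    have h5 : (mfderiv 𝓘(ℝ, E3) (𝓡 3) e.symm y) (((1 : ℝ) • F y : E3)) = ((1 : ℝ) • X (e.symm y) : E3) := by
      rw [one_smul, hFy]; refine h4.trans ?_; exact (one_smul ℝ (X (e.symm y) : E3)).symm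
    exact h5

/-- A compactly supported smooth vector field is complete, and its flow is smooth. -/
theorem exists_global_flow [T2Space M] {X : ∀ x : M, TangentSpace (𝓡 3) x}
    (hX : IsSmoothVectorField X) {S : Set M} (hS : IsCompact S) (h0 : ∀ x ∉ S, X x = 0) :
    ∃ φ : ℝ → M → M,
      ContMDiff (𝓘(ℝ, ℝ).prod (𝓡 3)) (𝓡 3) ∞ (fun p : ℝ × M => φ p.1 p.2) ∧
      (∀ x, φ 0 x = x) ∧ (∀ x, IsMIntegralCurve (fun t => φ t x) X) ∧
      ∀ s t x, φ (s + t) x = φ s (φ t x) := by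
  have hX1 : ContMDiff (𝓡 3) (𝓡 3).tangent 1 (fun x => (⟨x, X x⟩ : TangentBundle (𝓡 3) M)) :=
    ContMDiff.of_le hX (by simp)
  choose ψ ε hε U hU hxU hψ hψ0 hψc using exists_local_flow hX
  obtain ⟨T, hTS, hT⟩ := hS.elim_nhds_subcover U fun x _ => (hU x).mem_nhds (hxU x)
  obtain ⟨η, hη, hηT⟩ : ∃ η > 0, ∀ x ∈ T, η ≤ ε x := by
    classical
    clear hTS hT
    induction T using Finset.induction_on with
    | empty => exact ⟨1, one_pos, by simp⟩
    | insert a T _ ih =>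
      obtain ⟨η, hη, h⟩ := ih
      refine ⟨min η (ε a), lt_min hη (hε a), fun x hx => ?_⟩
      rcases Finset.mem_insert.1 hx with rfl | hx
      exacts [min_le_right _ _, (min_le_left _ _).trans (h x hx)]
  have hloc : ∀ x ∈ S, ∃ a, x ∈ U a ∧ η ≤ ε a := by
    intro x hx
    obtain ⟨a, ha, hxa⟩ := Set.mem_iUnion₂.1 (hT hx)
    exact ⟨a, hxa, hηT a ha⟩
  have hconst : ∀ x ∉ S, IsMIntegralCurve (fun _ : ℝ => x) X := by
    intro x hx t
    rw [h0 x hx]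
    refine (hasMFDerivAt_const x t).congr_mfderiv ?_
    exact (ContinuousLinearMap.ext_ring (smul_zero (1 : ℝ))).symm
  have hex : ∀ x, ∃ γ : ℝ → M, γ 0 = x ∧ IsMIntegralCurve γ X := by
    refine exists_isMIntegralCurve_of_isMIntegralCurveOn hX1 hη fun x => ?_
    by_cases hx : x ∈ S
    · obtain ⟨a, hxa, ha⟩ := hloc x hx
      exact ⟨fun t => ψ a (t, x), hψ0 a x hxa,
        (hψc a x hxa).mono (Set.Ioo_subset_Ioo (neg_le_neg ha) ha)⟩
    · exact ⟨fun _ => x, rfl, (hconst x hx).isMIntegralCurveOn _⟩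
  choose γ hγ0 hγ using hex
  let φ : ℝ → M → M := fun t x => γ x t
  have hgroup : ∀ s t x, φ (s + t) x = φ s (φ t x) := by
    intro s t x
    have := isMIntegralCurve_Ioo_eq_of_contMDiff_boundaryless (t₀ := 0) hX1
      ((hγ x).comp_add t) (hγ (φ t x)) (by simp [hγ0, φ])
    exact congrFun this s
  have hloc2 : ∀ x, ∀ t ∈ Set.Ioo (-η) η,
      ContMDiffAt (𝓘(ℝ, ℝ).prod (𝓡 3)) (𝓡 3) ∞ (fun p : ℝ × M => φ p.1 p.2) (t, x) := by
    intro x t ht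
    by_cases hx : x ∈ S
    · obtain ⟨a, hxa, ha⟩ := hloc x hx
      have ht' : t ∈ Set.Ioo (-ε a) (ε a) := Set.Ioo_subset_Ioo (neg_le_neg ha) ha ht
      refine (hψ a t ht' x hxa).congr_of_eventuallyEq ?_
      filter_upwards [(isOpen_Ioo.prod (hU a)).mem_nhds ⟨ht', hxa⟩] with p hp
      have := isMIntegralCurveOn_Ioo_eqOn_of_contMDiff_boundaryless (t₀ := 0) (a := -ε a) (b := ε a)
        ⟨by linarith [hε a], hε a⟩ hX1 ((hγ p.2).isMIntegralCurveOn _) (hψc a p.2 hp.2)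
        (by rw [hγ0, hψ0 a _ hp.2])
      exact this hp.1
    · have hSo : IsOpen Sᶜ := hS.isClosed.isOpen_compl
      refine contMDiffAt_snd.congr_of_eventuallyEq ?_
      filter_upwards [(isOpen_univ.prod hSo).mem_nhds ⟨Set.mem_univ t, hx⟩] with p hp
      have := isMIntegralCurve_Ioo_eq_of_contMDiff_boundaryless (t₀ := 0) hX1
        (hγ p.2) (hconst p.2 hp.2) (hγ0 _)
      exact congrFun this p.1
  have hsm : ∀ (n : ℕ) (t : ℝ), t ∈ Set.Ioo (-η) η → ContMDiff (𝓡 3) (𝓡 3) ∞ (φ (n * t)) := by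
    intro n t ht
    induction n with
    | zero =>
      have : φ ((0 : ℕ) * t) = id := by ext1 x; simp [φ, hγ0]
      rw [this]; exact contMDiff_id
    | succ n ih =>
      have : φ ((n + 1 : ℕ) * t) = φ t ∘ φ (n * t) := by
        ext1 x; rw [Function.comp_apply, ← hgroup]; congr 1; push_cast; ring
      rw [this]
      refine ContMDiff.comp (fun x => ?_) ih
      exact (hloc2 x t ht).comp x (contMDiffAt_const.prodMk contMDiffAt_id)
  have hsm' : ∀ t, ContMDiff (𝓡 3) (𝓡 3) ∞ (φ t) := by
    intro t
    obtain ⟨n, hn⟩ := exists_nat_gt (|t| / η)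
    have hn0 : (0 : ℝ) < n := lt_of_le_of_lt (by positivity) hn
    have := hsm n (t / n) (by
      rw [Set.mem_Ioo, ← abs_lt, abs_div, abs_of_pos hn0, div_lt_iff₀ hn0]
      rw [div_lt_iff₀ hη] at hn; linarith)
    rwa [mul_div_cancel₀ _ hn0.ne'] at this
  refine ⟨φ, ?_, hγ0, hγ, hgroup⟩
  rintro ⟨t, x⟩
  have h1 : ContMDiffAt (𝓘(ℝ, ℝ).prod (𝓡 3)) (𝓘(ℝ, ℝ).prod (𝓡 3)) ∞
      (fun p : ℝ × M => (p.1 - t, φ t p.2)) (t, x) := by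
    refine ContMDiffAt.prodMk ?_ ((hsm' t).contMDiffAt.comp (t, x) contMDiffAt_snd)
    exact contMDiffAt_fst.sub contMDiffAt_const
  have h2 := ContMDiffAt.comp_of_eq (y := ((0 : ℝ), φ t x)) (hloc2 (φ t x) 0 ⟨by linarith, hη⟩) h1 (by simp)
  refine h2.congr_of_eventuallyEq (Filter.Eventually.of_forall fun p => ?_)
  simp only [Function.comp_apply, ← hgroup, sub_add_cancel]

end Flow

/-! ### Local inverses and boxes -/

section LocalInverse

theorem exists_circleExp_inverse (s : ℝ) : ∃ d : Circle → ℝ,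
    ContMDiffAt (𝓡 1) 𝓘(ℝ, ℝ) ∞ d (Circle.exp s) ∧ d (Circle.exp s) = s ∧
      (∀ z, Circle.exp (d z) = z) ∧ ∀ᶠ s' in 𝓝 s, d (Circle.exp s') = s' := by
  have : Fact (Module.finrank ℝ ℂ = 1 + 1) := finrank_real_complex_fact'
  refine ⟨fun z => s + Complex.arg ((z * Circle.exp (-s) : Circle) : ℂ), ?_, ?_, ?_, ?_⟩
  · have h1 : ContMDiffAt (𝓡 1) 𝓘(ℝ, ℂ) ∞ (fun z : Circle => ((z * Circle.exp (-s) : Circle) : ℂ))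
        (Circle.exp s) :=
      ((contMDiff_coe_sphere (E := ℂ) (n := 1)).contMDiffAt).comp (Circle.exp s)
        ((contMDiff_mul_right (I := 𝓡 1) (n := ∞) (a := Circle.exp (-s))).contMDiffAt)
    have h2 : ContDiffAt ℝ ∞ Complex.arg ((Circle.exp s * Circle.exp (-s) : Circle) : ℂ) := by
      rw [← Circle.exp_add, add_neg_cancel, Circle.exp_zero, Circle.coe_one]
      have : ContDiffAt ℝ ∞ (fun z => (Complex.log z).im) 1 :=
        Complex.imCLM.contDiff.contDiffAt.comp (1 : ℂ)
          ((Complex.contDiffAt_log (by simp)).restrict_scalars ℝ)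
      simpa [Complex.log_im] using this
    exact contMDiffAt_const.add (h2.contMDiffAt.comp (Circle.exp s) h1)
  · simp
  · intro z
    rw [Circle.exp_add, Circle.exp_arg, mul_left_comm, ← Circle.exp_add, add_neg_cancel,
      Circle.exp_zero, mul_one]
  · have : Set.Ioo (s - Real.pi) (s + Real.pi) ∈ 𝓝 s :=
      Ioo_mem_nhds (by linarith [Real.pi_pos]) (by linarith [Real.pi_pos])
    filter_upwards [this] with s' hs'
    rw [← Circle.exp_add, Circle.arg_exp (by linarith [hs'.1]) (by linarith [hs'.2])]
    ring

theorem mfderiv_circleExp_ne_zero (s : ℝ) :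
    (mfderiv 𝓘(ℝ, ℝ) (𝓡 1) Circle.exp s (1 : ℝ)) ≠ 0 := by
  obtain ⟨d, hd, -, -, h⟩ := exists_circleExp_inverse s
  intro h0
  have h1 : HasMFDerivAt 𝓘(ℝ, ℝ) 𝓘(ℝ, ℝ) (d ∘ Circle.exp) s
      ((mfderiv (𝓡 1) 𝓘(ℝ, ℝ) d (Circle.exp s)).comp (mfderiv 𝓘(ℝ, ℝ) (𝓡 1) Circle.exp s)) :=
    HasMFDerivAt.comp s (hd.mdifferentiableAt (by simp)).hasMFDerivAt
      ((contMDiff_circleExp (m := ∞)).mdifferentiable (by simp) s).hasMFDerivAt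
  have h2 : HasMFDerivAt 𝓘(ℝ, ℝ) 𝓘(ℝ, ℝ) (d ∘ Circle.exp) s
      (ContinuousLinearMap.id ℝ (TangentSpace 𝓘(ℝ, ℝ) s)) :=
    (hasMFDerivAt_id s).congr_of_eventuallyEq (by filter_upwards [h] with y hy using hy)
  have h3 : mfderiv (𝓡 1) 𝓘(ℝ, ℝ) d (Circle.exp s) (mfderiv 𝓘(ℝ, ℝ) (𝓡 1) Circle.exp s (1 : ℝ))
      = (1 : ℝ) := congrArg (fun L : ℝ →L[ℝ] ℝ => L 1) (hasMFDerivAt_unique h1 h2)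
  rw [h0, map_zero] at h3
  exact zero_ne_one (α := ℝ) h3

section Box

variable {E E' H H' : Type*} [NormedAddCommGroup E] [NormedSpace ℝ E] [NormedAddCommGroup E']
  [NormedSpace ℝ E'] [TopologicalSpace H] [TopologicalSpace H'] {I : ModelWithCorners ℝ E H}
  {I' : ModelWithCorners ℝ E' H'} {N N' : Type*} [TopologicalSpace N] [ChartedSpace H N]
  [TopologicalSpace N'] [ChartedSpace H' N']

/-- An injective map with smooth local inverses is a partial diffeomorphism. -/
theorem exists_partialDiffeomorph [Nonempty N] {f : N → N'} {S : Set N} (hS : IsOpen S)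
    (hinj : Set.InjOn f S) (hf : ∀ p ∈ S, ContMDiffAt I I' ∞ f p)
    (hloc : ∀ p ∈ S, ∃ d : N' → N, ContMDiffAt I' I ∞ d (f p) ∧ d (f p) = p ∧
      ∀ᶠ x in 𝓝 (f p), f (d x) = x) :
    ∃ Φ : PartialDiffeomorph I I' N N' ∞, Φ.source = S ∧ Φ.target = f '' S ∧ ∀ p, Φ p = f p := by
  have key : ∀ p ∈ S, ∃ d : N' → N, ContMDiffAt I' I ∞ d (f p) ∧
      ∀ᶠ x in 𝓝 (f p), d x ∈ S ∧ f (d x) = x := by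
    intro p hp
    obtain ⟨d, hd, hdp, h⟩ := hloc p hp
    refine ⟨d, hd, ?_⟩
    have : ∀ᶠ x in 𝓝 (f p), d x ∈ S :=
      hd.continuousAt.eventually (by rw [hdp]; exact hS.mem_nhds hp)
    exact this.and h
  have hsymm : ∀ x ∈ S, Function.invFunOn f S (f x) = x := fun x hx =>
    hinj (Function.invFunOn_mem ⟨x, hx, rfl⟩) hx (Function.invFunOn_eq ⟨x, hx, rfl⟩)
  refine ⟨{ toFun := f, invFun := Function.invFunOn f S, source := S, target := f '' S,
            map_source' := fun x hx => ⟨x, hx, rfl⟩,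
            map_target' := ?_, left_inv' := hsymm, right_inv' := ?_, open_source := hS,
            open_target := ?_, contMDiffOn_toFun := fun p hp => (hf p hp).contMDiffWithinAt,
            contMDiffOn_invFun := ?_ }, rfl, rfl, fun _ => rfl⟩
  · rintro _ ⟨x, hx, rfl⟩; rw [hsymm x hx]; exact hx
  · rintro _ ⟨x, hx, rfl⟩; rw [hsymm x hx]
  · rw [isOpen_iff_mem_nhds]
    rintro _ ⟨p, hp, rfl⟩
    obtain ⟨d, -, h⟩ := key p hp
    filter_upwards [h] with x hx using ⟨d x, hx⟩
  · rintro _ ⟨p, hp, rfl⟩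
    obtain ⟨d, hd, h⟩ := key p hp
    refine (hd.congr_of_eventuallyEq ?_).contMDiffWithinAt
    filter_upwards [h] with x hx
    conv_lhs => rw [← hx.2]
    exact hsymm _ hx.1

end Box

variable {M : Type u} [TopologicalSpace M] [ChartedSpace E3 M] [IsManifold (𝓡 3) ∞ M]
  {E₀ : Type*} [NormedAddCommGroup E₀] [NormedSpace ℝ E₀]

theorem mfderiv_injective_of_leftInverse {c : E₀ → M} {D : M → E₀} {p : E₀}
    (hc : MDifferentiableAt 𝓘(ℝ, E₀) (𝓡 3) c p) (hD : MDifferentiableAt (𝓡 3) 𝓘(ℝ, E₀) D (c p))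
    (h : ∀ᶠ q in 𝓝 p, D (c q) = q) (v : E₀) :
    (mfderiv (𝓡 3) 𝓘(ℝ, E₀) D (c p) (mfderiv 𝓘(ℝ, E₀) (𝓡 3) c p v) : E₀) = v := by
  have h1 : HasMFDerivAt 𝓘(ℝ, E₀) 𝓘(ℝ, E₀) (D ∘ c) p
      ((mfderiv (𝓡 3) 𝓘(ℝ, E₀) D (c p)).comp (mfderiv 𝓘(ℝ, E₀) (𝓡 3) c p)) :=
    HasMFDerivAt.comp p hD.hasMFDerivAt hc.hasMFDerivAt
  have h2 : HasMFDerivAt 𝓘(ℝ, E₀) 𝓘(ℝ, E₀) (D ∘ c) p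
      (ContinuousLinearMap.id ℝ (TangentSpace 𝓘(ℝ, E₀) p)) :=
    (hasMFDerivAt_id p).congr_of_eventuallyEq (by filter_upwards [h] with y hy using hy)
  exact congrArg (fun L : E₀ →L[ℝ] E₀ => L v) (hasMFDerivAt_unique h1 h2)

/-- The inverse function theorem for maps from a vector space to a 3-manifold. -/
theorem exists_local_inverse [FiniteDimensional ℝ E₀] (hE : Module.finrank ℝ E₀ = 3) {c : E₀ → M}
    {p : E₀} (hc : ∀ᶠ q in 𝓝 p, ContMDiffAt 𝓘(ℝ, E₀) (𝓡 3) ∞ c q)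
    (hinj : ∀ v : E₀, (mfderiv 𝓘(ℝ, E₀) (𝓡 3) c p v : E3) = 0 → v = 0) :
    ∃ D : M → E₀, ContMDiffAt (𝓡 3) 𝓘(ℝ, E₀) ∞ D (c p) ∧ D (c p) = p ∧
      (∀ᶠ x in 𝓝 (c p), c (D x) = x) ∧ ∀ᶠ q in 𝓝 p, D (c q) = q := by
  set e := extChartAt (𝓡 3) (c p) with he
  have : CompleteSpace E₀ := FiniteDimensional.complete ℝ E₀
  let F : E₀ → E3 := fun q => e (c q)
  have hcp := hc.self_of_nhds
  have hsrc : ∀ᶠ q in 𝓝 p, c q ∈ e.source :=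
    hcp.continuousAt.preimage_mem_nhds (extChartAt_source_mem_nhds (c p))
  obtain ⟨U, hUs, hU, hpU⟩ := mem_nhds_iff.1 (hc.and hsrc)
  have hF : ContDiffOn ℝ ∞ F U := fun q hq =>
    (((extChartAt_contMDiffAt (hUs hq).2).comp q (hUs hq).1).contDiffAt).contDiffWithinAt
  have hFp : ContDiffAt ℝ ∞ F p := hF.contDiffAt (hU.mem_nhds hpU)
  have hcomp : HasMFDerivAt 𝓘(ℝ, E₀) 𝓘(ℝ, E3) F p
      ((mfderiv (𝓡 3) 𝓘(ℝ, E3) e (c p)).comp (mfderiv 𝓘(ℝ, E₀) (𝓡 3) c p)) :=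
    HasMFDerivAt.comp p
      ((extChartAt_contMDiffAt (mem_extChartAt_source (c p))).mdifferentiableAt
        (by simp)).hasMFDerivAt (hcp.mdifferentiableAt (by simp)).hasMFDerivAt
  have hF' : ∀ v : E₀, fderiv ℝ F p v =
      (mfderiv (𝓡 3) 𝓘(ℝ, E3) e (c p) (mfderiv 𝓘(ℝ, E₀) (𝓡 3) c p v) : E3) := by
    have := hcomp.mfderiv
    rw [mfderiv_eq_fderiv] at this
    exact fun v => congrArg (fun L : E₀ →L[ℝ] E3 => L v) this
  have hFinj : Function.Injective (fderiv ℝ F p) := by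
    rw [injective_iff_map_eq_zero]
    intro v hv
    rw [hF'] at hv
    refine hinj v ?_
    have h2 := mfderivWithin_extChartAt_symm_comp_mfderiv_extChartAt' (I := 𝓡 3)
      (mem_extChartAt_source (I := 𝓡 3) (c p))
    have h3 := congrArg (fun L : E3 →L[ℝ] E3 => L (mfderiv 𝓘(ℝ, E₀) (𝓡 3) c p v)) h2
    refine h3.symm.trans ?_
    refine (congrArg (mfderivWithin 𝓘(ℝ, E3) (𝓡 3) e.symm (Set.range (𝓡 3)) (e (c p)) :
      E3 →L[ℝ] E3) hv).trans ?_
    exact map_zero (mfderivWithin 𝓘(ℝ, E3) (𝓡 3) e.symm (Set.range (𝓡 3)) (e (c p)) :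
      E3 →L[ℝ] E3)
  have hfr : Module.finrank ℝ E₀ = Module.finrank ℝ E3 := by rw [hE, finrank_euclideanSpace_fin]
  let L : E₀ ≃L[ℝ] E3 :=
    ((fderiv ℝ F p : E₀ →ₗ[ℝ] E3).linearEquivOfInjective hFinj hfr).toContinuousLinearEquiv
  have hL : HasFDerivAt F (L : E₀ →L[ℝ] E3) p := by
    have : (L : E₀ →L[ℝ] E3) = fderiv ℝ F p := by ext1 v; rfl
    rw [this]; exact (hFp.differentiableAt (by simp)).hasFDerivAt
  obtain ⟨a, hpa, haU, haF, has⟩ := exists_smooth_openPartialHomeomorph hU hF hpU L hL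
  have hFpt : e (c p) ∈ a.target := by
    have := a.map_source hpa; rwa [haF] at this
  have hsp : a.symm (e (c p)) = p := by
    have := a.left_inv hpa; rwa [haF] at this
  have hee := extChartAt_contMDiffAt (mem_extChartAt_source (I := 𝓡 3) (c p))
  refine ⟨fun x => a.symm (e x), ?_, hsp, ?_, ?_⟩
  · exact (has.contDiffAt (a.open_target.mem_nhds hFpt)).contMDiffAt.comp (c p) hee
  · filter_upwards [hee.continuousAt.preimage_mem_nhds (a.open_target.mem_nhds hFpt),
      extChartAt_source_mem_nhds (I := 𝓡 3) (c p)] with x hx hx'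
    have h1 : a.symm (e x) ∈ a.source := a.map_target hx
    have h2 : e (c (a.symm (e x))) = e x := (haF _).symm.trans (a.right_inv hx)
    exact e.injOn (hUs (haU h1)).2 hx' h2
  · filter_upwards [a.open_source.mem_nhds hpa] with q hq
    have := a.left_inv hq
    rwa [haF] at this

/-- The real coordinates on `S¹ × ℝ × ℝ`. -/
def expCoord (p : ℝ × ℝ × ℝ) : Circle × ℝ × ℝ := (Circle.exp p.1, p.2.1, p.2.2)

theorem contMDiff_expCoord : ContMDiff 𝓘(ℝ, ℝ × ℝ × ℝ) ((𝓡 1).prod (𝓘(ℝ, ℝ).prod 𝓘(ℝ, ℝ))) ∞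
    expCoord :=
  (contMDiff_circleExp.comp contDiff_fst.contMDiff).prodMk
    ((contDiff_fst.comp contDiff_snd).contMDiff.prodMk (contDiff_snd.comp contDiff_snd).contMDiff)

theorem exists_expCoord_inverse (p : ℝ × ℝ × ℝ) : ∃ d : Circle × ℝ × ℝ → ℝ × ℝ × ℝ,
    ContMDiffAt ((𝓡 1).prod (𝓘(ℝ, ℝ).prod 𝓘(ℝ, ℝ))) 𝓘(ℝ, ℝ × ℝ × ℝ) ∞ d (expCoord p) ∧
      d (expCoord p) = p ∧ (∀ z, expCoord (d z) = z) ∧ ∀ᶠ q in 𝓝 p, d (expCoord q) = q := by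
  obtain ⟨d, hd, hdp, h1, h2⟩ := exists_circleExp_inverse p.1
  refine ⟨fun z => (d z.1, z.2.1, z.2.2), ?_, ?_, ?_, ?_⟩
  · exact (ContMDiffAt.comp_of_eq hd contMDiffAt_fst rfl).prodMk_space
      ((contMDiffAt_fst.comp _ contMDiffAt_snd).prodMk_space
        (contMDiffAt_snd.comp _ contMDiffAt_snd))
  · simp [expCoord, hdp]
  · intro z; simp [expCoord, h1]
  · filter_upwards [continuousAt_fst.eventually h2] with q hq
    simp [expCoord, hq]

theorem AnnulusBox.contMDiffAt_coord (Φ : AnnulusBox M) {p : ℝ × ℝ × ℝ}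
    (hp : expCoord p ∈ Φ.source) : ContMDiffAt 𝓘(ℝ, ℝ × ℝ × ℝ) (𝓡 3) ∞ Φ.coord p :=
  (Φ.contMDiffOn_toFun.contMDiffAt (Φ.open_source.mem_nhds hp)).comp p
    contMDiff_expCoord.contMDiffAt

theorem AnnulusBox.exists_coord_inverse (Φ : AnnulusBox M) {p : ℝ × ℝ × ℝ}
    (hp : expCoord p ∈ Φ.source) :
    ∃ D : M → ℝ × ℝ × ℝ, ContMDiffAt (𝓡 3) 𝓘(ℝ, ℝ × ℝ × ℝ) ∞ D (Φ.coord p) ∧ D (Φ.coord p) = p ∧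
      (∀ᶠ x in 𝓝 (Φ.coord p), Φ.coord (D x) = x) ∧ ∀ᶠ q in 𝓝 p, D (Φ.coord q) = q := by
  obtain ⟨d, hd, hdp, h1, h2⟩ := exists_expCoord_inverse p
  have hl : ∀ q, expCoord q ∈ Φ.source → Φ.toPartialEquiv.symm (Φ.coord q) = expCoord q :=
    fun q hq => Φ.left_inv' hq
  refine ⟨fun x => d (Φ.toPartialEquiv.symm x), ?_, ?_, ?_, ?_⟩
  · exact ContMDiffAt.comp_of_eq hd
      (Φ.contMDiffOn_invFun.contMDiffAt (Φ.open_target.mem_nhds (Φ.map_source' hp))) (hl p hp)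
  · show d (Φ.toPartialEquiv.symm (Φ.coord p)) = p
    rw [hl p hp, hdp]
  · filter_upwards [Φ.open_target.mem_nhds (Φ.map_source' hp)] with x hx
    show Φ (expCoord (d (Φ.toPartialEquiv.symm x))) = x
    rw [h1]; exact Φ.right_inv' hx
  · filter_upwards [contMDiff_expCoord.continuous.continuousAt.preimage_mem_nhds
      (Φ.open_source.mem_nhds hp), h2] with q hq hq'
    show d (Φ.toPartialEquiv.symm (Φ.coord q)) = q
    rw [hl q hq, hq']

end LocalInverse

/-! ### Smooth exterior derivatives and adapted frames -/

section Frames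

variable {M : Type u} [TopologicalSpace M] [ChartedSpace E3 M] [IsManifold (𝓡 3) ∞ M]
  {F : Type*} [NormedAddCommGroup F] [NormedSpace ℝ F] {G : Type*} [TopologicalSpace G]
  {J : ModelWithCorners ℝ F G} {N : Type*} [TopologicalSpace N] [ChartedSpace G N]
  [IsManifold J ∞ N]

theorem oneFormExtDeriv_eq_chart {α : ∀ x : M, TangentSpace (𝓡 3) x →L[ℝ] ℝ}
    (hα : IsSmoothOneForm α) (x₀ : M) {x : M} (hx : x ∈ (extChartAt (𝓡 3) x₀).source)
    (V W : TangentSpace (𝓡 3) x) :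
    oneFormExtDeriv α x V W =
      extD (pullbackForm α (extChartAt (𝓡 3) x₀).symm) (extChartAt (𝓡 3) x₀ x)
        (mfderiv (𝓡 3) 𝓘(ℝ, E3) (extChartAt (𝓡 3) x₀) x V)
        (mfderiv (𝓡 3) 𝓘(ℝ, E3) (extChartAt (𝓡 3) x₀) x W) := by
  obtain ⟨y, hy, rfl⟩ : ∃ y ∈ (extChartAt (𝓡 3) x₀).target, (extChartAt (𝓡 3) x₀).symm y = x :=
    ⟨_, (extChartAt (𝓡 3) x₀).map_source hx, (extChartAt (𝓡 3) x₀).left_inv hx⟩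
  rw [(extChartAt (𝓡 3) x₀).right_inv hy]
  refine Eq.trans ?_ (extD_pullbackForm (hα _) (extChartAt_symm_contMDiffAt hy) _ _).symm
  have h1 := mfderiv_extChartAt_symm_mfderiv hy V
  have h2 := mfderiv_extChartAt_symm_mfderiv hy W
  exact (congrArg₂ (fun a b : E3 => oneFormExtDeriv α ((extChartAt (𝓡 3) x₀).symm y) a b) h1 h2).symm

theorem IsSmoothOneForm.extDeriv_along {α : ∀ x : M, TangentSpace (𝓡 3) x →L[ℝ] ℝ}
    (hα : IsSmoothOneForm α) {b : N → M} {V W : ∀ n, TangentSpace (𝓡 3) (b n)} {n₀ : N}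
    (hV : ContMDiffAt J (𝓡 3).tangent ∞ (fun n => (⟨b n, V n⟩ : TangentBundle (𝓡 3) M)) n₀)
    (hW : ContMDiffAt J (𝓡 3).tangent ∞ (fun n => (⟨b n, W n⟩ : TangentBundle (𝓡 3) M)) n₀) :
    ContMDiffAt J 𝓘(ℝ, ℝ) ∞ (fun n => oneFormExtDeriv α (b n) (V n) (W n)) n₀ := by
  have hb : ContMDiffAt J (𝓡 3) ∞ b n₀ := (Bundle.contMDiffAt_totalSpace.1 hV).1
  set e := extChartAt (𝓡 3) (b n₀) with he
  have hsrc := mem_extChartAt_source (I := 𝓡 3) (b n₀)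
  have hee := extChartAt_contMDiffAt hsrc
  have hv : ContMDiffAt J 𝓘(ℝ, E3) ∞ (fun n => (mfderiv (𝓡 3) 𝓘(ℝ, E3) e (b n) (V n) : E3)) n₀ :=
    ContMDiffAt.mfderiv_apply_vector (b := b) hV hee
  have hw : ContMDiffAt J 𝓘(ℝ, E3) ∞ (fun n => (mfderiv (𝓡 3) 𝓘(ℝ, E3) e (b n) (W n) : E3)) n₀ :=
    ContMDiffAt.mfderiv_apply_vector (b := b) hW hee
  have hB : ContDiffAt ℝ ∞ (pullbackForm α e.symm) (e (b n₀)) :=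
    contDiffAt_pullbackForm (hα _) (extChartAt_symm_contMDiffAt (mem_extChartAt_target (b n₀)))
  have hB' : ContMDiffAt J 𝓘(ℝ, E3 →L[ℝ] E3 →L[ℝ] ℝ) ∞
      (fun n => fderiv ℝ (pullbackForm α e.symm) (e (b n))) n₀ :=
    (hB.fderiv_right (m := ∞) (by simp)).contMDiffAt.comp n₀ (hee.comp n₀ hb)
  have := ((hB'.clm_apply hv).clm_apply hw).sub ((hB'.clm_apply hw).clm_apply hv)
  refine this.congr_of_eventuallyEq ?_
  filter_upwards [hb.continuousAt.preimage_mem_nhds (extChartAt_source_mem_nhds (I := 𝓡 3) (b n₀))] with n hn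
  exact oneFormExtDeriv_eq_chart hα (b n₀) hn _ _

theorem exists_apply_eq_one_zero {E : Type*} [AddCommGroup E] [Module ℝ E] [TopologicalSpace E]
    [IsTopologicalAddGroup E] [ContinuousSMul ℝ E]
    {f g : E →L[ℝ] ℝ} (h : LinearIndependent ℝ ![f, g]) : ∃ u, f u = 1 ∧ g u = 0 := by
  by_contra! hc
  have hker : ∀ u, g u = 0 → f u = 0 := by
    intro u hu
    by_contra hfu
    exact hc ((f u)⁻¹ • u) (by simp [hfu]) (by simp [hu])
  have hmem : (f : E →ₗ[ℝ] ℝ) ∈ Submodule.span ℝ (Set.range fun _ : Unit => (g : E →ₗ[ℝ] ℝ)) :=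
    mem_span_of_iInf_ker_le_ker (by
      intro u hu
      simp only [ciInf_unique, LinearMap.mem_ker] at hu ⊢
      exact hker u hu)
  rw [Set.range_const, Submodule.mem_span_singleton] at hmem
  obtain ⟨a, ha⟩ := hmem
  have := (LinearIndependent.pair_iff.1 h) 1 (-a) (by
    ext u
    have h1 := LinearMap.congr_fun ha u
    simp only [LinearMap.smul_apply, ContinuousLinearMap.coe_coe, smul_eq_mul] at h1
    simp [← h1])
  exact one_ne_zero this.1

theorem chartConst_mfderiv_self (x₀ : M) (v : TangentSpace (𝓡 3) x₀) :
    chartConst x₀ (mfderiv (𝓡 3) 𝓘(ℝ, E3) (extChartAt (𝓡 3) x₀) x₀ v) x₀ = v := by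
  refine (chartConst_eq (mem_extChartAt_source x₀) _).trans ?_
  have h2 := mfderivWithin_extChartAt_symm_comp_mfderiv_extChartAt' (I := 𝓡 3)
    (mem_extChartAt_source (I := 𝓡 3) x₀)
  rw [ModelWithCorners.range_eq_univ, mfderivWithin_univ] at h2
  exact congrArg (fun L : E3 →L[ℝ] E3 => L v) h2

variable [T2Space M] [SigmaCompactSpace M]

theorem exists_smooth_field {α β : ∀ x : M, TangentSpace (𝓡 3) x →L[ℝ] ℝ}
    (hα : IsSmoothOneForm α) (hβ : IsSmoothOneForm β)
    (h : ∀ x, LinearIndependent ℝ ![α x, β x]) :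
    ∃ U : ∀ x : M, TangentSpace (𝓡 3) x, IsSmoothVectorField U ∧ ∀ x, α x (U x) = 1 ∧
      β x (U x) = 0 := by
  have key := exists_contMDiffSection_forall_mem_convex_of_local (n := ⊤) (𝓡 3)
    (F_fiber := E3) (fun x : M => TangentSpace (𝓡 3) x)
    (fun x => {v : TangentSpace (𝓡 3) x | α x v = 1 ∧ β x v = 0}) ?_ ?_
  · obtain ⟨s, hs⟩ := key
    exact ⟨s, s.contMDiff, hs⟩
  · rintro x u ⟨hu1, hu2⟩ v ⟨hv1, hv2⟩ a b - - hab
    refine ⟨?_, ?_⟩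
    · rw [map_add, map_smul, map_smul, hu1, hv1]; simpa using hab
    · rw [map_add, map_smul, map_smul, hu2, hv2]; simp
  · intro x₀
    obtain ⟨u₁, h1, h2⟩ := exists_apply_eq_one_zero (h x₀)
    obtain ⟨u₂, h3, h4⟩ := exists_apply_eq_one_zero (LinearIndependent.pair_symm_iff.1 (h x₀))
    let e := extChartAt (𝓡 3) x₀
    let V₁ : ∀ x : M, TangentSpace (𝓡 3) x := chartConst x₀ (mfderiv (𝓡 3) 𝓘(ℝ, E3) e x₀ u₁)
    let V₂ : ∀ x : M, TangentSpace (𝓡 3) x := chartConst x₀ (mfderiv (𝓡 3) 𝓘(ℝ, E3) e x₀ u₂)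
    have hV₁0 : V₁ x₀ = u₁ := chartConst_mfderiv_self x₀ u₁
    have hV₂0 : V₂ x₀ = u₂ := chartConst_mfderiv_self x₀ u₂
    have hV₁ : ∀ x ∈ e.source, IsSmoothVectorFieldAt V₁ x := fun x hx =>
      isSmoothVectorFieldAt_chartConst hx _
    have hV₂ : ∀ x ∈ e.source, IsSmoothVectorFieldAt V₂ x := fun x hx =>
      isSmoothVectorFieldAt_chartConst hx _
    let D : M → ℝ := fun x => α x (V₁ x) * β x (V₂ x) - α x (V₂ x) * β x (V₁ x)
    have hD : ∀ x ∈ e.source, ContMDiffAt (𝓡 3) 𝓘(ℝ, ℝ) ∞ D x := fun x hx =>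
      (((isSmoothOneForm_iff.1 hα x).apply_along (b := id) (hV₁ x hx)).mul ((isSmoothOneForm_iff.1 hβ x).apply_along (b := id) (hV₂ x hx))).sub
        (((isSmoothOneForm_iff.1 hα x).apply_along (b := id) (hV₂ x hx)).mul ((isSmoothOneForm_iff.1 hβ x).apply_along (b := id) (hV₁ x hx)))
    have hD0 : D x₀ = 1 := by simp only [D, hV₁0, hV₂0, h1, h2, h3, h4]; norm_num
    have hx₀ : x₀ ∈ e.source := mem_extChartAt_source x₀
    refine ⟨e.source ∩ {x | D x ≠ 0}, Filter.inter_mem (extChartAt_source_mem_nhds x₀)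
      ((hD x₀ hx₀).continuousAt.eventually_ne (by rw [hD0]; exact one_ne_zero)),
      fun x => (β x (V₂ x) / D x) • V₁ x - (β x (V₁ x) / D x) • V₂ x, ?_, ?_⟩
    · rintro x ⟨hx, hDx⟩
      refine ContMDiffAt.contMDiffWithinAt ?_
      exact ((((isSmoothOneForm_iff.1 hβ x).apply_along (b := id) (hV₂ x hx)).div₀ (hD x hx) hDx).smul_section
        (hV₁ x hx)).sub_section
        ((((isSmoothOneForm_iff.1 hβ x).apply_along (b := id) (hV₁ x hx)).div₀ (hD x hx) hDx).smul_section (hV₂ x hx))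
    · rintro x ⟨hx, hDx : D x ≠ 0⟩
      refine ⟨?_, ?_⟩
      · rw [map_sub, map_smul, map_smul, smul_eq_mul, smul_eq_mul, div_mul_eq_mul_div,
          div_mul_eq_mul_div, ← sub_div, div_eq_one_iff_eq hDx]
        simp only [D]; ring
      · rw [map_sub, map_smul, map_smul, smul_eq_mul, smul_eq_mul]; ring

theorem exists_smooth_oneForm {X : ∀ x : M, TangentSpace (𝓡 3) x} (hX : IsSmoothVectorField X)
    (h : ∀ x, X x ≠ 0) : ∃ γ : ∀ x : M, TangentSpace (𝓡 3) x →L[ℝ] ℝ, IsSmoothOneForm γ ∧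
      ∀ x, γ x (X x) = 1 := by
  have key := exists_contMDiffSection_forall_mem_convex_of_local (n := ⊤) (𝓡 3)
    (F_fiber := E3 →L[ℝ] ℝ) (fun x : M => TangentSpace (𝓡 3) x →L[ℝ] Bundle.Trivial M ℝ x)
    (fun x => {f | f (X x) = (1 : ℝ)}) ?_ ?_
  · obtain ⟨s, hs⟩ := key
    exact ⟨s, s.contMDiff, hs⟩
  · rintro x f (hf : f (X x) = (1 : ℝ)) g (hg : g (X x) = (1 : ℝ)) a b - - hab
    show a * f (X x) + b * g (X x) = (1 : ℝ)
    rw [hf, hg]; simpa using hab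
  · intro x₀
    let e := extChartAt (𝓡 3) x₀
    have hne : (mfderiv (𝓡 3) 𝓘(ℝ, E3) e x₀ (X x₀) : E3) ≠ 0 := by
      intro h0
      refine h x₀ ((chartConst_mfderiv_self x₀ (X x₀)).symm.trans ?_)
      exact (congrArg (Bundle.Trivialization.symmL ℝ
        (trivializationAt E3 (TangentSpace (𝓡 3)) x₀) x₀) h0).trans (map_zero _)
    obtain ⟨l, hl⟩ := SeparatingDual.exists_eq_one (R := ℝ) hne
    let f : ∀ x : M, TangentSpace (𝓡 3) x →L[ℝ] ℝ := fun x =>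
      l.comp (mfderiv (𝓡 3) 𝓘(ℝ, E3) e x)
    have hf : ∀ x ∈ e.source, IsSmoothOneFormAt f x := by
      intro x hx
      have hxe : e.symm (e x) = x := e.left_inv hx
      have hee := extChartAt_contMDiffAt hx
      have := isSmoothOneFormAt_of_pullback (α := f) (c := e.symm) (d := e) (p := e x)
        (A := fun _ => l) (extChartAt_symm_contMDiffAt (e.map_source hx)) (by rw [hxe]; exact hee)
        (by rw [hxe]) (by
          rw [hxe]
          filter_upwards [(isOpen_extChartAt_source (I := 𝓡 3) x₀).mem_nhds hx] with y hy
          exact e.left_inv hy) contDiffAt_const (by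
          filter_upwards [(isOpen_extChartAt_target (I := 𝓡 3) x₀).mem_nhds (e.map_source hx)]
            with y hy v
          have h2 := mfderiv_extChartAt_comp_mfderivWithin_extChartAt_symm (I := 𝓡 3) hy
          rw [ModelWithCorners.range_eq_univ, mfderivWithin_univ] at h2
          exact congrArg l (congrArg (fun L : E3 →L[ℝ] E3 => L v) h2))
      rwa [hxe] at this
    let D : M → ℝ := fun x => f x (X x)
    have hD : ∀ x ∈ e.source, ContMDiffAt (𝓡 3) 𝓘(ℝ, ℝ) ∞ D x := fun x hx =>
      (hf x hx).apply_along (b := id) (hX x)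
    have hD0 : D x₀ = 1 := hl
    have hx₀ : x₀ ∈ e.source := mem_extChartAt_source x₀
    refine ⟨e.source ∩ {x | D x ≠ 0}, Filter.inter_mem (extChartAt_source_mem_nhds x₀)
      ((hD x₀ hx₀).continuousAt.eventually_ne (by rw [hD0]; exact one_ne_zero)),
      fun x => (D x)⁻¹ • f x, ?_, ?_⟩
    · rintro x ⟨hx, hDx⟩
      refine ContMDiffAt.contMDiffWithinAt ?_
      exact ((hD x hx).inv₀ hDx).smul_section (hf x hx)
    · rintro x ⟨hx, hDx : D x ≠ 0⟩
      exact inv_mul_cancel₀ hDx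

end Frames

/-! ### The flow box around the knot -/

section FlowBox

/-- The coordinate one-forms `ds` and `dw`. -/
abbrev dS : ℝ × ℝ × ℝ →L[ℝ] ℝ := ContinuousLinearMap.fst ℝ ℝ (ℝ × ℝ)
abbrev dW : ℝ × ℝ × ℝ →L[ℝ] ℝ :=
  (ContinuousLinearMap.fst ℝ ℝ ℝ).comp (ContinuousLinearMap.snd ℝ ℝ (ℝ × ℝ))

def boxSet (ε τ : ℝ) : Set (ℝ × ℝ × ℝ) := {p | |p.2.1| < ε ∧ |p.2.2| < τ}

theorem isOpen_boxSet (ε τ : ℝ) : IsOpen (boxSet ε τ) :=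
  (isOpen_lt (f := fun p : ℝ × ℝ × ℝ => |p.2.1|) (by fun_prop) continuous_const).inter
    (isOpen_lt (f := fun p : ℝ × ℝ × ℝ => |p.2.2|) (by fun_prop) continuous_const)

theorem form_ext {L L' : ℝ × ℝ × ℝ →L[ℝ] ℝ} (h1 : L vecS = L' vecS) (h2 : L vecW = L' vecW)
    (h3 : L vecT = L' vecT) : L = L' := by
  refine ContinuousLinearMap.ext fun v => ?_
  rw [vec_eq v]
  simp only [map_add, map_smul, h1, h2, h3]

variable {M : Type u} [TopologicalSpace M] [ChartedSpace E3 M] [IsManifold (𝓡 3) ∞ M]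

theorem contactVolume_rho {α : ∀ x : M, TangentSpace (𝓡 3) x →L[ℝ] ℝ} {c : ℝ × ℝ × ℝ → M}
    {p : ℝ × ℝ × ℝ} {B ρ : ℝ × ℝ × ℝ → ℝ} (hα : IsSmoothOneFormAt α (c p))
    (hc : ContMDiffAt 𝓘(ℝ, ℝ × ℝ × ℝ) (𝓡 3) ∞ c p)
    (hA : pullbackForm α c =ᶠ[𝓝 p] fun q => B q • (ρ q • dS + dW))
    (hB : DifferentiableAt ℝ B p) (hρ : DifferentiableAt ℝ ρ p) :
    contactVolume α (c p) (mfderiv 𝓘(ℝ, ℝ × ℝ × ℝ) (𝓡 3) c p vecW)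
      (mfderiv 𝓘(ℝ, ℝ × ℝ × ℝ) (𝓡 3) c p vecS) (mfderiv 𝓘(ℝ, ℝ × ℝ × ℝ) (𝓡 3) c p vecT) =
    -((B p) ^ 2 * fderiv ℝ ρ p vecT) := by
  rw [contactVolume_coord hα hc hA (Filter.Eventually.of_forall fun q => by simp)]
  have h1 : (fun q => (B q • (ρ q • dS + dW)) vecW) = B := by ext q; simp
  have h2 : (fun q => (B q • (ρ q • dS + dW)) vecS) = fun q => B q * ρ q := by ext q; simp
  rw [h1, h2, fderiv_fun_mul hB hρ]
  simp; ring

theorem contactVolume_sigma {α : ∀ x : M, TangentSpace (𝓡 3) x →L[ℝ] ℝ} {c : ℝ × ℝ × ℝ → M}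
    {p : ℝ × ℝ × ℝ} {A σ : ℝ × ℝ × ℝ → ℝ} (hα : IsSmoothOneFormAt α (c p))
    (hc : ContMDiffAt 𝓘(ℝ, ℝ × ℝ × ℝ) (𝓡 3) ∞ c p)
    (hA : pullbackForm α c =ᶠ[𝓝 p] fun q => A q • (dS + σ q • dW))
    (hA' : DifferentiableAt ℝ A p) (hσ : DifferentiableAt ℝ σ p) :
    contactVolume α (c p) (mfderiv 𝓘(ℝ, ℝ × ℝ × ℝ) (𝓡 3) c p vecW)
      (mfderiv 𝓘(ℝ, ℝ × ℝ × ℝ) (𝓡 3) c p vecS) (mfderiv 𝓘(ℝ, ℝ × ℝ × ℝ) (𝓡 3) c p vecT) =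
    (A p) ^ 2 * fderiv ℝ σ p vecT := by
  rw [contactVolume_coord hα hc hA (Filter.Eventually.of_forall fun q => by simp)]
  have h1 : (fun q => (A q • (dS + σ q • dW)) vecS) = A := by ext q; simp
  have h2 : (fun q => (A q • (dS + σ q • dW)) vecW) = fun q => A q * σ q := by ext q; simp
  rw [h1, h2, fderiv_fun_mul hA' hσ]
  simp; ring

/-- A flow box of `X` around the knot, with coordinates `(s, w, t)` in which
`α = B (ρ ds + dw)` and `β = A (ds + σ dw)`, where `ρ` and `σ` are small, are strictly monotone in
`t`, and change sign between the times `-T` and `T`. -/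
structure IsSurgeryBox (o : ∀ x : M, Orientation ℝ (TangentSpace (𝓡 3) x) (Fin 3))
    (α β : ∀ x : M, TangentSpace (𝓡 3) x →L[ℝ] ℝ) (X : ∀ x : M, TangentSpace (𝓡 3) x)
    (K : Circle → M) (ς : ℝ) (Φ : AnnulusBox M) (ε₁ τ T : ℝ) (A B ρ σ : ℝ × ℝ × ℝ → ℝ) :
    Prop where
  pos : 0 < ε₁
  T_pos : 0 < T
  T_lt : 2 * T < τ
  source_eq : Φ.source = {p : Circle × ℝ × ℝ | |p.2.1| < ε₁ ∧ |p.2.2| < τ}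
  core : ∀ z : Circle, Φ (z, 0, 0) = K z
  flow : ∀ p ∈ boxSet ε₁ τ, Φ.vec p vecT = X (Φ.coord p)
  oriented : ∀ p ∈ boxSet ε₁ τ,
    IsPositiveTriple o (Φ.coord p) (Φ.vec p vecW) (Φ.vec p vecS) (Φ.vec p vecT)
  A_periodic : ∀ s w t, A (s + 2 * Real.pi, w, t) = A (s, w, t)
  B_periodic : ∀ s w t, B (s + 2 * Real.pi, w, t) = B (s, w, t)
  ρ_periodic : ∀ s w t, ρ (s + 2 * Real.pi, w, t) = ρ (s, w, t)
  σ_periodic : ∀ s w t, σ (s + 2 * Real.pi, w, t) = σ (s, w, t)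
  A_smooth : ∀ p ∈ boxSet ε₁ τ, ContDiffAt ℝ ∞ A p
  B_smooth : ∀ p ∈ boxSet ε₁ τ, ContDiffAt ℝ ∞ B p
  ρ_smooth : ∀ p ∈ boxSet ε₁ τ, ContDiffAt ℝ ∞ ρ p
  σ_smooth : ∀ p ∈ boxSet ε₁ τ, ContDiffAt ℝ ∞ σ p
  A_ne : ∀ p ∈ boxSet ε₁ τ, A p ≠ 0
  B_ne : ∀ p ∈ boxSet ε₁ τ, B p ≠ 0
  α_eq : ∀ p ∈ boxSet ε₁ τ, pullbackForm α Φ.coord p = B p • (ρ p • dS + dW)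
  β_eq : ∀ p ∈ boxSet ε₁ τ, pullbackForm β Φ.coord p = A p • (dS + σ p • dW)
  ρ_lt : ∀ p ∈ boxSet ε₁ τ, |ρ p| < 1 / 2
  σ_lt : ∀ p ∈ boxSet ε₁ τ, |σ p| < 1 / 2
  ρ_deriv : ∀ p ∈ boxSet ε₁ τ, 0 < ς * fderiv ℝ ρ p vecT
  σ_deriv : ∀ p ∈ boxSet ε₁ τ, 0 < ς * fderiv ℝ σ p vecT
  ρ_neg : ∀ s w, |w| < ε₁ → ς * ρ (s, w, -T) < 0
  ρ_pos : ∀ s w, |w| < ε₁ → 0 < ς * ρ (s, w, T)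
  σ_neg : ∀ s w, |w| < ε₁ → ς * σ (s, w, -T) < 0
  σ_pos : ∀ s w, |w| < ε₁ → 0 < ς * σ (s, w, T)

theorem exists_tube {P : ℝ × ℝ × ℝ → Prop}
    (hper : ∀ s w t (k : ℤ), P (s, w, t) → P (s + k * (2 * Real.pi), w, t))
    (h : ∀ s, ∀ᶠ q in 𝓝 (s, (0 : ℝ), (0 : ℝ)), P q) :
    ∃ r > 0, ∀ s w t, |w| < r → |t| < r → P (s, w, t) := by
  have h1 : ∀ᶠ y in 𝓝 ((0 : ℝ), (0 : ℝ)), ∀ s ∈ Set.Icc (-Real.pi) Real.pi, P (s, y) := by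
    refine isCompact_Icc.eventually_forall_of_forall_eventually
      (P := fun (y : ℝ × ℝ) s => P (s, y)) fun s _ => ?_
    have hc : Filter.Tendsto (Prod.swap : (ℝ × ℝ) × ℝ → ℝ × ℝ × ℝ)
        (𝓝 (((0 : ℝ), (0 : ℝ)), s)) (𝓝 (s, (0 : ℝ), (0 : ℝ))) :=
      continuous_swap.tendsto' _ _ rfl
    exact hc.eventually (h s)
  obtain ⟨r, hr, hrs⟩ := Metric.eventually_nhds_iff_ball.1 h1
  refine ⟨r, hr, fun s w t hw ht => ?_⟩
  obtain ⟨m, hm⟩ := Circle.exp_eq_exp.1 (Circle.exp_arg (Circle.exp s)).symm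
  rw [hm]
  refine hper _ _ _ m (hrs (w, t) ?_ _ ⟨(Complex.neg_pi_lt_arg _).le, Complex.arg_le_pi _⟩)
  rw [← ball_prod_same]
  simp [hw, ht]

theorem mfderiv_eq_of_line {E₀ : Type*} [NormedAddCommGroup E₀] [NormedSpace ℝ E₀] {c : E₀ → M}
    {p v : E₀} (hc : MDifferentiableAt 𝓘(ℝ, E₀) (𝓡 3) c p) {γ : ℝ → M} {L : ℝ →L[ℝ] E3} {t₀ : ℝ}
    (hγ : HasMFDerivAt 𝓘(ℝ, ℝ) (𝓡 3) γ t₀ L) (h : ∀ᶠ t in 𝓝 t₀, γ t = c (p + (t - t₀) • v)) :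
    (mfderiv 𝓘(ℝ, E₀) (𝓡 3) c p v : E3) = L 1 := by
  have h1 : HasDerivAt (fun t : ℝ => p + (t - t₀) • v) ((1 : ℝ) • v) t₀ :=
    (((hasDerivAt_id t₀).sub_const t₀).smul_const v).const_add p
  have h0 : p + (t₀ - t₀) • v = p := by simp
  have h2 : HasMFDerivAt 𝓘(ℝ, ℝ) (𝓡 3) (c ∘ fun t : ℝ => p + (t - t₀) • v) t₀
      ((mfderiv 𝓘(ℝ, E₀) (𝓡 3) c (p + (t₀ - t₀) • v)).comp
        (ContinuousLinearMap.toSpanSingleton ℝ ((1 : ℝ) • v))) := by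
    refine HasMFDerivAt.comp t₀ ?_ h1.hasFDerivAt.hasMFDerivAt
    rw [h0]; exact hc.hasMFDerivAt
  have h3 := hasMFDerivAt_unique h2 (hγ.congr_of_eventuallyEq (by
    filter_upwards [h] with t ht using ht.symm))
  have h4 := congrArg (fun L : ℝ →L[ℝ] E3 => L 1) h3
  refine Eq.trans ?_ h4
  have h5 : (ContinuousLinearMap.toSpanSingleton ℝ ((1 : ℝ) • v)) (1 : ℝ) = v := by simp
  have h6 := congrArg (mfderiv 𝓘(ℝ, E₀) (𝓡 3) c (p + (t₀ - t₀) • v) : E₀ →L[ℝ] E3) h5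
  refine Eq.trans ?_ h6.symm
  exact congrArg (fun q => (mfderiv 𝓘(ℝ, E₀) (𝓡 3) c q v : E3)) h0.symm

theorem mfderiv_periodic {c : ℝ × ℝ × ℝ → M} {a : ℝ × ℝ × ℝ} (h : ∀ p, c (p + a) = c p)
    (p : ℝ × ℝ × ℝ) (hc : MDifferentiableAt 𝓘(ℝ, ℝ × ℝ × ℝ) (𝓡 3) c (p + a)) :
    (mfderiv 𝓘(ℝ, ℝ × ℝ × ℝ) (𝓡 3) c p : ℝ × ℝ × ℝ →L[ℝ] E3) =
      mfderiv 𝓘(ℝ, ℝ × ℝ × ℝ) (𝓡 3) c (p + a) := by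
  have h1 : HasMFDerivAt 𝓘(ℝ, ℝ × ℝ × ℝ) (𝓡 3) (c ∘ fun q => q + a) p
      ((mfderiv 𝓘(ℝ, ℝ × ℝ × ℝ) (𝓡 3) c (p + a)).comp (ContinuousLinearMap.id ℝ (ℝ × ℝ × ℝ))) :=
    HasMFDerivAt.comp p hc.hasMFDerivAt ((hasFDerivAt_id p).add_const a).hasMFDerivAt
  have h2 : (c ∘ fun q => q + a) = c := funext h
  rw [h2] at h1
  exact h1.mfderiv

theorem pullbackForm_periodic {α : ∀ x : M, TangentSpace (𝓡 3) x →L[ℝ] ℝ} {c : ℝ × ℝ × ℝ → M}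
    {a : ℝ × ℝ × ℝ} (h : ∀ p, c (p + a) = c p) (p : ℝ × ℝ × ℝ)
    (hc : MDifferentiableAt 𝓘(ℝ, ℝ × ℝ × ℝ) (𝓡 3) c (p + a)) :
    pullbackForm α c (p + a) = pullbackForm α c p := by
  have h1 := mfderiv_periodic h p hc
  refine ContinuousLinearMap.ext fun v => ?_
  have h2 := congrArg (fun L : ℝ × ℝ × ℝ →L[ℝ] E3 => L v) h1
  have h3 : ∀ (x y : M) (u : E3), x = y → (α x : E3 →L[ℝ] ℝ) u = (α y : E3 →L[ℝ] ℝ) u := by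
    rintro x y u rfl; rfl
  exact (h3 _ _ _ (h p)).trans (congrArg (α (c p) : E3 →L[ℝ] ℝ) h2.symm)

end FlowBox

section FlowBoxExistence

variable {M : Type u} [TopologicalSpace M] [ChartedSpace E3 M] [IsManifold (𝓡 3) ∞ M]
  {o : ∀ x : M, Orientation ℝ (TangentSpace (𝓡 3) x) (Fin 3)}
  {α β : ∀ x : M, TangentSpace (𝓡 3) x →L[ℝ] ℝ} {X : ∀ x : M, TangentSpace (𝓡 3) x}
  {K : Circle → M}

theorem pos_or_neg_of_ne_zero {f : ℝ → ℝ} (hf : Continuous f) (h : ∀ s, f s ≠ 0) :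
    (∀ s, 0 < f s) ∨ ∀ s, f s < 0 := by
  by_contra! hc
  obtain ⟨⟨a, ha⟩, b, hb⟩ := hc
  obtain ⟨s, hs⟩ := mem_range_of_exists_le_of_exists_ge hf ⟨a, ha⟩ ⟨b, hb⟩
  exact h s hs

/-- The velocity of the knot. -/
def knotVelocity (K : Circle → M) (s : ℝ) : TangentSpace (𝓡 3) (K (Circle.exp s)) :=
  mfderiv 𝓘(ℝ, ℝ) (𝓡 3) (fun s => K (Circle.exp s)) s (1 : ℝ)

theorem IsLegendrianTransverseKnot.velocity (hK : IsLegendrianTransverseKnot α β K) (s : ℝ) :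
    α (K (Circle.exp s)) (knotVelocity K s) = 0 ∧ β (K (Circle.exp s)) (knotVelocity K s) ≠ 0 := by
  obtain ⟨hKs, -, h1, h2⟩ := hK
  have hcomp : HasMFDerivAt 𝓘(ℝ, ℝ) (𝓡 3) (fun s => K (Circle.exp s)) s
      ((mfderiv (𝓡 1) (𝓡 3) K (Circle.exp s)).comp (mfderiv 𝓘(ℝ, ℝ) (𝓡 1) Circle.exp s)) :=
    HasMFDerivAt.comp s (hKs.mdifferentiable (by simp) _).hasMFDerivAt
      ((contMDiff_circleExp (m := ∞)).mdifferentiable (by simp) s).hasMFDerivAt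
  have h3 : knotVelocity K s = mfderiv (𝓡 1) (𝓡 3) K (Circle.exp s)
      (mfderiv 𝓘(ℝ, ℝ) (𝓡 1) Circle.exp s (1 : ℝ)) := by
    rw [knotVelocity, hcomp.mfderiv]; rfl
  rw [h3]
  exact ⟨h1 _ _, h2 _ _ (mfderiv_circleExp_ne_zero s)⟩

theorem IsLegendrianTransverseKnot.contMDiff_exp (hK : IsLegendrianTransverseKnot α β K) :
    ContMDiff 𝓘(ℝ, ℝ) (𝓡 3) ∞ (fun s => K (Circle.exp s)) := hK.1.comp contMDiff_circleExp

variable [T2Space M] [SigmaCompactSpace M]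

/-- A smooth field in `ker β`, transverse to `ker α`, with the right orientation along `K`. -/
theorem exists_normal_field {ς : ℝ} (hα : IsSmoothOneForm α) (hβ : IsSmoothOneForm β)
    (hli : ∀ x, LinearIndependent ℝ ![α x, β x]) (hX : IsDefinedBy X α β)
    (hβc : ∀ x, IsContactAt o ς β x) (hK : IsLegendrianTransverseKnot α β K) :
    ∃ U : ∀ x : M, TangentSpace (𝓡 3) x, IsSmoothVectorField U ∧ (∀ x, α x (U x) ≠ 0) ∧
      (∀ x, β x (U x) = 0) ∧ ∀ s, 0 < ς * contactVolume β (K (Circle.exp s)) (U _)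
        (knotVelocity K s) (X _) := by
  obtain ⟨U, hU, hU1⟩ := exists_smooth_field hα hβ hli
  have hk := hK.contMDiff_exp
  let f : ℝ → ℝ := fun s => ς * contactVolume β (K (Circle.exp s)) (U _) (knotVelocity K s) (X _)
  have hfX : ∀ s, f s = ς * (β (K (Circle.exp s)) (knotVelocity K s) *
      oneFormExtDeriv β (K (Circle.exp s)) (X _) (U _)) := by
    intro s
    simp only [f, contactVolume, (hU1 _).2, (hX.2 _).2.2]; ring
  have hf : Continuous f := by
    rw [continuous_iff_continuousAt]
    intro s
    have hfe : f = _ := funext hfX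
    rw [hfe]
    have h1 : ContMDiffAt 𝓘(ℝ, ℝ) (𝓡 3).tangent ∞
        (fun s => (⟨K (Circle.exp s), knotVelocity K s⟩ : TangentBundle (𝓡 3) M)) s :=
      ContMDiffAt.mfderiv_vector (c := fun s => K (Circle.exp s)) (b := id) (v := fun _ => (1 : ℝ))
        hk.contMDiffAt contMDiffAt_id contMDiffAt_const
    have h2 := IsSmoothOneFormAt.apply_along (b := fun s => K (Circle.exp s))
      (isSmoothOneForm_iff.1 hβ _) h1
    have h3 := IsSmoothOneForm.extDeriv_along hβ (b := fun s => K (Circle.exp s))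
      (V := fun s => X (K (Circle.exp s))) (W := fun s => U (K (Circle.exp s)))
      ((hX.1 (K (Circle.exp s))).comp s hk.contMDiffAt)
      ((hU (K (Circle.exp s))).comp s hk.contMDiffAt)
    exact continuousAt_const.mul (h2.continuousAt.mul h3.continuousAt)
  have hne : ∀ s, f s ≠ 0 := by
    intro s
    obtain ⟨hv1, hv2⟩ := hK.velocity s
    have hl : LinearIndependent ℝ ![U (K (Circle.exp s)), knotVelocity K s, X (K (Circle.exp s))] := by
      rw [Fintype.linearIndependent_iff]
      intro g hg
      rw [Fin.sum_univ_three] at hg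
      simp only [Matrix.cons_val_zero, Matrix.cons_val_one, Matrix.cons_val_two, Matrix.head_cons,
        Matrix.tail_cons] at hg
      have h0 : g 0 = 0 := by
        have := congrArg (α (K (Circle.exp s))) hg
        simpa [map_add, map_smul, (hU1 _).1, hv1, (hX.2 _).2.1] using this
      have h1 : g 1 = 0 := by
        have := congrArg (β (K (Circle.exp s))) hg
        simpa [map_add, map_smul, (hU1 _).2, hv2, (hX.2 _).2.2] using this
      have h2 : g 2 = 0 := by
        rw [h0, h1, zero_smul, zero_smul, zero_add, zero_add] at hg
        exact (smul_eq_zero.1 hg).resolve_right (hX.2 _).1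
      intro i; fin_cases i
      exacts [h0, h1, h2]
    rcases isPositiveTriple_or (o := o) hl with h | h
    · exact (hβc _ _ _ _ h).ne'
    · have h1 := hβc _ _ _ _ h
      have h2 : f s = -(ς * contactVolume β (K (Circle.exp s)) (knotVelocity K s) (U _) (X _)) := by
        simp only [f, contactVolume]
        rw [oneFormExtDeriv_swap β _ (knotVelocity K s) (X _),
          oneFormExtDeriv_swap β _ (X _) (U _), oneFormExtDeriv_swap β _ (U _) (knotVelocity K s)]
        ring
      rw [h2]; exact (neg_neg_of_pos h1).ne
  rcases pos_or_neg_of_ne_zero hf hne with h | h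
  · exact ⟨U, hU, fun x => by rw [(hU1 x).1]; exact one_ne_zero, fun x => (hU1 x).2, h⟩
  · refine ⟨fun x => (-1 : ℝ) • U x, ?_, fun x => ?_, fun x => ?_, fun s => ?_⟩
    · exact ContMDiff.smul_section contMDiff_const hU
    · rw [map_smul, (hU1 x).1]; simp
    · rw [map_smul, (hU1 x).2]; simp
    · have h1 := h s
      rw [hfX] at h1
      simp only [contactVolume, map_smul, oneFormExtDeriv_smul_left, oneFormExtDeriv_smul_right,
        (hU1 _).2, (hX.2 _).2.2, smul_eq_mul]
      linarith

theorem exists_cutoff {C : Set M} (hC : IsCompact C) : ∃ (χ : M → ℝ) (S : Set M), IsCompact S ∧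
    ContMDiff (𝓡 3) 𝓘(ℝ, ℝ) ∞ χ ∧ (∀ x ∈ C, ∀ᶠ y in 𝓝 x, χ y = 1) ∧ ∀ x ∉ S, χ x = 0 := by
  have : LocallyCompactSpace M := Manifold.locallyCompact_of_finiteDimensional (𝓡 3)
  obtain ⟨S, hS, hCS⟩ := exists_compact_superset hC
  obtain ⟨f, hf1, hf2, -⟩ := exists_contMDiffMap_one_nhds_of_subset_interior (n := ⊤) (𝓡 3)
    hC.isClosed hCS
  refine ⟨f, S, hS, f.contMDiff, fun x hx => ?_, hf2⟩
  exact Filter.eventually_iff_exists_mem.2 ⟨_, (mem_nhdsSet_iff_forall.1 hf1 x hx), fun y hy => hy⟩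

end FlowBoxExistence

section FlowBoxExistence

variable {M : Type u} [TopologicalSpace M] [ChartedSpace E3 M] [IsManifold (𝓡 3) ∞ M]
  {o : ∀ x : M, Orientation ℝ (TangentSpace (𝓡 3) x) (Fin 3)}
  {α β : ∀ x : M, TangentSpace (𝓡 3) x →L[ℝ] ℝ} {X : ∀ x : M, TangentSpace (𝓡 3) x}
  {K : Circle → M}

abbrev boxModel := (𝓡 1).prod (𝓘(ℝ, ℝ).prod 𝓘(ℝ, ℝ))

variable [T2Space M] [SigmaCompactSpace M]

theorem contactVolume_congr {x y : M} (h : x = y) (u v w : E3) :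
    contactVolume β x u v w = contactVolume β y u v w := by subst h; rfl

theorem form_congr {x y : M} (h : x = y) (u : E3) :
    (α x : E3 →L[ℝ] ℝ) u = (α y : E3 →L[ℝ] ℝ) u := by subst h; rfl

theorem exists_box_map {ς : ℝ} (hα : IsSmoothOneForm α) (hβ : IsSmoothOneForm β)
    (hli : ∀ x, LinearIndependent ℝ ![α x, β x]) (hX : IsDefinedBy X α β)
    (hβc : ∀ x, IsContactAt o ς β x) (hK : IsLegendrianTransverseKnot α β K) :
    ∃ f : Circle × ℝ × ℝ → M, ContMDiff boxModel (𝓡 3) ∞ f ∧ (∀ z, f (z, 0, 0) = K z) ∧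
      ∀ c : ℝ × ℝ × ℝ → M, c = (fun p => f (expCoord p)) →
      (∀ p, pullbackForm α c p vecT = 0 ∧ pullbackForm β c p vecT = 0) ∧
      (∀ s, ∀ᶠ p in 𝓝 (s, (0 : ℝ), (0 : ℝ)), (mfderiv 𝓘(ℝ, ℝ × ℝ × ℝ) (𝓡 3) c p vecT : E3) = X (c p)) ∧
      (∀ s, pullbackForm α c (s, 0, 0) vecS = 0 ∧ pullbackForm β c (s, 0, 0) vecS ≠ 0 ∧
        pullbackForm α c (s, 0, 0) vecW ≠ 0 ∧ pullbackForm β c (s, 0, 0) vecW = 0 ∧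
        0 < ς * contactVolume β (c (s, 0, 0))
          (mfderiv 𝓘(ℝ, ℝ × ℝ × ℝ) (𝓡 3) c (s, 0, 0) vecW)
          (mfderiv 𝓘(ℝ, ℝ × ℝ × ℝ) (𝓡 3) c (s, 0, 0) vecS)
          (mfderiv 𝓘(ℝ, ℝ × ℝ × ℝ) (𝓡 3) c (s, 0, 0) vecT)) := by
  obtain ⟨U, hU, hUα, hUβ, hUc⟩ := exists_normal_field (o := o) (ς := ς) hα hβ hli hX hβc hK
  have hKc : IsCompact (Set.range K) := isCompact_range hK.1.continuous
  obtain ⟨χ, S, hS, hχ, hχ1, hχ0⟩ := exists_cutoff hKc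
  obtain ⟨φX, hφX, hφX0, hφXc, -⟩ := exists_global_flow (X := fun x => χ x • X x)
    (ContMDiff.smul_section hχ hX.1) hS fun x hx => by
      show χ x • X x = 0
      rw [hχ0 x hx, zero_smul]
  obtain ⟨φU, hφU, hφU0, hφUc, -⟩ := exists_global_flow (X := fun x => χ x • U x)
    (ContMDiff.smul_section hχ hU) hS fun x hx => by
      show χ x • U x = 0
      rw [hχ0 x hx, zero_smul]
  let f : Circle × ℝ × ℝ → M := fun p => φX p.2.2 (φU p.2.1 (K p.1))
  have hf : ContMDiff boxModel (𝓡 3) ∞ f := by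
    have h1 : ContMDiff boxModel (𝓡 3) ∞ (fun p : Circle × ℝ × ℝ => φU p.2.1 (K p.1)) :=
      hφU.comp ((contMDiff_fst.comp contMDiff_snd).prodMk (hK.1.comp contMDiff_fst))
    exact hφX.comp ((contMDiff_snd.comp contMDiff_snd).prodMk h1)
  refine ⟨f, hf, fun z => by simp [f, hφX0, hφU0], ?_⟩
  rintro c hc
  have hcs : ContMDiff 𝓘(ℝ, ℝ × ℝ × ℝ) (𝓡 3) ∞ c := by rw [hc]; exact hf.comp contMDiff_expCoord
  have hcd : ∀ p, MDifferentiableAt 𝓘(ℝ, ℝ × ℝ × ℝ) (𝓡 3) c p := hcs.mdifferentiable (by simp)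
  have hT : ∀ p, (mfderiv 𝓘(ℝ, ℝ × ℝ × ℝ) (𝓡 3) c p vecT : E3) = (χ (c p) • X (c p) : E3) := by
    intro p
    have h1 := hφXc (φU p.2.1 (K (Circle.exp p.1))) p.2.2
    refine (mfderiv_eq_of_line (hcd p) h1 (Filter.Eventually.of_forall fun t => ?_)).trans ?_
    · rw [hc]; simp [f, expCoord]
    · rw [hc]; exact one_smul ℝ (_ : E3)
  have hc0 : ∀ s, c (s, 0, 0) = K (Circle.exp s) := by
    intro s; rw [hc]; simp [f, expCoord, hφX0, hφU0]
  have hW : ∀ s, (mfderiv 𝓘(ℝ, ℝ × ℝ × ℝ) (𝓡 3) c (s, 0, 0) vecW : E3) = U (c (s, 0, 0)) := by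
    intro s
    have h1 := hφUc (K (Circle.exp s)) 0
    refine (mfderiv_eq_of_line (hcd _) h1 (Filter.Eventually.of_forall fun t => ?_)).trans ?_
    · rw [hc]; simp [f, expCoord, hφX0]
    · rw [hc0]
      have h2 : ((1 : ℝ →L[ℝ] ℝ).smulRight (χ (φU 0 (K (Circle.exp s))) •
        (U (φU 0 (K (Circle.exp s))) : E3))) 1 = (U (K (Circle.exp s)) : E3) := by
        rw [hφU0, (hχ1 _ ⟨_, rfl⟩).self_of_nhds, one_smul]
        exact one_smul ℝ (_ : E3)
      exact h2
  have hV : ∀ s, (mfderiv 𝓘(ℝ, ℝ × ℝ × ℝ) (𝓡 3) c (s, 0, 0) vecS : E3) = knotVelocity K s := by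
    intro s
    have h1 := (hK.contMDiff_exp.mdifferentiable (by simp) s).hasMFDerivAt
    refine (mfderiv_eq_of_line (hcd _) h1 (Filter.Eventually.of_forall fun t => ?_)).trans rfl
    rw [hc]; simp [f, expCoord, hφX0, hφU0]
  have hTnear : ∀ s, ∀ᶠ p in 𝓝 (s, (0 : ℝ), (0 : ℝ)),
      (mfderiv 𝓘(ℝ, ℝ × ℝ × ℝ) (𝓡 3) c p vecT : E3) = X (c p) := by
    intro s
    have h1 : ∀ᶠ p in 𝓝 (s, (0 : ℝ), (0 : ℝ)), χ (c p) = 1 := by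
      refine (hcs.continuous.continuousAt (x := (s, (0 : ℝ), (0 : ℝ)))).eventually
        (p := fun x => χ x = 1) ?_
      rw [hc0]
      exact hχ1 _ ⟨_, rfl⟩
    filter_upwards [h1] with p hp
    refine (hT p).trans ?_
    rw [hp]; exact one_smul ℝ (_ : E3)
  refine ⟨fun p => ⟨?_, ?_⟩, hTnear, fun s => ⟨?_, ?_, ?_, ?_, ?_⟩⟩
  · refine (congrArg (α (c p) : E3 →L[ℝ] ℝ) (hT p)).trans ?_
    refine (map_smul (α (c p) : E3 →L[ℝ] ℝ) _ _).trans ?_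
    exact (congrArg _ (hX.2 _).2.1).trans (smul_zero _)
  · refine (congrArg (β (c p) : E3 →L[ℝ] ℝ) (hT p)).trans ?_
    refine (map_smul (β (c p) : E3 →L[ℝ] ℝ) _ _).trans ?_
    exact (congrArg _ (hX.2 _).2.2).trans (smul_zero _)
  · exact (congrArg (α _ : E3 →L[ℝ] ℝ) (hV s)).trans
      ((form_congr (hc0 s) _).trans (hK.velocity s).1)
  · exact fun h => (hK.velocity s).2 (((congrArg (β _ : E3 →L[ℝ] ℝ) (hV s)).trans
      (form_congr (hc0 s) _)).symm.trans h)
  · exact fun h => hUα _ ((congrArg (α _ : E3 →L[ℝ] ℝ) (hW s)).symm.trans h)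
  · exact (congrArg (β _ : E3 →L[ℝ] ℝ) (hW s)).trans (hUβ _)
  · have h1 := hUc s
    have hW' : (mfderiv 𝓘(ℝ, ℝ × ℝ × ℝ) (𝓡 3) c (s, 0, 0) vecW : E3) = U (K (Circle.exp s)) := by
      rw [hW, hc0]
    have hT' : (mfderiv 𝓘(ℝ, ℝ × ℝ × ℝ) (𝓡 3) c (s, 0, 0) vecT : E3) = X (K (Circle.exp s)) := by
      rw [(hTnear s).self_of_nhds, hc0]
    have h2 := contactVolume_congr (β := β) (hc0 s)
      (mfderiv 𝓘(ℝ, ℝ × ℝ × ℝ) (𝓡 3) c (s, 0, 0) vecW)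
      (mfderiv 𝓘(ℝ, ℝ × ℝ × ℝ) (𝓡 3) c (s, 0, 0) vecS)
      (mfderiv 𝓘(ℝ, ℝ × ℝ × ℝ) (𝓡 3) c (s, 0, 0) vecT)
    have h3 : contactVolume β (c (s, 0, 0))
      (mfderiv 𝓘(ℝ, ℝ × ℝ × ℝ) (𝓡 3) c (s, 0, 0) vecW)
      (mfderiv 𝓘(ℝ, ℝ × ℝ × ℝ) (𝓡 3) c (s, 0, 0) vecS)
      (mfderiv 𝓘(ℝ, ℝ × ℝ × ℝ) (𝓡 3) c (s, 0, 0) vecT) = contactVolume β (K (Circle.exp s)) (U _)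
        (knotVelocity K s) (X _) := by
      refine h2.trans ?_
      rw [hW', hV s, hT']
    rw [h3]; exact h1

end FlowBoxExistence

section FlowBoxExistence

variable {M : Type u} [TopologicalSpace M] [ChartedSpace E3 M] [IsManifold (𝓡 3) ∞ M]
  {o : ∀ x : M, Orientation ℝ (TangentSpace (𝓡 3) x) (Fin 3)}
  {α β : ∀ x : M, TangentSpace (𝓡 3) x →L[ℝ] ℝ} {X : ∀ x : M, TangentSpace (𝓡 3) x}
  {K : Circle → M}

theorem IsPositiveTriple.linearIndependent {x : M} {u v w : TangentSpace (𝓡 3) x}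
    (h : IsPositiveTriple o x u v w) {a b c : ℝ} (h0 : a • u + b • v + c • w = 0) :
    a = 0 ∧ b = 0 ∧ c = 0 := by
  obtain ⟨B, -, rfl, rfl, rfl⟩ := h
  have h1 := Fintype.linearIndependent_iff.1 B.linearIndependent ![a, b, c] (by
    rw [Fin.sum_univ_three]; exact h0)
  exact ⟨h1 0, h1 1, h1 2⟩

theorem expCoord_add_int (s w t : ℝ) (k : ℤ) :
    expCoord (s + k * (2 * Real.pi), w, t) = expCoord (s, w, t) := by
  simp only [expCoord]
  rw [Circle.exp_eq_exp.2 ⟨k, rfl⟩]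

theorem mfderiv_injective_of_isPositiveTriple {c : ℝ × ℝ × ℝ → M} {p : ℝ × ℝ × ℝ}
    (h : IsPositiveTriple o (c p) (mfderiv 𝓘(ℝ, ℝ × ℝ × ℝ) (𝓡 3) c p vecW)
      (mfderiv 𝓘(ℝ, ℝ × ℝ × ℝ) (𝓡 3) c p vecS) (mfderiv 𝓘(ℝ, ℝ × ℝ × ℝ) (𝓡 3) c p vecT))
    (v : ℝ × ℝ × ℝ) (hv : (mfderiv 𝓘(ℝ, ℝ × ℝ × ℝ) (𝓡 3) c p v : E3) = 0) : v = 0 := by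
  have h1 : ∀ L : ℝ × ℝ × ℝ →L[ℝ] E3, L v = v.2.1 • L vecW + v.1 • L vecS + v.2.2 • L vecT := by
    intro L
    conv_lhs => rw [vec_eq v]
    simp only [map_add, map_smul]
    abel
  obtain ⟨h2, h3, h4⟩ := h.linearIndependent ((h1 _).symm.trans hv)
  ext
  exacts [h3, h2, h4]

theorem exists_nhds_injOn {N : Type*} [TopologicalSpace N] {f : Circle × ℝ × ℝ → N} {p : ℝ × ℝ × ℝ}
    {D : N → ℝ × ℝ × ℝ} (hD : ∀ᶠ q in 𝓝 p, D (f (expCoord q)) = q) :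
    ∃ u ∈ 𝓝 (expCoord p), Set.InjOn f u := by
  obtain ⟨d, hd, hdp, h1, -⟩ := exists_expCoord_inverse p
  have h2 : ∀ᶠ y in 𝓝 (expCoord p), D (f (expCoord (d y))) = d y :=
    hd.continuousAt.eventually (by rwa [hdp])
  refine ⟨_, h2, fun y (hy : _ = _) z (hz : _ = _) hyz => ?_⟩
  rw [h1] at hy hz
  rw [← h1 y, ← h1 z, ← hy, ← hz, hyz]

variable [T2Space M] [SigmaCompactSpace M]

theorem exists_surgeryBox {ς : ℝ} (hα : IsSmoothOneForm α) (hβ : IsSmoothOneForm β)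
    (hli : ∀ x, LinearIndependent ℝ ![α x, β x]) (hX : IsDefinedBy X α β)
    (hαc : ∀ x, IsContactAt o (-ς) α x) (hβc : ∀ x, IsContactAt o ς β x)
    (hK : IsLegendrianTransverseKnot α β K) :
    ∃ (Φ : AnnulusBox M) (ε₁ τ T : ℝ) (A B ρ σ : ℝ × ℝ × ℝ → ℝ),
      IsSurgeryBox o α β X K ς Φ ε₁ τ T A B ρ σ := by
  obtain ⟨f, hf, hfK, hrest⟩ := exists_box_map (o := o) (ς := ς) hα hβ hli hX hβc hK
  obtain ⟨c, hc⟩ : ∃ c : ℝ × ℝ × ℝ → M, c = (fun p => f (expCoord p)) := ⟨_, rfl⟩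
  obtain ⟨hT0, hTX, hcore⟩ := hrest c hc
  have hcs : ContMDiff 𝓘(ℝ, ℝ × ℝ × ℝ) (𝓡 3) ∞ c := by rw [hc]; exact hf.comp contMDiff_expCoord
  have hcper : ∀ (k : ℤ) (p : ℝ × ℝ × ℝ), c (p + (k * (2 * Real.pi), (0 : ℝ), (0 : ℝ))) = c p := by
    rintro k ⟨s, w, t⟩
    rw [hc]
    have := expCoord_add_int s w t k
    simp only [Prod.mk_add_mk, add_zero, this]
  have hpb : ∀ (θ : ∀ x : M, TangentSpace (𝓡 3) x →L[ℝ] ℝ) (s w t : ℝ) (k : ℤ),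
      pullbackForm θ c (s + k * (2 * Real.pi), w, t) = pullbackForm θ c (s, w, t) := by
    intro θ s w t k
    have := pullbackForm_periodic (α := θ) (hcper k) (s, w, t) (hcs.mdifferentiable (by simp) _)
    simpa using this
  have hpb1 : ∀ (θ : ∀ x : M, TangentSpace (𝓡 3) x →L[ℝ] ℝ) (s w t : ℝ),
      pullbackForm θ c (s + 2 * Real.pi, w, t) = pullbackForm θ c (s, w, t) := by
    intro θ s w t
    have := hpb θ s w t 1
    rwa [Int.cast_one, one_mul] at this
  have hαs : ∀ p, ContDiffAt ℝ ∞ (pullbackForm α c) p := fun p =>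
    contDiffAt_pullbackForm (hα _) (hcs p)
  have hβs : ∀ p, ContDiffAt ℝ ∞ (pullbackForm β c) p := fun p =>
    contDiffAt_pullbackForm (hβ _) (hcs p)
  let B : ℝ × ℝ × ℝ → ℝ := fun p => pullbackForm α c p vecW
  let A : ℝ × ℝ × ℝ → ℝ := fun p => pullbackForm β c p vecS
  let ρ : ℝ × ℝ × ℝ → ℝ := fun p => pullbackForm α c p vecS / B p
  let σ : ℝ × ℝ × ℝ → ℝ := fun p => pullbackForm β c p vecW / A p
  have hBs : ∀ p, ContDiffAt ℝ ∞ B p := fun p => (hαs p).clm_apply contDiffAt_const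
  have hAs : ∀ p, ContDiffAt ℝ ∞ A p := fun p => (hβs p).clm_apply contDiffAt_const
  have hρs : ∀ p, B p ≠ 0 → ContDiffAt ℝ ∞ ρ p := fun p hp =>
    ((hαs p).clm_apply contDiffAt_const).div (hBs p) hp
  have hσs : ∀ p, A p ≠ 0 → ContDiffAt ℝ ∞ σ p := fun p hp =>
    ((hβs p).clm_apply contDiffAt_const).div (hAs p) hp
  have hαeq : ∀ p, B p ≠ 0 → pullbackForm α c p = B p • (ρ p • dS + dW) := by
    intro p hp
    refine form_ext ?_ ?_ ?_
    · simp only [ρ]; simp; field_simp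
    · simp [B]
    · simpa using (hT0 p).1
  have hβeq : ∀ p, A p ≠ 0 → pullbackForm β c p = A p • (dS + σ p • dW) := by
    intro p hp
    refine form_ext ?_ ?_ ?_
    · simp [A]
    · simp only [σ]; simp; field_simp
    · simpa using (hT0 p).2
  have hcontσ : ∀ p, A p ≠ 0 → contactVolume β (c p) (mfderiv 𝓘(ℝ, ℝ × ℝ × ℝ) (𝓡 3) c p vecW)
      (mfderiv 𝓘(ℝ, ℝ × ℝ × ℝ) (𝓡 3) c p vecS) (mfderiv 𝓘(ℝ, ℝ × ℝ × ℝ) (𝓡 3) c p vecT) =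
        (A p) ^ 2 * fderiv ℝ σ p vecT := fun p hp =>
    contactVolume_sigma (hβ _) (hcs p)
      (by filter_upwards [(hAs p).continuousAt.eventually_ne hp] with q hq using hβeq q hq)
      ((hAs p).differentiableAt (by simp)) ((hσs p hp).differentiableAt (by simp))
  have hcontρ : ∀ p, B p ≠ 0 → contactVolume α (c p) (mfderiv 𝓘(ℝ, ℝ × ℝ × ℝ) (𝓡 3) c p vecW)
      (mfderiv 𝓘(ℝ, ℝ × ℝ × ℝ) (𝓡 3) c p vecS) (mfderiv 𝓘(ℝ, ℝ × ℝ × ℝ) (𝓡 3) c p vecT) =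
        -((B p) ^ 2 * fderiv ℝ ρ p vecT) := fun p hp =>
    contactVolume_rho (hα _) (hcs p)
      (by filter_upwards [(hBs p).continuousAt.eventually_ne hp] with q hq using hαeq q hq)
      ((hBs p).differentiableAt (by simp)) ((hρs p hp).differentiableAt (by simp))
  have hρ0 : ∀ s, ρ (s, 0, 0) = 0 := fun s => by simp only [ρ, (hcore s).1, zero_div]
  have hσ0 : ∀ s, σ (s, 0, 0) = 0 := fun s => by simp only [σ, (hcore s).2.2.2.1, zero_div]
  have hB0 : ∀ s, B (s, 0, 0) ≠ 0 := fun s => (hcore s).2.2.1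
  have hA0 : ∀ s, A (s, 0, 0) ≠ 0 := fun s => (hcore s).2.1
  have hσT : ∀ s, 0 < ς * fderiv ℝ σ (s, 0, 0) vecT := by
    intro s
    have h1 := (hcore s).2.2.2.2
    rw [hcontσ _ (hA0 s), mul_left_comm] at h1
    exact pos_of_mul_pos_right h1 (sq_nonneg _)
  have hor : ∀ p, A p ≠ 0 → 0 < ς * fderiv ℝ σ p vecT → IsPositiveTriple o (c p)
      (mfderiv 𝓘(ℝ, ℝ × ℝ × ℝ) (𝓡 3) c p vecW) (mfderiv 𝓘(ℝ, ℝ × ℝ × ℝ) (𝓡 3) c p vecS)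
      (mfderiv 𝓘(ℝ, ℝ × ℝ × ℝ) (𝓡 3) c p vecT) := by
    intro p hp h
    refine (hβc (c p)).isPositiveTriple ?_
    rw [hcontσ p hp, mul_left_comm]
    exact mul_pos (by positivity) h
  have hρT : ∀ p, A p ≠ 0 → B p ≠ 0 → 0 < ς * fderiv ℝ σ p vecT → 0 < ς * fderiv ℝ ρ p vecT := by
    intro p hA hB h
    have h1 := hαc (c p) _ _ _ (hor p hA h)
    rw [hcontρ p hB, neg_mul_neg, mul_left_comm] at h1
    exact pos_of_mul_pos_right h1 (sq_nonneg _)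
  -- injectivity near the core
  have hlocinv : ∀ p, A p ≠ 0 → 0 < ς * fderiv ℝ σ p vecT → _ := fun p hp h =>
    exists_local_inverse (c := c) (p := p) (by simp) (Filter.Eventually.of_forall hcs)
      (mfderiv_injective_of_isPositiveTriple (hor p hp h))
  have hinj : ∃ t ∈ 𝓝ˢ (Set.univ ×ˢ {((0 : ℝ), (0 : ℝ))} : Set (Circle × ℝ × ℝ)), Set.InjOn f t := by
    refine Set.InjOn.exists_mem_nhdsSet ?_ (isCompact_univ.prod isCompact_singleton)
      (fun x _ => hf.continuous.continuousAt) ?_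
    · rintro ⟨z, y⟩ ⟨-, rfl : y = (0, 0)⟩ ⟨z', y'⟩ ⟨-, rfl : y' = (0, 0)⟩ h
      rw [hfK, hfK] at h
      rw [hK.2.1 h]
    · rintro ⟨z, y⟩ ⟨-, rfl : y = (0, 0)⟩
      obtain ⟨s, rfl⟩ := Circle.exp_surjective z
      obtain ⟨D, -, -, -, hD⟩ := hlocinv _ (hA0 s) (hσT s)
      exact exists_nhds_injOn (p := (s, 0, 0)) (D := D) (by rwa [hc] at hD)
  obtain ⟨I, hI, hinj⟩ := hinj
  -- the box
  obtain ⟨r, hr, hP⟩ := exists_tube (P := fun p => expCoord p ∈ I ∧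
      (mfderiv 𝓘(ℝ, ℝ × ℝ × ℝ) (𝓡 3) c p vecT : E3) = X (c p) ∧ A p ≠ 0 ∧ B p ≠ 0 ∧
      |ρ p| < 1 / 2 ∧ |σ p| < 1 / 2 ∧ 0 < ς * fderiv ℝ σ p vecT) (by
    rintro s w t k ⟨h1, h2, h3, h4, h5, h6, h7⟩
    have hcp := hcper k (s, w, t)
    simp only [Prod.mk_add_mk, add_zero] at hcp
    have hm : ∀ p', p' = (s, w, t) + (k * (2 * Real.pi), (0 : ℝ), (0 : ℝ)) →
        (mfderiv 𝓘(ℝ, ℝ × ℝ × ℝ) (𝓡 3) c (s, w, t) : ℝ × ℝ × ℝ →L[ℝ] E3) =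
          mfderiv 𝓘(ℝ, ℝ × ℝ × ℝ) (𝓡 3) c p' := by
      rintro _ rfl
      exact mfderiv_periodic (hcper k) (s, w, t) (hcs.mdifferentiable (by simp) _)
    have hAp : ∀ w t, A (s + k * (2 * Real.pi), w, t) = A (s, w, t) := fun w t => by
      simp only [A, hpb]
    have hσp : ∀ p, σ (p + (k * (2 * Real.pi), (0 : ℝ), (0 : ℝ))) = σ p := by
      rintro ⟨s, w, t⟩; simp only [σ, A, Prod.mk_add_mk, add_zero, hpb]
    refine ⟨by rwa [expCoord_add_int], ?_, by rwa [hAp], by simp only [B, hpb]; exact h4,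
      by simp only [ρ, B, hpb]; exact h5, by simp only [σ, A, hpb]; exact h6, ?_⟩
    · rw [hcp]
      exact (congrArg (fun L : ℝ × ℝ × ℝ →L[ℝ] E3 => L vecT) (hm _ (by simp))).symm.trans h2
    · have h8 : fderiv ℝ σ (s + k * (2 * Real.pi), w, t) = fderiv ℝ σ (s, w, t) := by
        have h9 := fderiv_comp_add_right (𝕜 := ℝ) (f := σ) (x := (s, w, t))
          (k * (2 * Real.pi), (0 : ℝ), (0 : ℝ))
        rw [funext hσp] at h9
        simp only [Prod.mk_add_mk, add_zero] at h9
        exact h9.symm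
      rw [h8]; exact h7) (by
    intro s
    have h1 : ∀ᶠ q in 𝓝 (s, (0 : ℝ), (0 : ℝ)), expCoord q ∈ I :=
      contMDiff_expCoord.continuous.continuousAt
        (mem_nhdsSet_iff_forall.1 hI (expCoord (s, 0, 0)) ⟨Set.mem_univ _, rfl⟩)
    have hσ' := (hσs _ (hA0 s)).continuousAt
    have hρ' := (hρs _ (hB0 s)).continuousAt
    have h7 : ContinuousAt (fun p => ς * fderiv ℝ σ p vecT) (s, 0, 0) :=
      continuousAt_const.mul
        (((hσs _ (hA0 s)).fderiv_right (m := ∞) (by simp)).continuousAt.clm_apply continuousAt_const)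
    filter_upwards [h1, hTX s, (hAs (s, 0, 0)).continuousAt.eventually_ne (hA0 s),
      (hBs (s, 0, 0)).continuousAt.eventually_ne (hB0 s),
      hρ'.abs.eventually_lt_const (show |ρ (s, 0, 0)| < 1 / 2 by rw [hρ0]; norm_num),
      hσ'.abs.eventually_lt_const (show |σ (s, 0, 0)| < 1 / 2 by rw [hσ0]; norm_num),
      h7.eventually_const_lt (hσT s)] with q h1 h2 h3 h4 h5 h6 h7
    exact ⟨h1, h2, h3, h4, h5, h6, h7⟩)
  have hmono : ∀ (φ : ℝ × ℝ × ℝ → ℝ), (∀ s w t, |w| < r → |t| < r → DifferentiableAt ℝ φ (s, w, t) ∧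
      0 < ς * fderiv ℝ φ (s, w, t) vecT) → ∀ s, φ (s, 0, 0) = 0 → ∀ t, 0 < t → t < r →
      0 < ς * φ (s, 0, t) ∧ ς * φ (s, 0, -t) < 0 := by
    intro φ hφ s h0 t ht htr
    have hder : ∀ u ∈ Set.Ioo (-r) r, HasDerivAt (fun u => ς * φ (s, 0, u))
        (ς * fderiv ℝ φ (s, 0, u) vecT) u := by
      intro u hu
      have h1 := (hφ s 0 u (by simpa using hr) (abs_lt.2 hu)).1.hasFDerivAt
      have h2 : HasDerivAt (fun u : ℝ => (s, (0 : ℝ), u)) vecT u :=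
        (hasDerivAt_const u s).prodMk ((hasDerivAt_const u (0 : ℝ)).prodMk (hasDerivAt_id u))
      exact (h1.comp_hasDerivAt u h2).const_mul ς
    have hsm : StrictMonoOn (fun u => ς * φ (s, 0, u)) (Set.Ioo (-r) r) := by
      refine strictMonoOn_of_deriv_pos (convex_Ioo _ _)
        (fun u hu => (hder u hu).continuousAt.continuousWithinAt) fun u hu => ?_
      rw [interior_Ioo] at hu
      rw [(hder u hu).deriv]
      exact (hφ s 0 u (by simpa using hr) (abs_lt.2 hu)).2
    have h1 := hsm (a := 0) (b := t) ⟨by linarith, hr⟩ ⟨by linarith, htr⟩ ht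
    have h2 := hsm (a := -t) (b := 0) ⟨by linarith, by linarith⟩ ⟨by linarith, hr⟩ (by linarith)
    simp only [h0, mul_zero] at h1 h2
    exact ⟨h1, h2⟩
  have hdσ : ∀ s w t, |w| < r → |t| < r → DifferentiableAt ℝ σ (s, w, t) ∧
      0 < ς * fderiv ℝ σ (s, w, t) vecT := fun s w t hw ht => by
    obtain ⟨-, -, h3, h4, -, -, h7⟩ := hP s w t hw ht
    exact ⟨(hσs _ h3).differentiableAt (by simp), h7⟩
  have hdρ : ∀ s w t, |w| < r → |t| < r → DifferentiableAt ℝ ρ (s, w, t) ∧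
      0 < ς * fderiv ℝ ρ (s, w, t) vecT := fun s w t hw ht => by
    obtain ⟨-, -, h3, h4, -, -, h7⟩ := hP s w t hw ht
    exact ⟨(hρs _ h4).differentiableAt (by simp), hρT _ h3 h4 h7⟩
  have hT : 0 < r / 3 := by positivity
  have hsign : ∃ r' > 0, ∀ s w t, |w| < r' → |t| < r' →
      ς * ρ (s, w, -(r / 3)) < 0 ∧ 0 < ς * ρ (s, w, r / 3) ∧
      ς * σ (s, w, -(r / 3)) < 0 ∧ 0 < ς * σ (s, w, r / 3) := by
    refine exists_tube (P := fun p => ς * ρ (p.1, p.2.1, -(r / 3)) < 0 ∧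
      0 < ς * ρ (p.1, p.2.1, r / 3) ∧ ς * σ (p.1, p.2.1, -(r / 3)) < 0 ∧
      0 < ς * σ (p.1, p.2.1, r / 3)) ?_ ?_
    · intro s w t k h
      simpa only [ρ, σ, A, B, hpb] using h
    · intro s
      have hcw : ∀ (φ : ℝ × ℝ × ℝ → ℝ) (u : ℝ), DifferentiableAt ℝ φ (s, 0, u) →
          ContinuousAt (fun p : ℝ × ℝ × ℝ => ς * φ (p.1, p.2.1, u)) (s, 0, 0) := by
        intro φ u h
        refine continuousAt_const.mul ?_
        exact ContinuousAt.comp (f := fun p : ℝ × ℝ × ℝ => (p.1, p.2.1, u)) (x := (s, 0, 0))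
          h.continuousAt (by fun_prop)
      have hr3 : |r / 3| < r := by rw [abs_of_pos hT]; linarith
      have hr3' : |-(r / 3)| < r := by rwa [abs_neg]
      have hr0 : |(0 : ℝ)| < r := by simpa using hr
      obtain ⟨h1, h2⟩ := hmono ρ hdρ s (hρ0 s) (r / 3) hT (by linarith)
      obtain ⟨h3, h4⟩ := hmono σ hdσ s (hσ0 s) (r / 3) hT (by linarith)
      filter_upwards [(hcw ρ _ (hdρ s 0 _ hr0 hr3').1).eventually_lt_const h2,
        (hcw ρ _ (hdρ s 0 _ hr0 hr3).1).eventually_const_lt h1,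
        (hcw σ _ (hdσ s 0 _ hr0 hr3').1).eventually_lt_const h4,
        (hcw σ _ (hdσ s 0 _ hr0 hr3).1).eventually_const_lt h3] with q h1 h2 h3 h4
      exact ⟨h1, h2, h3, h4⟩
  obtain ⟨r', hr', hs⟩ := hsign
  let ε₁ := min r r'
  have hε₁ : 0 < ε₁ := lt_min hr hr'
  have hPb : ∀ p ∈ boxSet ε₁ r, _ := fun p hp =>
    hP p.1 p.2.1 p.2.2 (lt_of_lt_of_le hp.1 (min_le_left _ _)) hp.2
  let S : Set (Circle × ℝ × ℝ) := {p | |p.2.1| < ε₁ ∧ |p.2.2| < r}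
  have hSo : IsOpen S :=
    (isOpen_lt (f := fun p : Circle × ℝ × ℝ => |p.2.1|) (by fun_prop) continuous_const).inter
      (isOpen_lt (f := fun p : Circle × ℝ × ℝ => |p.2.2|) (by fun_prop) continuous_const)
  have hSI : S ⊆ I := by
    rintro ⟨z, w, t⟩ hz
    obtain ⟨s, rfl⟩ := Circle.exp_surjective z
    exact (hPb (s, w, t) hz).1
  obtain ⟨Φ, hΦS, -, hΦf⟩ := exists_partialDiffeomorph (I := boxModel) (I' := 𝓡 3) hSo
    (hinj.mono hSI) (fun p _ => hf p) (by
      rintro ⟨z, w, t⟩ hz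
      obtain ⟨s, rfl⟩ := Circle.exp_surjective z
      obtain ⟨-, -, h3, -, -, -, h7⟩ := hPb (s, w, t) hz
      obtain ⟨D, hD, hDp, hD1, -⟩ := hlocinv _ h3 h7
      have hcp : c (s, w, t) = f (Circle.exp s, w, t) := by rw [hc]; rfl
      rw [hcp] at hD hDp hD1
      refine ⟨fun x => expCoord (D x), contMDiff_expCoord.contMDiffAt.comp _ hD, ?_, ?_⟩
      · exact congrArg expCoord hDp
      · filter_upwards [hD1] with x hx
        rw [hc] at hx; exact hx)
  have hΦc : AnnulusBox.coord Φ = c := by rw [hc]; funext p; exact hΦf _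
  refine ⟨Φ, ε₁, r, r / 3, A, B, ρ, σ, ?_⟩
  have hs' : ∀ s w, |w| < ε₁ → _ := fun s w hw =>
    hs s w 0 (lt_of_lt_of_le hw (min_le_right _ _)) (by simpa using hr')
  exact
    { pos := hε₁
      T_pos := hT
      T_lt := by linarith
      source_eq := hΦS
      core := fun z => (hΦf _).trans (hfK z)
      flow := fun p hp => by
        unfold AnnulusBox.vec; rw [hΦc]; exact (hPb p hp).2.1
      oriented := fun p hp => by
        unfold AnnulusBox.vec; rw [hΦc]
        exact hor p (hPb p hp).2.2.1 (hPb p hp).2.2.2.2.2.2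
      A_periodic := fun s w t => by simp only [A, hpb1]
      B_periodic := fun s w t => by simp only [B, hpb1]
      ρ_periodic := fun s w t => by simp only [ρ, B, hpb1]
      σ_periodic := fun s w t => by simp only [σ, A, hpb1]
      A_smooth := fun p _ => hAs p
      B_smooth := fun p _ => hBs p
      ρ_smooth := fun p hp => hρs p (hPb p hp).2.2.2.1
      σ_smooth := fun p hp => hσs p (hPb p hp).2.2.1
      A_ne := fun p hp => (hPb p hp).2.2.1
      B_ne := fun p hp => (hPb p hp).2.2.2.1
      α_eq := fun p hp => by rw [hΦc]; exact hαeq p (hPb p hp).2.2.2.1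
      β_eq := fun p hp => by rw [hΦc]; exact hβeq p (hPb p hp).2.2.1
      ρ_lt := fun p hp => (hPb p hp).2.2.2.2.1
      σ_lt := fun p hp => (hPb p hp).2.2.2.2.2.1
      ρ_deriv := fun p hp =>
        hρT p (hPb p hp).2.2.1 (hPb p hp).2.2.2.1 (hPb p hp).2.2.2.2.2.2
      σ_deriv := fun p hp => (hPb p hp).2.2.2.2.2.2
      ρ_neg := fun s w hw => (hs' s w hw).1
      ρ_pos := fun s w hw => (hs' s w hw).2.1
      σ_neg := fun s w hw => (hs' s w hw).2.2.1
      σ_pos := fun s w hw => (hs' s w hw).2.2.2 }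

theorem IsSurgeryBox.isSurgeryFlowBox {ς : ℝ} {Φ : AnnulusBox M} {ε₁ τ T : ℝ}
    {A B ρ σ : ℝ × ℝ × ℝ → ℝ} (h : IsSurgeryBox o α β X K ς Φ ε₁ τ T A B ρ σ) {ε : ℝ} (hε : 0 < ε)
    (hεε : ε < ε₁) : IsSurgeryFlowBox o α X K Φ ε ε₁ τ where
  pos := hε
  lt := hεε
  time_pos := by linarith [h.T_pos, h.T_lt]
  source_eq := h.source_eq
  core := h.core
  flow := fun s w t hw ht => h.flow (s, w, t) ⟨hw, ht⟩
  oriented := fun s w t hw ht => h.oriented (s, w, t) ⟨hw, ht⟩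
  contact_framing := fun s => by
    have hp : ((s, 0, 0) : ℝ × ℝ × ℝ) ∈ boxSet ε₁ τ :=
      ⟨by simpa using h.pos, by simpa using (by linarith [h.T_pos, h.T_lt] : (0 : ℝ) < τ)⟩
    have h1 := congrArg (fun L : ℝ × ℝ × ℝ →L[ℝ] ℝ => L vecW) (h.α_eq _ hp)
    intro h0
    refine h.B_ne _ hp ?_
    have h2 := h1.symm.trans h0
    simpa using h2

end FlowBoxExistence

/-! ### Gluing manifolds -/

/-- A set covered by the sources of partial bijections to a 3-manifold, with smooth transition
maps; `idx` selects a preferred bijection at each point. -/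
structure GluingData (M : Type u) [TopologicalSpace M] [ChartedSpace E3 M] (ι : Type) where
  carrier : Type u
  e : ι → PartialEquiv carrier M
  idx : carrier → ι
  mem_source : ∀ x, x ∈ (e (idx x)).source
  open_target : ∀ i, IsOpen (e i).target
  open_overlap : ∀ i j, IsOpen ((e i).symm.trans (e j)).source
  smooth : ∀ i j, ContMDiffOn (𝓡 3) (𝓡 3) ∞ ((e i).symm.trans (e j)) ((e i).symm.trans (e j)).source

namespace GluingData

variable {M : Type u} [TopologicalSpace M] [ChartedSpace E3 M] {ι : Type} (D : GluingData M ι)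

def chart (i : ι) (y : M) : PartialEquiv D.carrier E3 :=
  (D.e i).trans (chartAt E3 y).toPartialEquiv

theorem chart_transition_source (i j : ι) (y y' : M) :
    ((D.chart i y).symm.trans (D.chart j y')).source =
      (chartAt E3 y).target ∩ (chartAt E3 y).symm ⁻¹' (((D.e i).symm.trans (D.e j)).source ∩
        ((D.e i).symm.trans (D.e j)) ⁻¹' (chartAt E3 y').source) := by
  ext v
  simp only [chart, PartialEquiv.trans_source, PartialEquiv.symm_source,
    PartialEquiv.trans_symm_eq_symm_trans_symm, PartialEquiv.coe_trans, Set.mem_inter_iff,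
    Set.mem_preimage, Function.comp_apply, OpenPartialHomeomorph.coe_toPartialEquiv_symm]
  tauto

theorem isOpen_chart_transition_source (i j : ι) (y y' : M) :
    IsOpen ((D.chart i y).symm.trans (D.chart j y')).source := by
  rw [chart_transition_source]
  exact (chartAt E3 y).symm.isOpen_inter_preimage
    ((D.smooth i j).continuousOn.isOpen_inter_preimage (D.open_overlap i j)
      (chartAt E3 y').open_source)

theorem contDiffOn_chart_transition [IsManifold (𝓡 3) ∞ M] (i j : ι) (y y' : M) :
    ContDiffOn ℝ ∞ ((D.chart i y).symm.trans (D.chart j y'))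
      ((D.chart i y).symm.trans (D.chart j y')).source := by
  rw [← contMDiffOn_iff_contDiffOn, chart_transition_source]
  have h1 : ContMDiffOn (𝓡 3) (𝓡 3) ∞ (chartAt E3 y).symm (chartAt E3 y).target :=
    contMDiffOn_chart_symm
  have h2 : ContMDiffOn (𝓡 3) (𝓡 3) ∞ (chartAt E3 y') (chartAt E3 y').source := contMDiffOn_chart
  refine ContMDiffOn.comp (g := chartAt E3 y')
    (f := fun v => ((D.e i).symm.trans (D.e j)) ((chartAt E3 y).symm v))
    (t := (chartAt E3 y').source) h2 ?_ fun v hv => hv.2.2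
  exact ContMDiffOn.comp (g := (D.e i).symm.trans (D.e j)) (f := (chartAt E3 y).symm)
    (D.smooth i j) (h1.mono fun v hv => hv.1) fun v hv => hv.2.1

variable [IsManifold (𝓡 3) ∞ M]

def core : ChartedSpaceCore E3 D.carrier where
  atlas := {c | ∃ i y, c = D.chart i y}
  chartAt x := D.chart (D.idx x) (D.e (D.idx x) x)
  mem_chart_source x := ⟨D.mem_source x, mem_chart_source E3 _⟩
  chart_mem_atlas x := ⟨_, _, rfl⟩
  open_source := by
    rintro _ _ ⟨i, y, rfl⟩ ⟨j, y', rfl⟩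
    exact D.isOpen_chart_transition_source i j y y'
  continuousOn_toFun := by
    rintro _ _ ⟨i, y, rfl⟩ ⟨j, y', rfl⟩
    exact (D.contDiffOn_chart_transition i j y y').continuousOn

/-- The manifold obtained by gluing. -/
def Glued : Type u := D.carrier

instance : TopologicalSpace D.Glued := D.core.toTopologicalSpace
instance : ChartedSpace E3 D.Glued := D.core.toChartedSpace

/-- The charts of the glued manifold. -/
def gluedChart (i : ι) (y : M) : OpenPartialHomeomorph D.Glued E3 :=
  D.core.openPartialHomeomorph (D.chart i y) ⟨i, y, rfl⟩

theorem gluedChart_mem_atlas (i : ι) (y : M) : D.gluedChart i y ∈ atlas E3 D.Glued :=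
  Set.mem_iUnion₂.2 ⟨D.chart i y, ⟨i, y, rfl⟩, rfl⟩

instance : IsManifold (𝓡 3) ∞ D.Glued := by
  refine isManifold_of_contDiffOn (𝓡 3) ∞ D.Glued ?_
  intro c c' hc hc'
  obtain ⟨e, ⟨i, y, rfl⟩, rfl⟩ := Set.mem_iUnion₂.1 hc
  obtain ⟨e', ⟨j, y', rfl⟩, rfl⟩ := Set.mem_iUnion₂.1 hc'
  have := D.contDiffOn_chart_transition i j y y'
  exact this.mono Set.inter_subset_left

/-- The partial bijections, seen on the glued manifold. -/
def loc (i : ι) : PartialEquiv D.Glued M := D.e i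

theorem isOpen_loc_source (i : ι) : IsOpen (D.loc i).source := by
  have : (D.loc i).source = ⋃ y : M, (D.gluedChart i y).source := by
    ext x
    refine ⟨fun hx => Set.mem_iUnion.2 ⟨D.loc i x, hx, mem_chart_source E3 _⟩, fun hx => ?_⟩
    obtain ⟨y, hy⟩ := Set.mem_iUnion.1 hx
    exact hy.1
  rw [this]
  exact isOpen_iUnion fun y => (D.gluedChart i y).open_source

theorem contMDiffAt_loc {i : ι} {x : D.Glued} (hx : x ∈ (D.loc i).source) :
    ContMDiffAt (𝓡 3) (𝓡 3) ∞ (D.loc i) x := by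
  set y := D.loc i x
  have hxs : x ∈ (D.gluedChart i y).source := ⟨hx, mem_chart_source E3 _⟩
  have h1 : ContMDiffAt (𝓡 3) (𝓡 3) ∞ (D.gluedChart i y) x :=
    contMDiffAt_of_mem_maximalAtlas
      (StructureGroupoid.subset_maximalAtlas _ (D.gluedChart_mem_atlas i y)) hxs
  have h2 : ContMDiffAt (𝓡 3) (𝓡 3) ∞ (chartAt E3 y).symm (D.gluedChart i y x) :=
    contMDiffOn_chart_symm.contMDiffAt
      ((chartAt E3 y).open_target.mem_nhds ((chartAt E3 y).map_source (mem_chart_source E3 y)))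
  refine (h2.comp x h1).congr_of_eventuallyEq ?_
  filter_upwards [(D.gluedChart i y).open_source.mem_nhds hxs] with z hz
  exact ((chartAt E3 y).left_inv hz.2).symm

theorem contMDiffAt_loc_symm {i : ι} {y : M} (hy : y ∈ (D.loc i).target) :
    ContMDiffAt (𝓡 3) (𝓡 3) ∞ (D.loc i).symm y := by
  have hyt : chartAt E3 y y ∈ (D.gluedChart i y).target := by
    refine ⟨(chartAt E3 y).map_source (mem_chart_source E3 y), ?_⟩
    show (chartAt E3 y).symm (chartAt E3 y y) ∈ (D.e i).target
    rw [(chartAt E3 y).left_inv (mem_chart_source E3 y)]; exact hy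
  have h1 : ContMDiffAt (𝓡 3) (𝓡 3) ∞ (D.gluedChart i y).symm (chartAt E3 y y) :=
    contMDiffAt_symm_of_mem_maximalAtlas
      (StructureGroupoid.subset_maximalAtlas _ (D.gluedChart_mem_atlas i y)) hyt
  have h2 : ContMDiffAt (𝓡 3) (𝓡 3) ∞ (chartAt E3 y) y := contMDiffAt_of_mem_maximalAtlas
    (IsManifold.chart_mem_maximalAtlas y) (mem_chart_source E3 y)
  refine (h1.comp y h2).congr_of_eventuallyEq ?_
  filter_upwards [(chartAt E3 y).open_source.mem_nhds (mem_chart_source E3 y)] with z hz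
  exact congrArg (D.loc i).symm ((chartAt E3 y).left_inv hz).symm

/-- The inclusion of a piece in the glued manifold. -/
def inc (i : ι) : PartialDiffeo3 M D.Glued where
  toPartialEquiv := (D.loc i).symm
  open_source := D.open_target i
  open_target := D.isOpen_loc_source i
  contMDiffOn_toFun := fun _ hy => (D.contMDiffAt_loc_symm hy).contMDiffWithinAt
  contMDiffOn_invFun := fun _ hx => (D.contMDiffAt_loc hx).contMDiffWithinAt

/-- The tangent space of the glued manifold at `x` is that of the piece `idx x`. -/
theorem mfderiv_loc {x : D.Glued} {i : ι} (hi : D.idx x = i) :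
    (mfderiv (𝓡 3) (𝓡 3) (D.loc i) x : E3 →L[ℝ] E3) = ContinuousLinearMap.id ℝ E3 := by
  subst hi
  set i := D.idx x
  set y := D.loc i x
  have hx : x ∈ (D.loc i).source := D.mem_source x
  have h1 : HasMFDerivAt (𝓡 3) 𝓘(ℝ, E3) (extChartAt (𝓡 3) x) x (ContinuousLinearMap.id ℝ E3) := by
    have := ((extChartAt_contMDiffAt (mem_extChartAt_source (I := 𝓡 3) x)).mdifferentiableAt
      (by simp)).hasMFDerivAt
    rwa [mfderiv_extChartAt_self] at this
  have hxy : extChartAt (𝓡 3) x x = extChartAt (𝓡 3) y y := rfl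
  have h2 : HasMFDerivAt 𝓘(ℝ, E3) (𝓡 3) (extChartAt (𝓡 3) y).symm (extChartAt (𝓡 3) x x)
      (ContinuousLinearMap.id ℝ E3) := by
    rw [hxy]
    have h3 := ((extChartAt_symm_contMDiffAt (mem_extChartAt_target (I := 𝓡 3) y)).mdifferentiableAt
      (by simp)).hasMFDerivAt
    have h4 := mfderivWithin_range_extChartAt_symm (I := 𝓡 3) (x := y)
    rw [ModelWithCorners.range_eq_univ, mfderivWithin_univ] at h4
    rwa [h4] at h3
  have h5 := (HasMFDerivAt.comp x h2 h1).congr_of_eventuallyEq (f₁ := D.loc i) (by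
    filter_upwards [extChartAt_source_mem_nhds (I := 𝓡 3) x] with z hz
    rw [extChartAt_source] at hz
    exact ((chartAt E3 y).left_inv hz.2).symm)
  exact h5.mfderiv

theorem mfderiv_inc {y : M} {i : ι} (hy : y ∈ (D.inc i).source) (hi : D.idx (D.inc i y) = i) :
    (mfderiv (𝓡 3) (𝓡 3) (D.inc i) y : E3 →L[ℝ] E3) = ContinuousLinearMap.id ℝ E3 := by
  have h1 : (D.loc i) (D.inc i y) = y := (D.loc i).right_inv hy
  have h2 : HasMFDerivAt (𝓡 3) (𝓡 3) ((D.loc i) ∘ (D.inc i)) y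
      ((mfderiv (𝓡 3) (𝓡 3) (D.loc i) (D.inc i y)).comp (mfderiv (𝓡 3) (𝓡 3) (D.inc i) y)) :=
    HasMFDerivAt.comp y
      ((D.contMDiffAt_loc ((D.loc i).map_target hy)).mdifferentiableAt (by simp)).hasMFDerivAt
      ((D.contMDiffAt_loc_symm hy).mdifferentiableAt (by simp)).hasMFDerivAt
  have h3 : HasMFDerivAt (𝓡 3) (𝓡 3) ((D.loc i) ∘ (D.inc i)) y
      (ContinuousLinearMap.id ℝ (TangentSpace (𝓡 3) y)) :=
    (hasMFDerivAt_id y).congr_of_eventuallyEq (by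
      filter_upwards [(D.open_target i).mem_nhds hy] with z hz using (D.loc i).right_inv hz)
  have h4 := hasMFDerivAt_unique h2 h3
  have h5 := D.mfderiv_loc hi
  ext1 v
  have h6 := congrArg (fun L : E3 →L[ℝ] E3 => L v) h4
  have h7 := congrArg (fun L : E3 →L[ℝ] E3 =>
    L ((mfderiv (𝓡 3) (𝓡 3) (D.inc i) y : E3 →L[ℝ] E3) v)) h5
  exact h7.symm.trans h6

theorem secondCountable [Countable ι] [SecondCountableTopology M] :
    SecondCountableTopology D.Glued := by
  let h : ι → OpenPartialHomeomorph D.Glued M := fun i =>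
    { toPartialEquiv := D.loc i
      open_source := D.isOpen_loc_source i
      open_target := D.open_target i
      continuousOn_toFun := fun x hx => (D.contMDiffAt_loc hx).continuousAt.continuousWithinAt
      continuousOn_invFun := fun x hx => (D.contMDiffAt_loc_symm hx).continuousAt.continuousWithinAt }
  have : ∀ i, SecondCountableTopology (D.loc i).source := fun i =>
    (h i).secondCountableTopology_source
  refine TopologicalSpace.secondCountableTopology_of_countable_cover (U := fun i => (D.loc i).source)
    D.isOpen_loc_source ?_
  exact Set.eq_univ_of_forall fun x => Set.mem_iUnion.2 ⟨_, D.mem_source x⟩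

end GluingData

/-! ### Twisting along the annulus -/

section Twist

variable {M : Type u} [TopologicalSpace M] [ChartedSpace E3 M]

/-- The rotation of the circle factor by `k(w, t)`. -/
def twistMap (k : ℝ × ℝ → Circle) (p : Circle × ℝ × ℝ) : Circle × ℝ × ℝ := (p.1 * k p.2, p.2)

open Classical in
/-- The twist of a box, extended by the identity. -/
def twist (Φ : AnnulusBox M) (k : ℝ × ℝ → Circle) (x : M) : M :=
  if x ∈ Φ.target then Φ (twistMap k (Φ.toPartialEquiv.symm x)) else x

/-- The source of the box is a product `S¹ × (-ε₁, ε₁) × (-τ, τ)`. -/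
def IsProductBox (Φ : AnnulusBox M) (ε₁ τ : ℝ) : Prop :=
  Φ.source = {p : Circle × ℝ × ℝ | |p.2.1| < ε₁ ∧ |p.2.2| < τ}

variable {Φ : AnnulusBox M} {ε₁ τ : ℝ} {k k' : ℝ × ℝ → Circle}

theorem IsProductBox.mem_source (h : IsProductBox Φ ε₁ τ) {p : Circle × ℝ × ℝ} :
    p ∈ Φ.source ↔ |p.2.1| < ε₁ ∧ |p.2.2| < τ := by rw [h]; rfl

theorem IsProductBox.twistMap_mem (h : IsProductBox Φ ε₁ τ) {p : Circle × ℝ × ℝ} :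
    twistMap k p ∈ Φ.source ↔ p ∈ Φ.source := by rw [h.mem_source, h.mem_source]; rfl

theorem AnnulusBox.exists_eq (Φ : AnnulusBox M) {x : M} (hx : x ∈ Φ.target) :
    ∃ p ∈ Φ.source, Φ p = x :=
  ⟨_, Φ.map_target' hx, Φ.right_inv' hx⟩

theorem AnnulusBox.symm_apply (Φ : AnnulusBox M) {p : Circle × ℝ × ℝ} (hp : p ∈ Φ.source) :
    Φ.toPartialEquiv.symm (Φ p) = p := Φ.left_inv' hp

theorem AnnulusBox.injOn (Φ : AnnulusBox M) {p p' : Circle × ℝ × ℝ} (hp : p ∈ Φ.source)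
    (hp' : p' ∈ Φ.source) (h : Φ p = Φ p') : p = p' := Φ.toPartialEquiv.injOn hp hp' h

theorem AnnulusBox.mem_target (Φ : AnnulusBox M) {p : Circle × ℝ × ℝ} (hp : p ∈ Φ.source) :
    Φ p ∈ Φ.target := Φ.map_source' hp

theorem twist_apply {p : Circle × ℝ × ℝ} (hp : p ∈ Φ.source) :
    twist Φ k (Φ p) = Φ (twistMap k p) := by
  rw [twist, if_pos (Φ.mem_target hp), Φ.symm_apply hp]

theorem twist_of_notMem {x : M} (hx : x ∉ Φ.target) : twist Φ k x = x := if_neg hx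

theorem IsProductBox.twist_mem_target (h : IsProductBox Φ ε₁ τ) {x : M} (hx : x ∈ Φ.target) :
    twist Φ k x ∈ Φ.target := by
  obtain ⟨p, hp, rfl⟩ := Φ.exists_eq hx
  rw [twist_apply hp]; exact Φ.mem_target (h.twistMap_mem.2 hp)

theorem IsProductBox.twist_twist (h : IsProductBox Φ ε₁ τ) (x : M) :
    twist Φ k (twist Φ k' x) = twist Φ (k' * k) x := by
  by_cases hx : x ∈ Φ.target
  · obtain ⟨p, hp, rfl⟩ := Φ.exists_eq hx
    rw [twist_apply hp, twist_apply (h.twistMap_mem.2 hp), twist_apply hp]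
    simp [twistMap, mul_assoc]
  · rw [twist_of_notMem hx, twist_of_notMem hx, twist_of_notMem hx]

theorem twist_eq_self {p : Circle × ℝ × ℝ} (hp : p ∈ Φ.source) (hk : k p.2 = 1) :
    twist Φ k (Φ p) = Φ p := by
  rw [twist_apply hp]; simp [twistMap, hk]

theorem twist_one (x : M) : twist Φ 1 x = x := by
  by_cases hx : x ∈ Φ.target
  · obtain ⟨p, hp, rfl⟩ := Φ.exists_eq hx
    exact twist_eq_self hp rfl
  · exact twist_of_notMem hx

theorem IsProductBox.twist_inv_twist (h : IsProductBox Φ ε₁ τ) (x : M) :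
    twist Φ k⁻¹ (twist Φ k x) = x := by rw [h.twist_twist, mul_inv_cancel, twist_one]

theorem IsProductBox.twist_twist_inv (h : IsProductBox Φ ε₁ τ) (x : M) :
    twist Φ k (twist Φ k⁻¹ x) = x := by rw [h.twist_twist, inv_mul_cancel, twist_one]

/-- A twist preserves the sets which are invariant under rotations. -/
theorem IsProductBox.twist_mem_image (h : IsProductBox Φ ε₁ τ) {S : Set (ℝ × ℝ)} {x : M}
    (hS : ∀ y ∈ S, |y.1| < ε₁ ∧ |y.2| < τ) :
    twist Φ k x ∈ Φ '' {p : Circle × ℝ × ℝ | p.2 ∈ S} ↔ x ∈ Φ '' {p : Circle × ℝ × ℝ | p.2 ∈ S} := by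
  have key : ∀ (k : ℝ × ℝ → Circle) (x : M), x ∈ Φ '' {p : Circle × ℝ × ℝ | p.2 ∈ S} →
      twist Φ k x ∈ Φ '' {p : Circle × ℝ × ℝ | p.2 ∈ S} := by
    rintro k _ ⟨p, hp, rfl⟩
    exact ⟨twistMap k p, hp, (twist_apply (h.mem_source.2 (hS _ hp))).symm⟩
  refine ⟨fun hx => ?_, key k x⟩
  have := key k⁻¹ _ hx
  rwa [h.twist_inv_twist] at this

theorem contMDiffAt_twistMap {p : Circle × ℝ × ℝ}
    (hk : ContMDiffAt (𝓘(ℝ, ℝ).prod 𝓘(ℝ, ℝ)) (𝓡 1) ∞ k p.2) :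
    ContMDiffAt boxModel boxModel ∞ (twistMap k) p :=
  (contMDiffAt_fst.mul (hk.comp p contMDiffAt_snd)).prodMk contMDiffAt_snd

theorem IsProductBox.contMDiffAt_twist (h : IsProductBox Φ ε₁ τ) {p : Circle × ℝ × ℝ}
    (hp : p ∈ Φ.source) (hk : ContMDiffAt (𝓘(ℝ, ℝ).prod 𝓘(ℝ, ℝ)) (𝓡 1) ∞ k p.2) :
    ContMDiffAt (𝓡 3) (𝓡 3) ∞ (twist Φ k) (Φ p) := by
  have h1 : ContMDiffAt (𝓡 3) boxModel ∞ Φ.toPartialEquiv.symm (Φ p) :=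
    Φ.contMDiffOn_invFun.contMDiffAt (Φ.open_target.mem_nhds (Φ.mem_target hp))
  have h2 : ContMDiffAt boxModel boxModel ∞ (twistMap k) (Φ.toPartialEquiv.symm (Φ p)) := by
    rw [Φ.symm_apply hp]; exact contMDiffAt_twistMap hk
  have h3 : ContMDiffAt boxModel (𝓡 3) ∞ Φ (twistMap k (Φ.toPartialEquiv.symm (Φ p))) := by
    rw [Φ.symm_apply hp]
    exact Φ.contMDiffOn_toFun.contMDiffAt (Φ.open_source.mem_nhds (h.twistMap_mem.2 hp))
  have h4 : ContMDiffAt (𝓡 3) boxModel ∞ (fun x => twistMap k (Φ.toPartialEquiv.symm x)) (Φ p) :=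
    ContMDiffAt.comp (I' := boxModel) (Φ p) h2 h1
  have h5 : ContMDiffAt (𝓡 3) (𝓡 3) ∞ (fun x => Φ (twistMap k (Φ.toPartialEquiv.symm x))) (Φ p) :=
    ContMDiffAt.comp (I' := boxModel) (Φ p) h3 h4
  refine h5.congr_of_eventuallyEq ?_
  filter_upwards [Φ.open_target.mem_nhds (Φ.mem_target hp)] with x hx
  rw [twist, if_pos hx]

/-- The rotation which realizes the shear on the positive side of the annulus. -/
def shearRotation (q : ℤ) (g : ℝ → ℝ) (ε : ℝ) (y : ℝ × ℝ) : Circle :=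
  if 0 < y.2 then Circle.exp (q * g (y.1 / ε)) else 1

theorem IsShearProfile.exp_eq_one {g : ℝ → ℝ} (hg : IsShearProfile g) {ε : ℝ} (hε : 0 < ε) (q : ℤ)
    {w : ℝ} (hw : ε ≤ |w|) : Circle.exp (q * g (w / ε)) = 1 := by
  rcases le_abs.1 hw with h | h
  · rw [hg.2.2.2 _ ((one_le_div hε).2 h)]
    rw [mul_comm]; exact Circle.exp_two_pi_mul_int q
  · rw [hg.2.2.1 _ (by rw [div_le_iff₀ hε]; linarith)]; simp

theorem IsShearProfile.contMDiff_exp {g : ℝ → ℝ} (hg : IsShearProfile g) (q : ℤ) (ε : ℝ) :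
    ContMDiff (𝓘(ℝ, ℝ).prod 𝓘(ℝ, ℝ)) (𝓡 1) ∞
      (fun y : ℝ × ℝ => Circle.exp (q * g (y.1 / ε))) := by
  have : ContDiff ℝ ∞ (fun w : ℝ => q * g (w / ε)) :=
    contDiff_const.mul (hg.1.comp (contDiff_id.div_const ε))
  exact contMDiff_circleExp.comp (this.contMDiff.comp contMDiff_fst)

theorem IsShearProfile.contMDiffAt_shearRotation {g : ℝ → ℝ} (hg : IsShearProfile g) {ε : ℝ}
    (hε : 0 < ε) (q : ℤ) {y : ℝ × ℝ} (hy : y.2 ≠ 0 ∨ ε < |y.1|) :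
    ContMDiffAt (𝓘(ℝ, ℝ).prod 𝓘(ℝ, ℝ)) (𝓡 1) ∞ (shearRotation q g ε) y := by
  have hone : ContMDiffAt (𝓘(ℝ, ℝ).prod 𝓘(ℝ, ℝ)) (𝓡 1) ∞ (fun _ : ℝ × ℝ => (1 : Circle)) y :=
    contMDiffAt_const
  rcases hy with hy | hy
  · rcases lt_or_gt_of_ne hy with h | h
    · refine hone.congr_of_eventuallyEq ?_
      filter_upwards [continuousAt_snd.eventually_lt_const h] with z hz
      exact if_neg hz.not_gt
    · refine (hg.contMDiff_exp q ε y).congr_of_eventuallyEq ?_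
      filter_upwards [continuousAt_snd.eventually_const_lt h] with z hz
      exact if_pos hz
  · refine hone.congr_of_eventuallyEq ?_
    filter_upwards [continuousAt_fst.abs.eventually_const_lt hy] with z hz
    by_cases h : 0 < z.2
    · rw [shearRotation, if_pos h]; exact hg.exp_eq_one hε q (le_of_lt hz)
    · exact if_neg h

end Twist

/-! ### The surgered manifold -/

section SurgeryManifold

variable {M : Type u} [TopologicalSpace M] [ChartedSpace E3 M] [IsManifold (𝓡 3) ∞ M]

/-- The hypotheses under which the surgery is performed. -/
structure SurgeryInput (M : Type u) [TopologicalSpace M] [ChartedSpace E3 M]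
    [IsManifold (𝓡 3) ∞ M] where
  Φ : AnnulusBox M
  ε : ℝ
  ε₁ : ℝ
  τ : ℝ
  q : ℤ
  g : ℝ → ℝ
  pos : 0 < ε
  lt : ε < ε₁
  τ_pos : 0 < τ
  box : IsProductBox Φ ε₁ τ
  profile : IsShearProfile g

namespace SurgeryInput

variable (I : SurgeryInput M)

abbrev rot : ℝ × ℝ → Circle := shearRotation I.q I.g I.ε

abbrev slit : Set (ℝ × ℝ) := {y | |y.1| ≤ I.ε ∧ y.2 = 0}

theorem slit_subset {y : ℝ × ℝ} (hy : y ∈ I.slit) : |y.1| < I.ε₁ ∧ |y.2| < I.τ :=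
  ⟨lt_of_le_of_lt hy.1 I.lt, by rw [hy.2, abs_zero]; exact I.τ_pos⟩

theorem isCompact_image {S : Set (ℝ × ℝ)} (hS : IsCompact S)
    (hS' : ∀ y ∈ S, |y.1| < I.ε₁ ∧ |y.2| < I.τ) :
    IsCompact (I.Φ '' {p : Circle × ℝ × ℝ | p.2 ∈ S}) := by
  have h1 : {p : Circle × ℝ × ℝ | p.2 ∈ S} = Set.univ ×ˢ S := by ext; simp
  rw [h1]
  refine (isCompact_univ.prod hS).image_of_continuousOn ?_
  refine I.Φ.contMDiffOn_toFun.continuousOn.mono ?_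
  rintro p ⟨-, hp⟩
  exact I.box.mem_source.2 (hS' _ hp)

theorem isOpen_image {S : Set (ℝ × ℝ)} (hS : IsOpen S)
    (hS' : ∀ y ∈ S, |y.1| < I.ε₁ ∧ |y.2| < I.τ) :
    IsOpen (I.Φ '' {p : Circle × ℝ × ℝ | p.2 ∈ S}) := by
  have h2 : IsOpen (I.Φ.target ∩ I.Φ.toPartialEquiv.symm ⁻¹' {p : Circle × ℝ × ℝ | p.2 ∈ S}) :=
    I.Φ.contMDiffOn_invFun.continuousOn.isOpen_inter_preimage I.Φ.open_target
      (hS.preimage continuous_snd)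
  convert h2 using 1
  ext x
  constructor
  · rintro ⟨p, hp, rfl⟩
    have hps := I.box.mem_source.2 (hS' _ hp)
    refine ⟨I.Φ.mem_target hps, ?_⟩
    rw [Set.mem_preimage, I.Φ.symm_apply hps]; exact hp
  · rintro ⟨hx, hx'⟩
    exact ⟨_, hx', I.Φ.right_inv' hx⟩

theorem isCompact_slit : IsCompact I.slit := by
  have : I.slit = Set.Icc (-I.ε) I.ε ×ˢ {0} := by
    ext y; simp [slit, abs_le]
  rw [this]; exact isCompact_Icc.prod isCompact_singleton

theorem isCompact_annulus : IsCompact (I.Φ.annulus I.ε) :=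
  I.isCompact_image I.isCompact_slit fun _ hy => I.slit_subset hy

theorem annulus_subset : I.Φ.annulus I.ε ⊆ I.Φ.target := by
  rintro _ ⟨p, hp, rfl⟩
  exact I.Φ.mem_target (I.box.mem_source.2 (I.slit_subset hp))

theorem twist_mem_annulus {k : ℝ × ℝ → Circle} {x : M} :
    twist I.Φ k x ∈ I.Φ.annulus I.ε ↔ x ∈ I.Φ.annulus I.ε :=
  I.box.twist_mem_image fun _ hy => I.slit_subset hy

theorem notMem_annulus {p : Circle × ℝ × ℝ} (hp : p ∈ I.Φ.source) :
    I.Φ p ∉ I.Φ.annulus I.ε ↔ p.2.2 ≠ 0 ∨ I.ε < |p.2.1| := by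
  have : I.Φ p ∈ I.Φ.annulus I.ε ↔ |p.2.1| ≤ I.ε ∧ p.2.2 = 0 := by
    constructor
    · rintro ⟨p', hp', h⟩
      rw [← I.Φ.injOn (I.box.mem_source.2 (I.slit_subset hp')) hp h]; exact hp'
    · intro h; exact ⟨p, h, rfl⟩
  rw [this, not_and_or, not_le, or_comm]

theorem contMDiffAt_twist {x : M} (hx : x ∈ I.Φ.target) (hx' : x ∉ I.Φ.annulus I.ε) :
    ContMDiffAt (𝓡 3) (𝓡 3) ∞ (twist I.Φ I.rot) x ∧
      ContMDiffAt (𝓡 3) (𝓡 3) ∞ (twist I.Φ I.rot⁻¹) x := by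
  obtain ⟨p, hp, rfl⟩ := I.Φ.exists_eq hx
  have h := I.profile.contMDiffAt_shearRotation I.pos I.q ((I.notMem_annulus hp).1 hx')
  exact ⟨I.box.contMDiffAt_twist hp h, I.box.contMDiffAt_twist hp h.inv⟩

variable [T2Space M]

open Classical in
/-- The pieces of the surgered manifold: the complement of the annulus, and the box. -/
def gluing : GluingData M Bool where
  carrier := M
  e b := match b with
    | false => PartialEquiv.ofSet (I.Φ.annulus I.ε)ᶜ
    | true =>
      { toFun := twist I.Φ I.rot⁻¹
        invFun := twist I.Φ I.rot
        source := I.Φ.target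
        target := I.Φ.target
        map_source' := fun _ hx => I.box.twist_mem_target hx
        map_target' := fun _ hx => I.box.twist_mem_target hx
        left_inv' := fun x _ => I.box.twist_twist_inv x
        right_inv' := fun x _ => I.box.twist_inv_twist x }
  idx x := decide (x ∈ I.Φ.annulus I.ε)
  mem_source x := by
    by_cases hx : x ∈ I.Φ.annulus I.ε
    · simp only [hx, decide_true]; exact I.annulus_subset hx
    · simp only [hx, decide_false]; exact hx
  open_target b := by
    cases b
    · exact I.isCompact_annulus.isClosed.isOpen_compl
    · exact I.Φ.open_target
  open_overlap i j := by
    have hc := I.isCompact_annulus.isClosed.isOpen_compl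
    cases i <;> cases j
    · exact hc.inter hc
    · exact hc.inter I.Φ.open_target
    · have : I.Φ.target ∩ twist I.Φ I.rot ⁻¹' (I.Φ.annulus I.ε)ᶜ =
          I.Φ.target ∩ (I.Φ.annulus I.ε)ᶜ := by
        ext x
        simp only [Set.mem_inter_iff, Set.mem_preimage, Set.mem_compl_iff, I.twist_mem_annulus]
      show IsOpen (I.Φ.target ∩ twist I.Φ I.rot ⁻¹' (I.Φ.annulus I.ε)ᶜ)
      rw [this]; exact I.Φ.open_target.inter hc
    · have : I.Φ.target ∩ twist I.Φ I.rot ⁻¹' I.Φ.target = I.Φ.target :=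
        Set.inter_eq_left.2 fun x hx => I.box.twist_mem_target hx
      show IsOpen (I.Φ.target ∩ twist I.Φ I.rot ⁻¹' I.Φ.target)
      rw [this]; exact I.Φ.open_target
  smooth i j := by
    cases i <;> cases j
    · exact contMDiffOn_id
    · rintro x ⟨hx, hx'⟩
      exact (I.contMDiffAt_twist hx' hx).2.contMDiffWithinAt
    · rintro x ⟨hx, hx'⟩
      refine (I.contMDiffAt_twist hx ?_).1.contMDiffWithinAt
      exact fun h => hx' (I.twist_mem_annulus.2 h)
    · refine contMDiffOn_id.congr fun x hx => ?_
      exact I.box.twist_inv_twist x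

/-- The surgered manifold. -/
abbrev Surgered : Type u := I.gluing.Glued

/-- The embedding of the complement of the annulus. -/
abbrev outer : PartialDiffeo3 M I.Surgered := I.gluing.inc false

/-- The embedding of the box. -/
def inner : AnnulusBox I.Surgered :=
  PartialDiffeomorph.trans I.Φ (I.gluing.inc true)

theorem inner_source : I.inner.source = I.Φ.source := by
  show I.Φ.source ∩ _ = _
  exact Set.inter_eq_left.2 fun p hp => I.Φ.mem_target hp

theorem inner_target : I.inner.target = (I.Φ.target : Set M) := by
  show I.Φ.target ∩ twist I.Φ I.rot⁻¹ ⁻¹' I.Φ.target = I.Φ.target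
  exact Set.inter_eq_left.2 fun x hx => I.box.twist_mem_target hx

theorem isShearSurgery : IsShearSurgery I.Φ I.ε I.q I.g I.outer I.inner where
  source_eq := rfl
  box_source_eq := I.inner_source
  cover := by
    rw [I.inner_target]
    refine Set.eq_univ_of_forall fun x => ?_
    by_cases hx : (x : M) ∈ I.Φ.annulus I.ε
    · exact Or.inr (I.annulus_subset hx)
    · exact Or.inl hx
  glue_neg := fun p hp ht => by
    exact twist_eq_self (Φ := I.Φ) (k := I.rot) hp (if_neg ht.not_gt)
  glue_pos := fun p hp ht => by
    refine (twist_apply (Φ := I.Φ) (k := I.rot) hp).trans (congrArg I.Φ ?_)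
    simp only [twistMap, rot, shearRotation, if_pos ht, shear, mul_comm]
  glue_side := fun p hp hw => by
    refine twist_eq_self (Φ := I.Φ) (k := I.rot) hp ?_
    by_cases h : 0 < p.2.2
    · rw [rot, shearRotation, if_pos h]; exact I.profile.exp_eq_one I.pos I.q hw.le
    · exact if_neg h

/-- A smaller closed box around the annulus. -/
abbrev closedRect : Set (ℝ × ℝ) := {y | |y.1| ≤ (I.ε + I.ε₁) / 2 ∧ |y.2| ≤ I.τ / 2}

abbrev openRect : Set (ℝ × ℝ) := {y | |y.1| < (I.ε + I.ε₁) / 2 ∧ |y.2| < I.τ / 2}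

theorem closedRect_subset {y : ℝ × ℝ} (hy : y ∈ I.closedRect) : |y.1| < I.ε₁ ∧ |y.2| < I.τ :=
  ⟨by linarith [hy.1, I.lt], by linarith [hy.2, I.τ_pos]⟩

theorem isCompact_closedRect : IsCompact I.closedRect := by
  have : I.closedRect = Set.Icc (-((I.ε + I.ε₁) / 2)) ((I.ε + I.ε₁) / 2) ×ˢ
      Set.Icc (-(I.τ / 2)) (I.τ / 2) := by
    ext y; simp only [Set.mem_ofPred_eq, Set.mem_prod, Set.mem_Icc, abs_le]
  rw [this]; exact isCompact_Icc.prod isCompact_Icc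

theorem isOpen_openRect : IsOpen I.openRect :=
  (isOpen_lt (f := fun y : ℝ × ℝ => |y.1|) (by fun_prop) continuous_const).inter
    (isOpen_lt (f := fun y : ℝ × ℝ => |y.2|) (by fun_prop) continuous_const)

theorem openRect_subset {y : ℝ × ℝ} (hy : y ∈ I.openRect) : y ∈ I.closedRect :=
  ⟨hy.1.le, hy.2.le⟩

theorem slit_subset_openRect {y : ℝ × ℝ} (hy : y ∈ I.slit) : y ∈ I.openRect :=
  ⟨by linarith [hy.1, I.lt], by rw [hy.2, abs_zero]; linarith [I.τ_pos]⟩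

theorem slit_image_subset : I.Φ '' {p : Circle × ℝ × ℝ | p.2 ∈ I.slit} ⊆
    I.Φ '' {p : Circle × ℝ × ℝ | p.2 ∈ I.openRect} :=
  Set.image_mono fun (p : Circle × ℝ × ℝ) (hp : p.2 ∈ I.slit) => I.slit_subset_openRect hp

theorem openRect_image_subset : I.Φ '' {p : Circle × ℝ × ℝ | p.2 ∈ I.openRect} ⊆
    I.Φ '' {p : Circle × ℝ × ℝ | p.2 ∈ I.closedRect} :=
  Set.image_mono fun (p : Circle × ℝ × ℝ) (hp : p.2 ∈ I.openRect) => I.openRect_subset hp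

theorem separated_of_mem_source {i : Bool} {x y : I.Surgered} (hxy : x ≠ y)
    (hx : x ∈ (I.gluing.loc i).source) (hy : y ∈ (I.gluing.loc i).source) :
    ∃ U V : Set I.Surgered, IsOpen U ∧ IsOpen V ∧ x ∈ U ∧ y ∈ V ∧ Disjoint U V := by
  have hne : I.gluing.loc i x ≠ I.gluing.loc i y := fun h => hxy ((I.gluing.loc i).injOn hx hy h)
  obtain ⟨U, V, hU, hV, hxU, hyV, hUV⟩ := t2_separation hne
  have hc : ContinuousOn (I.gluing.loc i) (I.gluing.loc i).source := fun z hz =>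
    (I.gluing.contMDiffAt_loc hz).continuousAt.continuousWithinAt
  refine ⟨_, _, hc.isOpen_inter_preimage (I.gluing.isOpen_loc_source i) hU,
    hc.isOpen_inter_preimage (I.gluing.isOpen_loc_source i) hV, ⟨hx, hxU⟩, ⟨hy, hyV⟩, ?_⟩
  rw [Set.disjoint_left] at hUV ⊢
  exact fun z hz hz' => hUV hz.2 hz'.2

theorem separated_of_mem_annulus {x y : I.Surgered} (hx : (x : M) ∈ I.Φ.annulus I.ε)
    (hy : (y : M) ∉ I.Φ.target) :
    ∃ U V : Set I.Surgered, IsOpen U ∧ IsOpen V ∧ x ∈ U ∧ y ∈ V ∧ Disjoint U V := by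
  have hc : ∀ i, ContinuousOn (I.gluing.loc i) (I.gluing.loc i).source := fun i z hz =>
    (I.gluing.contMDiffAt_loc hz).continuousAt.continuousWithinAt
  have hopen := I.isOpen_image I.isOpen_openRect fun y hy => I.closedRect_subset (I.openRect_subset hy)
  have hclosed := (I.isCompact_image I.isCompact_closedRect fun y hy =>
    I.closedRect_subset hy).isClosed.isOpen_compl
  refine ⟨_, _, (hc true).isOpen_inter_preimage (I.gluing.isOpen_loc_source true) hopen,
    (hc false).isOpen_inter_preimage (I.gluing.isOpen_loc_source false) hclosed,
    ⟨I.annulus_subset hx, ?_⟩, ⟨fun h => hy (I.annulus_subset h), ?_⟩, ?_⟩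
  · have : twist I.Φ I.rot⁻¹ (x : M) ∈ I.Φ.annulus I.ε := I.twist_mem_annulus.2 hx
    exact I.slit_image_subset this
  · rintro ⟨p, hp, h⟩
    refine hy ?_
    have h' : I.Φ p = (y : M) := h
    rw [← h']
    exact I.Φ.mem_target (I.box.mem_source.2 (I.closedRect_subset hp))
  · rw [Set.disjoint_left]
    rintro z ⟨-, hz⟩ ⟨-, hz'⟩
    refine hz' ?_
    have h1 : (z : M) ∈ I.Φ '' {p : Circle × ℝ × ℝ | p.2 ∈ I.openRect} :=
      (I.box.twist_mem_image fun y hy => I.closedRect_subset (I.openRect_subset hy)).1 hz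
    exact I.openRect_image_subset h1

instance : T2Space I.Surgered := by
  refine ⟨fun x y hxy => ?_⟩
  by_cases hx : (x : M) ∈ I.Φ.annulus I.ε <;> by_cases hy : (y : M) ∈ I.Φ.annulus I.ε
  · exact I.separated_of_mem_source (i := true) hxy (I.annulus_subset hx) (I.annulus_subset hy)
  · by_cases hy' : (y : M) ∈ I.Φ.target
    · exact I.separated_of_mem_source (i := true) hxy (I.annulus_subset hx) hy'
    · exact I.separated_of_mem_annulus hx hy'
  · by_cases hx' : (x : M) ∈ I.Φ.target
    · exact I.separated_of_mem_source (i := true) hxy hx' (I.annulus_subset hy)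
    · obtain ⟨U, V, h1, h2, h3, h4, h5⟩ := I.separated_of_mem_annulus hy hx'
      exact ⟨V, U, h2, h1, h4, h3, h5.symm⟩
  · exact I.separated_of_mem_source (i := false) hxy hx hy

theorem compactSpace [CompactSpace M] : CompactSpace I.Surgered := by
  have hopen := I.isOpen_image I.isOpen_openRect fun y hy => I.closedRect_subset (I.openRect_subset hy)
  have h1 : IsCompact (I.outer '' (I.Φ '' {p : Circle × ℝ × ℝ | p.2 ∈ I.openRect})ᶜ) := by
    refine hopen.isClosed_compl.isCompact.image_of_continuousOn
      (I.outer.contMDiffOn_toFun.continuousOn.mono ?_)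
    intro x hx hx'
    exact hx (I.slit_image_subset hx')
  have h2 : IsCompact ((I.gluing.inc true) '' (I.Φ '' {p : Circle × ℝ × ℝ | p.2 ∈ I.closedRect})) := by
    refine (I.isCompact_image I.isCompact_closedRect fun y hy =>
      I.closedRect_subset hy).image_of_continuousOn
      ((I.gluing.inc true).contMDiffOn_toFun.continuousOn.mono ?_)
    rintro _ ⟨p, hp, rfl⟩
    exact I.Φ.mem_target (I.box.mem_source.2 (I.closedRect_subset hp))
  refine ⟨?_⟩
  convert h1.union h2
  symm
  refine Set.eq_univ_of_forall fun x => ?_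
  by_cases hx : (x : M) ∈ I.Φ '' {p : Circle × ℝ × ℝ | p.2 ∈ I.openRect}
  · refine Or.inr ⟨twist I.Φ I.rot⁻¹ (x : M), ?_, I.box.twist_twist_inv (x : M)⟩
    refine (I.box.twist_mem_image fun y hy => I.closedRect_subset hy).2 ?_
    exact I.openRect_image_subset hx
  · exact Or.inl ⟨x, hx, rfl⟩

end SurgeryInput

end SurgeryManifold

/-! ### Shears of coordinates -/

section Shear

/-- A shear of the first coordinate. -/
def shearMap (h : ℝ × ℝ → ℝ) (p : ℝ × ℝ × ℝ) : ℝ × ℝ × ℝ := (p.1 + h p.2, p.2)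

theorem hasFDerivAt_shearMap {h : ℝ × ℝ → ℝ} {p : ℝ × ℝ × ℝ} (hh : DifferentiableAt ℝ h p.2) :
    HasFDerivAt (shearMap h) ((dS + (fderiv ℝ h p.2).comp (ContinuousLinearMap.snd ℝ ℝ (ℝ × ℝ))).prod
      (ContinuousLinearMap.snd ℝ ℝ (ℝ × ℝ))) p :=
  (hasFDerivAt_fst.add (HasFDerivAt.comp p hh.hasFDerivAt hasFDerivAt_snd)).prodMk hasFDerivAt_snd

variable {M : Type u} [TopologicalSpace M] [ChartedSpace E3 M] [IsManifold (𝓡 3) ∞ M]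
  {o : ∀ x : M, Orientation ℝ (TangentSpace (𝓡 3) x) (Fin 3)}

theorem IsPositiveTriple.congr {x y : M} {u v w u' v' w' : E3}
    (h : IsPositiveTriple o y u' v' w') (hx : x = y) (hu : u = u') (hv : v = v') (hw : w = w') :
    IsPositiveTriple o x u v w := by
  subst hx hu hv hw; exact h

theorem mfderiv_shearMap {c : ℝ × ℝ × ℝ → M} {h : ℝ × ℝ → ℝ} {p : ℝ × ℝ × ℝ}
    (hc : MDifferentiableAt 𝓘(ℝ, ℝ × ℝ × ℝ) (𝓡 3) c (shearMap h p))
    (hh : DifferentiableAt ℝ h p.2) (v : ℝ × ℝ × ℝ) :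
    (mfderiv 𝓘(ℝ, ℝ × ℝ × ℝ) (𝓡 3) (c ∘ shearMap h) p v : E3) =
      mfderiv 𝓘(ℝ, ℝ × ℝ × ℝ) (𝓡 3) c (shearMap h p) (v.1 + fderiv ℝ h p.2 v.2, v.2) := by
  have h1 := HasMFDerivAt.comp p hc.hasMFDerivAt (hasFDerivAt_shearMap hh).hasMFDerivAt
  exact congrArg (fun L : ℝ × ℝ × ℝ →L[ℝ] E3 => L v) h1.mfderiv

/-- A shear of the first coordinate preserves the orientation. -/
theorem isPositiveTriple_shearMap {x : M} {L L' : ℝ × ℝ × ℝ →L[ℝ] TangentSpace (𝓡 3) x}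
    {l : ℝ × ℝ → ℝ} (hl : ∀ v, L' v = L (v.1 + l v.2, v.2)) (hl0 : l 0 = 0)
    (h : IsPositiveTriple o x (L vecW) (L vecS) (L vecT)) :
    IsPositiveTriple o x (L' vecW) (L' vecS) (L' vecT) := by
  have h1 : ∀ v : ℝ × ℝ × ℝ, L v = v.1 • L vecS + v.2.1 • L vecW + v.2.2 • L vecT := by
    intro v
    conv_lhs => rw [vec_eq v]
    simp only [map_add, map_smul]
  refine h.of_matrix !![1, l (1, 0), 0; 0, 1, 0; 0, l (0, 1), 1] ?_ ?_ ?_ ?_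
  · rw [Matrix.det_fin_three]; simp
  · rw [hl, h1]; simp [add_comm]
  · have : l ((0 : ℝ), (0 : ℝ)) = 0 := hl0
    rw [hl, h1]; simp [this]
  · rw [hl, h1]; simp

end Shear

/-! ### The tangent spaces of the surgered manifold -/

section SurgeryTangent

variable {M : Type u} [TopologicalSpace M] [ChartedSpace E3 M] [IsManifold (𝓡 3) ∞ M]

namespace SurgeryInput

variable (I : SurgeryInput M) [T2Space M]

/-- The displacement of the shear. -/
def slide (y : ℝ × ℝ) : ℝ := I.q * I.g (y.1 / I.ε)

/-- The derivative of the displacement of the shear. -/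
def slope (w : ℝ) : ℝ := I.q * (deriv I.g (w / I.ε) / I.ε)

theorem hasFDerivAt_slide (y : ℝ × ℝ) :
    HasFDerivAt I.slide (I.slope y.1 • ContinuousLinearMap.fst ℝ ℝ ℝ) y := by
  have h1 : HasDerivAt (fun w : ℝ => (I.q : ℝ) * I.g (w / I.ε)) (I.slope y.1) y.1 := by
    have h2 : HasDerivAt I.g (deriv I.g (y.1 / I.ε)) (y.1 / I.ε) :=
      (I.profile.1.differentiable (by simp) _).hasDerivAt
    have h3 := (h2.comp y.1 ((hasDerivAt_id y.1).div_const I.ε)).const_mul (I.q : ℝ)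
    refine h3.congr_deriv ?_
    rw [slope]; ring
  have h4 := HasDerivAt.comp_hasFDerivAt y h1 (hasFDerivAt_fst (𝕜 := ℝ) (E := ℝ) (F := ℝ))
  exact h4

theorem contDiff_slide : ContDiff ℝ ∞ I.slide :=
  contDiff_const.mul (I.profile.1.comp (contDiff_fst.div_const _))

theorem contDiff_slope : ContDiff ℝ ∞ I.slope := by
  have h1 : ContDiff ℝ ∞ (deriv I.g) :=
    (contDiff_infty_iff_deriv.1 I.profile.1).2
  exact contDiff_const.mul ((h1.comp (contDiff_id.div_const _)).div_const _)

theorem expCoord_mem {p : ℝ × ℝ × ℝ} (hp : p ∈ boxSet I.ε₁ I.τ) : expCoord p ∈ I.Φ.source :=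
  I.box.mem_source.2 hp

theorem expCoord_mem' {p : ℝ × ℝ × ℝ} (hp : p ∈ boxSet I.ε₁ I.τ) : expCoord p ∈ I.inner.source := by
  rw [I.inner_source]; exact I.expCoord_mem hp

theorem shear_mem {p : ℝ × ℝ × ℝ} (hp : p ∈ boxSet I.ε₁ I.τ) :
    shearMap I.slide p ∈ boxSet I.ε₁ I.τ := hp

theorem coord_mem_target {p : ℝ × ℝ × ℝ} (hp : p ∈ boxSet I.ε₁ I.τ) : I.Φ.coord p ∈ I.Φ.target :=
  I.Φ.mem_target (I.expCoord_mem hp)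

theorem innerCoord_neg {p : ℝ × ℝ × ℝ} (hp : p ∈ boxSet I.ε₁ I.τ) (h : p.2.2 ≤ 0 ∨ I.ε ≤ |p.2.1|) :
    I.inner.coord p = (I.Φ.coord p : M) := by
  refine twist_eq_self (Φ := I.Φ) (k := I.rot) (I.expCoord_mem hp) ?_
  show shearRotation I.q I.g I.ε p.2 = 1
  by_cases ht : 0 < p.2.2
  · rw [shearRotation, if_pos ht]
    exact I.profile.exp_eq_one I.pos I.q (h.resolve_left ht.not_ge)
  · exact if_neg ht

theorem innerCoord_pos {p : ℝ × ℝ × ℝ} (hp : p ∈ boxSet I.ε₁ I.τ) (h : 0 < p.2.2) :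
    I.inner.coord p = (I.Φ.coord (shearMap I.slide p) : M) := by
  refine (twist_apply (Φ := I.Φ) (k := I.rot) (I.expCoord_mem hp)).trans (congrArg I.Φ ?_)
  have : (shearRotation I.q I.g I.ε (p.2.1, p.2.2)) = Circle.exp (I.slide p.2) := if_pos h
  simp only [twistMap, rot, shearMap, expCoord, this, Circle.exp_add]

theorem mfderiv_outer {x : M} (hx : x ∉ I.Φ.annulus I.ε) :
    (mfderiv (𝓡 3) (𝓡 3) I.outer x : E3 →L[ℝ] E3) = ContinuousLinearMap.id ℝ E3 :=
  I.gluing.mfderiv_inc hx (@decide_eq_false _ (Classical.propDecidable _) hx)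

theorem coord_notMem_annulus {p : ℝ × ℝ × ℝ} (hp : p ∈ boxSet I.ε₁ I.τ)
    (h : p.2.2 ≠ 0 ∨ I.ε < |p.2.1|) : I.Φ.coord p ∉ I.Φ.annulus I.ε :=
  (I.notMem_annulus (I.expCoord_mem hp)).2 h

theorem contMDiffAt_outer {x : M} (hx : x ∉ I.Φ.annulus I.ε) :
    ContMDiffAt (𝓡 3) (𝓡 3) ∞ I.outer x := I.gluing.contMDiffAt_loc_symm (i := false) hx

theorem contMDiffAt_innerCoord {p : ℝ × ℝ × ℝ} (hp : p ∈ boxSet I.ε₁ I.τ) :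
    ContMDiffAt 𝓘(ℝ, ℝ × ℝ × ℝ) (𝓡 3) ∞ I.inner.coord p :=
  I.inner.contMDiffAt_coord (I.expCoord_mem' hp)

theorem contMDiffAt_coord {p : ℝ × ℝ × ℝ} (hp : p ∈ boxSet I.ε₁ I.τ) :
    ContMDiffAt 𝓘(ℝ, ℝ × ℝ × ℝ) (𝓡 3) ∞ I.Φ.coord p :=
  I.Φ.contMDiffAt_coord (I.expCoord_mem hp)

theorem mfderiv_outer_comp {c : ℝ × ℝ × ℝ → M} {p : ℝ × ℝ × ℝ}
    (hc : ContMDiffAt 𝓘(ℝ, ℝ × ℝ × ℝ) (𝓡 3) ∞ c p) (hp : c p ∉ I.Φ.annulus I.ε)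
    (h : I.inner.coord =ᶠ[𝓝 p] fun q => I.outer (c q)) :
    (mfderiv 𝓘(ℝ, ℝ × ℝ × ℝ) (𝓡 3) I.inner.coord p : ℝ × ℝ × ℝ →L[ℝ] E3) =
      mfderiv 𝓘(ℝ, ℝ × ℝ × ℝ) (𝓡 3) c p := by
  have h1 := HasMFDerivAt.comp p
    ((I.contMDiffAt_outer hp).mdifferentiableAt (by simp)).hasMFDerivAt
    (hc.mdifferentiableAt (by simp)).hasMFDerivAt
  have h2 := (h1.congr_of_eventuallyEq h).mfderiv
  have h3 := I.mfderiv_outer hp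
  refine h2.trans ?_
  refine ContinuousLinearMap.ext fun v => ?_
  exact congrArg (fun L : E3 →L[ℝ] E3 => L (mfderiv 𝓘(ℝ, ℝ × ℝ × ℝ) (𝓡 3) c p v)) h3

theorem mfderiv_innerCoord_pos {p : ℝ × ℝ × ℝ} (hp : p ∈ boxSet I.ε₁ I.τ) (h : 0 < p.2.2)
    (v : ℝ × ℝ × ℝ) :
    (mfderiv 𝓘(ℝ, ℝ × ℝ × ℝ) (𝓡 3) I.inner.coord p v : E3) =
      mfderiv 𝓘(ℝ, ℝ × ℝ × ℝ) (𝓡 3) I.Φ.coord (shearMap I.slide p)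
        (v.1 + I.slope p.2.1 * v.2.1, v.2) := by
  have hd : DifferentiableAt ℝ I.slide p.2 := (I.hasFDerivAt_slide p.2).differentiableAt
  have hs : ContMDiffAt 𝓘(ℝ, ℝ × ℝ × ℝ) 𝓘(ℝ, ℝ × ℝ × ℝ) ∞ (shearMap I.slide) p := by
    have : ContDiff ℝ ∞ (shearMap I.slide) :=
      (contDiff_fst.add (I.contDiff_slide.comp contDiff_snd)).prodMk contDiff_snd
    exact this.contMDiff.contMDiffAt
  have h1 := I.mfderiv_outer_comp (c := I.Φ.coord ∘ shearMap I.slide) (p := p)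
    ((I.contMDiffAt_coord (I.shear_mem hp)).comp p hs)
    (I.coord_notMem_annulus (I.shear_mem hp) (Or.inl h.ne')) (by
      filter_upwards [(isOpen_boxSet I.ε₁ I.τ).mem_nhds hp,
        (continuous_snd.comp continuous_snd).continuousAt.eventually_const_lt h] with q hq hq'
      exact I.innerCoord_pos hq hq')
  refine (congrArg (fun L : ℝ × ℝ × ℝ →L[ℝ] E3 => L v) h1).trans ?_
  refine (mfderiv_shearMap ((I.contMDiffAt_coord (I.shear_mem hp)).mdifferentiableAt (by simp))
    hd v).trans ?_
  have h2 : fderiv ℝ I.slide p.2 v.2 = I.slope p.2.1 * v.2.1 := by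
    rw [(I.hasFDerivAt_slide p.2).fderiv]; simp
  rw [h2]

theorem mfderiv_innerCoord_neg {p : ℝ × ℝ × ℝ} (hp : p ∈ boxSet I.ε₁ I.τ)
    (h : p.2.2 ≤ 0 ∨ I.ε < |p.2.1|) :
    (mfderiv 𝓘(ℝ, ℝ × ℝ × ℝ) (𝓡 3) I.inner.coord p : ℝ × ℝ × ℝ →L[ℝ] E3) =
      mfderiv 𝓘(ℝ, ℝ × ℝ × ℝ) (𝓡 3) I.Φ.coord p := by
  by_cases hC : p.2.2 ≠ 0 ∨ I.ε < |p.2.1|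
  · refine I.mfderiv_outer_comp (I.contMDiffAt_coord hp) (I.coord_notMem_annulus hp hC) ?_
    by_cases hw : I.ε < |p.2.1|
    · filter_upwards [(isOpen_boxSet I.ε₁ I.τ).mem_nhds hp,
        (continuous_fst.comp continuous_snd).abs.continuousAt.eventually_const_lt hw] with q hq hq'
      exact I.innerCoord_neg hq (Or.inr (le_of_lt hq'))
    · have ht : p.2.2 < 0 := lt_of_le_of_ne (h.resolve_right hw) (hC.resolve_right hw)
      filter_upwards [(isOpen_boxSet I.ε₁ I.τ).mem_nhds hp,
        (continuous_snd.comp continuous_snd).continuousAt.eventually_lt_const ht] with q hq hq'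
      exact I.innerCoord_neg hq (Or.inl (le_of_lt hq'))
  · push Not at hC
    have hmem : I.Φ.coord p ∈ I.Φ.annulus I.ε := ⟨expCoord p, ⟨hC.2, hC.1⟩, rfl⟩
    have hx : I.Φ.coord p ∈ I.Φ.target := I.coord_mem_target hp
    have h1 := HasMFDerivAt.comp p
      ((I.gluing.contMDiffAt_loc_symm (i := true) hx).mdifferentiableAt (by simp)).hasMFDerivAt
      ((I.contMDiffAt_coord hp).mdifferentiableAt (by simp)).hasMFDerivAt
    have h3 := I.gluing.mfderiv_inc (i := true) hx
      (@decide_eq_true _ (Classical.propDecidable _) (I.twist_mem_annulus.2 hmem))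
    have h2 : (mfderiv 𝓘(ℝ, ℝ × ℝ × ℝ) (𝓡 3) I.inner.coord p : ℝ × ℝ × ℝ →L[ℝ] E3) = _ := h1.mfderiv
    refine h2.trans (ContinuousLinearMap.ext fun v => ?_)
    exact congrArg (fun L : E3 →L[ℝ] E3 => L (mfderiv 𝓘(ℝ, ℝ × ℝ × ℝ) (𝓡 3) I.Φ.coord p v)) h3

/-- The orientation of the surgered manifold. -/
def orient (o : ∀ x : M, Orientation ℝ (TangentSpace (𝓡 3) x) (Fin 3)) (x : I.Surgered) :
    Orientation ℝ (TangentSpace (𝓡 3) x) (Fin 3) := o (x : M)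

/-- The vector field on the surgered manifold. -/
def field (X : ∀ x : M, TangentSpace (𝓡 3) x) (x : I.Surgered) : TangentSpace (𝓡 3) x := X (x : M)

/-- The one-form on the surgered manifold which is given by a form on the complement of the
annulus. -/
def form (α : ∀ x : M, TangentSpace (𝓡 3) x →L[ℝ] ℝ) (x : I.Surgered) :
    TangentSpace (𝓡 3) x →L[ℝ] ℝ := α (x : M)

variable {I} {o : ∀ x : M, Orientation ℝ (TangentSpace (𝓡 3) x) (Fin 3)}
  {X : ∀ x : M, TangentSpace (𝓡 3) x} {α : ∀ x : M, TangentSpace (𝓡 3) x →L[ℝ] ℝ}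

theorem preservesOrientation_outer : PreservesOrientation I.outer o (I.orient o) := by
  intro x hx u v w h
  have h1 := I.mfderiv_outer hx
  have h2 : ∀ u : E3, (mfderiv (𝓡 3) (𝓡 3) I.outer x : E3 →L[ℝ] E3) u = u := fun u =>
    congrArg (fun L : E3 →L[ℝ] E3 => L u) h1
  have h3 : IsPositiveTriple (I.orient o) (I.outer x) (u : E3) (v : E3) (w : E3) := h
  exact h3.congr rfl (h2 u) (h2 v) (h2 w)

theorem isPositiveTriple_orient {x : I.Surgered} {y : M} {u v w u' v' w' : E3}
    (h : IsPositiveTriple o y u' v' w') (hx : (x : M) = y) (hu : u = u') (hv : v = v')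
    (hw : w = w') : IsPositiveTriple (I.orient o) x u v w := by
  subst hx hu hv hw; exact h

theorem inner_positive (h : ∀ p ∈ boxSet I.ε₁ I.τ,
    IsPositiveTriple o (I.Φ.coord p) (I.Φ.vec p vecW) (I.Φ.vec p vecS) (I.Φ.vec p vecT))
    {p : ℝ × ℝ × ℝ} (hp : p ∈ boxSet I.ε₁ I.τ) :
    IsPositiveTriple (I.orient o) (I.inner.coord p) (I.inner.vec p vecW) (I.inner.vec p vecS)
      (I.inner.vec p vecT) := by
  by_cases ht : 0 < p.2.2
  · have h3 := isPositiveTriple_shearMap (o := o)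
      (L := mfderiv 𝓘(ℝ, ℝ × ℝ × ℝ) (𝓡 3) I.Φ.coord (shearMap I.slide p))
      (L' := (mfderiv 𝓘(ℝ, ℝ × ℝ × ℝ) (𝓡 3) I.inner.coord p : ℝ × ℝ × ℝ →L[ℝ] E3))
      (l := fun y => I.slope p.2.1 * y.1) (I.mfderiv_innerCoord_pos hp ht) (by simp)
      (h _ (I.shear_mem hp))
    exact isPositiveTriple_orient h3 (I.innerCoord_pos hp ht) rfl rfl rfl
  · have h1 := I.mfderiv_innerCoord_neg hp (Or.inl (not_lt.1 ht))
    have h2 : ∀ v, (I.inner.vec p v : E3) = I.Φ.vec p v := fun v =>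
      congrArg (fun L : ℝ × ℝ × ℝ →L[ℝ] E3 => L v) h1
    exact isPositiveTriple_orient (h p hp) (I.innerCoord_neg hp (Or.inl (not_lt.1 ht)))
      (h2 _) (h2 _) (h2 _)

theorem inner_flow (h : ∀ p ∈ boxSet I.ε₁ I.τ, I.Φ.vec p vecT = X (I.Φ.coord p))
    {p : ℝ × ℝ × ℝ} (hp : p ∈ boxSet I.ε₁ I.τ) :
    I.inner.vec p vecT = I.field X (I.inner.coord p) := by
  have key : ∀ x y : M, x = y → (X x : E3) = X y := by rintro x y rfl; rfl
  by_cases ht : 0 < p.2.2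
  · refine Eq.trans (b := (X (I.Φ.coord (shearMap I.slide p)) : E3)) ?_
      (key _ _ (I.innerCoord_pos hp ht)).symm
    refine (I.mfderiv_innerCoord_pos hp ht vecT).trans ?_
    have h1 := h _ (I.shear_mem hp)
    have h2 : ((vecT.1 + I.slope p.2.1 * vecT.2.1, vecT.2) : ℝ × ℝ × ℝ) = vecT := by simp
    rw [h2]; exact h1
  · refine Eq.trans (b := (X (I.Φ.coord p) : E3)) ?_
      (key _ _ (I.innerCoord_neg hp (Or.inl (not_lt.1 ht)))).symm
    refine Eq.trans ?_ (h p hp)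
    exact congrArg (fun L : ℝ × ℝ × ℝ →L[ℝ] E3 => L vecT)
      (I.mfderiv_innerCoord_neg hp (Or.inl (not_lt.1 ht)))

theorem outer_field {x : M} (hx : x ∉ I.Φ.annulus I.ε) :
    mfderiv (𝓡 3) (𝓡 3) I.outer x (X x) = I.field X (I.outer x) :=
  congrArg (fun L : E3 →L[ℝ] E3 => L (X x)) (I.mfderiv_outer hx)

theorem exists_inner_coord {x : I.Surgered} (hx : (x : M) ∈ I.Φ.target) :
    ∃ p ∈ boxSet I.ε₁ I.τ, I.inner.coord p = x := by
  have hx' : x ∈ I.inner.target := by rw [I.inner_target]; exact hx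
  obtain ⟨z, hz, rfl⟩ := I.inner.exists_eq hx'
  rw [I.inner_source] at hz
  exact ⟨(Complex.arg z.1, z.2), I.box.mem_source.1 hz, by
    rw [AnnulusBox.coord, Circle.exp_arg]⟩

theorem isSmoothVectorField_field (hX : IsSmoothVectorField X)
    (h : ∀ p ∈ boxSet I.ε₁ I.τ, I.Φ.vec p vecT = X (I.Φ.coord p)) :
    IsSmoothVectorField (I.field X) := by
  intro x
  by_cases hx : (x : M) ∈ I.Φ.target
  · obtain ⟨p, hp, rfl⟩ := exists_inner_coord hx
    obtain ⟨D, hD, hDp, h1, -⟩ := I.inner.exists_coord_inverse (I.expCoord_mem' hp)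
    have h2 := ContMDiffAt.mfderiv_vector (J := 𝓡 3) (c := I.inner.coord) (b := D)
      (v := fun _ => vecT) (n₀ := I.inner.coord p)
      (by rw [hDp]; exact I.contMDiffAt_innerCoord hp) hD contMDiffAt_const
    refine h2.congr_of_eventuallyEq ?_
    have h3 : ∀ᶠ y in 𝓝 (I.inner.coord p), D y ∈ boxSet I.ε₁ I.τ :=
      hD.continuousAt.preimage_mem_nhds
        ((isOpen_boxSet I.ε₁ I.τ).mem_nhds (by rw [hDp]; exact hp))
    filter_upwards [h1, h3] with y hy hy'
    have h4 := inner_flow h hy'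
    have h5 : ∀ x y : I.Surgered, x = y →
      (⟨x, I.field X x⟩ : TangentBundle (𝓡 3) I.Surgered) = ⟨y, I.field X y⟩ := by
      rintro x y rfl; rfl
    rw [h5 _ _ hy.symm, ← h4]; rfl
  · have hxC : (x : M) ∉ I.Φ.annulus I.ε := fun h => hx (I.annulus_subset h)
    have hb : ContMDiffAt (𝓡 3) (𝓡 3) ∞ (I.gluing.loc false) x := I.gluing.contMDiffAt_loc hxC
    have h1 : ContMDiffAt (𝓡 3) (𝓡 3).tangent ∞
        (fun y : I.Surgered => (⟨I.gluing.loc false y, X (I.gluing.loc false y)⟩ :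
          TangentBundle (𝓡 3) M)) x :=
      ContMDiffAt.comp x (hX (I.gluing.loc false x)) hb
    have h2 := h1.mfderiv_along (h := I.outer) (I.contMDiffAt_outer hxC)
    refine h2.congr_of_eventuallyEq ?_
    have h3 : ∀ᶠ y : I.Surgered in 𝓝 x, (y : M) ∉ I.Φ.annulus I.ε :=
      (I.gluing.isOpen_loc_source false).mem_nhds hxC
    filter_upwards [h3] with y hy
    have h4 := outer_field (X := X) hy
    have h5 : ∀ (u v : TangentSpace (𝓡 3) y), u = v →
      (⟨y, u⟩ : TangentBundle (𝓡 3) I.Surgered) = ⟨y, v⟩ := by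
      rintro u v rfl; rfl
    exact h5 _ _ h4.symm

end SurgeryInput

end SurgeryTangent

/-! ### One-forms given in a box -/

section ModifiedForm

variable {M : Type u} [TopologicalSpace M] [ChartedSpace E3 M] [IsManifold (𝓡 3) ∞ M]
  {Φ : AnnulusBox M} {ε₁ τ : ℝ}

theorem IsProductBox.expCoord_mem (h : IsProductBox Φ ε₁ τ) {p : ℝ × ℝ × ℝ}
    (hp : p ∈ boxSet ε₁ τ) : expCoord p ∈ Φ.source := h.mem_source.2 hp

theorem IsProductBox.exists_coord (h : IsProductBox Φ ε₁ τ) {x : M} (hx : x ∈ Φ.target) :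
    ∃ p ∈ boxSet ε₁ τ, Φ.coord p = x := by
  obtain ⟨z, hz, rfl⟩ := Φ.exists_eq hx
  exact ⟨(Complex.arg z.1, z.2), h.mem_source.1 hz, by rw [AnnulusBox.coord, Circle.exp_arg]⟩

theorem IsProductBox.coord_mem (h : IsProductBox Φ ε₁ τ) {p : ℝ × ℝ × ℝ}
    (hp : p ∈ boxSet ε₁ τ) : Φ.coord p ∈ Φ.target := Φ.mem_target (h.expCoord_mem hp)

theorem AnnulusBox.coord_add_int (Φ : AnnulusBox M) (k : ℤ) (p : ℝ × ℝ × ℝ) :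
    Φ.coord (p + (k * (2 * Real.pi), 0, 0)) = Φ.coord p := by
  have := expCoord_add_int p.1 p.2.1 p.2.2 k
  refine congrArg Φ (Eq.trans ?_ this)
  simp [expCoord]

theorem IsProductBox.eq_add_int (h : IsProductBox Φ ε₁ τ) {p p' : ℝ × ℝ × ℝ}
    (hp : p ∈ boxSet ε₁ τ) (hp' : p' ∈ boxSet ε₁ τ) (he : Φ.coord p = Φ.coord p') :
    ∃ k : ℤ, p = p' + (k * (2 * Real.pi), 0, 0) := by
  have h1 : expCoord p = expCoord p' := Φ.injOn (h.expCoord_mem hp) (h.expCoord_mem hp') he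
  obtain ⟨k, hk⟩ := Circle.exp_eq_exp.1 (congrArg Prod.fst h1)
  have h2 : p.2 = p'.2 := congrArg (fun z : Circle × ℝ × ℝ => z.2) h1
  refine ⟨k, Prod.ext hk ?_⟩
  simp [h2]

/-- A one-form can be changed inside a box, by prescribing it in the coordinates of the box. -/
theorem exists_modified_form [T2Space M] (h : IsProductBox Φ ε₁ τ) {ε₂ τ₂ : ℝ} (hε : ε₂ < ε₁)
    (hτ : τ₂ < τ) {α₀ : ∀ x : M, TangentSpace (𝓡 3) x →L[ℝ] ℝ}
    (hα₀ : ∀ x ∉ Φ.target, IsSmoothOneFormAt α₀ x) {L : ℝ × ℝ × ℝ → ℝ × ℝ × ℝ →L[ℝ] ℝ}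
    (hL : ∀ p ∈ boxSet ε₁ τ, ContDiffAt ℝ ∞ L p)
    (hLper : ∀ (p : ℝ × ℝ × ℝ) (k : ℤ), L (p + (k * (2 * Real.pi), 0, 0)) = L p)
    (hLα : ∀ p ∈ boxSet ε₁ τ, (ε₂ < |p.2.1| ∨ τ₂ < |p.2.2|) → L p = pullbackForm α₀ Φ.coord p) :
    ∃ α : ∀ x : M, TangentSpace (𝓡 3) x →L[ℝ] ℝ, IsSmoothOneForm α ∧
      (∀ p ∈ boxSet ε₁ τ, pullbackForm α Φ.coord p = L p) ∧
      ∀ x ∉ Φ.target, ∀ᶠ y in 𝓝 x, α y = α₀ y := by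
  have hc : ∀ p ∈ boxSet ε₁ τ, ContMDiffAt 𝓘(ℝ, ℝ × ℝ × ℝ) (𝓡 3) ∞ Φ.coord p := fun p hp =>
    Φ.contMDiffAt_coord (h.expCoord_mem hp)
  have hex : ∀ p ∈ boxSet ε₁ τ, ∃ a : E3 →L[ℝ] ℝ,
      ∀ v, a (mfderiv 𝓘(ℝ, ℝ × ℝ × ℝ) (𝓡 3) Φ.coord p v) = L p v := by
    intro p hp
    obtain ⟨D, hD, -, -, h2⟩ := Φ.exists_coord_inverse (h.expCoord_mem hp)
    have h3 := mfderiv_injective_of_leftInverse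
      ((hc p hp).mdifferentiableAt (by simp)) (hD.mdifferentiableAt (by simp)) h2
    exact ⟨(L p).comp (mfderiv (𝓡 3) 𝓘(ℝ, ℝ × ℝ × ℝ) D (Φ.coord p) : E3 →L[ℝ] ℝ × ℝ × ℝ),
      fun v => congrArg (L p) (h3 v)⟩
  have hex' : ∀ x : M, ∃ a : E3 →L[ℝ] ℝ, (x ∉ Φ.target → a = α₀ x) ∧ ∀ p ∈ boxSet ε₁ τ,
      Φ.coord p = x → ∀ v, a (mfderiv 𝓘(ℝ, ℝ × ℝ × ℝ) (𝓡 3) Φ.coord p v) = L p v := by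
    intro x
    by_cases hx : x ∈ Φ.target
    · obtain ⟨p, hp, rfl⟩ := h.exists_coord hx
      obtain ⟨a, ha⟩ := hex p hp
      refine ⟨a, fun h => absurd hx h, fun p' hp' he v => ?_⟩
      obtain ⟨k, rfl⟩ := h.eq_add_int hp hp' he.symm
      rw [← hLper p' k]
      refine Eq.trans ?_ (ha v)
      refine congrArg a ?_
      exact congrArg (fun L : ℝ × ℝ × ℝ →L[ℝ] E3 => L v) (mfderiv_periodic (Φ.coord_add_int k) p'
        ((hc _ hp).mdifferentiableAt (by simp)))
    · refine ⟨α₀ x, fun _ => rfl, fun p hp he => absurd (h.coord_mem hp) ?_⟩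
      rwa [he]
  choose α hα1 hα2 using hex'
  have hαL : ∀ p ∈ boxSet ε₁ τ, pullbackForm α Φ.coord p = L p := fun p hp =>
    ContinuousLinearMap.ext fun v => hα2 _ p hp rfl v
  have hev : ∀ x ∉ Φ.target, ∀ᶠ y in 𝓝 x, (α y : E3 →L[ℝ] ℝ) = α₀ y := by
    intro x hx
    let S : Set (Circle × ℝ × ℝ) := Set.univ ×ˢ Set.Icc (-ε₂) ε₂ ×ˢ Set.Icc (-τ₂) τ₂
    have hS : S ⊆ Φ.source := by
      rintro p ⟨-, hp1, hp2⟩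
      exact h.mem_source.2 ⟨(abs_le.2 hp1).trans_lt hε, (abs_le.2 hp2).trans_lt hτ⟩
    have hK : IsCompact (Φ '' S) := (isCompact_univ.prod (isCompact_Icc.prod isCompact_Icc)).image_of_continuousOn
      (Φ.contMDiffOn_toFun.continuousOn.mono hS)
    have hxK : x ∉ Φ '' S := by
      rintro ⟨p, hp, rfl⟩
      exact hx (Φ.mem_target (hS hp))
    filter_upwards [hK.isClosed.isOpen_compl.mem_nhds hxK] with y hy
    by_cases hyt : y ∈ Φ.target
    · obtain ⟨p, hp, rfl⟩ := h.exists_coord hyt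
      have hp2 : ε₂ < |p.2.1| ∨ τ₂ < |p.2.2| := by
        by_contra! hcon
        exact hy ⟨expCoord p, ⟨trivial, abs_le.1 hcon.1, abs_le.1 hcon.2⟩, rfl⟩
      have h1 := (hαL p hp).trans (hLα p hp hp2)
      obtain ⟨D, hD, hDp, h2, -⟩ := Φ.exists_coord_inverse (h.expCoord_mem hp)
      have h3 : ∀ v : E3, (mfderiv 𝓘(ℝ, ℝ × ℝ × ℝ) (𝓡 3) Φ.coord p
          (mfderiv (𝓡 3) 𝓘(ℝ, ℝ × ℝ × ℝ) D (Φ.coord p) v) : E3) = v := by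
        have hcd : MDifferentiableAt 𝓘(ℝ, ℝ × ℝ × ℝ) (𝓡 3) Φ.coord (D (Φ.coord p)) := by
          rw [hDp]; exact (hc p hp).mdifferentiableAt (by simp)
        have h4 := HasMFDerivAt.comp (Φ.coord p) hcd.hasMFDerivAt
          (hD.mdifferentiableAt (by simp)).hasMFDerivAt
        have h5 := hasMFDerivAt_unique h4 ((hasMFDerivAt_id (Φ.coord p)).congr_of_eventuallyEq h2)
        intro v
        have h6 := congrArg (fun L : E3 →L[ℝ] E3 => L v) h5
        refine Eq.trans ?_ h6
        exact congrArg (fun q => (mfderiv 𝓘(ℝ, ℝ × ℝ × ℝ) (𝓡 3) Φ.coord q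
          (mfderiv (𝓡 3) 𝓘(ℝ, ℝ × ℝ × ℝ) D (Φ.coord p) v) : E3)) hDp.symm
      refine ContinuousLinearMap.ext fun v => ?_
      have h4 := congrArg (fun L : ℝ × ℝ × ℝ →L[ℝ] ℝ =>
        L (mfderiv (𝓡 3) 𝓘(ℝ, ℝ × ℝ × ℝ) D (Φ.coord p) v)) h1
      have h5 := h3 v
      refine (congrArg (α (Φ.coord p)) h5).symm.trans (Eq.trans h4 ?_)
      exact congrArg (α₀ (Φ.coord p) : E3 →L[ℝ] ℝ) h5
    · exact hα1 y hyt
  refine ⟨α, isSmoothOneForm_iff.2 fun x => ?_, hαL, hev⟩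
  by_cases hx : x ∈ Φ.target
  · obtain ⟨p, hp, rfl⟩ := h.exists_coord hx
    obtain ⟨D, hD, hDp, h2, -⟩ := Φ.exists_coord_inverse (h.expCoord_mem hp)
    refine isSmoothOneFormAt_of_pullback (hc p hp) hD hDp h2 (hL p hp) ?_
    filter_upwards [(isOpen_boxSet ε₁ τ).mem_nhds hp] with q hq v
    exact hα2 _ q hq rfl v
  · refine (hα₀ x hx).congr_of_eventuallyEq ?_
    filter_upwards [hev x hx] with y hy
    have h5 : ∀ (f g : TangentSpace (𝓡 3) y →L[ℝ] Bundle.Trivial M ℝ y), f = g →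
      Bundle.TotalSpace.mk' (E3 →L[ℝ] ℝ)
        (E := fun x : M => TangentSpace (𝓡 3) x →L[ℝ] Bundle.Trivial M ℝ x) y f =
      Bundle.TotalSpace.mk' (E3 →L[ℝ] ℝ) y g := by rintro f g rfl; rfl
    exact h5 _ _ hy

theorem contactVolume_eq_of_pullback {M' : Type u} [TopologicalSpace M'] [ChartedSpace E3 M']
    [IsManifold (𝓡 3) ∞ M'] {E₀ : Type*} [NormedAddCommGroup E₀] [NormedSpace ℝ E₀]
    [FiniteDimensional ℝ E₀] {α : ∀ x : M, TangentSpace (𝓡 3) x →L[ℝ] ℝ}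
    {α' : ∀ x : M', TangentSpace (𝓡 3) x →L[ℝ] ℝ} {c : E₀ → M} {c' : E₀ → M'} {p : E₀}
    (hα : IsSmoothOneFormAt α (c p)) (hα' : IsSmoothOneFormAt α' (c' p))
    (hc : ContMDiffAt 𝓘(ℝ, E₀) (𝓡 3) ∞ c p) (hc' : ContMDiffAt 𝓘(ℝ, E₀) (𝓡 3) ∞ c' p)
    (h : pullbackForm α' c' =ᶠ[𝓝 p] pullbackForm α c) (u v w : E₀) :
    contactVolume α' (c' p) (mfderiv 𝓘(ℝ, E₀) (𝓡 3) c' p u) (mfderiv 𝓘(ℝ, E₀) (𝓡 3) c' p v)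
      (mfderiv 𝓘(ℝ, E₀) (𝓡 3) c' p w) =
    contactVolume α (c p) (mfderiv 𝓘(ℝ, E₀) (𝓡 3) c p u) (mfderiv 𝓘(ℝ, E₀) (𝓡 3) c p v)
      (mfderiv 𝓘(ℝ, E₀) (𝓡 3) c p w) := by
  have h1 : ∀ v, α' (c' p) (mfderiv 𝓘(ℝ, E₀) (𝓡 3) c' p v) =
      α (c p) (mfderiv 𝓘(ℝ, E₀) (𝓡 3) c p v) := fun v =>
    congrArg (fun L : E₀ →L[ℝ] ℝ => L v) h.self_of_nhds
  have h2 : ∀ u v, extD (pullbackForm α' c') p u v = extD (pullbackForm α c) p u v := by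
    intro u v
    simp only [extD, h.fderiv_eq]
  simp only [contactVolume, ← extD_pullbackForm hα hc, ← extD_pullbackForm hα' hc', h2]
  exact congrArg₂ (· + ·) (congrArg₂ (· + ·) (congrArg (· * _) (h1 u)) (congrArg (· * _) (h1 v)))
    (congrArg (· * _) (h1 w))

end ModifiedForm

section SurgeryForm

variable {M : Type u} [TopologicalSpace M] [ChartedSpace E3 M] [IsManifold (𝓡 3) ∞ M]

namespace SurgeryInput

variable {I : SurgeryInput M} [T2Space M] {α : ∀ x : M, TangentSpace (𝓡 3) x →L[ℝ] ℝ}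
  {o : ∀ x : M, Orientation ℝ (TangentSpace (𝓡 3) x) (Fin 3)}

theorem inner_box : IsProductBox I.inner I.ε₁ I.τ := I.inner_source.trans I.box

theorem pullbackForm_form_neg {p : ℝ × ℝ × ℝ} (hp : p ∈ boxSet I.ε₁ I.τ)
    (h : p.2.2 ≤ 0 ∨ I.ε < |p.2.1|) :
    pullbackForm (I.form α) I.inner.coord p = pullbackForm α I.Φ.coord p := by
  refine ContinuousLinearMap.ext fun v => ?_
  have h1 := congrArg (fun L : ℝ × ℝ × ℝ →L[ℝ] E3 => L v) (I.mfderiv_innerCoord_neg hp h)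
  have h2 : ∀ (x y : M) (u v : E3), x = y → u = v → (α x : E3 →L[ℝ] ℝ) u = (α y : E3 →L[ℝ] ℝ) v := by
    rintro x y u v rfl rfl; rfl
  exact h2 _ _ _ _ (I.innerCoord_neg hp (h.imp id le_of_lt)) h1

theorem pullbackForm_form_pos {p : ℝ × ℝ × ℝ} (hp : p ∈ boxSet I.ε₁ I.τ) (h : 0 < p.2.2)
    (v : ℝ × ℝ × ℝ) :
    pullbackForm (I.form α) I.inner.coord p v =
      pullbackForm α I.Φ.coord (shearMap I.slide p) (v.1 + I.slope p.2.1 * v.2.1, v.2) := by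
  have h2 : ∀ (x y : M) (u v : E3), x = y → u = v → (α x : E3 →L[ℝ] ℝ) u = (α y : E3 →L[ℝ] ℝ) v := by
    rintro x y u v rfl rfl; rfl
  exact h2 _ _ _ _ (I.innerCoord_pos hp h) (I.mfderiv_innerCoord_pos hp h v)

/-- Near a point outside of the annulus, the surgered manifold is a copy of the old one. -/
theorem exists_outer_coord {x : I.Surgered} (hx : (x : M) ∉ I.Φ.annulus I.ε) :
    ∃ (c : E3 → M) (c' : E3 → I.Surgered) (d : I.Surgered → E3) (p : E3), c p = (x : M) ∧
      c' p = x ∧ ContMDiffAt 𝓘(ℝ, E3) (𝓡 3) ∞ c p ∧ ContMDiffAt 𝓘(ℝ, E3) (𝓡 3) ∞ c' p ∧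
      ContMDiffAt (𝓡 3) 𝓘(ℝ, E3) ∞ d x ∧ d x = p ∧ (∀ᶠ y in 𝓝 x, c' (d y) = y) ∧
      (∀ α : ∀ x : M, TangentSpace (𝓡 3) x →L[ℝ] ℝ,
        pullbackForm (I.form α) c' =ᶠ[𝓝 p] pullbackForm α c) ∧
      (∀ v : E3, (mfderiv 𝓘(ℝ, E3) (𝓡 3) c p v : E3) = v) ∧
      ∀ v : E3, (mfderiv 𝓘(ℝ, E3) (𝓡 3) c' p v : E3) = v := by
  set y : M := I.gluing.loc false x with hy
  set e := extChartAt (𝓡 3) y with he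
  have hcp : e.symm (e y) = y := extChartAt_to_inv y
  have hc : ContMDiffAt 𝓘(ℝ, E3) (𝓡 3) ∞ e.symm (e y) :=
    extChartAt_symm_contMDiffAt (mem_extChartAt_target y)
  have hout : ContMDiffAt (𝓡 3) (𝓡 3) ∞ I.outer (e.symm (e y)) := by
    rw [hcp]; exact I.contMDiffAt_outer hx
  have hc1 : ∀ v : E3, (mfderiv 𝓘(ℝ, E3) (𝓡 3) e.symm (e y) v : E3) = v := by
    have h4 := mfderivWithin_range_extChartAt_symm (I := 𝓡 3) (x := y)
    rw [ModelWithCorners.range_eq_univ, mfderivWithin_univ] at h4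
    exact fun v => congrArg (fun L : E3 →L[ℝ] E3 => L v) h4
  have hev : ∀ᶠ q in 𝓝 (e y), ∀ v : E3,
      (mfderiv 𝓘(ℝ, E3) (𝓡 3) (fun q => I.outer (e.symm q)) q v : E3) =
        mfderiv 𝓘(ℝ, E3) (𝓡 3) e.symm q v := by
    have h1 : ∀ᶠ q in 𝓝 (e y), e.symm q ∉ I.Φ.annulus I.ε :=
      hc.continuousAt.preimage_mem_nhds
        (I.isCompact_annulus.isClosed.isOpen_compl.mem_nhds (by rw [hcp]; exact hx))
    filter_upwards [h1, contMDiffAt_nhds_one hc] with q hq hq' v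
    have h2 := HasMFDerivAt.comp q
      ((I.contMDiffAt_outer hq).mdifferentiableAt (by simp)).hasMFDerivAt hq'.hasMFDerivAt
    have h3 := I.mfderiv_outer hq
    refine (congrArg (fun L : E3 →L[ℝ] E3 => L v) h2.mfderiv).trans ?_
    exact congrArg (fun L : E3 →L[ℝ] E3 => L (mfderiv 𝓘(ℝ, E3) (𝓡 3) e.symm q v)) h3
  refine ⟨e.symm, fun q => I.outer (e.symm q), fun z => e (I.gluing.loc false z), e y, hcp, hcp,
    hc, hout.comp _ hc, ?_, rfl, ?_, fun α => ?_, hc1, fun v => (hev.self_of_nhds v).trans (hc1 v)⟩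
  · exact (extChartAt_contMDiffAt (mem_extChartAt_source y)).comp x (I.gluing.contMDiffAt_loc hx)
  · have h1 : ∀ᶠ z in 𝓝 x, I.gluing.loc false z ∈ e.source :=
      (I.gluing.contMDiffAt_loc (i := false) hx).continuousAt.preimage_mem_nhds
        (extChartAt_source_mem_nhds (I := 𝓡 3) y)
    filter_upwards [h1] with z hz
    exact e.left_inv hz
  · filter_upwards [hev] with q hq
    refine ContinuousLinearMap.ext fun v => ?_
    exact congrArg (α (e.symm q) : E3 →L[ℝ] ℝ) (hq v)

theorem isSmoothOneFormAt_form (hα : IsSmoothOneForm α) {x : I.Surgered}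
    (hx : (x : M) ∉ I.Φ.annulus I.ε) : IsSmoothOneFormAt (I.form α) x := by
  obtain ⟨c, c', d, p, hcp, rfl, hc, hc', hd, hdp, hcd, h, -⟩ := exists_outer_coord hx
  refine isSmoothOneFormAt_of_pullback hc' hd hdp hcd
    (contDiffAt_pullbackForm (isSmoothOneForm_iff.1 hα _) hc) ?_
  filter_upwards [h α] with q hq v
  exact congrArg (fun L : E3 →L[ℝ] ℝ => L v) hq

theorem isContactAt_of_eventuallyEq {s : ℝ} (hα : IsSmoothOneForm α)
    {α' : ∀ x : I.Surgered, TangentSpace (𝓡 3) x →L[ℝ] ℝ} {x : I.Surgered}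
    (hx : (x : M) ∉ I.Φ.annulus I.ε) (h : ∀ᶠ y in 𝓝 x, α' y = I.form α y)
    (hα' : IsSmoothOneForm α') (hs : IsContactAt o s α (x : M)) :
    IsContactAt (I.orient o) s α' x := by
  obtain ⟨c, c', d, p, hcp, rfl, hc, hc', -, -, -, hf, hD, hD'⟩ := exists_outer_coord hx
  intro u v w huvw
  have h1 : pullbackForm α' c' =ᶠ[𝓝 p] pullbackForm α c := by
    refine Filter.EventuallyEq.trans ?_ (hf α)
    filter_upwards [hc'.continuousAt.eventually h] with q hq
    exact ContinuousLinearMap.ext fun v =>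
      congrArg (fun L : E3 →L[ℝ] ℝ => L (mfderiv 𝓘(ℝ, E3) (𝓡 3) c' q v)) hq
  have h2 := contactVolume_eq_of_pullback (isSmoothOneForm_iff.1 hα (c p))
    (isSmoothOneForm_iff.1 hα' (c' p)) hc hc' h1 u v w
  have h3 : ∀ u' v' w' : E3, u' = u → v' = v → w' = w →
      contactVolume α' (c' p) u' v' w' = contactVolume α' (c' p) u v w := by
    rintro _ _ _ rfl rfl rfl; rfl
  have h4 : ∀ (y : M) (u' v' w' : E3), c p = y → u' = u → v' = v → w' = w →
      contactVolume α (c p) u' v' w' = contactVolume α y u v w := by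
    rintro _ _ _ _ rfl rfl rfl rfl; rfl
  rw [← h3 _ _ _ (hD' u) (hD' v) (hD' w)]
  refine lt_of_lt_of_eq (hs u v w huvw) (congrArg (fun r => s * r) ?_)
  exact ((h4 _ _ _ _ hcp (hD u) (hD v) (hD w)).symm).trans h2.symm

end SurgeryInput

end SurgeryForm

/-! ### Interpolation between functions which increase through zero -/

section Interpolation

theorem deriv_smoothTransition_pos {x : ℝ} (h0 : 0 < x) (h1 : x < 1) :
    0 < deriv Real.smoothTransition x := by
  have he : ∀ y : ℝ, 0 < y → HasDerivAt expNegInvGlue (Real.exp (-y⁻¹) * (y ^ 2)⁻¹) y := by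
    intro y hy
    have h2 : HasDerivAt (fun y : ℝ => Real.exp (-y⁻¹)) (Real.exp (-y⁻¹) * -(-(y ^ 2)⁻¹)) y :=
      ((hasDerivAt_inv hy.ne').neg).exp
    rw [neg_neg] at h2
    refine h2.congr_of_eventuallyEq ?_
    filter_upwards [eventually_gt_nhds hy] with z hz
    simp [expNegInvGlue, hz.not_ge]
  have hx1 : 0 < 1 - x := by linarith
  have h3 : HasDerivAt (fun y => expNegInvGlue (1 - y)) (-(Real.exp (-(1 - x)⁻¹) * ((1 - x) ^ 2)⁻¹)) x := by
    have := HasDerivAt.comp x (he (1 - x) hx1) ((hasDerivAt_id x).const_sub 1)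
    exact this.congr_deriv (by simp)
  have hpos := Real.smoothTransition.pos_denom x
  have h4 := (he x h0).div ((he x h0).add h3) hpos.ne'
  have h5 : HasDerivAt Real.smoothTransition _ x := h4
  rw [h5.deriv]
  have e1 := expNegInvGlue.pos_of_pos h0
  have e2 := expNegInvGlue.pos_of_pos hx1
  refine div_pos ?_ (by positivity)
  simp only [Pi.add_apply]
  have e3 : 0 < Real.exp (-x⁻¹) * (x ^ 2)⁻¹ := by positivity
  have e4 : 0 < Real.exp (-(1 - x)⁻¹) * ((1 - x) ^ 2)⁻¹ := by positivity
  nlinarith [mul_pos e3 e2, mul_pos e1 e4]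

theorem differentiable_smoothTransition : Differentiable ℝ Real.smoothTransition :=
  (Real.smoothTransition.contDiff (n := 1)).differentiable (by simp)

theorem monotone_smoothTransition : Monotone Real.smoothTransition := Real.smoothTransition.monotone

/-- A transition function from `0` to `1` on `[-2T, 2T]`. -/
def timeCut (T t : ℝ) : ℝ := Real.smoothTransition ((t + 2 * T) / (4 * T))

/-- A time change which is the identity before `-2T`, and is constant after `-T`. -/
def timeBefore (T t : ℝ) : ℝ := -T + (1 - Real.smoothTransition ((t + 2 * T) / T)) * (t + T)

/-- A time change which is constant before `T`, and the identity after `2T`. -/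
def timeAfter (T t : ℝ) : ℝ := -timeBefore T (-t)

variable {T : ℝ}

theorem contDiff_timeCut : ContDiff ℝ ∞ (timeCut T) :=
  Real.smoothTransition.contDiff.comp ((contDiff_id.add contDiff_const).div_const _)

theorem contDiff_timeBefore : ContDiff ℝ ∞ (timeBefore T) :=
  contDiff_const.add ((contDiff_const.sub
    (Real.smoothTransition.contDiff.comp ((contDiff_id.add contDiff_const).div_const _))).mul
      (contDiff_id.add contDiff_const))

theorem contDiff_timeAfter : ContDiff ℝ ∞ (timeAfter T) :=
  (contDiff_timeBefore.comp contDiff_neg).neg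

theorem timeCut_nonneg (t : ℝ) : 0 ≤ timeCut T t := Real.smoothTransition.nonneg _

theorem timeCut_le_one (t : ℝ) : timeCut T t ≤ 1 := Real.smoothTransition.le_one _

theorem timeCut_of_le (hT : 0 < T) {t : ℝ} (h : t ≤ -(2 * T)) : timeCut T t = 0 :=
  Real.smoothTransition.zero_of_nonpos (div_nonpos_of_nonpos_of_nonneg (by linarith) (by linarith))

theorem timeCut_of_ge (hT : 0 < T) {t : ℝ} (h : 2 * T ≤ t) : timeCut T t = 1 :=
  Real.smoothTransition.one_of_one_le (by rw [le_div_iff₀ (by linarith)]; linarith)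

theorem hasDerivAt_timeCut (t : ℝ) : HasDerivAt (timeCut T)
    (deriv Real.smoothTransition ((t + 2 * T) / (4 * T)) * (1 / (4 * T))) t :=
  HasDerivAt.comp t (differentiable_smoothTransition _).hasDerivAt
    (((hasDerivAt_id t).add_const _).div_const _)

theorem exists_hasDerivAt_timeCut (hT : 0 < T) (t : ℝ) : ∃ d, HasDerivAt (timeCut T) d t ∧ 0 ≤ d ∧
    (|t| < 2 * T → 0 < d) := by
  refine ⟨_, hasDerivAt_timeCut t, mul_nonneg monotone_smoothTransition.deriv_nonneg (by positivity),
    fun h => ?_⟩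
  rw [abs_lt] at h
  refine mul_pos (deriv_smoothTransition_pos (div_pos (by linarith) (by linarith)) ?_) (by positivity)
  rw [div_lt_one (by linarith)]; linarith

theorem timeBefore_le (hT : 0 < T) (t : ℝ) : timeBefore T t ≤ -T := by
  rcases le_total t (-T) with h | h
  · have := Real.smoothTransition.le_one ((t + 2 * T) / T)
    rw [timeBefore]; nlinarith
  · rw [timeBefore, Real.smoothTransition.one_of_one_le (by rw [le_div_iff₀ hT]; linarith)]
    simp

theorem timeBefore_of_le (hT : 0 < T) {t : ℝ} (h : t ≤ -(2 * T)) : timeBefore T t = t := by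
  rw [timeBefore, Real.smoothTransition.zero_of_nonpos
    (div_nonpos_of_nonpos_of_nonneg (by linarith) hT.le)]
  ring

theorem abs_timeBefore_lt (hT : 0 < T) {t τ : ℝ} (hτ : T < τ) (h : |t| < τ) :
    |timeBefore T t| < τ := by
  have h1 := timeBefore_le hT t
  rw [abs_of_neg (by linarith)]
  rw [abs_lt] at h
  rcases le_total t (-T) with h' | h'
  · have := Real.smoothTransition.le_one ((t + 2 * T) / T)
    have := Real.smoothTransition.nonneg ((t + 2 * T) / T)
    rw [timeBefore]; nlinarith
  · rw [timeBefore, Real.smoothTransition.one_of_one_le (by rw [le_div_iff₀ hT]; linarith)]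
    simpa using hτ

theorem exists_hasDerivAt_timeBefore (hT : 0 < T) (t : ℝ) : ∃ d, HasDerivAt (timeBefore T) d t ∧
    0 ≤ d ∧ (t ≤ -(2 * T) → 0 < d) := by
  set a := deriv Real.smoothTransition ((t + 2 * T) / T) * (1 / T) with ha
  have h1 : HasDerivAt (fun t => Real.smoothTransition ((t + 2 * T) / T)) a t :=
    HasDerivAt.comp t (differentiable_smoothTransition _).hasDerivAt
      (((hasDerivAt_id t).add_const _).div_const _)
  have ha0 : 0 ≤ a := mul_nonneg monotone_smoothTransition.deriv_nonneg (by positivity)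
  have h2 := ((h1.const_sub 1).mul ((hasDerivAt_id t).add_const T)).const_add (-T)
  have h3 := Real.smoothTransition.le_one ((t + 2 * T) / T)
  have hneg : t ≤ -T → 0 ≤ -a * (t + T) := fun h => by nlinarith
  refine ⟨_, h2, ?_, fun h => ?_⟩
  · rcases le_or_gt t (-T) with h | h
    · have := hneg h
      simp only [id_eq, mul_one]; linarith
    · have h4 : a = 0 := by
        have h5 : (fun t => Real.smoothTransition ((t + 2 * T) / T)) =ᶠ[𝓝 t] fun _ => (1 : ℝ) := by
          filter_upwards [eventually_gt_nhds h] with y hy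
          exact Real.smoothTransition.one_of_one_le (by rw [le_div_iff₀ hT]; linarith)
        exact h1.unique ((hasDerivAt_const t (1 : ℝ)).congr_of_eventuallyEq h5)
      rw [h4]; simp [h3]
  · have := hneg (by linarith)
    rw [Real.smoothTransition.zero_of_nonpos (div_nonpos_of_nonpos_of_nonneg (by linarith) hT.le)]
    simp only [id_eq, mul_one]; linarith

theorem le_timeAfter (hT : 0 < T) (t : ℝ) : T ≤ timeAfter T t := by
  have := timeBefore_le hT (-t)
  rw [timeAfter]; linarith

theorem timeAfter_of_ge (hT : 0 < T) {t : ℝ} (h : 2 * T ≤ t) : timeAfter T t = t := by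
  rw [timeAfter, timeBefore_of_le hT (by linarith), neg_neg]

theorem abs_timeAfter_lt (hT : 0 < T) {t τ : ℝ} (hτ : T < τ) (h : |t| < τ) :
    |timeAfter T t| < τ := by
  rw [timeAfter, abs_neg]; exact abs_timeBefore_lt hT hτ (by rwa [abs_neg])

theorem exists_hasDerivAt_timeAfter (hT : 0 < T) (t : ℝ) : ∃ d, HasDerivAt (timeAfter T) d t ∧
    0 ≤ d ∧ (2 * T ≤ t → 0 < d) := by
  obtain ⟨d, hd, h0, h1⟩ := exists_hasDerivAt_timeBefore hT (-t)
  refine ⟨d, ?_, h0, fun h => h1 (by linarith)⟩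
  have := (HasDerivAt.comp t hd (hasDerivAt_neg t)).neg
  exact this.congr_deriv (by ring)

/-- Interpolation, near the annulus, between the function `f` on the negative side and the
function `f'` on the positive side. -/
def interp (T : ℝ) (ϖ : ℝ → ℝ) (f f' : ℝ × ℝ × ℝ → ℝ) (p : ℝ × ℝ × ℝ) : ℝ :=
  (1 - ϖ p.2.1) * f p + ϖ p.2.1 * ((1 - timeCut T p.2.2) * f (p.1, p.2.1, timeBefore T p.2.2) +
    timeCut T p.2.2 * f' (p.1, p.2.1, timeAfter T p.2.2))

theorem hasDerivAt_slice {f : ℝ × ℝ × ℝ → ℝ} {s w t : ℝ} (hf : DifferentiableAt ℝ f (s, w, t)) :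
    HasDerivAt (fun t => f (s, w, t)) (fderiv ℝ f (s, w, t) vecT) t := by
  have h1 : HasDerivAt (fun t : ℝ => (s, w, t)) vecT t :=
    (hasDerivAt_const t s).prodMk ((hasDerivAt_const t w).prodMk (hasDerivAt_id t))
  exact hf.hasFDerivAt.comp_hasDerivAt t h1

/-- A function which increases (for `ς > 0`) from negative values at time `-T` to positive values
at time `T`. -/
structure IsCrossing (ς ε₁ τ T : ℝ) (f : ℝ × ℝ × ℝ → ℝ) : Prop where
  smooth : ∀ p ∈ boxSet ε₁ τ, ContDiffAt ℝ ∞ f p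
  lt : ∀ p ∈ boxSet ε₁ τ, |f p| < 1 / 2
  deriv : ∀ p ∈ boxSet ε₁ τ, 0 < ς * fderiv ℝ f p vecT
  neg : ∀ s w, |w| < ε₁ → ς * f (s, w, -T) < 0
  pos : ∀ s w, |w| < ε₁ → 0 < ς * f (s, w, T)

variable {ς ε₁ τ : ℝ} {f f' : ℝ × ℝ × ℝ → ℝ}

theorem IsCrossing.strictMonoOn (h : IsCrossing ς ε₁ τ T f) (s : ℝ) {w : ℝ} (hw : |w| < ε₁) :
    StrictMonoOn (fun t => ς * f (s, w, t)) (Set.Ioo (-τ) τ) := by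
  have hd : ∀ t ∈ Set.Ioo (-τ) τ, HasDerivAt (fun t => ς * f (s, w, t))
      (ς * fderiv ℝ f (s, w, t) vecT) t := fun t ht =>
    (hasDerivAt_slice ((h.smooth (s, w, t) ⟨hw, abs_lt.2 ht⟩).differentiableAt (by simp))).const_mul ς
  refine strictMonoOn_of_deriv_pos (convex_Ioo _ _)
    (fun t ht => (hd t ht).continuousAt.continuousWithinAt) fun t ht => ?_
  rw [interior_Ioo] at ht
  rw [(hd t ht).deriv]
  exact h.deriv _ ⟨hw, abs_lt.2 ht⟩

theorem IsCrossing.neg_of_le (h : IsCrossing ς ε₁ τ T f) (hT : 0 < T) (hTτ : T < τ) {s w t : ℝ}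
    (hp : (s, w, t) ∈ boxSet ε₁ τ) (ht : t ≤ -T) : ς * f (s, w, t) < 0 :=
  ((h.strictMonoOn s hp.1).monotoneOn (abs_lt.1 hp.2) (by constructor <;> linarith) ht).trans_lt
    (h.neg s w hp.1)

theorem IsCrossing.pos_of_ge (h : IsCrossing ς ε₁ τ T f) (hT : 0 < T) (hTτ : T < τ) {s w t : ℝ}
    (hp : (s, w, t) ∈ boxSet ε₁ τ) (ht : T ≤ t) : 0 < ς * f (s, w, t) :=
  (h.pos s w hp.1).trans_le
    ((h.strictMonoOn s hp.1).monotoneOn (by constructor <;> linarith) (abs_lt.1 hp.2) ht)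

theorem contDiffAt_interp {ϖ : ℝ → ℝ} (hϖ : ContDiff ℝ ∞ ϖ) (hT : 0 < T) (hTτ : T < τ)
    (hf : ∀ p ∈ boxSet ε₁ τ, ContDiffAt ℝ ∞ f p)
    (hf' : ∀ p ∈ boxSet ε₁ τ, T ≤ p.2.2 → ContDiffAt ℝ ∞ f' p) {p : ℝ × ℝ × ℝ}
    (hp : p ∈ boxSet ε₁ τ) : ContDiffAt ℝ ∞ (interp T ϖ f f') p := by
  have hw : ContDiff ℝ ∞ (fun p : ℝ × ℝ × ℝ => p.2.1) := contDiff_fst.comp contDiff_snd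
  have ht : ContDiff ℝ ∞ (fun p : ℝ × ℝ × ℝ => p.2.2) := contDiff_snd.comp contDiff_snd
  have h1 : ContDiffAt ℝ ∞ (fun p : ℝ × ℝ × ℝ => f (p.1, p.2.1, timeBefore T p.2.2)) p :=
    ContDiffAt.comp p (hf _ ⟨hp.1, abs_timeBefore_lt hT hTτ hp.2⟩)
      (contDiff_fst.prodMk (hw.prodMk (contDiff_timeBefore.comp ht))).contDiffAt
  have h2 : ContDiffAt ℝ ∞ (fun p : ℝ × ℝ × ℝ => f' (p.1, p.2.1, timeAfter T p.2.2)) p :=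
    ContDiffAt.comp p (hf' _ ⟨hp.1, abs_timeAfter_lt hT hTτ hp.2⟩ (le_timeAfter hT _))
      (contDiff_fst.prodMk (hw.prodMk (contDiff_timeAfter.comp ht))).contDiffAt
  have h3 : ContDiffAt ℝ ∞ (fun p : ℝ × ℝ × ℝ => ϖ p.2.1) p := (hϖ.comp hw).contDiffAt
  have h4 : ContDiffAt ℝ ∞ (fun p : ℝ × ℝ × ℝ => timeCut T p.2.2) p :=
    (contDiff_timeCut.comp ht).contDiffAt
  exact ((contDiffAt_const.sub h3).mul (hf p hp)).add
    (h3.mul (((contDiffAt_const.sub h4).mul h1).add (h4.mul h2)))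

theorem interp_deriv_pos {ϖ : ℝ → ℝ} (hϖ : ContDiff ℝ ∞ ϖ) (hϖ0 : ∀ w, 0 ≤ ϖ w)
    (hϖ1 : ∀ w, ϖ w ≤ 1) (hT : 0 < T) (hTτ : T < τ) (hf : IsCrossing ς ε₁ τ T f)
    (hf' : ∀ p ∈ boxSet ε₁ τ, T ≤ p.2.2 → ContDiffAt ℝ ∞ f' p)
    (hpos : ∀ p ∈ boxSet ε₁ τ, T ≤ p.2.2 → 0 < ς * f' p)
    (hder : ∀ p ∈ boxSet ε₁ τ, T ≤ p.2.2 → 0 < ς * fderiv ℝ f' p vecT) {p : ℝ × ℝ × ℝ}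
    (hp : p ∈ boxSet ε₁ τ) : 0 < ς * fderiv ℝ (interp T ϖ f f') p vecT := by
  obtain ⟨s, w, t⟩ := p
  obtain ⟨d, hd, hd0, hd1⟩ := exists_hasDerivAt_timeCut hT t
  obtain ⟨e, he, he0, he1⟩ := exists_hasDerivAt_timeBefore hT t
  obtain ⟨e', he', he0', he1'⟩ := exists_hasDerivAt_timeAfter hT t
  have hpm : (s, w, timeBefore T t) ∈ boxSet ε₁ τ := ⟨hp.1, abs_timeBefore_lt hT hTτ hp.2⟩
  have hpp : (s, w, timeAfter T t) ∈ boxSet ε₁ τ := ⟨hp.1, abs_timeAfter_lt hT hTτ hp.2⟩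
  have k1 := hasDerivAt_slice ((hf.smooth _ hp).differentiableAt (by simp))
  have k2 := HasDerivAt.comp t (hasDerivAt_slice ((hf.smooth _ hpm).differentiableAt (by simp))) he
  have k3 := HasDerivAt.comp t
    (hasDerivAt_slice ((hf' _ hpp (le_timeAfter hT t)).differentiableAt (by simp))) he'
  have k4 := hasDerivAt_slice (f := interp T ϖ f f')
    ((contDiffAt_interp hϖ hT hTτ hf.smooth hf' hp).differentiableAt (by simp))
  have k5 := (k1.const_mul (1 - ϖ w)).add
    ((((hd.const_sub 1).mul k2).add (hd.mul k3)).const_mul (ϖ w))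
  rw [k4.unique k5]
  simp only [Function.comp_apply]
  have a1 := hf.deriv _ hp
  have a2 := hf.deriv _ hpm
  have a3 := hder _ hpp (le_timeAfter hT t)
  have a4 := hf.neg_of_le hT hTτ hpm (timeBefore_le hT t)
  have a5 := hpos _ hpp (le_timeAfter hT t)
  set x := fderiv ℝ f (s, w, t) vecT
  set y := fderiv ℝ f (s, w, timeBefore T t) vecT
  set z := fderiv ℝ f' (s, w, timeAfter T t) vecT
  set b := f (s, w, timeBefore T t)
  set b' := f' (s, w, timeAfter T t)
  have c0 := timeCut_nonneg (T := T) t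
  have c1 := timeCut_le_one (T := T) t
  have key : 0 < (1 - timeCut T t) * ((ς * y) * e) + timeCut T t * ((ς * z) * e') +
      d * (ς * b' - ς * b) := by
    have t1 : 0 ≤ (1 - timeCut T t) * ((ς * y) * e) := by
      have := mul_nonneg a2.le he0
      exact mul_nonneg (by linarith) this
    have t2 : 0 ≤ timeCut T t * ((ς * z) * e') := mul_nonneg c0 (mul_nonneg a3.le he0')
    have t3 : 0 ≤ d * (ς * b' - ς * b) := mul_nonneg hd0 (by linarith)
    rcases lt_or_ge (|t|) (2 * T) with h | h
    · have : 0 < d * (ς * b' - ς * b) := mul_pos (hd1 h) (by linarith)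
      linarith
    · rcases le_abs.1 h with h | h
      · rw [timeCut_of_ge hT h] at t1 t2 ⊢
        have := mul_pos a3 (he1' h)
        linarith
      · rw [timeCut_of_le hT (by linarith)] at t1 t2 ⊢
        have := mul_pos a2 (he1 (by linarith))
        linarith
  have e1 : ς * ((1 - ϖ w) * x + ϖ w * (-d * b + (1 - timeCut T t) * (y * e) +
      (d * b' + timeCut T t * (z * e')))) = (1 - ϖ w) * (ς * x) + ϖ w *
      ((1 - timeCut T t) * ((ς * y) * e) + timeCut T t * ((ς * z) * e') + d * (ς * b' - ς * b)) := by
    ring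
  rw [e1]
  rcases (hϖ0 w).eq_or_lt with h | h
  · rw [← h]; simpa using a1
  · have := mul_pos h key
    have := mul_nonneg (sub_nonneg.2 (hϖ1 w)) a1.le
    linarith

theorem interp_of_le {ϖ : ℝ → ℝ} (hT : 0 < T) {p : ℝ × ℝ × ℝ} (h : p.2.2 ≤ -(2 * T)) :
    interp T ϖ f f' p = f p := by
  rw [interp, timeCut_of_le hT h, timeBefore_of_le hT h]
  ring

theorem interp_of_ge {ϖ : ℝ → ℝ} (hT : 0 < T) {p : ℝ × ℝ × ℝ} (h : 2 * T ≤ p.2.2)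
    (hf : ϖ p.2.1 ≠ 1 → f p = f' p) : interp T ϖ f f' p = f' p := by
  rw [interp, timeCut_of_ge hT h, timeAfter_of_ge hT h]
  by_cases hw : ϖ p.2.1 = 1
  · rw [hw]; ring
  · rw [hf hw]; ring

theorem interp_of_eq_zero {ϖ : ℝ → ℝ} {p : ℝ × ℝ × ℝ} (h : ϖ p.2.1 = 0) :
    interp T ϖ f f' p = f p := by
  rw [interp, h]; ring

end Interpolation

/-! ### The coefficients of the new forms -/

section Coefficients

/-- Periodicity in the angle. -/
def IsAngular (f : ℝ × ℝ × ℝ → ℝ) : Prop :=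
  ∀ (p : ℝ × ℝ × ℝ) (k : ℤ), f (p + (k * (2 * Real.pi), 0, 0)) = f p

theorem isAngular_of_periodic {f : ℝ × ℝ × ℝ → ℝ}
    (h : ∀ s w t, f (s + 2 * Real.pi, w, t) = f (s, w, t)) : IsAngular f := by
  rintro ⟨s, w, t⟩ k
  have h1 : Function.Periodic (fun s => f (s, w, t)) (2 * Real.pi) := fun s => h s w t
  have h2 := (h1.int_mul k) s
  simpa using h2

theorem boxSet_pos_or_neg {ε₁ τ : ℝ} {B : ℝ × ℝ × ℝ → ℝ}
    (hB : ∀ p ∈ boxSet ε₁ τ, ContDiffAt ℝ ∞ B p) (hB0 : ∀ p ∈ boxSet ε₁ τ, B p ≠ 0) :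
    (∀ p ∈ boxSet ε₁ τ, 0 < B p) ∨ ∀ p ∈ boxSet ε₁ τ, B p < 0 := by
  have hconv : Convex ℝ (boxSet ε₁ τ) := by
    have : boxSet ε₁ τ = Set.univ ×ˢ Set.Ioo (-ε₁) ε₁ ×ˢ Set.Ioo (-τ) τ := by
      ext p; simp [boxSet, abs_lt]
    rw [this]
    exact convex_univ.prod ((convex_Ioo _ _).prod (convex_Ioo _ _))
  by_contra! hc
  obtain ⟨⟨a, ha, ha'⟩, b, hb, hb'⟩ := hc
  obtain ⟨p, hp, hp'⟩ := hconv.isPreconnected.intermediate_value ha hb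
    (fun p hp => (hB p hp).continuousAt.continuousWithinAt) ⟨ha', hb'⟩
  exact hB0 p hp hp'

theorem mix_ne_zero {a b x : ℝ} (h : (0 < a ∧ 0 < b) ∨ (a < 0 ∧ b < 0)) (h0 : 0 ≤ x) (h1 : x ≤ 1) :
    (1 - x) * a + x * b ≠ 0 := by
  rcases h with ⟨ha, hb⟩ | ⟨ha, hb⟩
  · rcases h0.eq_or_lt with h | h
    · rw [← h]; simpa using ha.ne'
    · have := mul_pos h hb
      have := mul_nonneg (sub_nonneg.2 h1) ha.le
      linarith
  · rcases h0.eq_or_lt with h | h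
    · rw [← h]; simpa using ha.ne
    · have := mul_pos h (neg_pos.2 hb)
      have := mul_nonneg (sub_nonneg.2 h1) (neg_pos.2 ha).le
      linarith

theorem mix_mul_mix_lt_one {a r c s k x : ℝ} (ha : a < 0) (ha' : -(1 / 2) < a) (hr : 0 < r)
    (hr' : r < 1 / 2) (hc : c < 0) (hc' : -(1 / 2) < c) (hs : 0 < s) (hs' : s < 1 / 2) (hk : 0 ≤ k)
    (h0 : 0 ≤ x) (h1 : x ≤ 1) :
    ((1 - x) * a + x * (r / (1 + k * r))) * ((1 - x) * c + x * (s + k)) < 1 := by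
  have hd : 0 < 1 + k * r := by positivity
  set b := r / (1 + k * r) with hb
  have hb0 : 0 < b := div_pos hr hd
  have hbd : b * (s + k) < 1 := by
    rw [hb, div_mul_eq_mul_div, div_lt_one hd]
    nlinarith
  have hx : 0 ≤ 1 - x := by linarith
  have p1 : (1 - x) * a + x * b ≤ b := by nlinarith
  have p2 : -(1 / 2) < (1 - x) * a + x * b := by
    have := mul_nonneg h0 hb0.le
    nlinarith
  have q1 : (1 - x) * c + x * (s + k) ≤ s + k := by nlinarith
  have q2 : -(1 / 2) < (1 - x) * c + x * (s + k) := by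
    have := mul_nonneg h0 (by linarith : (0 : ℝ) ≤ s + k)
    nlinarith
  set P := (1 - x) * a + x * b
  set Q := (1 - x) * c + x * (s + k)
  rcases le_total P 0 with hP | hP <;> rcases le_total Q 0 with hQ | hQ
  · nlinarith
  · nlinarith
  · nlinarith
  · exact (mul_le_mul p1 q1 hQ hb0.le).trans_lt hbd

variable {ς ε ε₁ τ T : ℝ} {h : ℝ × ℝ → ℝ} {κ : ℝ → ℝ} {f ρ σ A B : ℝ × ℝ × ℝ → ℝ}

theorem contDiff_shearMap (hh : ContDiff ℝ ∞ h) : ContDiff ℝ ∞ (shearMap h) :=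
  (contDiff_fst.add (hh.comp contDiff_snd)).prodMk contDiff_snd

theorem IsAngular.comp_shearMap (hf : IsAngular f) : IsAngular (f ∘ shearMap h) := by
  intro p k
  have : shearMap h (p + (k * (2 * Real.pi), 0, 0)) = shearMap h p + (k * (2 * Real.pi), 0, 0) := by
    have h2 : (p + (k * (2 * Real.pi), 0, 0)).2 = p.2 := by simp
    simp only [shearMap, h2]
    ext <;> simp; ring
  rw [Function.comp_apply, this, hf]; rfl

theorem IsAngular.shearMap_eq (hf : IsAngular f) {p : ℝ × ℝ × ℝ}
    (hp : ∃ k : ℤ, h p.2 = k * (2 * Real.pi)) : f (shearMap h p) = f p := by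
  obtain ⟨k, hk⟩ := hp
  rw [← hf p k, shearMap, hk]
  congr 1
  ext <;> simp

theorem IsCrossing.comp_shearMap (hf : IsCrossing ς ε₁ τ T f) (hh : ContDiff ℝ ∞ h)
    (ht : ∀ w t, h (w, t) = h (w, 0)) : IsCrossing ς ε₁ τ T (f ∘ shearMap h) := by
  have hs : ∀ s w t, shearMap h (s, w, t) = (s + h (w, 0), w, t) := by
    intro s w t; simp only [shearMap, ht w t]
  have hsm : ∀ p ∈ boxSet ε₁ τ, ContDiffAt ℝ ∞ (f ∘ shearMap h) p := fun p hp =>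
    ContDiffAt.comp p (hf.smooth _ hp) (contDiff_shearMap hh).contDiffAt
  refine ⟨hsm, fun p hp => hf.lt _ hp, ?_, fun s w hw => ?_, fun s w hw => ?_⟩
  · rintro ⟨s, w, t⟩ hp
    have h1 := hasDerivAt_slice ((hsm _ hp).differentiableAt (by simp))
    have hp' : (s + h (w, 0), w, t) ∈ boxSet ε₁ τ := hp
    have h2 := hasDerivAt_slice ((hf.smooth _ hp').differentiableAt (by simp))
    have h3 : (fun t => (f ∘ shearMap h) (s, w, t)) = fun t => f (s + h (w, 0), w, t) := by
      funext t; rw [Function.comp_apply, hs]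
    rw [h3] at h1
    rw [h1.unique h2]; exact hf.deriv _ hp'
  · rw [Function.comp_apply, hs]; exact hf.neg _ _ hw
  · rw [Function.comp_apply, hs]; exact hf.pos _ _ hw

/-- The slope of `α` on the positive side, in the coordinates of the negative side. -/
def shearedSlope (h : ℝ × ℝ → ℝ) (κ : ℝ → ℝ) (ρ : ℝ × ℝ × ℝ → ℝ) (p : ℝ × ℝ × ℝ) : ℝ :=
  ρ (shearMap h p) / (1 + κ p.2.1 * ρ (shearMap h p))

theorem exists_sheared_coefficients (hς : ς * ς = 1) (hε0 : 0 < ε) (hε : ε < ε₁) (hT : 0 < T)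
    (hTτ : 2 * T < τ) (hh : ContDiff ℝ ∞ h) (ht : ∀ w t, h (w, t) = h (w, 0))
    (hκ : ContDiff ℝ ∞ κ) (hκ0 : ∀ w, 0 ≤ ς * κ w) (hκε : ∀ w, ε < |w| → κ w = 0)
    (hhε : ∀ y : ℝ × ℝ, ε < |y.1| → ∃ k : ℤ, h y = k * (2 * Real.pi))
    (hρ : IsCrossing ς ε₁ τ T ρ) (hσ : IsCrossing ς ε₁ τ T σ)
    (hA : ∀ p ∈ boxSet ε₁ τ, ContDiffAt ℝ ∞ A p) (hB : ∀ p ∈ boxSet ε₁ τ, ContDiffAt ℝ ∞ B p)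
    (hA0 : ∀ p ∈ boxSet ε₁ τ, A p ≠ 0) (hB0 : ∀ p ∈ boxSet ε₁ τ, B p ≠ 0)
    (hAa : IsAngular A) (hBa : IsAngular B) (hρa : IsAngular ρ) (hσa : IsAngular σ) :
    ∃ A' B' ρ' σ' : ℝ × ℝ × ℝ → ℝ,
      (∀ p ∈ boxSet ε₁ τ, ContDiffAt ℝ ∞ A' p ∧ ContDiffAt ℝ ∞ B' p ∧ ContDiffAt ℝ ∞ ρ' p ∧
        ContDiffAt ℝ ∞ σ' p) ∧
      (IsAngular A' ∧ IsAngular B' ∧ IsAngular ρ' ∧ IsAngular σ') ∧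
      (∀ p ∈ boxSet ε₁ τ, A' p ≠ 0 ∧ B' p ≠ 0 ∧ ρ' p * σ' p < 1 ∧
        0 < ς * fderiv ℝ ρ' p vecT ∧ 0 < ς * fderiv ℝ σ' p vecT) ∧
      ∀ p ∈ boxSet ε₁ τ, ((ε + ε₁) / 2 < |p.2.1| ∨ 2 * T < |p.2.2|) →
        (p.2.2 ≤ 0 → A' p = A p ∧ B' p = B p ∧ ρ' p = ρ p ∧ σ' p = σ p) ∧
        (0 < p.2.2 → A' p = A (shearMap h p) ∧
          B' p = B (shearMap h p) * (1 + κ p.2.1 * ρ (shearMap h p)) ∧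
          B' p * ρ' p = B (shearMap h p) * ρ (shearMap h p) ∧
          σ' p = σ (shearMap h p) + κ p.2.1) := by
  have hTτ' : T < τ := by linarith
  have hw : ContDiff ℝ ∞ (fun p : ℝ × ℝ × ℝ => p.2.1) := contDiff_fst.comp contDiff_snd
  have htt : ContDiff ℝ ∞ (fun p : ℝ × ℝ × ℝ => p.2.2) := contDiff_snd.comp contDiff_snd
  set ε₂ := (ε + ε₁) / 2 with hε₂
  have hden : 0 < ε₂ ^ 2 - ε ^ 2 := by nlinarith
  let ϖ : ℝ → ℝ := fun w => Real.smoothTransition (1 - (w ^ 2 - ε ^ 2) / (ε₂ ^ 2 - ε ^ 2))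
  have hϖ : ContDiff ℝ ∞ ϖ := Real.smoothTransition.contDiff.comp
    (contDiff_const.sub (((contDiff_id.pow 2).sub contDiff_const).div_const _))
  have hϖ0 : ∀ w, 0 ≤ ϖ w := fun w => Real.smoothTransition.nonneg _
  have hϖ1 : ∀ w, ϖ w ≤ 1 := fun w => Real.smoothTransition.le_one _
  have hϖin : ∀ w, |w| ≤ ε → ϖ w = 1 := fun w hw => Real.smoothTransition.one_of_one_le (by
    have : w ^ 2 ≤ ε ^ 2 := sq_le_sq' (by linarith [(abs_le.1 hw).1]) (abs_le.1 hw).2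
    have : (w ^ 2 - ε ^ 2) / (ε₂ ^ 2 - ε ^ 2) ≤ 0 :=
      div_nonpos_of_nonpos_of_nonneg (by linarith) hden.le
    linarith)
  have hϖout : ∀ w, ε₂ < |w| → ϖ w = 0 := fun w hw => Real.smoothTransition.zero_of_nonpos (by
    have : ε₂ ^ 2 < w ^ 2 := by rw [← sq_abs w]; exact pow_lt_pow_left₀ hw (by linarith) (by simp)
    have : 1 ≤ (w ^ 2 - ε ^ 2) / (ε₂ ^ 2 - ε ^ 2) := by rw [le_div_iff₀ hden]; linarith
    linarith)
  let χ : ℝ → ℝ := fun t => Real.smoothTransition ((t - T) / T)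
  have hχ : ContDiff ℝ ∞ χ := Real.smoothTransition.contDiff.comp
    ((contDiff_id.sub contDiff_const).div_const _)
  have hχ0 : ∀ t ≤ T, χ t = 0 := fun t h => Real.smoothTransition.zero_of_nonpos
    (div_nonpos_of_nonpos_of_nonneg (by linarith) hT.le)
  have hχ1 : ∀ t, 2 * T ≤ t → χ t = 1 := fun t h => Real.smoothTransition.one_of_one_le (by
    rw [le_div_iff₀ hT]; linarith)
  have hF : ContDiff ℝ ∞ (shearMap h) := contDiff_shearMap hh
  have hFm : ∀ p ∈ boxSet ε₁ τ, shearMap h p ∈ boxSet ε₁ τ := fun p hp => hp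
  have hρF := hρ.comp_shearMap hh ht
  have hσF := hσ.comp_shearMap hh ht
  have hκs : ContDiff ℝ ∞ (fun p : ℝ × ℝ × ℝ => κ p.2.1) := hκ.comp hw
  have hκρ : ∀ p ∈ boxSet ε₁ τ, T ≤ p.2.2 → 0 < ς * ρ (shearMap h p) ∧
      0 ≤ κ p.2.1 * ρ (shearMap h p) := by
    intro p hp hpt
    have h1 : 0 < ς * ρ (shearMap h p) := hρF.pos_of_ge hT hTτ' hp hpt
    refine ⟨h1, ?_⟩
    have h2 := mul_nonneg (hκ0 p.2.1) h1.le
    have h3 : ς * κ p.2.1 * (ς * ρ (shearMap h p)) = (ς * ς) * (κ p.2.1 * ρ (shearMap h p)) := by ring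
    rwa [h3, hς, one_mul] at h2
  have hρ's : ∀ p ∈ boxSet ε₁ τ, T ≤ p.2.2 → ContDiffAt ℝ ∞ (shearedSlope h κ ρ) p := fun p hp hpt =>
    (hρF.smooth p hp).div (contDiffAt_const.add (hκs.contDiffAt.mul (hρF.smooth p hp)))
      (by have := (hκρ p hp hpt).2; exact ne_of_gt (by positivity : 0 < 1 + κ p.2.1 * ρ (shearMap h p)))
  have hρ'pos : ∀ p ∈ boxSet ε₁ τ, T ≤ p.2.2 → 0 < ς * shearedSlope h κ ρ p := by
    intro p hp hpt
    obtain ⟨h1, h2⟩ := hκρ p hp hpt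
    rw [shearedSlope, ← mul_div_assoc]
    exact div_pos h1 (by linarith)
  have hρ'der : ∀ p ∈ boxSet ε₁ τ, T ≤ p.2.2 → 0 < ς * fderiv ℝ (shearedSlope h κ ρ) p vecT := by
    rintro ⟨s, w, t⟩ hp hpt
    have hne : 1 + κ w * ρ (shearMap h (s, w, t)) ≠ 0 := by
      have := (hκρ _ hp hpt).2; positivity
    have h1 := hasDerivAt_slice ((hρF.smooth _ hp).differentiableAt (by simp))
    have h2 := hasDerivAt_slice ((hρ's _ hp hpt).differentiableAt (by simp))
    have h3 := h1.div ((h1.const_mul (κ w)).const_add 1) hne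
    rw [h2.unique h3]
    have h4 := hρF.deriv _ hp
    simp only [Function.comp_apply]
    set x := fderiv ℝ (ρ ∘ shearMap h) (s, w, t) vecT
    rw [← mul_div_assoc]
    refine div_pos ?_ (by positivity)
    have : ς * (x * (1 + κ w * ρ (shearMap h (s, w, t))) - ρ (shearMap h (s, w, t)) * (κ w * x)) =
      ς * x := by ring
    rw [this]; exact h4
  let σ₁ : ℝ × ℝ × ℝ → ℝ := fun p => σ (shearMap h p) + κ p.2.1
  have hσ's : ∀ p ∈ boxSet ε₁ τ, T ≤ p.2.2 → ContDiffAt ℝ ∞ σ₁ p := fun p hp _ =>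
    (hσF.smooth p hp).add hκs.contDiffAt
  have hσF0 : ∀ p ∈ boxSet ε₁ τ, T ≤ p.2.2 → 0 < ς * σ (shearMap h p) := fun p hp hpt =>
    hσF.pos_of_ge hT hTτ' hp hpt
  have hσ'pos : ∀ p ∈ boxSet ε₁ τ, T ≤ p.2.2 → 0 < ς * σ₁ p := by
    intro p hp hpt
    have h1 := hσF0 p hp hpt
    have h2 := hκ0 p.2.1
    simp only [σ₁]; linarith
  have hσ'der : ∀ p ∈ boxSet ε₁ τ, T ≤ p.2.2 → 0 < ς * fderiv ℝ σ₁ p vecT := by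
    rintro ⟨s, w, t⟩ hp hpt
    have h1 := hasDerivAt_slice ((hσF.smooth _ hp).differentiableAt (by simp))
    have h2 := hasDerivAt_slice ((hσ's _ hp hpt).differentiableAt (by simp))
    rw [h2.unique (h1.add_const (κ w))]
    exact hσF.deriv _ hp
  have hρside : ∀ p ∈ boxSet ε₁ τ, ε < |p.2.1| → ρ p = shearedSlope h κ ρ p := by
    intro p hp hpw
    rw [shearedSlope, hκε _ hpw, hρa.shearMap_eq (hhε p.2 hpw)]; simp
  have hσside : ∀ p ∈ boxSet ε₁ τ, ε < |p.2.1| → σ p = σ₁ p := by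
    intro p hp hpw
    simp only [σ₁]
    rw [hκε _ hpw, hσa.shearMap_eq (hhε p.2 hpw)]; simp
  have hϖne : ∀ w, ϖ w ≠ 1 → ε < |w| := fun w hw => not_le.1 fun h => hw (hϖin w h)
  let R := interp T ϖ ρ (shearedSlope h κ ρ)
  let S := interp T ϖ σ σ₁
  let B₁ : ℝ × ℝ × ℝ → ℝ := fun p => B (shearMap h p) * (1 + κ p.2.1 * ρ (shearMap h p))
  let A' : ℝ × ℝ × ℝ → ℝ := fun p => (1 - χ p.2.2) * A p + χ p.2.2 * A (shearMap h p)
  let B' : ℝ × ℝ × ℝ → ℝ := fun p => (1 - χ p.2.2) * B p + χ p.2.2 * B₁ p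
  have hχs : ContDiff ℝ ∞ (fun p : ℝ × ℝ × ℝ => χ p.2.2) := hχ.comp htt
  have hfar : ∀ (k : ℤ) (p : ℝ × ℝ × ℝ), (p + (k * (2 * Real.pi), 0, 0)).2 = p.2 := by simp
  have hang : ∀ {f f' : ℝ × ℝ × ℝ → ℝ}, IsAngular f → IsAngular f' → IsAngular (interp T ϖ f f') := by
    intro f f' hf hf' p k
    have h1 : ∀ (g : ℝ × ℝ × ℝ → ℝ) (y : ℝ × ℝ), IsAngular g →
        g ((p + (k * (2 * Real.pi), 0, 0)).1, y) = g (p.1, y) := by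
      intro g y hg
      rw [← hg (p.1, y) k]
      congr 1
      ext <;> simp
    rw [interp, interp, hf, hfar, h1 f _ hf, h1 f' _ hf']
  have hABpos := boxSet_pos_or_neg hA hA0
  have hBBpos := boxSet_pos_or_neg hB hB0
  refine ⟨A', B', R, S, fun p hp => ⟨?_, ?_, ?_, ?_⟩, ⟨?_, ?_, ?_, ?_⟩,
    fun p hp => ⟨?_, ?_, ?_, ?_, ?_⟩, fun p hp hout => ⟨fun hpt => ?_, fun hpt => ?_⟩⟩
  · exact ((contDiffAt_const.sub hχs.contDiffAt).mul (hA p hp)).add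
      (hχs.contDiffAt.mul (ContDiffAt.comp p (hA _ (hFm p hp)) hF.contDiffAt))
  · exact ((contDiffAt_const.sub hχs.contDiffAt).mul (hB p hp)).add
      (hχs.contDiffAt.mul ((ContDiffAt.comp p (hB _ (hFm p hp)) hF.contDiffAt).mul
        (contDiffAt_const.add (hκs.contDiffAt.mul (hρF.smooth p hp)))))
  · exact contDiffAt_interp hϖ hT hTτ' hρ.smooth hρ's hp
  · exact contDiffAt_interp hϖ hT hTτ' hσ.smooth hσ's hp
  · intro p k
    have h1 := hAa.comp_shearMap (h := h) p k
    simp only [Function.comp_apply] at h1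
    simp only [A']; rw [hfar, hAa, h1]
  · intro p k
    have h1 := hBa.comp_shearMap (h := h) p k
    have h2 := hρa.comp_shearMap (h := h) p k
    simp only [Function.comp_apply] at h1 h2
    simp only [B', B₁]; rw [hfar, hBa, h1, h2]
  · refine hang hρa fun p k => ?_
    have h2 := hρa.comp_shearMap (h := h) p k
    simp only [Function.comp_apply] at h2
    simp only [shearedSlope]; rw [hfar, h2]
  · refine hang hσa fun p k => ?_
    have h2 := hσa.comp_shearMap (h := h) p k
    simp only [Function.comp_apply] at h2
    simp only [σ₁]; rw [hfar, h2]
  · refine mix_ne_zero ?_ (Real.smoothTransition.nonneg _) (Real.smoothTransition.le_one _)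
    exact hABpos.imp (fun h => ⟨h p hp, h _ (hFm p hp)⟩) fun h => ⟨h p hp, h _ (hFm p hp)⟩
  · rcases le_or_gt p.2.2 T with hpt | hpt
    · simp only [B', hχ0 _ hpt]; simpa using hB0 p hp
    · refine mix_ne_zero ?_ (Real.smoothTransition.nonneg _) (Real.smoothTransition.le_one _)
      have h1 : 0 < 1 + κ p.2.1 * ρ (shearMap h p) := by
        have := (hκρ p hp hpt.le).2; positivity
      exact hBBpos.imp (fun h => ⟨h p hp, mul_pos (h _ (hFm p hp)) h1⟩)
        fun h => ⟨h p hp, mul_neg_of_neg_of_pos (h _ (hFm p hp)) h1⟩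
  · have hpm : (p.1, p.2.1, timeBefore T p.2.2) ∈ boxSet ε₁ τ :=
      ⟨hp.1, abs_timeBefore_lt hT hTτ' hp.2⟩
    have hpp : (p.1, p.2.1, timeAfter T p.2.2) ∈ boxSet ε₁ τ :=
      ⟨hp.1, abs_timeAfter_lt hT hTτ' hp.2⟩
    have c0 := timeCut_nonneg (T := T) p.2.2
    have c1 := timeCut_le_one (T := T) p.2.2
    rcases le_or_gt (|p.2.1|) ε with hwε | hwε
    · have ra := hρ.neg_of_le hT hTτ' hpm (timeBefore_le hT _)
      have rb := (abs_lt.1 (hρ.lt _ hpm))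
      have rc := (hκρ _ hpp (le_timeAfter hT _)).1
      have rd := (abs_lt.1 (hρF.lt _ hpp))
      have sa := hσ.neg_of_le hT hTτ' hpm (timeBefore_le hT _)
      have sb := (abs_lt.1 (hσ.lt _ hpm))
      have sc := hσF0 _ hpp (le_timeAfter hT _)
      have sd := (abs_lt.1 (hσF.lt _ hpp))
      simp only [Function.comp_apply] at rd sd
      have hRS : R p * S p = ((1 - timeCut T p.2.2) * ρ (p.1, p.2.1, timeBefore T p.2.2) +
          timeCut T p.2.2 * shearedSlope h κ ρ (p.1, p.2.1, timeAfter T p.2.2)) *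
          ((1 - timeCut T p.2.2) * σ (p.1, p.2.1, timeBefore T p.2.2) +
          timeCut T p.2.2 * σ₁ (p.1, p.2.1, timeAfter T p.2.2)) := by
        simp only [R, S, interp, hϖin _ hwε]; ring
      rw [hRS]
      simp only [shearedSlope, σ₁]
      set a := ρ (p.1, p.2.1, timeBefore T p.2.2)
      set c := σ (p.1, p.2.1, timeBefore T p.2.2)
      set r := ρ (shearMap h (p.1, p.2.1, timeAfter T p.2.2))
      set s := σ (shearMap h (p.1, p.2.1, timeAfter T p.2.2))
      set x := timeCut T p.2.2
      have hς' : ς = 1 ∨ ς = -1 := mul_self_eq_one_iff.1 hς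
      have hk := hκ0 p.2.1
      rcases hς' with h | h <;> rw [h] at ra rc sa sc hk
      · exact mix_mul_mix_lt_one (by linarith) (by linarith) (by linarith) (by linarith)
          (by linarith) (by linarith) (by linarith) (by linarith) (by linarith) c0 c1
      · have := mix_mul_mix_lt_one (a := -a) (r := -r) (c := -c) (s := -s) (k := -κ p.2.1)
          (by linarith) (by linarith) (by linarith) (by linarith)
          (by linarith) (by linarith) (by linarith) (by linarith) (by linarith) c0 c1
        have e : ((1 - x) * -a + x * (-r / (1 + -κ p.2.1 * -r))) * ((1 - x) * -c + x * (-s + -κ p.2.1)) =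
          ((1 - x) * a + x * (r / (1 + κ p.2.1 * r))) * ((1 - x) * c + x * (s + κ p.2.1)) := by
          rw [neg_mul_neg, neg_div]; ring
        rwa [e] at this
    · have hconv : Convex ℝ (Set.Ioo (-(1 / 2) : ℝ) (1 / 2)) := convex_Ioo _ _
      have key : ∀ {f f' : ℝ × ℝ × ℝ → ℝ}, IsCrossing ς ε₁ τ T f →
          (f (p.1, p.2.1, timeAfter T p.2.2) = f' (p.1, p.2.1, timeAfter T p.2.2)) →
          |interp T ϖ f f' p| < 1 / 2 := by
        intro f f' hf hff
        rw [interp, ← hff, abs_lt]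
        refine hconv (abs_lt.1 (hf.lt p hp)) (hconv (abs_lt.1 (hf.lt _ hpm)) (abs_lt.1 (hf.lt _ hpp))
          ?_ c0 (by ring)) ?_ (hϖ0 _) (by ring)
        · linarith
        · linarith [hϖ1 p.2.1]
      have h1 := key hρ (hρside _ hpp hwε)
      have h2 := key hσ (hσside _ hpp hwε)
      have h3 : |R p| * |S p| < 1 / 2 * (1 / 2) := mul_lt_mul'' h1 h2 (abs_nonneg _) (abs_nonneg _)
      rw [← abs_mul] at h3
      linarith [le_abs_self (R p * S p)]
  · exact interp_deriv_pos hϖ hϖ0 hϖ1 hT hTτ' hρ hρ's hρ'pos hρ'der hp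
  · exact interp_deriv_pos hϖ hϖ0 hϖ1 hT hTτ' hσ hσ's hσ'pos hσ'der hp
  · have h0 : χ p.2.2 = 0 := hχ0 _ (by linarith)
    refine ⟨by simp [A', h0], by simp [B', h0], ?_, ?_⟩
    all_goals
      rcases hout with hout | hout
      · exact interp_of_eq_zero (hϖout _ hout)
      · refine interp_of_le hT ?_
        rw [abs_of_nonpos hpt] at hout; linarith
  · rcases hout with hout | hout
    · have hwε : ε < |p.2.1| := by linarith
      have hk := hκε _ hwε
      have hA1 := hAa.shearMap_eq (hhε p.2 hwε)
      have hB1 := hBa.shearMap_eq (hhε p.2 hwε)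
      have hρ1 := hρa.shearMap_eq (hhε p.2 hwε)
      have hσ1 := hσa.shearMap_eq (hhε p.2 hwε)
      have hR : R p = ρ p := interp_of_eq_zero (hϖout _ hout)
      have hS : S p = σ p := interp_of_eq_zero (hϖout _ hout)
      have hB2 : B' p = B p := by simp only [B', B₁, hk, hB1]; ring
      rw [hA1, hB1, hρ1, hσ1, hR, hS, hB2, hk]
      refine ⟨?_, by ring, rfl, by ring⟩
      simp only [A', hA1]; ring
    · have hpt2 : 2 * T < p.2.2 := by rwa [abs_of_pos hpt] at hout
      have h1 := hχ1 _ hpt2.le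
      have hR : R p = shearedSlope h κ ρ p :=
        interp_of_ge hT hpt2.le fun hne => hρside p hp (hϖne _ hne)
      have hS : S p = σ₁ p := interp_of_ge hT hpt2.le fun hne => hσside p hp (hϖne _ hne)
      have hB2 : B' p = B₁ p := by simp only [B', h1]; ring
      have hne : 1 + κ p.2.1 * ρ (shearMap h p) ≠ 0 := by
        have := (hκρ p hp (by linarith)).2; positivity
      refine ⟨by simp only [A', h1]; ring, hB2, ?_, hS⟩
      rw [hB2, hR]
      simp only [B₁, shearedSlope]
      field_simp

end Coefficients

/-! ### The new bi-contact structure -/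

section NewForms

variable {M : Type u} [TopologicalSpace M] [ChartedSpace E3 M] [IsManifold (𝓡 3) ∞ M]
  {o : ∀ x : M, Orientation ℝ (TangentSpace (𝓡 3) x) (Fin 3)}
  {α β : ∀ x : M, TangentSpace (𝓡 3) x →L[ℝ] ℝ} {X : ∀ x : M, TangentSpace (𝓡 3) x}
  {K : Circle → M} {ς ε₁ τ T : ℝ} {A B ρ σ : ℝ × ℝ × ℝ → ℝ}

theorem IsSurgeryBox.isCrossing_rho {Φ : AnnulusBox M}
    (h : IsSurgeryBox o α β X K ς Φ ε₁ τ T A B ρ σ) : IsCrossing ς ε₁ τ T ρ :=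
  ⟨h.ρ_smooth, h.ρ_lt, h.ρ_deriv, h.ρ_neg, h.ρ_pos⟩

theorem IsSurgeryBox.isCrossing_sigma {Φ : AnnulusBox M}
    (h : IsSurgeryBox o α β X K ς Φ ε₁ τ T A B ρ σ) : IsCrossing ς ε₁ τ T σ :=
  ⟨h.σ_smooth, h.σ_lt, h.σ_deriv, h.σ_neg, h.σ_pos⟩

namespace SurgeryInput

variable [T2Space M] (I : SurgeryInput M)

theorem slope_eq_zero {w : ℝ} (hw : I.ε < |w|) : I.slope w = 0 := by
  have hg := I.profile
  have h : deriv I.g (w / I.ε) = 0 := by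
    rcases lt_abs.1 hw with h | h
    · have h1 : 1 < w / I.ε := by rwa [lt_div_iff₀ I.pos, one_mul]
      have h2 : I.g =ᶠ[𝓝 (w / I.ε)] fun _ => 2 * Real.pi := by
        filter_upwards [eventually_gt_nhds h1] with y hy using hg.2.2.2 y hy.le
      rw [h2.deriv_eq]; simp
    · have h1 : w / I.ε < -1 := by rw [div_lt_iff₀ I.pos]; linarith
      have h2 : I.g =ᶠ[𝓝 (w / I.ε)] fun _ => 0 := by
        filter_upwards [eventually_lt_nhds h1] with y hy using hg.2.2.1 y hy.le
      rw [h2.deriv_eq]; simp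
  rw [slope, h]; simp

theorem slope_sign {ς : ℝ} (hq : 0 ≤ ς * I.q) (w : ℝ) : 0 ≤ ς * I.slope w := by
  have h1 : 0 ≤ deriv I.g (w / I.ε) := I.profile.2.1.deriv_nonneg
  have h2 : ς * I.slope w = (ς * I.q) * (deriv I.g (w / I.ε) / I.ε) := by rw [slope]; ring
  rw [h2]
  exact mul_nonneg hq (div_nonneg h1 I.pos.le)

theorem slide_eq_int {y : ℝ × ℝ} (hy : I.ε < |y.1|) : ∃ k : ℤ, I.slide y = k * (2 * Real.pi) := by
  rcases lt_abs.1 hy with h | h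
  · refine ⟨I.q, ?_⟩
    rw [slide, I.profile.2.2.2 _ ((one_le_div I.pos).2 h.le)]
  · refine ⟨0, ?_⟩
    rw [slide, I.profile.2.2.1 _ (by rw [div_le_iff₀ I.pos]; linarith)]; simp

variable {I}

theorem mfderiv_inner_apply_eq {α' : ∀ x : I.Surgered, TangentSpace (𝓡 3) x →L[ℝ] ℝ}
    {p : ℝ × ℝ × ℝ} {L : ℝ × ℝ × ℝ →L[ℝ] ℝ} (h : pullbackForm α' I.inner.coord p = L)
    (v : ℝ × ℝ × ℝ) : α' (I.inner.coord p) (I.inner.vec p v) = L v :=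
  congrArg (fun L : ℝ × ℝ × ℝ →L[ℝ] ℝ => L v) h

theorem exists_new_forms (h : IsSurgeryBox o α β X K ς I.Φ I.ε₁ I.τ T A B ρ σ) (hς : ς * ς = 1)
    (hq : 0 ≤ ς * I.q) (hα : IsSmoothOneForm α) (hβ : IsSmoothOneForm β)
    (hαc : ∀ x, IsContactAt o (-ς) α x) (hβc : ∀ x, IsContactAt o ς β x)
    (hli : ∀ x, LinearIndependent ℝ ![α x, β x]) (hX : IsDefinedBy X α β) :
    ∃ α' β' : ∀ x : I.Surgered, TangentSpace (𝓡 3) x →L[ℝ] ℝ,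
      IsSmoothOneForm α' ∧ IsSmoothOneForm β' ∧
      (∀ x, IsContactAt (I.orient o) (-ς) α' x) ∧ (∀ x, IsContactAt (I.orient o) ς β' x) ∧
      (∀ x, LinearIndependent ℝ ![α' x, β' x]) ∧ IsDefinedBy (I.field X) α' β' ∧
      ∀ x : I.Surgered, (x : M) ∉ I.Φ.target → α' x = I.form α x ∧ β' x = I.form β x := by
  obtain ⟨A', B', ρ', σ', hsm, ⟨aA, aB, aρ, aσ⟩, hne, hout⟩ := exists_sheared_coefficients
    (h := I.slide) (κ := I.slope) hς I.pos I.lt h.T_pos h.T_lt I.contDiff_slide (fun w t => rfl)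
    I.contDiff_slope (I.slope_sign hq) (fun w hw => I.slope_eq_zero hw)
    (fun y hy => I.slide_eq_int hy) h.isCrossing_rho h.isCrossing_sigma h.A_smooth h.B_smooth h.A_ne
    h.B_ne (isAngular_of_periodic h.A_periodic) (isAngular_of_periodic h.B_periodic)
    (isAngular_of_periodic h.ρ_periodic) (isAngular_of_periodic h.σ_periodic)
  have hεε : (I.ε + I.ε₁) / 2 < I.ε₁ := by linarith [I.lt]
  have hnot : ∀ x : I.Surgered, x ∉ I.inner.target → (x : M) ∉ I.Φ.annulus I.ε := fun x hx hC =>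
    hx (by rw [I.inner_target]; exact I.annulus_subset hC)
  have hbox : IsProductBox I.inner I.ε₁ I.τ := inner_box
  obtain ⟨α', hα's, hα'L, hα'o⟩ := exists_modified_form hbox hεε h.T_lt (α₀ := I.form α)
    (L := fun p => B' p • (ρ' p • dS + dW))
    (fun x hx => isSmoothOneFormAt_form hα (hnot x hx))
    (fun p hp => (hsm p hp).2.1.smul (((hsm p hp).2.2.1.smul contDiffAt_const).add contDiffAt_const))
    (fun p k => by rw [aB, aρ]) (fun p hp hpo => by
      obtain ⟨hn, hpos⟩ := hout p hp hpo
      rcases le_or_gt p.2.2 0 with ht | ht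
      · obtain ⟨-, e1, e2, -⟩ := hn ht
        rw [pullbackForm_form_neg hp (Or.inl ht), h.α_eq p hp, e1, e2]
      · obtain ⟨-, e1, e2, -⟩ := hpos ht
        refine ContinuousLinearMap.ext fun v => ?_
        rw [pullbackForm_form_pos hp ht, h.α_eq _ (I.shear_mem hp)]
        have e3 : B' p * (ρ' p * v.1 + v.2.1) = B (shearMap I.slide p) *
            (ρ (shearMap I.slide p) * (v.1 + I.slope p.2.1 * v.2.1) + v.2.1) := by
          rw [mul_add, ← mul_assoc, e2, e1]; ring
        simpa [mul_add] using e3)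
  obtain ⟨β', hβ's, hβ'L, hβ'o⟩ := exists_modified_form hbox hεε h.T_lt (α₀ := I.form β)
    (L := fun p => A' p • (dS + σ' p • dW))
    (fun x hx => isSmoothOneFormAt_form hβ (hnot x hx))
    (fun p hp => (hsm p hp).1.smul (contDiffAt_const.add ((hsm p hp).2.2.2.smul contDiffAt_const)))
    (fun p k => by rw [aA, aσ]) (fun p hp hpo => by
      obtain ⟨hn, hpos⟩ := hout p hp hpo
      rcases le_or_gt p.2.2 0 with ht | ht
      · obtain ⟨e1, -, -, e2⟩ := hn ht
        rw [pullbackForm_form_neg hp (Or.inl ht), h.β_eq p hp, e1, e2]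
      · obtain ⟨e1, -, -, e2⟩ := hpos ht
        refine ContinuousLinearMap.ext fun v => ?_
        rw [pullbackForm_form_pos hp ht, h.β_eq _ (I.shear_mem hp)]
        have e3 : A' p * (v.1 + σ' p * v.2.1) = A (shearMap I.slide p) *
            (v.1 + I.slope p.2.1 * v.2.1 + σ (shearMap I.slide p) * v.2.1) := by
          rw [e1, e2]; ring
        simpa [mul_add] using e3)
  have hc : ∀ p ∈ boxSet I.ε₁ I.τ, ContMDiffAt 𝓘(ℝ, ℝ × ℝ × ℝ) (𝓡 3) ∞ I.inner.coord p :=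
    fun p hp => I.contMDiffAt_innerCoord hp
  have hαev : ∀ p ∈ boxSet I.ε₁ I.τ,
      pullbackForm α' I.inner.coord =ᶠ[𝓝 p] fun q => B' q • (ρ' q • dS + dW) := fun p hp => by
    filter_upwards [(isOpen_boxSet I.ε₁ I.τ).mem_nhds hp] with q hq using hα'L q hq
  have hβev : ∀ p ∈ boxSet I.ε₁ I.τ,
      pullbackForm β' I.inner.coord =ᶠ[𝓝 p] fun q => A' q • (dS + σ' q • dW) := fun p hp => by
    filter_upwards [(isOpen_boxSet I.ε₁ I.τ).mem_nhds hp] with q hq using hβ'L q hq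
  have hcases : ∀ x : I.Surgered, (∃ p ∈ boxSet I.ε₁ I.τ, I.inner.coord p = x) ∨
      x ∉ I.inner.target := fun x => by
    by_cases hx : x ∈ I.inner.target
    · exact Or.inl (hbox.exists_coord hx)
    · exact Or.inr hx
  have hαeq : ∀ x ∉ I.inner.target, α' x = I.form α x := fun x hx => (hα'o x hx).self_of_nhds
  have hβeq : ∀ x ∉ I.inner.target, β' x = I.form β x := fun x hx => (hβ'o x hx).self_of_nhds
  refine ⟨α', β', hα's, hβ's, fun x => ?_, fun x => ?_, fun x => ?_,
    ⟨isSmoothVectorField_field hX.1 h.flow, fun x => ⟨(hX.2 (x : M)).1, ?_⟩⟩, fun x hx => ?_⟩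
  · rcases hcases x with ⟨p, hp, rfl⟩ | hx
    · refine isContactAt_of_one (inner_positive h.oriented hp) ?_
      have := contactVolume_rho (isSmoothOneForm_iff.1 hα's _) (hc p hp) (hαev p hp)
        ((hsm p hp).2.1.differentiableAt (by simp)) ((hsm p hp).2.2.1.differentiableAt (by simp))
      refine lt_of_lt_of_eq ?_ (congrArg (fun r => -ς * r) this).symm
      have h1 := (hne p hp).2.2.2.1
      have h2 : 0 < B' p ^ 2 := by have := (hne p hp).2.1; positivity
      have := mul_pos h2 h1
      linarith
    · exact isContactAt_of_eventuallyEq hα (hnot x hx) (hα'o x hx) hα's (hαc (x : M))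
  · rcases hcases x with ⟨p, hp, rfl⟩ | hx
    · refine isContactAt_of_one (inner_positive h.oriented hp) ?_
      have := contactVolume_sigma (isSmoothOneForm_iff.1 hβ's _) (hc p hp) (hβev p hp)
        ((hsm p hp).1.differentiableAt (by simp)) ((hsm p hp).2.2.2.differentiableAt (by simp))
      refine lt_of_lt_of_eq ?_ (congrArg (fun r => ς * r) this).symm
      have h1 := (hne p hp).2.2.2.2
      have h2 : 0 < A' p ^ 2 := by have := (hne p hp).1; positivity
      have := mul_pos h2 h1
      linarith
    · exact isContactAt_of_eventuallyEq hβ (hnot x hx) (hβ'o x hx) hβ's (hβc (x : M))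
  · rcases hcases x with ⟨p, hp, rfl⟩ | hx
    · rw [LinearIndependent.pair_iff]
      intro a b hab
      have e : ∀ v, a * (B' p • (ρ' p • dS + dW)) v + b * (A' p • (dS + σ' p • dW)) v = 0 := by
        intro v
        rw [← mfderiv_inner_apply_eq (hα'L p hp) v, ← mfderiv_inner_apply_eq (hβ'L p hp) v]
        exact congrArg (fun L : E3 →L[ℝ] ℝ => L (I.inner.vec p v)) hab
      have eS := e vecS
      have eW := e vecW
      simp at eS eW
      obtain ⟨hA0, hB0, hlt, -⟩ := hne p hp
      have h1 : a * B' p * (1 - ρ' p * σ' p) = 0 := by linear_combination eW - σ' p * eS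
      have ha : a = 0 := by
        rcases mul_eq_zero.1 h1 with h1 | h1
        · exact (mul_eq_zero.1 h1).resolve_right hB0
        · linarith
      rw [ha] at eS
      exact ⟨ha, by simpa [hA0] using eS⟩
    · rw [hαeq x hx, hβeq x hx]; exact hli (x : M)
  · rcases hcases x with ⟨p, hp, rfl⟩ | hx
    · rw [← inner_flow h.flow hp, mfderiv_inner_apply_eq (hα'L p hp) vecT,
        mfderiv_inner_apply_eq (hβ'L p hp) vecT]
      simp
    · rw [hαeq x hx, hβeq x hx]; exact (hX.2 (x : M)).2
  · have hx' : x ∉ I.inner.target := by rw [I.inner_target]; exact hx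
    exact ⟨hαeq x hx', hβeq x hx'⟩

end SurgeryInput

end NewForms

/-! ### Solid tori in a box -/

section SolidTorusInBox

variable {M : Type u} [TopologicalSpace M] [ChartedSpace E3 M] [IsManifold (𝓡 3) ∞ M]
  {Φ : AnnulusBox M} {ε₁ τ δ : ℝ}

/-- The coordinates `(z, w, t)` of the points of a solid torus. -/
def torusToBox (δ : ℝ) (c : Circle) (p : Circle × ℂ) : Circle × ℝ × ℝ :=
  (p.1 * c, δ * p.2.re, -(δ * p.2.im))

def boxToTorus (δ : ℝ) (c : Circle) (p : Circle × ℝ × ℝ) : Circle × ℂ :=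
  (p.1 * c⁻¹, Complex.equivRealProdCLM.symm (p.2.1 / δ, -(p.2.2 / δ)))

theorem boxToTorus_torusToBox (hδ : 0 < δ) (c : Circle) (p : Circle × ℂ) :
    boxToTorus δ c (torusToBox δ c p) = p := by
  refine Prod.ext ?_ (Complex.ext ?_ ?_)
  · simp [boxToTorus, torusToBox]
  · simp [boxToTorus, torusToBox]; field_simp
  · simp [boxToTorus, torusToBox]; field_simp

theorem torusToBox_boxToTorus (hδ : 0 < δ) (c : Circle) (p : Circle × ℝ × ℝ) :
    torusToBox δ c (boxToTorus δ c p) = p := by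
  refine Prod.ext ?_ (Prod.ext ?_ ?_)
  · simp [boxToTorus, torusToBox]
  · simp [boxToTorus, torusToBox]; field_simp
  · simp [boxToTorus, torusToBox]; field_simp

theorem contMDiff_torusToBox (δ : ℝ) (c : Circle) :
    ContMDiff ((𝓡 1).prod 𝓘(ℝ, ℂ)) boxModel ∞ (torusToBox δ c) := by
  have h1 : ContDiff ℝ ∞ (fun y : ℂ => δ * y.re) := contDiff_const.mul Complex.reCLM.contDiff
  have h2 : ContDiff ℝ ∞ (fun y : ℂ => -(δ * y.im)) := (contDiff_const.mul Complex.imCLM.contDiff).neg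
  exact (contMDiff_fst.mul contMDiff_const).prodMk
    ((h1.contMDiff.comp contMDiff_snd).prodMk (h2.contMDiff.comp contMDiff_snd))

theorem contMDiff_boxToTorus (δ : ℝ) (c : Circle) :
    ContMDiff boxModel ((𝓡 1).prod 𝓘(ℝ, ℂ)) ∞ (boxToTorus δ c) := by
  have h1 : ContDiff ℝ ∞ (fun w : ℝ => w / δ) := contDiff_id.div_const _
  have h2 : ContDiff ℝ ∞ (fun w : ℝ => -(w / δ)) := (contDiff_id.div_const _).neg
  have h3 : ContMDiff boxModel 𝓘(ℝ, ℝ × ℝ) ∞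
      (fun p : Circle × ℝ × ℝ => (p.2.1 / δ, -(p.2.2 / δ))) :=
    (h1.contMDiff.comp (contMDiff_fst.comp contMDiff_snd)).prodMk_space
      (h2.contMDiff.comp (contMDiff_snd.comp contMDiff_snd))
  exact (contMDiff_fst.mul contMDiff_const).prodMk
    (Complex.equivRealProdCLM.symm.contDiff.contMDiff.comp h3)

theorem IsProductBox.torusToBox_mem (h : IsProductBox Φ ε₁ τ) (hδ : 0 < δ) (hδε : δ ≤ ε₁) (hδτ : δ ≤ τ)
    (c : Circle) {p : Circle × ℂ} (hp : ‖p.2‖ < 1) : torusToBox δ c p ∈ Φ.source := by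
  have h1 := (Complex.abs_re_le_norm p.2).trans_lt hp
  have h2 := (Complex.abs_im_le_norm p.2).trans_lt hp
  refine h.mem_source.2 ⟨?_, ?_⟩
  · simp only [torusToBox, abs_mul, abs_of_pos hδ]; nlinarith
  · simp only [torusToBox, abs_neg, abs_mul, abs_of_pos hδ]; nlinarith

/-- The solid torus of radius `δ` around the core of a box. -/
def IsProductBox.torus (h : IsProductBox Φ ε₁ τ) (hδ : 0 < δ) (hδε : δ ≤ ε₁) (hδτ : δ ≤ τ)
    (c : Circle) : SolidTorus M where
  toFun p := Φ (torusToBox δ c p)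
  invFun x := boxToTorus δ c (Φ.toPartialEquiv.symm x)
  source := {p : Circle × ℂ | ‖p.2‖ < 1}
  target := Φ.target ∩ Φ.toPartialEquiv.symm ⁻¹' {p | ‖(boxToTorus δ c p).2‖ < 1}
  map_source' p hp := by
    have h1 := h.torusToBox_mem hδ hδε hδτ c hp
    refine ⟨Φ.mem_target h1, ?_⟩
    rw [Set.mem_preimage, Φ.symm_apply h1]
    show ‖(boxToTorus δ c (torusToBox δ c p)).2‖ < 1
    rw [boxToTorus_torusToBox hδ]; exact hp
  map_target' x hx := hx.2
  left_inv' p hp := by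
    rw [Φ.symm_apply (h.torusToBox_mem hδ hδε hδτ c hp), boxToTorus_torusToBox hδ]
  right_inv' x hx := by
    rw [torusToBox_boxToTorus hδ]; exact Φ.right_inv' hx.1
  open_source := isOpen_lt (f := fun p : Circle × ℂ => ‖p.2‖) (by fun_prop) continuous_const
  open_target := by
    refine Φ.contMDiffOn_invFun.continuousOn.isOpen_inter_preimage Φ.open_target ?_
    exact isOpen_lt ((contMDiff_boxToTorus δ c).continuous.snd.norm) continuous_const
  contMDiffOn_toFun := by
    refine ContMDiffOn.comp (t := Φ.source) Φ.contMDiffOn_toFun (contMDiff_torusToBox δ c).contMDiffOn ?_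
    exact fun p hp => h.torusToBox_mem hδ hδε hδτ c hp
  contMDiffOn_invFun := by
    have h1 : ContMDiffOn (𝓡 3) boxModel ∞ Φ.toPartialEquiv.symm Φ.target := Φ.contMDiffOn_invFun
    exact (contMDiff_boxToTorus δ c).contMDiffOn.comp (t := Set.univ) (h1.mono Set.inter_subset_left)
      (Set.subset_univ _)

/-- The linear map from the coordinates of the solid torus to those of the box. -/
def torusLinear (δ : ℝ) : ℝ × ℂ →L[ℝ] ℝ × ℝ × ℝ :=
  (ContinuousLinearMap.fst ℝ ℝ ℂ).prod
    ((δ • Complex.reCLM.comp (ContinuousLinearMap.snd ℝ ℝ ℂ)).prod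
      (-(δ • Complex.imCLM.comp (ContinuousLinearMap.snd ℝ ℝ ℂ))))

theorem IsProductBox.torus_vec (h : IsProductBox Φ ε₁ τ) (hδ : 0 < δ) (hδε : δ ≤ ε₁) (hδτ : δ ≤ τ)
    {p : ℝ × ℂ} (hp : ‖p.2‖ < 1) :
    (h.torus hδ hδε hδτ 1).coord p = Φ.coord (torusLinear δ p) ∧ torusLinear δ p ∈ boxSet ε₁ τ ∧
      ∀ v : ℝ × ℂ, ((h.torus hδ hδε hδτ 1).vec p v : E3) = Φ.vec (torusLinear δ p) (torusLinear δ v) := by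
  have hc : (h.torus hδ hδε hδτ 1).coord = Φ.coord ∘ torusLinear δ := by
    funext p
    show Φ (torusToBox δ 1 (Circle.exp p.1, p.2)) = Φ (Circle.exp p.1, δ * p.2.re, -(δ * p.2.im))
    simp [torusToBox]
  have hm : torusLinear δ p ∈ boxSet ε₁ τ := by
    have := h.torusToBox_mem hδ hδε hδτ 1 (p := (Circle.exp p.1, p.2)) hp
    exact h.mem_source.1 this
  refine ⟨congrFun hc p, hm, fun v => ?_⟩
  have h1 := HasMFDerivAt.comp p
    ((Φ.contMDiffAt_coord (h.expCoord_mem hm)).mdifferentiableAt (by simp)).hasMFDerivAt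
    (torusLinear δ).hasFDerivAt.hasMFDerivAt
  rw [← hc] at h1
  exact congrArg (fun L : ℝ × ℂ →L[ℝ] E3 => L v) h1.mfderiv

end SolidTorusInBox

/-! ### The unwinding function -/

section Unwinding

variable {g : ℝ → ℝ} {ε : ℝ}

/-- A radial transition function, from `0` near the disc of radius `ε` to `1` outside of the disc of
radius `2ε`. -/
def radialCut (ε : ℝ) (y : ℝ × ℝ) : ℝ :=
  Real.smoothTransition ((y.1 ^ 2 + y.2 ^ 2) / ε ^ 2 - 2)

theorem contDiff_radialCut : ContDiff ℝ ∞ (radialCut ε) :=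
  Real.smoothTransition.contDiff.comp
    ((((contDiff_fst.pow 2).add (contDiff_snd.pow 2)).div_const _).sub contDiff_const)

theorem radialCut_eq_zero (hε : 0 < ε) {y : ℝ × ℝ} (h : y.1 ^ 2 + y.2 ^ 2 ≤ 2 * ε ^ 2) :
    radialCut ε y = 0 :=
  Real.smoothTransition.zero_of_nonpos (by
    rw [sub_nonpos, div_le_iff₀ (by positivity)]; exact h)

theorem radialCut_eq_one (hε : 0 < ε) {y : ℝ × ℝ} (h : 3 * ε ^ 2 ≤ y.1 ^ 2 + y.2 ^ 2) :
    radialCut ε y = 1 :=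
  Real.smoothTransition.one_of_one_le (by
    have : 3 ≤ (y.1 ^ 2 + y.2 ^ 2) / ε ^ 2 := by rw [le_div_iff₀ (by positivity)]; exact h
    linarith)

/-- The displacement, on both sides of the annulus. -/
def sideAngle (g : ℝ → ℝ) (ε : ℝ) (y : ℝ × ℝ) : ℝ := if 0 < y.2 then g (y.1 / ε) else 2 * Real.pi

/-- The complex coordinate `w - i t`. -/
def planeCoord (y : ℝ × ℝ) : ℂ := Complex.equivRealProdCLM.symm (y.1, -y.2)

theorem planeCoord_re (y : ℝ × ℝ) : (planeCoord y).re = y.1 := by simp [planeCoord]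

theorem planeCoord_im (y : ℝ × ℝ) : (planeCoord y).im = -y.2 := by simp [planeCoord]

theorem contDiff_planeCoord : ContDiff ℝ ∞ planeCoord :=
  Complex.equivRealProdCLM.symm.contDiff.comp (contDiff_fst.prodMk contDiff_snd.neg)

/-- The angle which interpolates between the polar angle and the displacement of the shear. -/
def unwindAngle (g : ℝ → ℝ) (ε : ℝ) (y : ℝ × ℝ) : ℝ :=
  (1 - radialCut ε y) * (Complex.arg (planeCoord y) + Real.pi) + radialCut ε y * sideAngle g ε y

theorem contDiffAt_arg {z : ℂ} (hz : z ∈ Complex.slitPlane) : ContDiffAt ℝ ∞ Complex.arg z := by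
  have h1 : ContDiffAt ℝ ∞ Complex.log z := (Complex.contDiffAt_log hz).restrict_scalars ℝ
  have h2 : ContDiffAt ℝ ∞ (fun z => (Complex.log z).im) z :=
    Complex.imCLM.contDiff.contDiffAt.comp z h1
  simpa [Complex.log_im] using h2

/-- Locally, away from the origin, the unwinding angle is smooth up to multiples of `2π`. -/
theorem exists_smooth_unwindAngle (hg : IsShearProfile g) (hε : 0 < ε) {y : ℝ × ℝ} (hy : y ≠ 0) :
    ∃ Θ : ℝ × ℝ → ℝ, ContDiffAt ℝ ∞ Θ y ∧
      ∀ᶠ z in 𝓝 y, Circle.exp (unwindAngle g ε z) = Circle.exp (Θ z) := by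
  have hχ := (contDiff_radialCut (ε := ε)).contDiffAt (x := y)
  have hnear : y.2 = 0 → |y.1| ≤ ε → ∀ᶠ z in 𝓝 y, radialCut ε z = 0 := by
    intro h2 h1
    have h3 : y.1 ^ 2 + y.2 ^ 2 < 2 * ε ^ 2 := by
      rw [h2]
      have : y.1 ^ 2 ≤ ε ^ 2 := sq_le_sq' (by linarith [(abs_le.1 h1).1]) (abs_le.1 h1).2
      nlinarith
    have h4 : Continuous fun z : ℝ × ℝ => z.1 ^ 2 + z.2 ^ 2 := by fun_prop
    filter_upwards [h4.continuousAt.eventually_lt_const h3] with z hz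
    exact radialCut_eq_zero hε (le_of_lt hz)
  by_cases hs : planeCoord y ∈ Complex.slitPlane
  · have harg : ContDiffAt ℝ ∞ (fun z => Complex.arg (planeCoord z) + Real.pi) y :=
      (ContDiffAt.comp y (contDiffAt_arg hs) contDiff_planeCoord.contDiffAt).add contDiffAt_const
    have hside : ∀ Θ₁ : ℝ × ℝ → ℝ, ContDiffAt ℝ ∞ Θ₁ y → (∀ᶠ z in 𝓝 y, sideAngle g ε z = Θ₁ z) →
        ∃ Θ : ℝ × ℝ → ℝ, ContDiffAt ℝ ∞ Θ y ∧
          ∀ᶠ z in 𝓝 y, Circle.exp (unwindAngle g ε z) = Circle.exp (Θ z) := by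
      intro Θ₁ h1 h2
      refine ⟨fun z => (1 - radialCut ε z) * (Complex.arg (planeCoord z) + Real.pi) +
        radialCut ε z * Θ₁ z, ((contDiffAt_const.sub hχ).mul harg).add (hχ.mul h1), ?_⟩
      filter_upwards [h2] with z hz
      rw [unwindAngle, hz]
    rcases lt_trichotomy y.2 0 with h | h | h
    · refine hside (fun _ => 2 * Real.pi) contDiffAt_const ?_
      filter_upwards [continuousAt_snd.eventually_lt_const h] with z hz
      exact if_neg hz.not_gt
    · have hw : 0 < y.1 := by
        rw [Complex.mem_slitPlane_iff, planeCoord_re, planeCoord_im, h] at hs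
        simpa using hs
      rcases le_or_gt y.1 ε with h1 | h1
      · refine ⟨_, harg, ?_⟩
        filter_upwards [hnear h (by rwa [abs_of_pos hw])] with z hz
        rw [unwindAngle, hz]; simp
      · refine hside (fun _ => 2 * Real.pi) contDiffAt_const ?_
        filter_upwards [continuousAt_fst.eventually_const_lt h1] with z hz
        rw [sideAngle]
        split_ifs
        · exact hg.2.2.2 _ ((one_le_div hε).2 (le_of_lt hz))
        · rfl
    · refine hside (fun z => g (z.1 / ε)) ?_ ?_
      · exact (hg.1.comp (contDiff_fst.div_const _)).contDiffAt
      · filter_upwards [continuousAt_snd.eventually_const_lt h] with z hz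
        exact if_pos hz
  · rw [Complex.mem_slitPlane_iff, planeCoord_re, planeCoord_im] at hs
    push Not at hs
    have h2 : y.2 = 0 := by simpa using hs.2
    have h1 : y.1 < 0 := lt_of_le_of_ne hs.1 fun h => hy (Prod.ext h h2)
    have hneg : -planeCoord y ∈ Complex.slitPlane := by
      rw [Complex.mem_slitPlane_iff]; left
      rw [Complex.neg_re, planeCoord_re]; linarith
    have harg : ContDiffAt ℝ ∞ (fun z => Complex.arg (-planeCoord z)) y :=
      ContDiffAt.comp y (contDiffAt_arg hneg) contDiff_planeCoord.neg.contDiffAt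
    refine ⟨fun z => (1 - radialCut ε z) * Complex.arg (-planeCoord z),
      (contDiffAt_const.sub hχ).mul harg, ?_⟩
    have hside : ∀ᶠ z in 𝓝 y, radialCut ε z = 0 ∨ z.1 ≤ -ε := by
      rcases le_or_gt (-ε) y.1 with h | h
      · filter_upwards [hnear h2 (abs_le.2 ⟨h, by linarith⟩)] with z hz using Or.inl hz
      · filter_upwards [continuousAt_fst.eventually_lt_const h] with z hz using Or.inr (le_of_lt hz)
    filter_upwards [hside, continuousAt_fst.eventually_lt_const h1] with z hz hz1
    rcases le_or_gt z.2 0 with ht | ht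
    · have h3 : Complex.arg (planeCoord z) = Complex.arg (-planeCoord z) + Real.pi := by
        rcases ht.lt_or_eq with ht | ht
        · rw [Complex.arg_neg_eq_arg_sub_pi_of_im_pos (by rw [planeCoord_im]; linarith)]; ring
        · have h4 : planeCoord z = (z.1 : ℂ) := by
            apply Complex.ext
            · rw [planeCoord_re]; simp
            · rw [planeCoord_im, ht]; simp
          rw [h4, Complex.arg_ofReal_of_neg hz1, ← Complex.ofReal_neg,
            Complex.arg_ofReal_of_nonneg (by linarith)]; ring
      have h5 : unwindAngle g ε z = (1 - radialCut ε z) * Complex.arg (-planeCoord z) + 2 * Real.pi := by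
        rw [unwindAngle, sideAngle, if_neg ht.not_gt, h3]; ring
      rw [h5, Circle.exp_add, Circle.exp_two_pi, mul_one]
    · have h3 : Complex.arg (-planeCoord z) = Complex.arg (planeCoord z) + Real.pi :=
        Complex.arg_neg_eq_arg_add_pi_of_im_neg (by rw [planeCoord_im]; linarith)
      congr 1
      rw [unwindAngle, sideAngle, if_pos ht, h3]
      rcases hz with hz | hz
      · rw [hz]; ring
      · rw [hg.2.2.1 _ (by rw [div_le_iff₀ hε]; linarith)]; ring

end Unwinding

/-! ### The surgered manifold as a Dehn surgery -/

section DehnSurgery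

variable {M : Type u} [TopologicalSpace M] [ChartedSpace E3 M] [IsManifold (𝓡 3) ∞ M]

namespace SurgeryInput

variable (I : SurgeryInput M)

/-- The rotation which unwinds the shear away from the core. -/
def unwind (y : ℝ × ℝ) : Circle := Circle.exp (((-I.q : ℤ) : ℝ) * unwindAngle I.g I.ε y)

theorem exists_smooth_unwind {y : ℝ × ℝ} (hy : y ≠ 0) :
    ∃ h : ℝ × ℝ → ℝ, ContDiffAt ℝ ∞ h y ∧ ∀ᶠ z in 𝓝 y, I.unwind z = Circle.exp (h z) := by
  obtain ⟨Θ, hΘ, h⟩ := exists_smooth_unwindAngle I.profile I.pos hy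
  refine ⟨fun z => ((-I.q : ℤ) : ℝ) * Θ z, contDiffAt_const.mul hΘ, ?_⟩
  filter_upwards [h] with z hz
  rw [unwind, Circle.exp_intCast_mul, Circle.exp_intCast_mul, hz]

theorem contMDiffAt_unwind {y : ℝ × ℝ} (hy : y ≠ 0) :
    ContMDiffAt (𝓘(ℝ, ℝ).prod 𝓘(ℝ, ℝ)) (𝓡 1) ∞ I.unwind y := by
  obtain ⟨h, hh, he⟩ := I.exists_smooth_unwind hy
  have h1 : ContMDiffAt (𝓘(ℝ, ℝ).prod 𝓘(ℝ, ℝ)) 𝓘(ℝ, ℝ) ∞ h y := by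
    have := hh.contMDiffAt
    rwa [modelWithCornersSelf_prod, ← chartedSpaceSelf_prod] at this
  exact (contMDiff_circleExp.contMDiffAt.comp y h1).congr_of_eventuallyEq he

/-- The rotation which relates the old box to the new one, away from the core. -/
abbrev unwindRot : ℝ × ℝ → Circle := I.unwind * I.rot

theorem unwindRot_eq_one {y : ℝ × ℝ} (h : 3 * I.ε ^ 2 ≤ y.1 ^ 2 + y.2 ^ 2) : I.unwindRot y = 1 := by
  rw [unwindRot, Pi.mul_apply, unwind, rot, shearRotation, unwindAngle, radialCut_eq_one I.pos h,
    sideAngle]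
  split_ifs with ht
  · rw [← Circle.exp_add]
    push_cast
    rw [← Circle.exp_zero]; congr 1; ring
  · rw [mul_one, sub_self, zero_mul, zero_add, one_mul, ← Circle.exp_two_pi_mul_int (-I.q), mul_comm]

theorem unwind_near {y : ℝ × ℝ} (h : y.1 ^ 2 + y.2 ^ 2 ≤ 2 * I.ε ^ 2) :
    I.unwind y = (Circle.exp (Complex.arg (planeCoord y)) * Circle.exp Real.pi) ^ (-I.q) := by
  rw [unwind, Circle.exp_intCast_mul, unwindAngle, radialCut_eq_zero I.pos h, ← Circle.exp_add]
  congr 2; ring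

/-- The core of the box. -/
def core : Set M := I.Φ '' {p : Circle × ℝ × ℝ | p.2 ∈ ({0} : Set (ℝ × ℝ))}

theorem zero_bound {y : ℝ × ℝ} (hy : y ∈ ({0} : Set (ℝ × ℝ))) : |y.1| < I.ε₁ ∧ |y.2| < I.τ := by
  rw [Set.mem_singleton_iff.1 hy]
  exact ⟨by simpa using I.pos.trans I.lt, by simpa using I.τ_pos⟩

theorem twist_mem_core {k : ℝ × ℝ → Circle} {x : M} : twist I.Φ k x ∈ I.core ↔ x ∈ I.core :=
  I.box.twist_mem_image fun _ hy => I.zero_bound hy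

theorem ne_zero_of_notMem_core {p : Circle × ℝ × ℝ} (h : I.Φ p ∉ I.core) : p.2 ≠ 0 :=
  fun h0 => h ⟨p, h0, rfl⟩

variable [T2Space M]

theorem isClosed_core : IsClosed I.core :=
  (I.isCompact_image isCompact_singleton fun _ hy => I.zero_bound hy).isClosed

/-- The core, as a subset of the new manifold. -/
def coreNew : Set I.Surgered := {x | (x : M) ∈ I.core}

theorem isClosed_coreNew : IsClosed I.coreNew := by
  have h1 : I.coreNew = I.inner '' {p : Circle × ℝ × ℝ | p.2 ∈ ({0} : Set (ℝ × ℝ))} := by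
    ext x
    constructor
    · intro hx
      obtain ⟨p, hp, he⟩ := (I.twist_mem_core (k := I.rot⁻¹)).2 hx
      refine ⟨p, hp, ?_⟩
      exact (congrArg (twist I.Φ I.rot) he).trans (I.box.twist_twist_inv (x : M))
    · rintro ⟨p, hp, rfl⟩
      exact (I.twist_mem_core (k := I.rot)).2 ⟨p, hp, rfl⟩
  have h2 : {p : Circle × ℝ × ℝ | p.2 ∈ ({0} : Set (ℝ × ℝ))} = Set.univ ×ˢ {0} := by ext; simp
  rw [h1, h2]
  refine ((isCompact_univ.prod isCompact_singleton).image_of_continuousOn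
    (I.inner.contMDiffOn_toFun.continuousOn.mono ?_)).isClosed
  rintro p ⟨-, hp⟩
  rw [I.inner_source]
  exact I.box.mem_source.2 (I.zero_bound hp)

/-- Away from a compact part of the box, the unwinding twist is the identity. -/
theorem unwindRot_far (h1 : 2 * I.ε ≤ I.ε₁) (h2 : 2 * I.ε ≤ I.τ) {x : M} (hx : x ∉ I.Φ.target) :
    (∀ᶠ y in 𝓝 x, twist I.Φ I.unwindRot y = y) ∧
      ∀ᶠ y : I.Surgered in 𝓝 (x : I.Surgered), twist I.Φ I.unwindRot⁻¹ (y : M) = y := by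
  have hε := I.pos
  let S : Set (ℝ × ℝ) := Set.Icc (-(7 / 4 * I.ε)) (7 / 4 * I.ε) ×ˢ
    Set.Icc (-(7 / 4 * I.ε)) (7 / 4 * I.ε)
  have hS : IsCompact S := isCompact_Icc.prod isCompact_Icc
  have hSb : ∀ y ∈ S, |y.1| < I.ε₁ ∧ |y.2| < I.τ := by
    rintro y ⟨hy1, hy2⟩
    exact ⟨(abs_le.2 hy1).trans_lt (by linarith), (abs_le.2 hy2).trans_lt (by linarith)⟩
  have hK := I.isCompact_image hS hSb
  have hfar : ∀ y ∉ S, I.unwindRot y = 1 := by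
    intro y hy
    refine I.unwindRot_eq_one ?_
    rw [Set.mem_prod, not_and_or] at hy
    rcases hy with hy | hy
    all_goals
      rw [Set.mem_Icc, ← abs_le, not_le] at hy
      have := pow_lt_pow_left₀ hy (by positivity) (n := 2) (by simp)
      rw [sq_abs] at this
      nlinarith [sq_nonneg y.1, sq_nonneg y.2, sq_nonneg I.ε]
  have key : ∀ (k : ℝ × ℝ → Circle), (∀ y ∉ S, k y = 1) →
      ∀ y ∉ I.Φ '' {p : Circle × ℝ × ℝ | p.2 ∈ S}, twist I.Φ k y = y := by
    intro k hk y hy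
    by_cases hyt : y ∈ I.Φ.target
    · obtain ⟨p, hp, rfl⟩ := I.Φ.exists_eq hyt
      exact twist_eq_self hp (hk _ fun h => hy ⟨p, h, rfl⟩)
    · exact twist_of_notMem hyt
  have hxK : x ∉ I.Φ '' {p : Circle × ℝ × ℝ | p.2 ∈ S} := by
    rintro ⟨p, hp, rfl⟩
    exact hx (I.Φ.mem_target (I.box.mem_source.2 (hSb _ hp)))
  have hxC : x ∉ I.Φ.annulus I.ε := fun h => hx (I.annulus_subset h)
  refine ⟨?_, ?_⟩
  · filter_upwards [hK.isClosed.isOpen_compl.mem_nhds hxK] with y hy using key _ hfar y hy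
  · have hc : ContinuousAt (I.gluing.loc false) (x : I.Surgered) :=
      (I.gluing.contMDiffAt_loc (i := false) hxC).continuousAt
    have h3 : ∀ᶠ y : I.Surgered in 𝓝 (x : I.Surgered), I.gluing.loc false y ∉
        I.Φ '' {p : Circle × ℝ × ℝ | p.2 ∈ S} :=
      hc.preimage_mem_nhds (hK.isClosed.isOpen_compl.mem_nhds hxK)
    filter_upwards [h3] with y hy
    refine key _ (fun z hz => ?_) _ hy
    rw [Pi.inv_apply, hfar z hz, inv_one]

theorem dehn_eq {p : Circle × ℝ × ℝ} (hp : p ∈ I.Φ.source) :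
    twist I.Φ I.unwindRot (I.Φ p) = I.inner (twistMap I.unwind p) := by
  have h0 : twist I.Φ I.unwindRot (I.Φ p) = twist I.Φ I.rot (I.Φ (twistMap I.unwind p)) := by
    rw [twist_apply hp, twist_apply (I.box.twistMap_mem.2 hp)]
    simp [unwindRot, twistMap, mul_assoc]
  exact h0

theorem dehn_symm_eq {p : Circle × ℝ × ℝ} (hp : p ∈ I.Φ.source) :
    twist I.Φ I.unwindRot⁻¹ (I.inner p : M) = I.Φ (twistMap I.unwind⁻¹ p) := by
  have h1 : (I.inner p : M) = twist I.Φ I.rot (I.Φ p) := rfl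
  rw [h1, I.box.twist_twist, twist_apply hp]
  congr 2
  simp [unwindRot, mul_inv_rev]

/-- The twist which unwinds the shear away from the core, as a map to the new manifold. -/
def dehnMap (x : M) : I.Surgered := (show M from twist I.Φ I.unwindRot x)

theorem contMDiffAt_dehn (h1 : 2 * I.ε ≤ I.ε₁) (h2 : 2 * I.ε ≤ I.τ) {x : M} (hx : x ∉ I.core) :
    ContMDiffAt (𝓡 3) (𝓡 3) ∞ I.dehnMap x := by
  by_cases hxt : x ∈ I.Φ.target
  · obtain ⟨p, hp, rfl⟩ := I.Φ.exists_eq hxt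
    have k1 : ContMDiffAt (𝓡 3) boxModel ∞ I.Φ.toPartialEquiv.symm (I.Φ p) :=
      I.Φ.contMDiffOn_invFun.contMDiffAt (I.Φ.open_target.mem_nhds (I.Φ.mem_target hp))
    have k2 : ContMDiffAt boxModel boxModel ∞ (twistMap I.unwind) (I.Φ.toPartialEquiv.symm (I.Φ p)) := by
      rw [I.Φ.symm_apply hp]
      exact contMDiffAt_twistMap (I.contMDiffAt_unwind (I.ne_zero_of_notMem_core hx))
    have k3 : ContMDiffAt boxModel (𝓡 3) ∞ I.inner (twistMap I.unwind (I.Φ.toPartialEquiv.symm (I.Φ p))) := by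
      rw [I.Φ.symm_apply hp]
      refine I.inner.contMDiffOn_toFun.contMDiffAt (I.inner.open_source.mem_nhds ?_)
      rw [I.inner_source]; exact I.box.twistMap_mem.2 hp
    have k4 : ContMDiffAt (𝓡 3) boxModel ∞ (fun x => twistMap I.unwind (I.Φ.toPartialEquiv.symm x))
        (I.Φ p) := ContMDiffAt.comp (I' := boxModel) (I.Φ p) k2 k1
    have k5 : ContMDiffAt (𝓡 3) (𝓡 3) ∞
        (fun x => I.inner (twistMap I.unwind (I.Φ.toPartialEquiv.symm x))) (I.Φ p) :=
      ContMDiffAt.comp (I' := boxModel) (I.Φ p) k3 k4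
    refine k5.congr_of_eventuallyEq ?_
    filter_upwards [I.Φ.open_target.mem_nhds (I.Φ.mem_target hp)] with y hy
    obtain ⟨p', hp', rfl⟩ := I.Φ.exists_eq hy
    rw [I.Φ.symm_apply hp']; exact I.dehn_eq hp'
  · refine (I.contMDiffAt_outer fun h => hxt (I.annulus_subset h)).congr_of_eventuallyEq ?_
    filter_upwards [(I.unwindRot_far h1 h2 hxt).1] with y hy using hy

theorem contMDiffAt_dehn_symm (h1 : 2 * I.ε ≤ I.ε₁) (h2 : 2 * I.ε ≤ I.τ) {x : I.Surgered}
    (hx : (x : M) ∉ I.core) :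
    ContMDiffAt (𝓡 3) (𝓡 3) ∞ (fun y : I.Surgered => twist I.Φ I.unwindRot⁻¹ (y : M)) x := by
  by_cases hxt : x ∈ I.inner.target
  · obtain ⟨p, hp, rfl⟩ := I.inner.exists_eq hxt
    have hp' := hp
    rw [I.inner_source] at hp'
    have hp0 : p.2 ≠ 0 := fun h0 => hx ((I.twist_mem_core (k := I.rot)).2 ⟨p, h0, rfl⟩)
    have k1 : ContMDiffAt (𝓡 3) boxModel ∞ I.inner.toPartialEquiv.symm (I.inner p) :=
      I.inner.contMDiffOn_invFun.contMDiffAt (I.inner.open_target.mem_nhds (I.inner.mem_target hp))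
    have k2 : ContMDiffAt boxModel boxModel ∞ (twistMap I.unwind⁻¹)
        (I.inner.toPartialEquiv.symm (I.inner p)) := by
      rw [I.inner.symm_apply hp]
      exact contMDiffAt_twistMap (I.contMDiffAt_unwind hp0).inv
    have k3 : ContMDiffAt boxModel (𝓡 3) ∞ I.Φ
        (twistMap I.unwind⁻¹ (I.inner.toPartialEquiv.symm (I.inner p))) := by
      rw [I.inner.symm_apply hp]
      exact I.Φ.contMDiffOn_toFun.contMDiffAt (I.Φ.open_source.mem_nhds (I.box.twistMap_mem.2 hp'))
    have k4 : ContMDiffAt (𝓡 3) boxModel ∞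
        (fun x => twistMap I.unwind⁻¹ (I.inner.toPartialEquiv.symm x)) (I.inner p) :=
      ContMDiffAt.comp (I' := boxModel) (I.inner p) k2 k1
    have k5 : ContMDiffAt (𝓡 3) (𝓡 3) ∞
        (fun x => I.Φ (twistMap I.unwind⁻¹ (I.inner.toPartialEquiv.symm x))) (I.inner p) :=
      ContMDiffAt.comp (I' := boxModel) (I.inner p) k3 k4
    refine k5.congr_of_eventuallyEq ?_
    filter_upwards [I.inner.open_target.mem_nhds (I.inner.mem_target hp)] with y hy
    obtain ⟨p', hp', rfl⟩ := I.inner.exists_eq hy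
    rw [I.inner.symm_apply hp']
    rw [I.inner_source] at hp'
    exact I.dehn_symm_eq hp'
  · have hxt' : (x : M) ∉ I.Φ.target := by rwa [I.inner_target] at hxt
    refine (I.gluing.contMDiffAt_loc (i := false)
      (fun h => hxt' (I.annulus_subset h))).congr_of_eventuallyEq ?_
    filter_upwards [(I.unwindRot_far h1 h2 hxt').2] with y hy using hy

/-- The complement of the core in the old manifold is the complement of the core in the new one. -/
def dehn (h1 : 2 * I.ε ≤ I.ε₁) (h2 : 2 * I.ε ≤ I.τ) : PartialDiffeo3 M I.Surgered where
  toFun := I.dehnMap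
  invFun x := twist I.Φ I.unwindRot⁻¹ (x : M)
  source := I.coreᶜ
  target := I.coreNewᶜ
  map_source' _ hx := fun h => hx (I.twist_mem_core.1 h)
  map_target' _ hx := fun h => hx (I.twist_mem_core.1 h)
  left_inv' _ _ := I.box.twist_inv_twist _
  right_inv' _ _ := I.box.twist_twist_inv _
  open_source := I.isClosed_core.isOpen_compl
  open_target := I.isClosed_coreNew.isOpen_compl
  contMDiffOn_toFun := fun _ hx => (I.contMDiffAt_dehn h1 h2 hx).contMDiffWithinAt
  contMDiffOn_invFun := fun _ hx => (I.contMDiffAt_dehn_symm h1 h2 hx).contMDiffWithinAt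

variable {I} {o : ∀ x : M, Orientation ℝ (TangentSpace (𝓡 3) x) (Fin 3)}

theorem preservesOrientation_dehn (h1 : 2 * I.ε ≤ I.ε₁) (h2 : 2 * I.ε ≤ I.τ)
    (ho : ∀ p ∈ boxSet I.ε₁ I.τ,
      IsPositiveTriple o (I.Φ.coord p) (I.Φ.vec p vecW) (I.Φ.vec p vecS) (I.Φ.vec p vecT)) :
    PreservesOrientation (I.dehn h1 h2) o (I.orient o) := by
  intro x hx u v w huvw
  by_cases hxt : x ∈ I.Φ.target
  · obtain ⟨p, hp, rfl⟩ := I.box.exists_coord hxt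
    have hp0 : p.2 ≠ 0 := I.ne_zero_of_notMem_core (p := expCoord p) hx
    obtain ⟨h, hh, he⟩ := I.exists_smooth_unwind hp0
    have hev : ∀ᶠ q in 𝓝 p, I.dehn h1 h2 (I.Φ.coord q) = I.inner.coord (shearMap h q) := by
      filter_upwards [(isOpen_boxSet I.ε₁ I.τ).mem_nhds hp, continuousAt_snd.eventually he]
        with q hq hq'
      refine (I.dehn_eq (I.expCoord_mem hq)).trans (congrArg I.inner ?_)
      simp only [twistMap, expCoord, shearMap]
      rw [hq', Circle.exp_add]
    have hps : shearMap h p ∈ boxSet I.ε₁ I.τ := hp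
    have k1 := HasMFDerivAt.comp p
      (((I.contMDiffAt_dehn h1 h2 hx).mdifferentiableAt (by simp)).hasMFDerivAt)
      ((I.contMDiffAt_coord hp).mdifferentiableAt (by simp)).hasMFDerivAt
    have k2 := HasMFDerivAt.comp p
      ((I.contMDiffAt_innerCoord hps).mdifferentiableAt (by simp)).hasMFDerivAt
      (hasFDerivAt_shearMap (hh.differentiableAt (by simp))).hasMFDerivAt
    have k3 := hasMFDerivAt_unique k1 (k2.congr_of_eventuallyEq hev)
    have hpos := inner_positive ho hps
    have k4 := isPositiveTriple_shearMap (o := I.orient o) (x := I.inner.coord (shearMap h p))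
      (L := mfderiv 𝓘(ℝ, ℝ × ℝ × ℝ) (𝓡 3) I.inner.coord (shearMap h p))
      (L' := ((mfderiv (𝓡 3) (𝓡 3) (I.dehn h1 h2) (I.Φ.coord p) : E3 →L[ℝ] E3).comp
        (mfderiv 𝓘(ℝ, ℝ × ℝ × ℝ) (𝓡 3) I.Φ.coord p : ℝ × ℝ × ℝ →L[ℝ] E3)))
      (l := fderiv ℝ h p.2)
      (fun v => congrArg (fun L : ℝ × ℝ × ℝ →L[ℝ] E3 => L v) k3) (map_zero _) hpos
    have k5 : IsPositiveTriple (I.orient o) (I.dehn h1 h2 (I.Φ.coord p))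
        (mfderiv (𝓡 3) (𝓡 3) (I.dehn h1 h2) (I.Φ.coord p) (I.Φ.vec p vecW))
        (mfderiv (𝓡 3) (𝓡 3) (I.dehn h1 h2) (I.Φ.coord p) (I.Φ.vec p vecS))
        (mfderiv (𝓡 3) (𝓡 3) (I.dehn h1 h2) (I.Φ.coord p) (I.Φ.vec p vecT)) := by
      have key : ∀ (x y : I.Surgered) (u v w : E3), x = y →
          IsPositiveTriple (I.orient o) y u v w → IsPositiveTriple (I.orient o) x u v w := by
        rintro x y u v w rfl h; exact h
      exact key _ _ _ _ _ hev.self_of_nhds k4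
    exact (ho p hp).map_of_one (mfderiv (𝓡 3) (𝓡 3) (I.dehn h1 h2) (I.Φ.coord p)) k5 huvw
  · have hxC : x ∉ I.Φ.annulus I.ε := fun h => hxt (I.annulus_subset h)
    have k1 : (I.dehn h1 h2 : M → I.Surgered) =ᶠ[𝓝 x] I.outer := by
      filter_upwards [(I.unwindRot_far h1 h2 hxt).1] with y hy using hy
    have k2 := preservesOrientation_outer (o := o) x hxC u v w huvw
    have k3 : ∀ u : E3, (mfderiv (𝓡 3) (𝓡 3) (I.dehn h1 h2) x u : E3) =
        mfderiv (𝓡 3) (𝓡 3) I.outer x u := fun u =>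
      congrArg (fun L : E3 →L[ℝ] E3 => L u) k1.mfderiv_eq
    exact k2.congr k1.self_of_nhds (k3 u) (k3 v) (k3 w)

variable {α : ∀ x : M, TangentSpace (𝓡 3) x →L[ℝ] ℝ} {K : Circle → M}

theorem isContactFramedDehnSurgery (h1 : 2 * I.ε ≤ I.ε₁) (h2 : 2 * I.ε ≤ I.τ)
    (ho : ∀ p ∈ boxSet I.ε₁ I.τ,
      IsPositiveTriple o (I.Φ.coord p) (I.Φ.vec p vecW) (I.Φ.vec p vecS) (I.Φ.vec p vecT))
    (hcore : ∀ z, I.Φ (z, 0, 0) = K z)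
    (hα : ∀ s : ℝ, α (I.Φ.coord (s, 0, 0)) (I.Φ.vec (s, 0, 0) vecW) ≠ 0) :
    IsContactFramedDehnSurgery o α K I.q (I.orient o) := by
  have hε := I.pos
  have e1 : I.ε ≤ I.ε₁ := I.lt.le
  have e2 : I.ε ≤ I.τ := by linarith
  have hKc : Set.range K = I.core := by
    ext x
    constructor
    · rintro ⟨z, rfl⟩; exact ⟨(z, 0, 0), rfl, hcore z⟩
    · rintro ⟨⟨z, y⟩, hp, rfl⟩
      have hy : y = (0, 0) := hp
      exact ⟨z, by rw [hy, hcore]⟩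
  have hlin : ∀ p : ℝ × ℝ × ℝ, ∀ v : ℝ × ℝ × ℝ, I.Φ.vec p v =
      v.1 • I.Φ.vec p vecS + v.2.1 • I.Φ.vec p vecW + v.2.2 • I.Φ.vec p vecT := by
    intro p v
    have h3 : ∀ L : ℝ × ℝ × ℝ →L[ℝ] E3, L v = v.1 • L vecS + v.2.1 • L vecW + v.2.2 • L vecT := by
      intro L
      conv_lhs => rw [vec_eq v]
      simp only [map_add, map_smul]
    exact h3 _
  refine ⟨I.box.torus hε e1 e2 1, I.dehn h1 h2, inner_box.torus hε e1 e2 (Circle.exp Real.pi ^ (-I.q)),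
    rfl, fun z => ?_, fun s y hy => ?_, fun s => ?_, by rw [hKc]; rfl,
    preservesOrientation_dehn h1 h2 ho, rfl, ?_, fun z u r hr hr1 => ?_⟩
  · refine Eq.trans ?_ (hcore z)
    show I.Φ (torusToBox I.ε 1 (z, 0)) = _
    simp [torusToBox]
  · obtain ⟨k1, k2, k3⟩ := I.box.torus_vec hε e1 e2 (p := (s, y)) hy
    set p := torusLinear I.ε (s, y)
    have key : ∀ (x x' : M) (u v w u' v' w' : E3), x = x' → u = u' → v = v' → w = w' →
        IsPositiveTriple o x' u' v' w' → IsPositiveTriple o x u v w := by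
      rintro _ _ _ _ _ _ _ _ rfl rfl rfl rfl h; exact h
    refine key _ _ _ _ _ _ _ _ k1 (k3 _) (k3 _) (k3 _) ?_
    refine (ho p k2).of_matrix !![0, 1, 0; I.ε, 0, 0; 0, 0, -I.ε] ?_ ?_ ?_ ?_
    · rw [Matrix.det_fin_three]; simp; positivity
    all_goals
      refine (hlin p _).trans ?_
      simp [torusLinear]
  · obtain ⟨k1, k2, k3⟩ := I.box.torus_vec hε e1 e2 (p := (s, 0)) (by simp)
    have k0 : torusLinear I.ε (s, 0) = (s, 0, 0) := by simp [torusLinear]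
    rw [k0] at k1 k2 k3
    have key : ∀ (x x' : M) (u u' : E3), x = x' → u = u' →
        (α x : E3 →L[ℝ] ℝ) u = (α x' : E3 →L[ℝ] ℝ) u' := by rintro _ _ _ _ rfl rfl; rfl
    have k4 := key _ _ _ _ k1 (k3 (0, 1))
    refine ne_of_eq_of_ne k4 ?_
    have k5 : I.Φ.vec (s, 0, 0) (torusLinear I.ε (0, 1)) = I.ε • I.Φ.vec (s, 0, 0) vecW := by
      refine (hlin _ _).trans ?_
      simp [torusLinear]
    have k6 := congrArg (α (I.Φ.coord (s, 0, 0))) k5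
    refine ne_of_eq_of_ne k6 ?_
    rw [map_smul]
    exact mul_ne_zero hε.ne' (hα s)
  · refine Set.eq_univ_of_forall fun x => ?_
    by_cases hx : (x : M) ∈ I.core
    · right
      obtain ⟨p, hp, he⟩ := (I.twist_mem_core (k := I.rot⁻¹)).2 hx
      have hp' : p.2 = 0 := hp
      have hps : p ∈ I.inner.source := by
        rw [I.inner_source]; exact I.box.mem_source.2 (I.zero_bound hp)
      have hx' : I.inner p = x := by
        exact (congrArg (twist I.Φ I.rot) he).trans (I.box.twist_twist_inv (x : M))
      rw [← hx']
      refine ⟨I.inner.mem_target hps, ?_⟩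
      rw [Set.mem_preimage, I.inner.symm_apply hps]
      show ‖(boxToTorus I.ε _ p).2‖ < 1
      have h00 : ((0 : ℝ), (0 : ℝ)) = 0 := rfl
      simp [boxToTorus, hp', h00]
    · exact Or.inl hx
  · have hu : ‖(u : ℂ)‖ = 1 := Circle.norm_coe u
    have hn : ‖(r : ℂ) * (u : ℂ)‖ < 1 := by
      rw [norm_mul, hu, mul_one, Complex.norm_real, Real.norm_eq_abs, abs_of_pos hr]; exact hr1
    have k1 := I.box.torusToBox_mem hε e1 e2 1 (p := (z * u ^ I.q, (r : ℂ) * (u : ℂ))) hn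
    have k2 := I.dehn_eq k1
    refine Eq.trans ?_ k2.symm
    show I.inner (torusToBox I.ε (Circle.exp Real.pi ^ (-I.q)) (z, (r : ℂ) * (u : ℂ))) = _
    congr 1
    have hy : planeCoord (I.ε * ((r : ℂ) * (u : ℂ)).re, -(I.ε * ((r : ℂ) * (u : ℂ)).im)) =
        ((I.ε * r : ℝ) : ℂ) * (u : ℂ) := by
      apply Complex.ext
      · rw [planeCoord_re]; simp; ring
      · rw [planeCoord_im]; simp; ring
    have hsq : (I.ε * ((r : ℂ) * (u : ℂ)).re) ^ 2 + (-(I.ε * ((r : ℂ) * (u : ℂ)).im)) ^ 2 ≤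
        2 * I.ε ^ 2 := by
      have k3 : ((r : ℂ) * (u : ℂ)).re ^ 2 + ((r : ℂ) * (u : ℂ)).im ^ 2 < 1 := by
        have := Complex.sq_norm ((r : ℂ) * (u : ℂ))
        rw [Complex.normSq_apply] at this
        nlinarith [norm_nonneg ((r : ℂ) * (u : ℂ))]
      nlinarith [sq_nonneg I.ε]
    have k4 := I.unwind_near (y := (I.ε * ((r : ℂ) * (u : ℂ)).re, -(I.ε * ((r : ℂ) * (u : ℂ)).im))) hsq
    rw [hy, Complex.arg_real_mul _ (mul_pos hε hr), Circle.exp_arg] at k4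
    simp only [torusToBox, twistMap, mul_one]
    rw [k4, mul_zpow, zpow_neg u]
    refine Prod.ext ?_ rfl
    simp [mul_assoc]

end SurgeryInput

end DehnSurgery

/-! ### Planar linear systems which preserve a cone -/

section PlanarCone

/-- A positive function on the line cannot have a derivative which is bounded below by a positive
constant wherever the function is small. -/
theorem le_of_deriv_ge_of_lt {y y' : ℝ → ℝ} {y₀ k : ℝ} (hk : 0 < k)
    (hd : ∀ t, HasDerivAt y (y' t) t) (hpos : ∀ t, 0 < y t) (h : ∀ t, y t < y₀ → k ≤ y' t) (t : ℝ) :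
    y₀ ≤ y t := by
  by_contra hc
  push Not at hc
  have hT : 0 ≤ 2 * y t / k := by have := hpos t; positivity
  have hf : ∀ τ, HasDerivAt (fun τ => y (t - τ)) (-y' (t - τ)) τ := fun τ =>
    ((hd (t - τ)).comp τ ((hasDerivAt_id τ).const_sub t)).congr_deriv (by ring)
  have hB : ∀ τ, HasDerivAt (fun τ => y t - k / 2 * τ) (-(k / 2)) τ := fun τ => by
    simpa using ((hasDerivAt_id τ).const_mul (k / 2)).const_sub (y t)
  have hle := image_le_of_deriv_right_lt_deriv_boundary
    (fun τ _ => (hf τ).continuousAt.continuousWithinAt) (fun τ _ => (hf τ).hasDerivWithinAt)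
    (a := 0) (b := 2 * y t / k) (by simp) hB (fun τ hτ he => by
      have h1 : y (t - τ) < y₀ := by
        rw [he]; nlinarith [hτ.1]
      have := h _ h1
      linarith) (Set.right_mem_Icc.2 hT)
  have h2 : k / 2 * (2 * y t / k) = y t := by field_simp
  rw [h2, sub_self] at hle
  exact absurd (hpos _) (not_lt.2 hle)

/-- `(a, b)` solves `a' = p a + q b`, `b' = r a + s b`. -/
structure IsPlanarSolution (p q r s a b : ℝ → ℝ) : Prop where
  left : ∀ t, HasDerivAt a (p t * a t + q t * b t) t
  right : ∀ t, HasDerivAt b (r t * a t + s t * b t) t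

/-- The coefficients `p`, `q`, `r`, `s` are bounded by `C`, and `q`, `r` are at least `m > 0`. -/
structure IsConeSystem (m C : ℝ) (p q r s : ℝ → ℝ) : Prop where
  pos : 0 < m
  continuous_p : Continuous p
  continuous_s : Continuous s
  le_q : ∀ t, m ≤ q t
  le_r : ∀ t, m ≤ r t
  abs_p : ∀ t, |p t| ≤ C
  q_le : ∀ t, q t ≤ C
  r_le : ∀ t, r t ≤ C
  abs_s : ∀ t, |s t| ≤ C

variable {m C : ℝ} {p q r s a b a₁ b₁ a₂ b₂ : ℝ → ℝ}

theorem IsConeSystem.swap (h : IsConeSystem m C p q r s) : IsConeSystem m C s r q p :=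
  ⟨h.pos, h.continuous_s, h.continuous_p, h.le_r, h.le_q, h.abs_s, h.r_le, h.q_le, h.abs_p⟩

theorem IsPlanarSolution.swap (h : IsPlanarSolution p q r s a b) : IsPlanarSolution s r q p b a :=
  ⟨fun t => (h.right t).congr_deriv (by ring), fun t => (h.left t).congr_deriv (by ring)⟩

theorem IsPlanarSolution.linear (h₁ : IsPlanarSolution p q r s a₁ b₁)
    (h₂ : IsPlanarSolution p q r s a₂ b₂) (c d : ℝ) :
    IsPlanarSolution p q r s (fun t => c * a₁ t + d * a₂ t) (fun t => c * b₁ t + d * b₂ t) :=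
  ⟨fun t => (((h₁.left t).const_mul c).add ((h₂.left t).const_mul d)).congr_deriv (by ring),
    fun t => (((h₁.right t).const_mul c).add ((h₂.right t).const_mul d)).congr_deriv (by ring)⟩

theorem IsConeSystem.le (h : IsConeSystem m C p q r s) : m ≤ C := (h.le_q 0).trans (h.q_le 0)

theorem IsConeSystem.hasDerivAt_weight (h : IsConeSystem m C p q r s)
    (hab : IsPlanarSolution p q r s a b) (t : ℝ) :
    HasDerivAt (fun t => a t * b t * Real.exp (-∫ u in (0 : ℝ)..t, (p u + s u)))
      ((q t * b t ^ 2 + r t * a t ^ 2) * Real.exp (-∫ u in (0 : ℝ)..t, (p u + s u))) t := by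
  have h1 : HasDerivAt (fun t => ∫ u in (0 : ℝ)..t, (p u + s u)) (p t + s t) t :=
    ((h.continuous_p.add h.continuous_s).integral_hasStrictDerivAt 0 t).hasDerivAt
  exact (((hab.left t).mul (hab.right t)).mul h1.neg.exp).congr_deriv
    (by simp only [Pi.mul_apply, Pi.neg_apply]; ring)

theorem IsConeSystem.forward (h : IsConeSystem m C p q r s) (hab : IsPlanarSolution p q r s a b)
    {t t' : ℝ} (htt : t ≤ t') (h0 : 0 ≤ a t * b t) : 0 ≤ a t' * b t' := by
  have hm : Monotone fun t => a t * b t * Real.exp (-∫ u in (0 : ℝ)..t, (p u + s u)) :=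
    monotone_of_hasDerivAt_nonneg (h.hasDerivAt_weight hab) fun t => by
      have h1 := h.pos.le.trans (h.le_q t)
      have h2 := h.pos.le.trans (h.le_r t)
      simp only [Pi.zero_apply]
      positivity
  have h3 := (mul_nonneg h0 (Real.exp_pos _).le).trans (hm htt)
  exact nonneg_of_mul_nonneg_left h3 (Real.exp_pos _)

theorem IsConeSystem.mul_pos (h : IsConeSystem m C p q r s) (hab : IsPlanarSolution p q r s a b)
    (h0 : ∀ t, 0 ≤ a t * b t) (hne : ∀ t, a t ≠ 0 ∨ b t ≠ 0) (t : ℝ) : 0 < a t * b t := by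
  have hm : StrictMono fun t => a t * b t * Real.exp (-∫ u in (0 : ℝ)..t, (p u + s u)) := by
    refine strictMono_of_hasDerivAt_pos (h.hasDerivAt_weight hab) fun t => ?_
    have h1 := h.pos.trans_le (h.le_q t)
    have h2 := h.pos.trans_le (h.le_r t)
    refine _root_.mul_pos ?_ (Real.exp_pos _)
    rcases hne t with h3 | h3 <;> positivity
  have h3 := (mul_nonneg (h0 (t - 1)) (Real.exp_pos _).le).trans_lt (hm (sub_one_lt t))
  exact pos_of_mul_pos_left h3 (Real.exp_pos _).le

theorem ne_zero_of_mul_pos {x y : ℝ} (h : 0 < x * y) : x ≠ 0 ∧ y ≠ 0 :=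
  ⟨left_ne_zero_of_mul h.ne', right_ne_zero_of_mul h.ne'⟩

/-- The slope of a solution satisfies a Riccati equation. -/
theorem IsPlanarSolution.hasDerivAt_div (hab : IsPlanarSolution p q r s a b)
    (hpos : ∀ t, 0 < a t * b t) (t : ℝ) : HasDerivAt (fun t => a t / b t)
      (q t + (p t - s t) * (a t / b t) - r t * (a t / b t) ^ 2) t := by
  have hb := (ne_zero_of_mul_pos (hpos t)).2
  refine ((hab.left t).div (hab.right t) hb).congr_deriv ?_
  field_simp
  ring

theorem div_pos_of_mul_pos {x y : ℝ} (h : 0 < x * y) : 0 < x / y := by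
  rcases pos_and_pos_or_neg_and_neg_of_mul_pos h with ⟨h1, h2⟩ | ⟨h1, h2⟩
  exacts [div_pos h1 h2, div_pos_of_neg_of_neg h1 h2]

theorem IsConeSystem.le_div (h : IsConeSystem m C p q r s) (hab : IsPlanarSolution p q r s a b)
    (hpos : ∀ t, 0 < a t * b t) (t : ℝ) : m / (6 * C) ≤ a t / b t := by
  have hm := h.pos
  have hC := hm.trans_le h.le
  refine le_of_deriv_ge_of_lt (half_pos hm) (hab.hasDerivAt_div hpos)
    (fun t => div_pos_of_mul_pos (hpos t)) (fun t ht => ?_) t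
  have hz := div_pos_of_mul_pos (hpos t)
  set z := a t / b t
  have h1 : z * (6 * C) < m := (lt_div_iff₀ (by positivity)).1 ht
  have h2 : z < 1 := by nlinarith [h.le]
  have h3 := abs_le.1 (h.abs_p t)
  have h4 := abs_le.1 (h.abs_s t)
  have h5 : -(2 * C) * z ≤ (p t - s t) * z := mul_le_mul_of_nonneg_right (by linarith) hz.le
  have h6 : r t * z ^ 2 ≤ C * z := by
    have : z ^ 2 ≤ z := by nlinarith
    exact mul_le_mul (h.r_le t) this (sq_nonneg _) hC.le
  have := h.le_q t
  linarith

theorem IsConeSystem.sq_add_sq_le (h : IsConeSystem m C p q r s)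
    (hab : IsPlanarSolution p q r s a b) (hpos : ∀ t, 0 < a t * b t) (t : ℝ) :
    a t ^ 2 + b t ^ 2 ≤ 12 * C / m * (a t * b t) := by
  have hm := h.pos
  have hC := hm.trans_le h.le
  have key : ∀ {x y : ℝ}, 0 < x * y → m / (6 * C) ≤ x / y → y ^ 2 ≤ 6 * C / m * (x * y) := by
    intro x y hxy hd
    have hy := (ne_zero_of_mul_pos hxy).2
    have h1 := mul_le_mul_of_nonneg_right hd (sq_nonneg y)
    have h2 : x / y * y ^ 2 = x * y := by field_simp
    rw [h2] at h1
    have h3 := mul_le_mul_of_nonneg_left h1 (show 0 ≤ 6 * C / m by positivity)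
    have h4 : 6 * C / m * (m / (6 * C) * y ^ 2) = y ^ 2 := by field_simp
    rwa [h4] at h3
  have h1 := key (hpos t) (h.le_div hab hpos t)
  have h2 := key (by rw [mul_comm]; exact hpos t)
    (h.swap.le_div hab.swap (fun t => by rw [mul_comm]; exact hpos t) t)
  have h3 : 12 * C / m * (a t * b t) = 6 * C / m * (a t * b t) + 6 * C / m * (b t * a t) := by ring
  rw [h3]
  linarith

theorem IsConeSystem.div_le_div (h : IsConeSystem m C p q r s)
    (h₁ : IsPlanarSolution p q r s a₁ b₁) (h₂ : IsPlanarSolution p q r s a₂ b₂)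
    (hpos₁ : ∀ t, 0 < a₁ t * b₁ t) (hpos₂ : ∀ t, 0 < a₂ t * b₂ t) (t : ℝ) :
    a₁ t / b₁ t ≤ a₂ t / b₂ t := by
  have hz₁ := fun t => div_pos_of_mul_pos (hpos₁ t)
  have hz₂ := fun t => div_pos_of_mul_pos (hpos₂ t)
  have hd₁ := h₁.hasDerivAt_div hpos₁
  have hd₂ := h₂.hasDerivAt_div hpos₂
  generalize hZ₁ : (fun t => a₁ t / b₁ t) = z₁ at hd₁
  generalize hZ₂ : (fun t => a₂ t / b₂ t) = z₂ at hd₂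
  have e₁ : ∀ t, a₁ t / b₁ t = z₁ t := fun t => congrFun hZ₁ t
  have e₂ : ∀ t, a₂ t / b₂ t = z₂ t := fun t => congrFun hZ₂ t
  simp only [e₁, e₂] at hz₁ hz₂ hd₁ hd₂ ⊢
  clear hZ₁ hZ₂ e₁ e₂
  have hm := h.pos
  let g : ℝ → ℝ := fun t => Real.sqrt (z₂ t / z₁ t)
  have hg : ∀ t, 0 < g t := fun t => Real.sqrt_pos.2 (div_pos (hz₂ t) (hz₁ t))
  have hg2 : ∀ t, g t ^ 2 = z₂ t / z₁ t := fun t => Real.sq_sqrt (div_pos (hz₂ t) (hz₁ t)).le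
  have hgd : ∀ t, HasDerivAt g
      ((1 - g t ^ 2) * (q t / z₁ t + r t * z₂ t) * g t ^ 2 / (2 * g t) / g t ^ 2) t := by
    intro t
    have h3 := ((hd₂ t).div (hd₁ t) (hz₁ t).ne').sqrt (div_pos (hz₂ t) (hz₁ t)).ne'
    refine h3.congr_deriv ?_
    have h1 := (hz₁ t).ne'
    have h2 := (hg t).ne'
    have h4 : z₂ t = g t ^ 2 * z₁ t := by rw [hg2]; field_simp
    show _ / (2 * g t) = _
    rw [h4]
    field_simp
    ring
  have hall : ∀ y₀ < 1, y₀ ≤ g t := by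
    intro y₀ hy₀
    by_cases hy : y₀ ≤ 0
    · exact hy.trans (hg t).le
    push Not at hy
    have hk : 0 < m * (1 - y₀ ^ 2) := _root_.mul_pos hm (by nlinarith)
    refine le_of_deriv_ge_of_lt hk hgd hg (fun t ht => ?_) t
    have h1 := hz₁ t
    have h2 := hg t
    have h4 : z₂ t = g t ^ 2 * z₁ t := by rw [hg2]; field_simp
    have h5 : 2 * m * g t ≤ q t / z₁ t + r t * z₂ t := by
      have h6 : m / z₁ t ≤ q t / z₁ t := div_le_div_of_nonneg_right (h.le_q t) h1.le
      have h7 : m * z₂ t ≤ r t * z₂ t := mul_le_mul_of_nonneg_right (h.le_r t) (hz₂ t).le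
      have h8 : 2 * m * g t ≤ m / z₁ t + m * z₂ t := by
        rw [h4, ← sub_nonneg]
        have : m / z₁ t + m * (g t ^ 2 * z₁ t) - 2 * m * g t =
            m / z₁ t * (1 - g t * z₁ t) ^ 2 := by field_simp; ring
        rw [this]
        positivity
      linarith
    have h9 : (1 - g t ^ 2) * (q t / z₁ t + r t * z₂ t) * g t ^ 2 / (2 * g t) / g t ^ 2 =
        (1 - g t ^ 2) * ((q t / z₁ t + r t * z₂ t) / (2 * g t)) := by field_simp
    rw [h9]
    have h10 : m ≤ (q t / z₁ t + r t * z₂ t) / (2 * g t) := by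
      rw [le_div_iff₀ (by positivity)]; linarith
    have h11 : 1 - y₀ ^ 2 ≤ 1 - g t ^ 2 := by nlinarith
    rw [mul_comm m]
    exact mul_le_mul h11 h10 hm.le (by nlinarith)
  have h1 : 1 ≤ g t := le_of_forall_lt_imp_le_of_dense hall
  have h2 : 1 ≤ z₂ t / z₁ t := by rw [← hg2]; nlinarith
  rwa [one_le_div (hz₁ t)] at h2

theorem IsConeSystem.cross_eq (h : IsConeSystem m C p q r s)
    (h₁ : IsPlanarSolution p q r s a₁ b₁) (h₂ : IsPlanarSolution p q r s a₂ b₂)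
    (hpos₁ : ∀ t, 0 < a₁ t * b₁ t) (hpos₂ : ∀ t, 0 < a₂ t * b₂ t) (t : ℝ) :
    a₁ t * b₂ t = a₂ t * b₁ t :=
  (div_eq_div_iff (ne_zero_of_mul_pos (hpos₁ t)).2 (ne_zero_of_mul_pos (hpos₂ t)).2).1
    ((h.div_le_div h₁ h₂ hpos₁ hpos₂ t).antisymm (h.div_le_div h₂ h₁ hpos₂ hpos₁ t))

/-- Some solution stays in the cone for all times. -/
theorem IsConeSystem.exists_solution (h : IsConeSystem m C p q r s)
    (h₁ : IsPlanarSolution p q r s a₁ b₁) (h₂ : IsPlanarSolution p q r s a₂ b₂) :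
    ∃ c d : ℝ, c ^ 2 + d ^ 2 = 1 ∧
      ∀ t, 0 ≤ (c * a₁ t + d * a₂ t) * (c * b₁ t + d * b₂ t) := by
  let K : Set (ℝ × ℝ) := {x | x.1 ^ 2 + x.2 ^ 2 = 1}
  have hKc : IsClosed K := isClosed_eq (by fun_prop) continuous_const
  have hK : IsCompact K := by
    refine (isCompact_Icc (a := ((-1 : ℝ), (-1 : ℝ))) (b := (1, 1))).of_isClosed_subset hKc ?_
    rintro ⟨x, y⟩ hxy
    have hxy' : x ^ 2 + y ^ 2 = 1 := hxy
    refine ⟨⟨?_, ?_⟩, ⟨?_, ?_⟩⟩ <;> simp only <;> nlinarith [sq_nonneg x, sq_nonneg y]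
  let Q : ℕ → Set (ℝ × ℝ) := fun n => {x | x ∈ K ∧
    0 ≤ (x.1 * a₁ (-n) + x.2 * a₂ (-n)) * (x.1 * b₁ (-n) + x.2 * b₂ (-n))}
  have hQc : ∀ n, IsClosed (Q n) := fun n =>
    hKc.inter (isClosed_le continuous_const (g := fun x : ℝ × ℝ =>
      (x.1 * a₁ (-n) + x.2 * a₂ (-n)) * (x.1 * b₁ (-n) + x.2 * b₂ (-n))) (by fun_prop))
  have hQd : ∀ n, Q (n + 1) ⊆ Q n := by
    rintro n x ⟨hx, hn⟩
    exact ⟨hx, h.forward (h₁.linear h₂ x.1 x.2) (by push_cast; linarith) hn⟩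
  have hQn : ∀ n, (Q n).Nonempty := by
    intro n
    set u := a₁ (-n) with hu
    set v := a₂ (-n) with hv
    by_cases hw : u ^ 2 + v ^ 2 = 0
    · have hu0 : u = 0 := by nlinarith [sq_nonneg u, sq_nonneg v]
      have hv0 : v = 0 := by nlinarith [sq_nonneg u, sq_nonneg v]
      refine ⟨(1, 0), by simp [K], ?_⟩
      simp only
      rw [← hu, ← hv, hu0, hv0]; simp
    · have hw' : 0 < u ^ 2 + v ^ 2 := lt_of_le_of_ne (by positivity) (Ne.symm hw)
      set l := Real.sqrt (u ^ 2 + v ^ 2) with hl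
      have hl2 : l ^ 2 = u ^ 2 + v ^ 2 := Real.sq_sqrt hw'.le
      have hl0 : l ≠ 0 := (Real.sqrt_pos.2 hw').ne'
      refine ⟨(v / l, -u / l), ?_, ?_⟩
      · show (v / l) ^ 2 + (-u / l) ^ 2 = 1
        field_simp
        rw [hl2]; ring
      · simp only
        rw [← hu, ← hv]
        have : v / l * u + -u / l * v = 0 := by ring
        rw [this, zero_mul]
  obtain ⟨x, hx⟩ := IsCompact.nonempty_iInter_of_sequence_nonempty_isCompact_isClosed Q hQd hQn
    (hK.of_isClosed_subset (hQc 0) fun x hx => hx.1) hQc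
  rw [Set.mem_iInter] at hx
  refine ⟨x.1, x.2, (hx 0).1, fun t => ?_⟩
  obtain ⟨n, hn⟩ := exists_nat_ge (-t)
  exact h.forward (h₁.linear h₂ x.1 x.2) (by linarith) (hx n).2

end PlanarCone

section SignedCone

variable {m C δ σ : ℝ} {p q r s a b a₁ b₁ a₂ b₂ : ℝ → ℝ}

/-- Reversal of time (`δ = -1`) and of the second coordinate. -/
theorem IsPlanarSolution.reverse (h : IsPlanarSolution p q r s a b) (hδ : δ * δ = 1)
    (hσ : σ * σ = 1) : IsPlanarSolution (fun t => δ * p (δ * t)) (fun t => σ * q (δ * t))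
      (fun t => σ * r (δ * t)) (fun t => δ * s (δ * t)) (fun t => a (δ * t))
      (fun t => δ * σ * b (δ * t)) := by
  have hd : ∀ t, HasDerivAt (fun t => δ * t) δ t := fun t => by
    simpa using (hasDerivAt_id t).const_mul δ
  refine ⟨fun t => ?_, fun t => ?_⟩
  · refine (HasDerivAt.comp t (h.left (δ * t)) (hd t)).congr_deriv ?_
    linear_combination (-(δ * q (δ * t) * b (δ * t))) * hσ
  · refine ((HasDerivAt.comp t (h.right (δ * t)) (hd t)).const_mul (δ * σ)).congr_deriv ?_
    linear_combination (σ * r (δ * t) * a (δ * t)) * hδ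

theorem mul_self_mul_self {t : ℝ} (hδ : δ * δ = 1) : δ * (δ * t) = t := by
  rw [← mul_assoc, hδ, one_mul]

theorem abs_eq_one_of_mul_self (hδ : δ * δ = 1) : |δ| = 1 := by
  rcases mul_self_eq_one_iff.1 hδ with h | h <;> simp [h]

variable (h : IsConeSystem m C p (fun t => σ * q t) (fun t => σ * r t) s)

include h

theorem IsConeSystem.reverse (hδ : δ * δ = 1) : IsConeSystem m C (fun t => δ * p (δ * t))
    (fun t => σ * q (δ * t)) (fun t => σ * r (δ * t)) (fun t => δ * s (δ * t)) where
  pos := h.pos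
  continuous_p := by have := h.continuous_p; fun_prop
  continuous_s := by have := h.continuous_s; fun_prop
  le_q t := h.le_q _
  le_r t := h.le_r _
  abs_p t := by rw [abs_mul, abs_eq_one_of_mul_self hδ, one_mul]; exact h.abs_p _
  q_le t := h.q_le _
  r_le t := h.r_le _
  abs_s t := by rw [abs_mul, abs_eq_one_of_mul_self hδ, one_mul]; exact h.abs_s _

theorem IsConeSystem.signed_pos (hδ : δ * δ = 1) (hσ : σ * σ = 1)
    (hab : IsPlanarSolution p q r s a b) (h0 : ∀ t, 0 ≤ δ * σ * (a t * b t))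
    (hne : ∀ t, a t ≠ 0 ∨ b t ≠ 0) (t : ℝ) : 0 < δ * σ * (a t * b t) := by
  have h1 := (h.reverse hδ).mul_pos (hab.reverse hδ hσ)
    (fun t => by have := h0 (δ * t); linarith) (fun t => (hne (δ * t)).imp id fun hb =>
      mul_ne_zero (mul_ne_zero (left_ne_zero_of_mul (hδ ▸ one_ne_zero))
        (left_ne_zero_of_mul (hσ ▸ one_ne_zero))) hb) (δ * t)
  simp only [mul_self_mul_self hδ] at h1
  linarith

theorem IsConeSystem.signed_sq_add_sq_le (hδ : δ * δ = 1) (hσ : σ * σ = 1)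
    (hab : IsPlanarSolution p q r s a b) (hpos : ∀ t, 0 < δ * σ * (a t * b t)) (t : ℝ) :
    a t ^ 2 + b t ^ 2 ≤ 12 * C / m * (δ * σ * (a t * b t)) := by
  have h1 := (h.reverse hδ).sq_add_sq_le (hab.reverse hδ hσ)
    (fun t => by have := hpos (δ * t); linarith) (δ * t)
  simp only [mul_self_mul_self hδ] at h1
  have h2 : (δ * σ * b t) ^ 2 = b t ^ 2 := by
    linear_combination (σ * σ * b t ^ 2) * hδ + b t ^ 2 * hσ
  rw [h2] at h1
  refine h1.trans_eq ?_
  ring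

theorem IsConeSystem.signed_cross_eq (hδ : δ * δ = 1) (hσ : σ * σ = 1)
    (h₁ : IsPlanarSolution p q r s a₁ b₁) (h₂ : IsPlanarSolution p q r s a₂ b₂)
    (hpos₁ : ∀ t, 0 < δ * σ * (a₁ t * b₁ t)) (hpos₂ : ∀ t, 0 < δ * σ * (a₂ t * b₂ t)) (t : ℝ) :
    a₁ t * b₂ t = a₂ t * b₁ t := by
  have h1 := (h.reverse hδ).cross_eq (h₁.reverse hδ hσ) (h₂.reverse hδ hσ)
    (fun t => by have := hpos₁ (δ * t); linarith) (fun t => by have := hpos₂ (δ * t); linarith)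
    (δ * t)
  simp only [mul_self_mul_self hδ] at h1
  refine mul_left_cancel₀ (mul_ne_zero (left_ne_zero_of_mul (hδ ▸ one_ne_zero : δ * δ ≠ 0))
        (left_ne_zero_of_mul (hσ ▸ one_ne_zero : σ * σ ≠ 0))) ?_
  linarith

theorem IsConeSystem.exists_signed_solution (hδ : δ * δ = 1) (hσ : σ * σ = 1)
    (h₁ : IsPlanarSolution p q r s a₁ b₁) (h₂ : IsPlanarSolution p q r s a₂ b₂) :
    ∃ c d : ℝ, c ^ 2 + d ^ 2 = 1 ∧
      ∀ t, 0 ≤ δ * σ * ((c * a₁ t + d * a₂ t) * (c * b₁ t + d * b₂ t)) := by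
  obtain ⟨c, d, hcd, hall⟩ := (h.reverse hδ).exists_solution (h₁.reverse hδ hσ) (h₂.reverse hδ hσ)
  refine ⟨c, d, hcd, fun t => ?_⟩
  have h1 := hall (δ * t)
  simp only [mul_self_mul_self hδ] at h1
  linarith

theorem IsConeSystem.exp_le_mul_div (hσ : σ * σ = 1)
    (h₁ : IsPlanarSolution p q r s a₁ b₁) (h₂ : IsPlanarSolution p q r s a₂ b₂)
    (hpos₁ : ∀ t, 0 < σ * (a₁ t * b₁ t)) (hpos₂ : ∀ t, 0 < -(σ * (a₂ t * b₂ t))) {t : ℝ}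
    (ht : 0 ≤ t) :
    Real.exp (4 * m * t) * (σ * (a₁ 0 * b₁ 0) / -(σ * (a₂ 0 * b₂ 0))) ≤
      σ * (a₁ t * b₁ t) / -(σ * (a₂ t * b₂ t)) := by
  have hσ1 := abs_eq_one_of_mul_self hσ
  have hd : ∀ t, HasDerivAt (fun t => σ * (a₁ t * b₁ t) / -(σ * (a₂ t * b₂ t)) *
      Real.exp (-(4 * m * t))) (((σ * q t * b₁ t ^ 2 + σ * r t * a₁ t ^ 2) * -(σ * (a₂ t * b₂ t)) +
        σ * (a₁ t * b₁ t) * (σ * q t * b₂ t ^ 2 + σ * r t * a₂ t ^ 2)) /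
          (-(σ * (a₂ t * b₂ t))) ^ 2 * Real.exp (-(4 * m * t)) -
      σ * (a₁ t * b₁ t) / -(σ * (a₂ t * b₂ t)) * (4 * m) * Real.exp (-(4 * m * t))) t := by
    intro t
    have k1 : HasDerivAt (fun t => σ * (a₁ t * b₁ t)) _ t :=
      ((h₁.left t).mul (h₁.right t)).const_mul σ
    have k2 : HasDerivAt (fun t => -(σ * (a₂ t * b₂ t))) _ t :=
      (((h₂.left t).mul (h₂.right t)).const_mul σ).neg
    have k3 : HasDerivAt (fun t => Real.exp (-(4 * m * t))) _ t :=
      ((hasDerivAt_id t).const_mul (4 * m)).neg.exp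
    refine ((k1.div k2 (hpos₂ t).ne').mul k3).congr_deriv ?_
    simp only [Pi.neg_apply, Pi.div_apply, id]
    ring
  have hm : Monotone fun t => σ * (a₁ t * b₁ t) / -(σ * (a₂ t * b₂ t)) *
      Real.exp (-(4 * m * t)) := by
    refine monotone_of_hasDerivAt_nonneg hd fun t => ?_
    simp only [Pi.zero_apply]
    have key : ∀ a b : ℝ, 2 * m * |a * b| ≤ σ * q t * b ^ 2 + σ * r t * a ^ 2 := by
      intro a b
      have k1 := mul_le_mul_of_nonneg_right (h.le_q t) (sq_nonneg b)
      have k2 := mul_le_mul_of_nonneg_right (h.le_r t) (sq_nonneg a)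
      have k3 : 2 * |a * b| ≤ a ^ 2 + b ^ 2 := by
        rw [abs_mul, ← sq_abs a, ← sq_abs b]
        nlinarith [sq_nonneg (|a| - |b|)]
      nlinarith [h.pos]
    have k1 := key (a₁ t) (b₁ t)
    have k2 := key (a₂ t) (b₂ t)
    have e1 : |a₁ t * b₁ t| = σ * (a₁ t * b₁ t) := by
      rw [← abs_of_pos (hpos₁ t), abs_mul σ, hσ1, one_mul]
    have e2 : |a₂ t * b₂ t| = -(σ * (a₂ t * b₂ t)) := by
      rw [← abs_of_pos (hpos₂ t), abs_neg, abs_mul σ, hσ1, one_mul]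
    rw [e1] at k1
    rw [e2] at k2
    have hu := hpos₁ t
    have hw := hpos₂ t
    generalize σ * q t * b₁ t ^ 2 + σ * r t * a₁ t ^ 2 = x at k1
    generalize σ * q t * b₂ t ^ 2 + σ * r t * a₂ t ^ 2 = y at k2
    generalize σ * (a₁ t * b₁ t) = u at k1 hu
    generalize -(σ * (a₂ t * b₂ t)) = w at k2 hw
    have k3 : (x * w + u * y) / w ^ 2 * Real.exp (-(4 * m * t)) -
        u / w * (4 * m) * Real.exp (-(4 * m * t)) =
        ((x - 2 * m * u) * w + u * (y - 2 * m * w)) / w ^ 2 * Real.exp (-(4 * m * t)) := by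
      field_simp
      ring
    rw [k3]
    have := sub_nonneg.2 k1
    have := sub_nonneg.2 k2
    positivity
  have k1 := hm ht
  simp only [mul_zero, neg_zero, Real.exp_zero, mul_one] at k1
  have k2 := mul_le_mul_of_nonneg_left k1 (Real.exp_pos (4 * m * t)).le
  refine k2.trans_eq ?_
  rw [mul_left_comm, ← Real.exp_add, add_neg_cancel, Real.exp_zero, mul_one]

theorem IsConeSystem.dominated (hσ : σ * σ = 1)
    (h₁ : IsPlanarSolution p q r s a₁ b₁) (h₂ : IsPlanarSolution p q r s a₂ b₂)
    (hpos₁ : ∀ t, 0 < 1 * σ * (a₁ t * b₁ t)) (hpos₂ : ∀ t, 0 < -1 * σ * (a₂ t * b₂ t)) {t : ℝ}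
    (ht : 0 ≤ t) :
    m / (6 * C) * Real.exp (2 * m * t) *
      (√(a₁ 0 ^ 2 + b₁ 0 ^ 2) / √(a₂ 0 ^ 2 + b₂ 0 ^ 2)) ≤
      √(a₁ t ^ 2 + b₁ t ^ 2) / √(a₂ t ^ 2 + b₂ t ^ 2) := by
  have hm := h.pos
  have hC := hm.trans_le h.le
  have k1 := h.exp_le_mul_div hσ h₁ h₂ (fun t => by simpa using hpos₁ t)
    (fun t => by simpa using hpos₂ t) ht
  have low : ∀ x y : ℝ, σ * (x * y) ≤ (x ^ 2 + y ^ 2) / 2 ∧ -(σ * (x * y)) ≤ (x ^ 2 + y ^ 2) / 2 := by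
    intro x y
    rcases mul_self_eq_one_iff.1 hσ with e | e <;> rw [e] <;> constructor <;>
      nlinarith [sq_nonneg (x - y), sq_nonneg (x + y)]
  have u1 := h.signed_sq_add_sq_le (by norm_num) hσ h₁ hpos₁ 0
  have w1 := h.signed_sq_add_sq_le (by norm_num) hσ h₂ hpos₂ t
  have u2 := (low (a₁ t) (b₁ t)).1
  have w2 := (low (a₂ 0) (b₂ 0)).2
  have w3 := (low (a₂ t) (b₂ t)).2
  have p1 := hpos₁ 0
  have p2 := hpos₁ t
  have p3 := hpos₂ 0
  have p4 := hpos₂ t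
  simp only [one_mul, neg_mul] at u1 w1 p1 p2 p3 p4
  generalize σ * (a₁ 0 * b₁ 0) = U₀ at *
  generalize -(σ * (a₂ 0 * b₂ 0)) = W₀ at *
  generalize σ * (a₁ t * b₁ t) = U at *
  generalize -(σ * (a₂ t * b₂ t)) = W at *
  set n₀ := a₁ 0 ^ 2 + b₁ 0 ^ 2
  set l₀ := a₂ 0 ^ 2 + b₂ 0 ^ 2
  set n := a₁ t ^ 2 + b₁ t ^ 2
  set l := a₂ t ^ 2 + b₂ t ^ 2
  have hl₀ : 0 < l₀ := by linarith
  have hl : 0 < l := by linarith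
  rw [← Real.sqrt_div (by positivity), ← Real.sqrt_div (by positivity)]
  refine Real.le_sqrt_of_sq_le ?_
  rw [mul_pow, mul_pow, Real.sq_sqrt (by positivity), ← Real.exp_nat_mul]
  have e1 : ((2 : ℕ) : ℝ) * (2 * m * t) = 4 * m * t := by push_cast; ring
  rw [e1]
  set κ := m / (6 * C)
  have hκ : 0 < κ := by positivity
  have eκ : 12 * C / m = 2 / κ := by simp only [κ]; field_simp; norm_num
  rw [eκ] at u1 w1
  have f1 : n₀ / l₀ ≤ U₀ / (κ * W₀) := by
    rw [div_le_div_iff₀ hl₀ (by positivity)]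
    have g1 : κ * n₀ ≤ 2 * U₀ := by
      have := mul_le_mul_of_nonneg_left u1 hκ.le
      rwa [← mul_assoc, mul_div_cancel₀ _ hκ.ne'] at this
    nlinarith
  have f2 : κ * (U / W) ≤ n / l := by
    rw [← mul_div_assoc, div_le_div_iff₀ p4 hl]
    have g1 : κ * l ≤ 2 * W := by
      have := mul_le_mul_of_nonneg_left w1 hκ.le
      rwa [← mul_assoc, mul_div_cancel₀ _ hκ.ne'] at this
    nlinarith
  calc κ ^ 2 * Real.exp (4 * m * t) * (n₀ / l₀)
      ≤ κ ^ 2 * Real.exp (4 * m * t) * (U₀ / (κ * W₀)) := by gcongr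
    _ = κ * (Real.exp (4 * m * t) * (U₀ / W₀)) := by field_simp
    _ ≤ κ * (U / W) := by gcongr
    _ ≤ n / l := f2

end SignedCone

/-! ### The derivative of a one-form along a flow -/

section FlowDerivative

variable {M : Type u} [TopologicalSpace M] [ChartedSpace (EuclideanSpace ℝ (Fin 3)) M]
  [IsManifold (𝓡 3) ∞ M]

/-- If `α(X) = 0` then the derivative of the pull-back of `α` under the flow is the pull-back of
`dα(X, ·)`. -/
theorem hasDerivAt_flow_apply {X : ∀ x : M, TangentSpace (𝓡 3) x} {φ : ℝ → M → M}
    (hφ : ContMDiff (𝓘(ℝ, ℝ).prod (𝓡 3)) (𝓡 3) ∞ (fun p : ℝ × M => φ p.1 p.2))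
    (hint : ∀ x, IsMIntegralCurve (fun t => φ t x) X)
    {α : ∀ x : M, TangentSpace (𝓡 3) x →L[ℝ] ℝ} (hα : IsSmoothOneForm α)
    (h0 : ∀ x, α x (X x) = 0) (x : M) (v : TangentSpace (𝓡 3) x) (t : ℝ) :
    HasDerivAt (fun t => α (φ t x) (mfderiv (𝓡 3) (𝓡 3) (φ t) x v))
      (oneFormExtDeriv α (φ t x) (X (φ t x)) (mfderiv (𝓡 3) (𝓡 3) (φ t) x v)) t := by
  let e := extChartAt (𝓡 3) x
  let c : ℝ × E3 → M := fun p => φ p.1 (e.symm p.2)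
  let y := e x
  have hy : y ∈ e.target := mem_extChartAt_target x
  have hxe : x ∈ e.source := mem_extChartAt_source x
  have hey : e.symm y = x := extChartAt_to_inv x
  have hc : ∀ p : ℝ × E3, p.2 ∈ e.target → ContMDiffAt 𝓘(ℝ, ℝ × E3) (𝓡 3) ∞ c p := by
    intro p hp
    have k1 : ContMDiffAt 𝓘(ℝ, ℝ × E3) (𝓘(ℝ, ℝ).prod (𝓡 3)) ∞
        (fun p : ℝ × E3 => (p.1, e.symm p.2)) p :=
      ContMDiffAt.prodMk contDiffAt_fst.contMDiffAt
        (ContMDiffAt.comp p (extChartAt_symm_contMDiffAt hp) contDiffAt_snd.contMDiffAt)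
    exact ContMDiffAt.comp p hφ.contMDiffAt k1
  have hX : ∀ p : ℝ × E3, p.2 ∈ e.target →
      (mfderiv 𝓘(ℝ, ℝ × E3) (𝓡 3) c p ((1 : ℝ), (0 : E3)) : E3) = X (c p) := by
    intro p hp
    refine (mfderiv_eq_of_line ((hc p hp).mdifferentiableAt (by simp))
      (hint (e.symm p.2) p.1) (Filter.Eventually.of_forall fun t => ?_)).trans ?_
    · simp [c]
    · show (1 : ℝ →L[ℝ] ℝ) 1 • (X (c p) : E3) = X (c p)
      exact one_smul ℝ _
  have hφt : ∀ t, ContMDiff (𝓡 3) (𝓡 3) ∞ (φ t) := fun t =>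
    hφ.comp (contMDiff_const.prodMk contMDiff_id)
  let w : E3 := mfderiv (𝓡 3) 𝓘(ℝ, E3) e x v
  have hv : ∀ t, (mfderiv 𝓘(ℝ, ℝ × E3) (𝓡 3) c (t, y) ((0 : ℝ), w) : E3) =
      mfderiv (𝓡 3) (𝓡 3) (φ t) x v := by
    intro t
    have key : ∀ x', x' = x → HasMFDerivAt (𝓡 3) (𝓡 3) (φ t) x'
        (mfderiv (𝓡 3) (𝓡 3) (φ t) x : E3 →L[ℝ] E3) := by
      rintro _ rfl; exact ((hφt t).contMDiffAt.mdifferentiableAt (by simp)).hasMFDerivAt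
    have k1 : HasMFDerivAt 𝓘(ℝ, E3) (𝓡 3) (φ t ∘ e.symm) y _ := HasMFDerivAt.comp y (key _ hey)
      ((extChartAt_symm_contMDiffAt hy).mdifferentiableAt (by simp)).hasMFDerivAt
    have k2 : HasFDerivAt (fun z : E3 => (t, z)) (ContinuousLinearMap.inr ℝ ℝ E3) y :=
      hasFDerivAt_prodMk_right t y
    have k3 : HasMFDerivAt 𝓘(ℝ, E3) (𝓡 3) (c ∘ fun z : E3 => (t, z)) y _ := HasMFDerivAt.comp y
      ((hc (t, y) hy).mdifferentiableAt (by simp)).hasMFDerivAt k2.hasMFDerivAt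
    have k4 := congrArg (fun L : E3 →L[ℝ] E3 => L w) (hasMFDerivAt_unique k3 k1)
    refine Eq.trans k4 (congrArg (mfderiv (𝓡 3) (𝓡 3) (φ t) x : E3 →L[ℝ] E3) ?_)
    exact (chartConst_eq hxe w).symm.trans (chartConst_mfderiv_self x v)
  let A := pullbackForm α c
  have hA : ContDiffAt ℝ ∞ A (t, y) :=
    contDiffAt_pullbackForm (α := α) (c := c) (p := (t, y)) (hα _) (hc _ hy)
  have hAd : HasFDerivAt A (fderiv ℝ A (t, y)) (t, y) :=
    (hA.differentiableAt (by simp)).hasFDerivAt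
  have hAv : ∀ u, HasFDerivAt (fun p => A p u) ((fderiv ℝ A (t, y)).flip u) (t, y) := fun u =>
    ((ContinuousLinearMap.apply ℝ ℝ u).hasFDerivAt.comp (t, y) hAd).congr_fderiv
      (ContinuousLinearMap.ext fun _ => rfl)
  have k1 := extD_pullbackForm (α := α) (c := c) (p := (t, y)) (hα _) (hc _ hy) (1, 0) (0, w)
  have k2 : fderiv ℝ A (t, y) (0, w) (1, 0) = 0 := by
    have h1 : HasFDerivAt (fun p => A p (1, 0)) ((fderiv ℝ A (t, y)).flip (1, 0)) (t, y) :=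
      hAv _
    have h2 : (fun p => A p (1, 0)) =ᶠ[𝓝 (t, y)] fun _ => 0 := by
      filter_upwards [(isOpen_univ.prod (isOpen_extChartAt_target x)).mem_nhds
        (show (t, y) ∈ Set.univ ×ˢ e.target from ⟨trivial, hy⟩)] with p hp
      exact (congrArg (α (c p)) (hX p hp.2)).trans (h0 (c p))
    have h3 := h1.unique ((hasFDerivAt_const (0 : ℝ) (t, y)).congr_of_eventuallyEq h2)
    exact congrArg (fun L : ℝ × E3 →L[ℝ] ℝ => L (0, w)) h3
  have k3 : HasDerivAt (fun h => A (h, y) (0, w)) (fderiv ℝ A (t, y) (1, 0) (0, w)) t := by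
    have h1 : HasFDerivAt (fun p => A p (0, w)) ((fderiv ℝ A (t, y)).flip (0, w)) (t, y) :=
      hAv _
    have h2 : HasDerivAt (fun h : ℝ => (h, y)) ((1 : ℝ), (0 : E3)) t :=
      (hasDerivAt_id t).prodMk (hasDerivAt_const t y)
    exact HasFDerivAt.comp_hasDerivAt t h1 h2
  have key : ∀ (x' : M) (u u' : E3), x' = φ t x → u = X x' →
      u' = mfderiv (𝓡 3) (𝓡 3) (φ t) x v → oneFormExtDeriv α x' u u' =
        oneFormExtDeriv α (φ t x) (X (φ t x)) (mfderiv (𝓡 3) (𝓡 3) (φ t) x v) := by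
    rintro _ _ _ rfl rfl rfl; rfl
  have key' : ∀ (h : ℝ) (x' : M) (u' : E3), x' = φ h x →
      u' = mfderiv (𝓡 3) (𝓡 3) (φ h) x v → (α x' : E3 →L[ℝ] ℝ) u' =
        α (φ h x) (mfderiv (𝓡 3) (𝓡 3) (φ h) x v) := by
    rintro _ _ _ rfl rfl; rfl
  have hcx : ∀ h, c (h, y) = φ h x := fun h => congrArg (φ h) hey
  rw [extD, k2, sub_zero] at k1
  have k4 := k1.trans (key _ _ _ (hcx t) (hX (t, y) hy) (hv t))
  rw [← k4]
  exact k3.congr_of_eventuallyEq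
    (Filter.Eventually.of_forall fun h => (key' h _ _ (hcx h) (hv h)).symm)

end FlowDerivative

section Metric

variable {M : Type u} [TopologicalSpace M] [ChartedSpace (EuclideanSpace ℝ (Fin 3)) M]
  [IsManifold (𝓡 3) ∞ M]

/-- The symmetric form `α² + β² + γ²`. -/
def sumSq (α β γ : ∀ x : M, TangentSpace (𝓡 3) x →L[ℝ] ℝ) (x : M) :
    TangentSpace (𝓡 3) x →L[ℝ] TangentSpace (𝓡 3) x →L[ℝ] ℝ :=
  (α x).smulRight (α x) + (β x).smulRight (β x) + (γ x).smulRight (γ x)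

theorem sumSq_apply (α β γ : ∀ x : M, TangentSpace (𝓡 3) x →L[ℝ] ℝ) (x : M)
    (v w : TangentSpace (𝓡 3) x) :
    sumSq α β γ x v w = α x v * α x w + β x v * β x w + γ x v * γ x w := rfl

set_option synthInstance.maxHeartbeats 400000 in
theorem contDiff_smulRight_self {V : Type*} [NormedAddCommGroup V] [NormedSpace ℝ V] :
    ContDiff ℝ ∞ fun f : V →L[ℝ] ℝ => f.smulRight f := by
  have h1 : IsBoundedBilinearMap ℝ fun p : (V →L[ℝ] ℝ) × (V →L[ℝ] ℝ) => p.1.smulRight p.2 :=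
    isBoundedBilinearMap_smulRight
  exact ContDiff.comp (g := fun p : (V →L[ℝ] ℝ) × (V →L[ℝ] ℝ) => p.1.smulRight p.2) h1.contDiff
    (f := fun f => (f, f)) (contDiff_id.prodMk contDiff_id)

theorem contMDiffAt_smulRight_self {A : M → EuclideanSpace ℝ (Fin 3) →L[ℝ] ℝ} {x₀ : M}
    (hA : ContMDiffAt (𝓡 3) 𝓘(ℝ, EuclideanSpace ℝ (Fin 3) →L[ℝ] ℝ) ∞ A x₀) :
    ContMDiffAt (𝓡 3) 𝓘(ℝ, EuclideanSpace ℝ (Fin 3) →L[ℝ] EuclideanSpace ℝ (Fin 3) →L[ℝ] ℝ) ∞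
      (fun x => (A x).smulRight (A x)) x₀ :=
  ContMDiffAt.comp x₀ contDiff_smulRight_self.contMDiff.contMDiffAt hA

theorem continuousLinearMapAt_cotangent {x₀ x : M}
    (hx : x ∈ (trivializationAt E3 (TangentSpace (𝓡 3)) x₀).baseSet)
    (f : TangentSpace (𝓡 3) x →L[ℝ] ℝ) (w : E3) :
    (Bundle.Trivialization.continuousLinearMapAt ℝ (trivializationAt (E3 →L[ℝ] ℝ)
      (fun x : M => TangentSpace (𝓡 3) x →L[ℝ] Bundle.Trivial M ℝ x) x₀) x f) w =
      f (Bundle.Trivialization.symmL ℝ (trivializationAt E3 (TangentSpace (𝓡 3)) x₀) x w) := by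
  have hx' : x ∈ (trivializationAt (E3 →L[ℝ] ℝ)
      (fun x : M => TangentSpace (𝓡 3) x →L[ℝ] Bundle.Trivial M ℝ x) x₀).baseSet := ⟨hx, trivial⟩
  rw [Bundle.Trivialization.continuousLinearMapAt_apply, Bundle.Trivialization.coe_linearMapAt_of_mem _ hx']
  beta_reduce
  rw [hom_trivializationAt_apply]
  simp only [ContinuousLinearMap.inCoordinates, Bundle.Trivial.fiberBundle_trivializationAt',
    Bundle.Trivial.continuousLinearMapAt_trivialization]
  rfl

theorem contMDiff_sumSq {α β γ : ∀ x : M, TangentSpace (𝓡 3) x →L[ℝ] ℝ} (hα : IsSmoothOneForm α)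
    (hβ : IsSmoothOneForm β) (hγ : IsSmoothOneForm γ) :
    ContMDiff (𝓡 3) ((𝓡 3).prod 𝓘(ℝ, EuclideanSpace ℝ (Fin 3) →L[ℝ]
      EuclideanSpace ℝ (Fin 3) →L[ℝ] ℝ)) ∞
      (fun x : M => Bundle.TotalSpace.mk' (EuclideanSpace ℝ (Fin 3) →L[ℝ]
        EuclideanSpace ℝ (Fin 3) →L[ℝ] ℝ)
        (E := fun x : M => TangentSpace (𝓡 3) x →L[ℝ] TangentSpace (𝓡 3) x →L[ℝ] ℝ) x
          (sumSq α β γ x)) := by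
  intro x₀
  rw [contMDiffAt_hom_bundle]
  refine ⟨contMDiffAt_id, ?_⟩
  have hA := ((contMDiffAt_hom_bundle _).1 (hα x₀)).2
  have hB := ((contMDiffAt_hom_bundle _).1 (hβ x₀)).2
  have hC := ((contMDiffAt_hom_bundle _).1 (hγ x₀)).2
  refine (((contMDiffAt_smulRight_self hA).add (contMDiffAt_smulRight_self hB)).add
    (contMDiffAt_smulRight_self hC)).congr_of_eventuallyEq ?_
  filter_upwards [(trivializationAt E3 (TangentSpace (𝓡 3)) x₀).open_baseSet.mem_nhds
    (mem_baseSet_trivializationAt E3 (TangentSpace (𝓡 3)) x₀)] with x hx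
  ext v w
  refine (continuousLinearMapAt_cotangent hx _ w).trans ?_
  refine (sumSq_apply α β γ x _ _).trans ?_
  simp only [ContinuousLinearMap.inCoordinates, Bundle.Trivial.fiberBundle_trivializationAt',
    Bundle.Trivial.continuousLinearMapAt_trivialization]
  rfl

/-- The Riemannian metric `α² + β² + γ²`. -/
def sumSqMetric {α β γ : ∀ x : M, TangentSpace (𝓡 3) x →L[ℝ] ℝ} (hα : IsSmoothOneForm α)
    (hβ : IsSmoothOneForm β) (hγ : IsSmoothOneForm γ)
    (h : ∀ x v, α x v = 0 → β x v = 0 → γ x v = 0 → v = 0) :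
    Bundle.ContMDiffRiemannianMetric (𝓡 3) ∞ (EuclideanSpace ℝ (Fin 3))
      (fun x : M => TangentSpace (𝓡 3) x) where
  inner := sumSq α β γ
  symm x v w := by simp only [sumSq_apply]; ring
  pos x v hv := by
    rw [sumSq_apply]
    by_contra hc
    push Not at hc
    refine hv (h x v ?_ ?_ ?_) <;> nlinarith [sq_nonneg (α x v), sq_nonneg (β x v), sq_nonneg (γ x v)]
  isVonNBounded x := by
    let L : E3 →L[ℝ] ℝ × ℝ × ℝ := (α x : E3 →L[ℝ] ℝ).prod ((β x : E3 →L[ℝ] ℝ).prod (γ x))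
    have hL : LinearMap.ker (L : E3 →ₗ[ℝ] ℝ × ℝ × ℝ) = ⊥ := by
      rw [LinearMap.ker_eq_bot']
      intro v hv
      have h1 : α x v = 0 := congrArg (fun y => y.1) hv
      have h2 : β x v = 0 := congrArg (fun y => y.2.1) hv
      have h3 : γ x v = 0 := congrArg (fun y => y.2.2) hv
      exact h x v h1 h2 h3
    obtain ⟨K, hK, hanti⟩ := LinearMap.exists_antilipschitzWith (L : E3 →ₗ[ℝ] ℝ × ℝ × ℝ) hL
    show Bornology.IsVonNBounded ℝ {v : E3 | sumSq α β γ x v v < 1}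
    rw [NormedSpace.isVonNBounded_iff]
    refine (hanti.isBounded_preimage (Metric.isBounded_closedBall (x := 0) (r := 1))).subset ?_
    intro v hv
    have hv' : α x v * α x v + β x v * β x v + γ x v * γ x v < 1 := hv
    rw [Set.mem_preimage, mem_closedBall_zero_iff]
    have h1 : |α x v| ≤ 1 := by rw [abs_le]; constructor <;> nlinarith [sq_nonneg (β x v), sq_nonneg (γ x v)]
    have h2 : |β x v| ≤ 1 := by rw [abs_le]; constructor <;> nlinarith [sq_nonneg (α x v), sq_nonneg (γ x v)]
    have h3 : |γ x v| ≤ 1 := by rw [abs_le]; constructor <;> nlinarith [sq_nonneg (α x v), sq_nonneg (β x v)]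
    exact max_le h1 (max_le h2 h3)
  contMDiff := contMDiff_sumSq hα hβ hγ

theorem quotientNorm_sumSqMetric {α β γ : ∀ x : M, TangentSpace (𝓡 3) x →L[ℝ] ℝ}
    (hα : IsSmoothOneForm α) (hβ : IsSmoothOneForm β) (hγ : IsSmoothOneForm γ)
    (h : ∀ x v, α x v = 0 → β x v = 0 → γ x v = 0 → v = 0) {X : ∀ x : M, TangentSpace (𝓡 3) x}
    (hX : ∀ x, α x (X x) = 0 ∧ β x (X x) = 0 ∧ γ x (X x) = 1) (x : M) (v : TangentSpace (𝓡 3) x) :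
    quotientNorm (sumSqMetric hα hβ hγ h) X x v = √(α x v ^ 2 + β x v ^ 2) := by
  obtain ⟨h1, h2, h3⟩ := hX x
  have key : ∀ c : ℝ, (sumSqMetric hα hβ hγ h).inner x (v + c • X x) (v + c • X x) =
      α x v ^ 2 + β x v ^ 2 + (γ x v + c) ^ 2 := by
    intro c
    refine (sumSq_apply α β γ x _ _).trans ?_
    simp only [map_add, map_smul, h1, h2, h3, smul_eq_mul]
    ring
  rw [quotientNorm]
  simp only [key]
  refine le_antisymm ?_ (le_ciInf fun c => Real.sqrt_le_sqrt (by nlinarith [sq_nonneg (γ x v + c)]))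
  refine (ciInf_le ⟨0, by rintro _ ⟨c, rfl⟩; exact Real.sqrt_nonneg _⟩ (-γ x v)).trans_eq ?_
  simp

end Metric

/-! ### The flow of a bi-contact structure is projectively Anosov -/

section ConeFlow

variable {M : Type u} [TopologicalSpace M] [ChartedSpace (EuclideanSpace ℝ (Fin 3)) M]
  [IsManifold (𝓡 3) ∞ M]

/-- A complete flow `φ` of `X`, two one-forms `α`, `β` which vanish on `X`, and a frame
`(U, V, X)` with `α = U*`, `β = V*` modulo `X`. -/
structure IsFramedFlow (α β : ∀ x : M, TangentSpace (𝓡 3) x →L[ℝ] ℝ)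
    (U V X : ∀ x : M, TangentSpace (𝓡 3) x) (φ : ℝ → M → M) : Prop where
  smooth_left : IsSmoothOneForm α
  smooth_right : IsSmoothOneForm β
  left_X : ∀ x, α x (X x) = 0
  right_X : ∀ x, β x (X x) = 0
  left_U : ∀ x, α x (U x) = 1
  right_U : ∀ x, β x (U x) = 0
  left_V : ∀ x, α x (V x) = 0
  right_V : ∀ x, β x (V x) = 1
  ne_zero : ∀ x, X x ≠ 0
  smooth_flow : ContMDiff (𝓘(ℝ, ℝ).prod (𝓡 3)) (𝓡 3) ∞ (fun p : ℝ × M => φ p.1 p.2)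
  flow_zero : ∀ x, φ 0 x = x
  integral : ∀ x, IsMIntegralCurve (fun t => φ t x) X
  group : ∀ s t x, φ (s + t) x = φ s (φ t x)

/-- The value of a one-form on a vector transported by a flow. -/
def alongFlow (α : ∀ x : M, TangentSpace (𝓡 3) x →L[ℝ] ℝ) (φ : ℝ → M → M) (x : M)
    (v : TangentSpace (𝓡 3) x) (t : ℝ) : ℝ :=
  α (φ t x) (mfderiv (𝓡 3) (𝓡 3) (φ t) x v)

theorem alongFlow_linear (α : ∀ x : M, TangentSpace (𝓡 3) x →L[ℝ] ℝ) (φ : ℝ → M → M) (x : M)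
    (v w : TangentSpace (𝓡 3) x) (c d t : ℝ) :
    alongFlow α φ x (c • v + d • w) t = c * alongFlow α φ x v t + d * alongFlow α φ x w t := by
  have h1 := map_add (mfderiv (𝓡 3) (𝓡 3) (φ t) x) (c • v) (d • w)
  rw [map_smul, map_smul] at h1
  have h2 := congrArg (α (φ t x)) h1
  exact h2.trans ((map_add (α (φ t x)) _ _).trans (congrArg₂ (fun r s : ℝ => r + s)
    (map_smul (α (φ t x)) c _) (map_smul (α (φ t x)) d _)))

namespace IsFramedFlow

variable {α β : ∀ x : M, TangentSpace (𝓡 3) x →L[ℝ] ℝ} {U V X : ∀ x : M, TangentSpace (𝓡 3) x}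
  {φ : ℝ → M → M} (h : IsFramedFlow α β U V X φ)

include h

theorem linearIndependent (x : M) : LinearIndependent ℝ ![U x, V x, X x] := by
  rw [Fintype.linearIndependent_iff]
  intro g hg
  simp only [Fin.sum_univ_three, Matrix.cons_val_zero, Matrix.cons_val_one, Matrix.cons_val] at hg
  have h1 := congrArg (α x) hg
  have h2 := congrArg (β x) hg
  simp only [map_add, map_smul, map_zero, h.left_U, h.left_V, h.left_X, h.right_U, h.right_V,
    h.right_X, smul_eq_mul, mul_one, mul_zero, add_zero, zero_add] at h1 h2
  rw [h1, h2, zero_smul, zero_smul, zero_add, zero_add] at hg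
  have h3 := (smul_eq_zero.1 hg).resolve_right (h.ne_zero x)
  intro i
  fin_cases i
  exacts [h1, h2, h3]

theorem exists_frame (x : M) (v : TangentSpace (𝓡 3) x) :
    ∃ c : ℝ, v = α x v • U x + β x v • V x + c • X x := by
  have h1 := (h.linearIndependent x).span_eq_top_of_card_eq_finrank'
    (by rw [finrank_tangentSpace]; simp)
  have h2 : v ∈ Submodule.span ℝ (Set.range ![U x, V x, X x]) := by rw [h1]; trivial
  obtain ⟨g, hg⟩ := (Submodule.mem_span_range_iff_exists_fun ℝ).1 h2
  simp only [Fin.sum_univ_three, Matrix.cons_val_zero, Matrix.cons_val_one, Matrix.cons_val] at hg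
  have h3 := congrArg (α x) hg
  have h4 := congrArg (β x) hg
  simp only [map_add, map_smul, h.left_U, h.left_V, h.left_X, h.right_U, h.right_V,
    h.right_X, smul_eq_mul, mul_one, mul_zero, add_zero, zero_add] at h3 h4
  exact ⟨g 2, by rw [← h3, ← h4, hg]⟩

theorem mem_span_iff {x : M} {v : TangentSpace (𝓡 3) x} :
    v ∈ Submodule.span ℝ {X x} ↔ α x v = 0 ∧ β x v = 0 := by
  rw [Submodule.mem_span_singleton]
  constructor
  · rintro ⟨c, rfl⟩
    simp [h.left_X, h.right_X]
  · rintro ⟨h1, h2⟩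
    obtain ⟨c, hc⟩ := h.exists_frame x v
    exact ⟨c, by rw [hc, h1, h2]; simp⟩

theorem contMDiff_flow (t : ℝ) : ContMDiff (𝓡 3) (𝓡 3) ∞ (φ t) :=
  h.smooth_flow.comp (contMDiff_const.prodMk contMDiff_id)

theorem hasMFDerivAt_flow (t : ℝ) (x : M) :
    HasMFDerivAt (𝓡 3) (𝓡 3) (φ t) x (mfderiv (𝓡 3) (𝓡 3) (φ t) x) :=
  ((h.contMDiff_flow t).contMDiffAt.mdifferentiableAt (by simp)).hasMFDerivAt

theorem mfderiv_add (s t : ℝ) (x : M) (v : TangentSpace (𝓡 3) x) :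
    (mfderiv (𝓡 3) (𝓡 3) (φ (s + t)) x v : E3) =
      mfderiv (𝓡 3) (𝓡 3) (φ s) (φ t x) (mfderiv (𝓡 3) (𝓡 3) (φ t) x v) := by
  have h1 : HasMFDerivAt (𝓡 3) (𝓡 3) (φ s ∘ φ t) x _ :=
    HasMFDerivAt.comp x (h.hasMFDerivAt_flow s (φ t x)) (h.hasMFDerivAt_flow t x)
  have h2 : φ (s + t) = φ s ∘ φ t := funext fun x => h.group s t x
  have h3 := h.hasMFDerivAt_flow (s + t) x
  have key : ∀ (f g : M → M) (L L' : E3 →L[ℝ] E3), f = g → HasMFDerivAt (𝓡 3) (𝓡 3) f x L →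
      HasMFDerivAt (𝓡 3) (𝓡 3) g x L' → L v = L' v := by
    rintro f _ L L' rfl hf hg
    exact congrArg (fun L : E3 →L[ℝ] E3 => L v) (hasMFDerivAt_unique hf hg)
  exact key _ _ _ _ h2 h3 h1

theorem mfderiv_zero (x : M) (v : TangentSpace (𝓡 3) x) :
    (mfderiv (𝓡 3) (𝓡 3) (φ 0) x v : E3) = v := by
  have h2 : φ 0 = id := funext h.flow_zero
  have key : ∀ f : M → M, f = id → (mfderiv (𝓡 3) (𝓡 3) f x v : E3) = v := by
    rintro _ rfl
    exact congrArg (fun L : E3 →L[ℝ] E3 => L v) (mfderiv_id (I := 𝓡 3) (x := x))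
  exact key _ h2

theorem mfderiv_field (t : ℝ) (x : M) :
    (mfderiv (𝓡 3) (𝓡 3) (φ t) x (X x) : E3) = X (φ t x) := by
  have key : ∀ (z z' : M) (L : ℝ →L[ℝ] E3), z = z' → HasMFDerivAt 𝓘(ℝ, ℝ) (𝓡 3) (fun s => φ s x) 0 L →
      HasMFDerivAt 𝓘(ℝ, ℝ) (𝓡 3) (φ t ∘ fun s => φ s x) 0
        ((mfderiv (𝓡 3) (𝓡 3) (φ t) (φ 0 x) : E3 →L[ℝ] E3).comp L) :=
    fun _ _ L _ hL => HasMFDerivAt.comp (0 : ℝ) (h.hasMFDerivAt_flow t (φ 0 x)) hL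
  have h1 := key x x _ rfl (h.integral x 0)
  have h2 : HasMFDerivAt 𝓘(ℝ, ℝ) (𝓡 3) ((fun s => φ s x) ∘ fun s => s + t) 0 _ :=
    HasMFDerivAt.comp (0 : ℝ) (h.integral x (0 + t))
      (((hasDerivAt_id (0 : ℝ)).add_const t).hasFDerivAt.hasMFDerivAt)
  have h3 : (φ t ∘ fun s => φ s x) = (fun s => φ s x) ∘ fun s => s + t := by
    funext s
    simp only [Function.comp_apply]
    rw [add_comm, h.group]
  have key : ∀ (f g : ℝ → M) (L L' : ℝ →L[ℝ] E3), f = g → HasMFDerivAt 𝓘(ℝ, ℝ) (𝓡 3) f 0 L →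
      HasMFDerivAt 𝓘(ℝ, ℝ) (𝓡 3) g 0 L' → L 1 = L' 1 := by
    rintro f _ L L' rfl hf hg
    exact congrArg (fun L : ℝ →L[ℝ] E3 => L 1) (hasMFDerivAt_unique hf hg)
  have h4 := key _ _ _ _ h3 h1 h2
  have e1 : ∀ (z : M) (w : E3), z = x → w = X z →
      (mfderiv (𝓡 3) (𝓡 3) (φ t) z w : E3) = mfderiv (𝓡 3) (𝓡 3) (φ t) x (X x) := by
    rintro _ _ rfl rfl; rfl
  have e2 : ∀ s : ℝ, s = t → (X (φ s x) : E3) = X (φ t x) := by rintro _ rfl; rfl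
  refine ((e1 _ _ (h.flow_zero x) (one_smul ℝ (X (φ 0 x) : E3))).symm.trans h4).trans ?_
  refine Eq.trans ?_ (e2 _ (zero_add t))
  show (1 : ℝ →L[ℝ] ℝ) (ContinuousLinearMap.toSpanSingleton ℝ (1 : ℝ) 1) •
    (X (φ (0 + t) x) : E3) = _
  simp

theorem alongFlow_zero (θ : ∀ x : M, TangentSpace (𝓡 3) x →L[ℝ] ℝ) (x : M)
    (v : TangentSpace (𝓡 3) x) : alongFlow θ φ x v 0 = θ x v := by
  have key : ∀ (z : M) (w : E3), z = x → w = v → (θ z : E3 →L[ℝ] ℝ) w = θ x v := by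
    rintro _ _ rfl rfl; rfl
  exact key _ _ (h.flow_zero x) (h.mfderiv_zero x v)

theorem alongFlow_add (θ : ∀ x : M, TangentSpace (𝓡 3) x →L[ℝ] ℝ) (x : M)
    (v : TangentSpace (𝓡 3) x) (s t : ℝ) :
    alongFlow θ φ (φ t x) (mfderiv (𝓡 3) (𝓡 3) (φ t) x v) s = alongFlow θ φ x v (s + t) := by
  have key : ∀ (z z' : M) (w w' : E3), z = z' → w = w' →
      (θ z : E3 →L[ℝ] ℝ) w = (θ z' : E3 →L[ℝ] ℝ) w' := by
    rintro _ _ _ _ rfl rfl; rfl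
  exact (key _ _ _ _ (h.group s t x) (h.mfderiv_add s t x v)).symm

theorem alongFlow_field (x : M) (t : ℝ) :
    alongFlow α φ x (X x) t = 0 ∧ alongFlow β φ x (X x) t = 0 :=
  ⟨(congrArg (α (φ t x)) (h.mfderiv_field t x)).trans (h.left_X _),
    (congrArg (β (φ t x)) (h.mfderiv_field t x)).trans (h.right_X _)⟩

theorem alongFlow_ne_zero {x : M} {v : TangentSpace (𝓡 3) x} (hv : α x v ≠ 0 ∨ β x v ≠ 0) (t : ℝ) :
    alongFlow α φ x v t ≠ 0 ∨ alongFlow β φ x v t ≠ 0 := by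
  by_contra hc
  push Not at hc
  obtain ⟨c, hc'⟩ := Submodule.mem_span_singleton.1 (h.mem_span_iff.2 hc)
  have key : ∀ θ : ∀ x : M, TangentSpace (𝓡 3) x →L[ℝ] ℝ, (∀ x, θ x (X x) = 0) → θ x v = 0 := by
    intro θ hθ
    have h1 := h.alongFlow_add θ x v (-t) t
    rw [neg_add_cancel, h.alongFlow_zero, ← hc'] at h1
    rw [← h1]
    have h2 := map_smul (mfderiv (𝓡 3) (𝓡 3) (φ (-t)) (φ t x)) c (X (φ t x))
    refine (congrArg (θ (φ (-t) (φ t x))) (h2.trans (congrArg (fun w : E3 => c • w)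
      (h.mfderiv_field (-t) (φ t x))))).trans ?_
    refine (map_smul (θ (φ (-t) (φ t x))) c _).trans ?_
    rw [hθ, smul_zero]
  rcases hv with hv | hv
  exacts [hv (key α h.left_X), hv (key β h.right_X)]

theorem oneFormExtDeriv_field (θ : ∀ x : M, TangentSpace (𝓡 3) x →L[ℝ] ℝ) (x : M)
    (v : TangentSpace (𝓡 3) x) : oneFormExtDeriv θ x (X x) v =
      oneFormExtDeriv θ x (X x) (U x) * α x v + oneFormExtDeriv θ x (X x) (V x) * β x v := by
  obtain ⟨c, hc⟩ := h.exists_frame x v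
  have h1 := congrArg (oneFormExtDeriv θ x (X x)) hc
  rw [oneFormExtDeriv_add_right, oneFormExtDeriv_add_right, oneFormExtDeriv_smul_right,
    oneFormExtDeriv_smul_right, oneFormExtDeriv_smul_right, oneFormExtDeriv_self] at h1
  rw [h1]; ring

theorem isPlanarSolution (x : M) (v : TangentSpace (𝓡 3) x) :
    IsPlanarSolution (fun t => oneFormExtDeriv α (φ t x) (X (φ t x)) (U (φ t x)))
      (fun t => oneFormExtDeriv α (φ t x) (X (φ t x)) (V (φ t x)))
      (fun t => oneFormExtDeriv β (φ t x) (X (φ t x)) (U (φ t x)))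
      (fun t => oneFormExtDeriv β (φ t x) (X (φ t x)) (V (φ t x)))
      (alongFlow α φ x v) (alongFlow β φ x v) :=
  ⟨fun t => (hasDerivAt_flow_apply h.smooth_flow h.integral h.smooth_left h.left_X x v t).congr_deriv
      (h.oneFormExtDeriv_field α _ _),
    fun t => (hasDerivAt_flow_apply h.smooth_flow h.integral h.smooth_right h.right_X x v
      t).congr_deriv (h.oneFormExtDeriv_field β _ _)⟩

/-- The vectors which stay in a cone for all times form an invariant plane field. -/
theorem exists_plane {m C δ σ : ℝ} (hδ : δ * δ = 1) (hσ : σ * σ = 1) {x : M}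
    (hc : IsConeSystem m C (fun t => oneFormExtDeriv α (φ t x) (X (φ t x)) (U (φ t x)))
      (fun t => σ * oneFormExtDeriv α (φ t x) (X (φ t x)) (V (φ t x)))
      (fun t => σ * oneFormExtDeriv β (φ t x) (X (φ t x)) (U (φ t x)))
      (fun t => oneFormExtDeriv β (φ t x) (X (φ t x)) (V (φ t x)))) :
    ∃ E : Submodule ℝ (TangentSpace (𝓡 3) x), Module.finrank ℝ E = 2 ∧ ∀ v, v ∈ E ↔
      ∀ t, 0 ≤ δ * σ * (alongFlow α φ x v t * alongFlow β φ x v t) := by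
  obtain ⟨c, d, hcd, hpos⟩ := hc.exists_signed_solution hδ hσ (h.isPlanarSolution x (U x))
    (h.isPlanarSolution x (V x))
  obtain ⟨v₀, hv₀⟩ : ∃ v₀, v₀ = c • U x + d • V x := ⟨_, rfl⟩
  have hα₀ : α x v₀ = c := by
    simp only [hv₀, map_add, map_smul, h.left_U, h.left_V, smul_eq_mul]; ring
  have hβ₀ : β x v₀ = d := by
    simp only [hv₀, map_add, map_smul, h.right_U, h.right_V, smul_eq_mul]; ring
  have hpos₀ : ∀ t, 0 ≤ δ * σ * (alongFlow α φ x v₀ t * alongFlow β φ x v₀ t) := fun t => by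
    rw [hv₀, alongFlow_linear, alongFlow_linear]; exact hpos t
  have hne₀ : α x v₀ ≠ 0 ∨ β x v₀ ≠ 0 := by
    rw [hα₀, hβ₀]
    by_contra hc'
    push Not at hc'
    rw [hc'.1, hc'.2] at hcd
    norm_num at hcd
  have hp₀ := hc.signed_pos hδ hσ (h.isPlanarSolution x v₀) hpos₀ (h.alongFlow_ne_zero hne₀)
  have hα0 : α x v₀ ≠ 0 := by
    have := hp₀ 0
    rw [h.alongFlow_zero, h.alongFlow_zero] at this
    exact left_ne_zero_of_mul (right_ne_zero_of_mul this.ne')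
  refine ⟨Submodule.span ℝ {X x, v₀}, ?_, fun v => ⟨fun hv t => ?_, fun hv => ?_⟩⟩
  · have hli : LinearIndependent ℝ ![X x, v₀] := by
      rw [LinearIndependent.pair_iff]
      intro s t hst
      have h1 := congrArg (α x) hst
      rw [map_add, map_smul, map_smul, h.left_X, smul_zero, zero_add, map_zero, smul_eq_mul] at h1
      have ht := (mul_eq_zero.1 h1).resolve_right hα0
      rw [ht, zero_smul, add_zero] at hst
      exact ⟨(smul_eq_zero.1 hst).resolve_right (h.ne_zero x), ht⟩
    have h2 := finrank_span_eq_card hli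
    rwa [Matrix.range_cons_cons_empty, Fintype.card_fin] at h2
  · obtain ⟨s, t', rfl⟩ := Submodule.mem_span_pair.1 hv
    rw [alongFlow_linear, alongFlow_linear, (h.alongFlow_field x t).1, (h.alongFlow_field x t).2]
    have := mul_nonneg (sq_nonneg t') (hpos₀ t)
    linarith
  · by_cases hv0 : α x v ≠ 0 ∨ β x v ≠ 0
    · have hp := hc.signed_pos hδ hσ (h.isPlanarSolution x v) hv (h.alongFlow_ne_zero hv0)
      have hcr := hc.signed_cross_eq hδ hσ (h.isPlanarSolution x v) (h.isPlanarSolution x v₀) hp hp₀ 0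
      simp only [h.alongFlow_zero] at hcr
      have hw : v - (α x v / α x v₀) • v₀ ∈ Submodule.span ℝ {X x} := by
        rw [h.mem_span_iff]
        simp only [map_sub, map_smul, smul_eq_mul]
        constructor
        · field_simp; ring
        · field_simp; linarith
      obtain ⟨e, he⟩ := Submodule.mem_span_singleton.1 hw
      rw [Submodule.mem_span_pair]
      exact ⟨e, α x v / α x v₀, by rw [he]; abel⟩
    · push Not at hv0
      exact Submodule.span_mono (by simp) (h.mem_span_iff.2 hv0)

end IsFramedFlow

end ConeFlow

section ProjectivelyAnosovFlow

variable {M : Type u} [TopologicalSpace M] [ChartedSpace (EuclideanSpace ℝ (Fin 3)) M]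
  [IsManifold (𝓡 3) ∞ M] {o : ∀ x : M, Orientation ℝ (TangentSpace (𝓡 3) x) (Fin 3)}
  {α β : ∀ x : M, TangentSpace (𝓡 3) x →L[ℝ] ℝ} {U V X : ∀ x : M, TangentSpace (𝓡 3) x}
  {φ : ℝ → M → M}

/-- The two contact conditions: the derivatives of `α` and `β` along the flow rotate the planes in
opposite directions. -/
theorem IsFramedFlow.mul_pos_of_contact (h : IsFramedFlow α β U V X φ) {ς : ℝ} {x : M}
    (hα : IsContactAt o (-ς) α x) (hβ : IsContactAt o ς β x) :
    0 < oneFormExtDeriv α x (X x) (V x) * oneFormExtDeriv β x (X x) (U x) := by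
  have hςne : ς ^ 2 ≥ 0 := sq_nonneg ς
  have h1 : ∀ q r : ℝ, 0 < ς * q → 0 < ς * r → 0 < q * r := by
    intro q r hq hr
    have h2 := mul_pos hq hr
    have h3 : ς * q * (ς * r) = ς ^ 2 * (q * r) := by ring
    rw [h3] at h2
    exact pos_of_mul_pos_right h2 hςne
  rcases isPositiveTriple_or (o := o) (h.linearIndependent x) with hp | hp
  · have k1 := hα _ _ _ hp
    have k2 := hβ _ _ _ hp
    simp only [contactVolume, h.left_U, h.left_V, h.left_X, h.right_U, h.right_V, h.right_X] at k1 k2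
    rw [oneFormExtDeriv_swap α x (V x) (X x)] at k1
    exact h1 _ _ (by linarith) (by linarith)
  · have k1 := hα _ _ _ hp
    have k2 := hβ _ _ _ hp
    simp only [contactVolume, h.left_U, h.left_V, h.left_X, h.right_U, h.right_V, h.right_X] at k1 k2
    rw [oneFormExtDeriv_swap β x (U x) (X x)] at k2
    rw [← neg_mul_neg]
    exact h1 _ _ (by linarith) (by linarith)

/-- On a compact manifold the coefficients of the linearized flow are uniformly controlled. -/
theorem IsFramedFlow.exists_isConeSystem [CompactSpace M] (h : IsFramedFlow α β U V X φ)
    (hX : IsSmoothVectorField X) (hU : IsSmoothVectorField U) (hV : IsSmoothVectorField V)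
    (hqr : ∀ x, 0 < oneFormExtDeriv α x (X x) (V x) * oneFormExtDeriv β x (X x) (U x)) :
    ∃ (m C : ℝ) (σ : M → ℝ), 0 < m ∧ 0 < C ∧ (∀ x, σ x * σ x = 1) ∧ (∀ t x, σ (φ t x) = σ x) ∧
      ∀ x, IsConeSystem m C (fun t => oneFormExtDeriv α (φ t x) (X (φ t x)) (U (φ t x)))
      (fun t => σ x * oneFormExtDeriv α (φ t x) (X (φ t x)) (V (φ t x)))
      (fun t => σ x * oneFormExtDeriv β (φ t x) (X (φ t x)) (U (φ t x)))
      (fun t => oneFormExtDeriv β (φ t x) (X (φ t x)) (V (φ t x))) := by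
  have hcont : ∀ {θ : ∀ x : M, TangentSpace (𝓡 3) x →L[ℝ] ℝ} {W : ∀ x : M, TangentSpace (𝓡 3) x},
      IsSmoothOneForm θ → IsSmoothVectorField W →
        Continuous fun x => oneFormExtDeriv θ x (X x) (W x) := fun hθ hW =>
    continuous_iff_continuousAt.2 fun x =>
      (hθ.extDeriv_along (b := fun x => x) hX.contMDiffAt (hW.contMDiffAt (x := x))).continuousAt
  have hp := hcont h.smooth_left hU
  have hq := hcont h.smooth_left hV
  have hr := hcont h.smooth_right hU
  have hs := hcont h.smooth_right hV
  generalize hP : (fun x => oneFormExtDeriv α x (X x) (U x)) = p at hp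
  generalize hQ : (fun x => oneFormExtDeriv α x (X x) (V x)) = q at hq
  generalize hR : (fun x => oneFormExtDeriv β x (X x) (U x)) = r at hr
  generalize hS : (fun x => oneFormExtDeriv β x (X x) (V x)) = s at hs
  have eP : ∀ x, oneFormExtDeriv α x (X x) (U x) = p x := fun x => congrFun hP x
  have eQ : ∀ x, oneFormExtDeriv α x (X x) (V x) = q x := fun x => congrFun hQ x
  have eR : ∀ x, oneFormExtDeriv β x (X x) (U x) = r x := fun x => congrFun hR x
  have eS : ∀ x, oneFormExtDeriv β x (X x) (V x) = s x := fun x => congrFun hS x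
  simp only [eP, eQ, eR, eS] at hqr ⊢
  have hq0 : ∀ x, q x ≠ 0 := fun x => left_ne_zero_of_mul (hqr x).ne'
  have hr0 : ∀ x, r x ≠ 0 := fun x => right_ne_zero_of_mul (hqr x).ne'
  have hφ : ∀ x, Continuous fun t => φ t x := fun x =>
    h.smooth_flow.continuous.comp (continuous_id.prodMk continuous_const)
  obtain ⟨C₀, hC₀⟩ : BddAbove (Set.range fun x => |p x| + |q x| + |r x| + |s x| + |q x|⁻¹ + |r x|⁻¹) := by
    refine (isCompact_range ?_).bddAbove
    exact ((((hp.abs.add hq.abs).add hr.abs).add hs.abs).add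
      (hq.abs.inv₀ fun x => abs_ne_zero.2 (hq0 x))).add
      (hr.abs.inv₀ fun x => abs_ne_zero.2 (hr0 x))
  have hb : ∀ x, |p x| + |q x| + |r x| + |s x| + |q x|⁻¹ + |r x|⁻¹ ≤ max C₀ 1 := fun x =>
    (hC₀ ⟨x, rfl⟩).trans (le_max_left _ _)
  have hC : 0 < max C₀ 1 := lt_max_of_lt_right one_pos
  generalize max C₀ 1 = C at hb hC
  have hpos : ∀ x, 0 < |q x|⁻¹ ∧ 0 < |r x|⁻¹ := fun x =>
    ⟨inv_pos.2 (abs_pos.2 (hq0 x)), inv_pos.2 (abs_pos.2 (hr0 x))⟩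
  let σ : M → ℝ := fun x => if 0 < q x then 1 else -1
  have hσ : ∀ x, σ x * σ x = 1 := by
    intro x
    by_cases hx : 0 < q x <;> simp [σ, hx]
  have hσφ : ∀ t x, σ (φ t x) = σ x := by
    intro t x
    have hc : Continuous fun t => q (φ t x) := hq.comp (hφ x)
    have hnot : ¬∃ t, q (φ t x) = 0 := fun ⟨t, ht⟩ => hq0 _ ht
    have key : ∀ a b, 0 < q (φ a x) → 0 < q (φ b x) := by
      intro a b ha
      by_contra hb
      exact hnot (mem_range_of_exists_le_of_exists_ge hc ⟨b, not_lt.1 hb⟩ ⟨a, ha.le⟩)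
    have h1 : 0 < q (φ t x) ↔ 0 < q x := by
      have h2 := key 0 t
      have h3 := key t 0
      rw [h.flow_zero] at h2 h3
      exact ⟨h3, h2⟩
    simp only [σ, h1]
  have hσq : ∀ x, σ x * q x = |q x| ∧ σ x * r x = |r x| := by
    intro x
    have hqr' := hqr x
    by_cases hx : 0 < q x
    · have hr' := pos_of_mul_pos_right hqr' hx.le
      simp [σ, hx, abs_of_pos hr', abs_of_pos hx]
    · have hx' : q x < 0 := lt_of_le_of_ne (not_lt.1 hx) (hq0 x)
      have hr' : r x < 0 := by
        by_contra hc
        exact absurd hqr' (not_lt.2 (mul_nonpos_of_nonpos_of_nonneg hx'.le (not_lt.1 hc)))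
      simp [σ, hx, abs_of_neg hr', abs_of_neg hx']
  refine ⟨C⁻¹, C, σ, inv_pos.2 hC, hC, hσ, hσφ, fun x => ?_⟩
  have eq : ∀ t, σ x * q (φ t x) = |q (φ t x)| := fun t => by rw [← hσφ t x, (hσq _).1]
  have er : ∀ t, σ x * r (φ t x) = |r (φ t x)| := fun t => by rw [← hσφ t x, (hσq _).2]
  have hinv : ∀ y : ℝ, 0 < |y|⁻¹ → |y|⁻¹ ≤ C → C⁻¹ ≤ |y| := fun y h1 h2 => by
    rw [← inv_inv |y|]; exact inv_anti₀ h1 h2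
  refine ⟨inv_pos.2 hC, hp.comp (hφ x), hs.comp (hφ x), fun t => ?_, fun t => ?_, fun t => ?_,
    fun t => ?_, fun t => ?_, fun t => ?_⟩ <;>
  have h1 := hb (φ t x) <;> have h2 := hpos (φ t x) <;> have h3 := abs_nonneg (p (φ t x)) <;>
  have h4 := abs_nonneg (q (φ t x)) <;> have h5 := abs_nonneg (r (φ t x)) <;>
  have h6 := abs_nonneg (s (φ t x))
  · rw [eq]; exact hinv _ h2.1 (by linarith [h2.2])
  · rw [er]; exact hinv _ h2.2 (by linarith [h2.1])
  · linarith [h2.1, h2.2]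
  · rw [eq]; linarith [h2.1, h2.2]
  · rw [er]; linarith [h2.1, h2.2]
  · linarith [h2.1, h2.2]

/-- The flow defined by a bi-contact structure on a compact manifold is projectively Anosov. -/
theorem isProjectivelyAnosov_of_contact [T2Space M] [CompactSpace M] {ς : ℝ}
    (hα : IsSmoothOneForm α) (hβ : IsSmoothOneForm β) (hαc : ∀ x, IsContactAt o (-ς) α x)
    (hβc : ∀ x, IsContactAt o ς β x) (hli : ∀ x, LinearIndependent ℝ ![α x, β x])
    (hX : IsDefinedBy X α β) : IsProjectivelyAnosov X := by
  obtain ⟨φ, hφ, hφ0, hφi, hφg⟩ := exists_global_flow hX.1 isCompact_univ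
    (fun x hx => absurd (Set.mem_univ x) hx)
  obtain ⟨U, hU, hU1⟩ := exists_smooth_field hα hβ hli
  obtain ⟨V, hV, hV1⟩ := exists_smooth_field hβ hα fun x => by
    have := hli x
    rw [LinearIndependent.pair_iff] at this ⊢
    intro s t hst
    exact (this t s (by rw [add_comm]; exact hst)).symm
  obtain ⟨γ, hγ, hγ1⟩ := exists_smooth_oneForm hX.1 fun x => (hX.2 x).1
  have h : IsFramedFlow α β U V X φ := ⟨hα, hβ, fun x => (hX.2 x).2.1, fun x => (hX.2 x).2.2,
    fun x => (hU1 x).1, fun x => (hU1 x).2, fun x => (hV1 x).2, fun x => (hV1 x).1,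
    fun x => (hX.2 x).1, hφ, hφ0, hφi, hφg⟩
  obtain ⟨m, C, σ, hm, hC, hσ, hσφ, hcone⟩ := h.exists_isConeSystem hX.1 hU hV
    fun x => h.mul_pos_of_contact (hαc x) (hβc x)
  have hinj : ∀ x v, α x v = 0 → β x v = 0 → γ x v = 0 → v = 0 := by
    intro x v h1 h2 h3
    obtain ⟨c, rfl⟩ := Submodule.mem_span_singleton.1 (h.mem_span_iff.2 ⟨h1, h2⟩)
    rw [map_smul, hγ1, smul_eq_mul, mul_one] at h3
    rw [h3, zero_smul]
  have hXs : ∀ x, α x (X x) = 0 ∧ β x (X x) = 0 ∧ γ x (X x) = 1 := fun x =>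
    ⟨h.left_X x, h.right_X x, hγ1 x⟩
  have e1 : (1 : ℝ) * 1 = 1 := one_mul 1
  have e2 : (-1 : ℝ) * -1 = 1 := by norm_num
  choose Eu hEu2 hEu using fun x => h.exists_plane e1 (hσ x) (hcone x)
  choose Es hEs2 hEs using fun x => h.exists_plane e2 (hσ x) (hcone x)
  have hinv : ∀ δ : ℝ, ∀ (t : ℝ) (x : M) (v : TangentSpace (𝓡 3) x),
      (∀ s, 0 ≤ δ * σ x * (alongFlow α φ x v s * alongFlow β φ x v s)) →
      ∀ s, 0 ≤ δ * σ (φ t x) * (alongFlow α φ (φ t x) (mfderiv (𝓡 3) (𝓡 3) (φ t) x v) s *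
        alongFlow β φ (φ t x) (mfderiv (𝓡 3) (𝓡 3) (φ t) x v) s) := by
    intro δ t x v hv s
    rw [h.alongFlow_add, h.alongFlow_add, hσφ]
    exact hv _
  have hne : ∀ {x : M} {v : TangentSpace (𝓡 3) x}, v ∉ Submodule.span ℝ {X x} →
      α x v ≠ 0 ∨ β x v ≠ 0 := by
    intro x v hv
    rw [h.mem_span_iff] at hv
    tauto
  refine ⟨φ, hφ.of_le (by simp), hφ0, hφi, Eu, Es, sumSqMetric hα hβ hγ hinj, m / (6 * C), 2 * m,
    by positivity, by positivity, fun x => ⟨hEu2 x, hEs2 x, ?_⟩, ?_, ?_, ?_⟩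
  · ext v
    rw [Submodule.mem_inf, hEu, hEs]
    constructor
    · rintro ⟨h1, h2⟩
      by_contra hv
      have h3 := (hcone x).signed_pos e1 (hσ x) (h.isPlanarSolution x v) h1
        (h.alongFlow_ne_zero (hne hv)) 0
      linarith [h2 0]
    · intro hv
      obtain ⟨c, rfl⟩ := Submodule.mem_span_singleton.1 hv
      have h0 : ∀ t, alongFlow α φ x (c • X x) t = 0 := fun t => by
        have := alongFlow_linear α φ x (X x) 0 c 0 t
        rw [smul_zero, add_zero, (h.alongFlow_field x t).1] at this
        rw [this]; ring
      simp only [h0, zero_mul, mul_zero, le_refl, implies_true, and_self]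
  · intro t x v hv
    exact (hEu _ _).2 (hinv 1 t x v ((hEu x v).1 hv))
  · intro t x v hv
    exact (hEs _ _).2 (hinv (-1) t x v ((hEs x v).1 hv))
  · intro t x ht v hv w hw hvX hwX
    have k1 := (hcone x).signed_pos e1 (hσ x) (h.isPlanarSolution x v) ((hEu x v).1 hv)
      (h.alongFlow_ne_zero (hne hvX))
    have k2 := (hcone x).signed_pos e2 (hσ x) (h.isPlanarSolution x w) ((hEs x w).1 hw)
      (h.alongFlow_ne_zero (hne hwX))
    have k3 := (hcone x).dominated (hσ x) (h.isPlanarSolution x v) (h.isPlanarSolution x w) k1 k2 ht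
    simp only [h.alongFlow_zero] at k3
    simp only [quotientNorm_sumSqMetric hα hβ hγ hinj hXs]
    exact k3

end ProjectivelyAnosovFlow

section Signs

variable {M : Type u} [TopologicalSpace M] [ChartedSpace (EuclideanSpace ℝ (Fin 3)) M]
  [IsManifold (𝓡 3) ∞ M] {o : ∀ x : M, Orientation ℝ (TangentSpace (𝓡 3) x) (Fin 3)}
  {α β : ∀ x : M, TangentSpace (𝓡 3) x →L[ℝ] ℝ}

theorem exists_sign_of_isBiContact (h : IsBiContact o α β) : ∃ ς : ℝ, ς * ς = 1 ∧
    IsSmoothOneForm α ∧ IsSmoothOneForm β ∧ (∀ x, IsContactAt o (-ς) α x) ∧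
      ∀ x, IsContactAt o ς β x := by
  rcases h.1 with ⟨h1, h2⟩ | ⟨h1, h2⟩
  · rw [isNegativeContactForm_iff] at h1
    rw [isPositiveContactForm_iff] at h2
    exact ⟨1, one_mul 1, h1.1, h2.1, h1.2, h2.2⟩
  · rw [isPositiveContactForm_iff] at h1
    rw [isNegativeContactForm_iff] at h2
    exact ⟨-1, by norm_num, h1.1, h2.1, by rw [neg_neg]; exact h1.2, h2.2⟩

theorem isBiContact_of_isContactAt {ς : ℝ} (hς : ς * ς = 1) (hα : IsSmoothOneForm α)
    (hβ : IsSmoothOneForm β) (hαc : ∀ x, IsContactAt o (-ς) α x) (hβc : ∀ x, IsContactAt o ς β x)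
    (hli : ∀ x, LinearIndependent ℝ ![α x, β x]) : IsBiContact o α β := by
  refine ⟨?_, hli⟩
  rcases mul_self_eq_one_iff.1 hς with rfl | rfl
  · exact Or.inl ⟨isNegativeContactForm_iff.2 ⟨hα, hαc⟩, isPositiveContactForm_iff.2 ⟨hβ, hβc⟩⟩
  · rw [neg_neg] at hαc
    exact Or.inr ⟨isPositiveContactForm_iff.2 ⟨hα, hαc⟩, isNegativeContactForm_iff.2 ⟨hβ, hβc⟩⟩

theorem eq_of_isContactAt {ς ς' : ℝ} (hς : ς * ς = 1) (hς' : ς' * ς' = 1) {x : M}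
    (h : IsContactAt o ς β x) (h' : IsContactAt o ς' β x) : ς = ς' := by
  obtain ⟨u, v, w, hp⟩ := exists_isPositiveTriple o x
  have h1 := h u v w hp
  have h2 := h' u v w hp
  rcases mul_self_eq_one_iff.1 hς with rfl | rfl <;>
    rcases mul_self_eq_one_iff.1 hς' with rfl | rfl <;> first | rfl | linarith

theorem isPositiveContactForm_iff_of_isContactAt {M' : Type u} [TopologicalSpace M']
    [ChartedSpace (EuclideanSpace ℝ (Fin 3)) M'] [IsManifold (𝓡 3) ∞ M']
    {o' : ∀ x : M', Orientation ℝ (TangentSpace (𝓡 3) x) (Fin 3)}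
    {β' : ∀ x : M', TangentSpace (𝓡 3) x →L[ℝ] ℝ} {ς : ℝ} (hς : ς * ς = 1)
    (hβ : IsSmoothOneForm β) (hβ' : IsSmoothOneForm β') (hβc : ∀ x, IsContactAt o ς β x)
    (hβc' : ∀ x, IsContactAt o' ς β' x) (x : M) (x' : M') :
    IsPositiveContactForm o' β' ↔ IsPositiveContactForm o β := by
  simp only [isPositiveContactForm_iff, hβ, hβ', true_and]
  constructor
  · intro h
    rwa [eq_of_isContactAt hς (one_mul 1) (hβc' x') (h x')] at hβc
  · intro h
    rwa [eq_of_isContactAt hς (one_mul 1) (hβc x) (h x)] at hβc'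

end Signs

end

theorem theoremA {M : Type u} [TopologicalSpace M] [ChartedSpace (EuclideanSpace ℝ (Fin 3)) M]
    [IsManifold (𝓡 3) ∞ M] [T2Space M] [SecondCountableTopology M]
    (o : ∀ x : M, Orientation ℝ (TangentSpace (𝓡 3) x) (Fin 3))
    (α β : ∀ x : M, TangentSpace (𝓡 3) x →L[ℝ] ℝ) (hbi : IsBiContact o α β)
    (X : ∀ x : M, TangentSpace (𝓡 3) x) (hX : IsDefinedBy X α β)
    (K : Circle → M) (hK : IsLegendrianTransverseKnot α β K) :
    ∃ (Φ : AnnulusBox M) (ε ε₁ τ : ℝ), IsSurgeryFlowBox o α X K Φ ε ε₁ τ ∧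
      ∀ q : ℤ,
        ((IsPositiveContactForm o β ∧ 0 ≤ q) ∨ (IsNegativeContactForm o β ∧ q ≤ 0)) →
        ∀ g : ℝ → ℝ, IsShearProfile g →
          ∃ (M' : Type u) (_ : TopologicalSpace M')
            (_ : ChartedSpace (EuclideanSpace ℝ (Fin 3)) M') (_ : IsManifold (𝓡 3) ∞ M')
            (_ : T2Space M') (_ : SecondCountableTopology M')
            (j : PartialDiffeo3 M M') (Ψ : AnnulusBox M')
            (o' : ∀ x : M', Orientation ℝ (TangentSpace (𝓡 3) x) (Fin 3))
            (α' β' : ∀ x : M', TangentSpace (𝓡 3) x →L[ℝ] ℝ)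
            (X' : ∀ x : M', TangentSpace (𝓡 3) x),
            IsShearSurgery Φ ε q g j Ψ ∧
            PreservesOrientation j o o' ∧
            IsContactFramedDehnSurgery o α K q o' ∧
            IsBiContact o' α' β' ∧
            (IsPositiveContactForm o' β' ↔ IsPositiveContactForm o β) ∧
            IsDefinedBy X' α' β' ∧
            (∀ x ∈ j.source, mfderiv (𝓡 3) (𝓡 3) j x (X x) = X' (j x)) ∧
            (∀ x ∉ Φ.target, ∀ v : TangentSpace (𝓡 3) x,
              (α' (j x) (mfderiv (𝓡 3) (𝓡 3) j x v) = 0 ↔ α x v = 0) ∧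
              (β' (j x) (mfderiv (𝓡 3) (𝓡 3) j x v) = 0 ↔ β x v = 0)) ∧
            (CompactSpace M → CompactSpace M' ∧ IsProjectivelyAnosov X') := by
  have : LocallyCompactSpace M := Manifold.locallyCompact_of_finiteDimensional (𝓡 3)
  obtain ⟨ς, hς, hα, hβ, hαc, hβc⟩ := exists_sign_of_isBiContact hbi
  obtain ⟨Φ, ε₁, τ, T, A, B, ρ, σ, hbox⟩ := exists_surgeryBox hα hβ hbi.2 hX hαc hβc hK
  have hτ : 0 < τ := by linarith [hbox.T_pos, hbox.T_lt]
  have hε : 0 < min ε₁ τ / 2 := half_pos (lt_min hbox.pos hτ)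
  have h1 : 2 * (min ε₁ τ / 2) ≤ ε₁ := by linarith [min_le_left ε₁ τ]
  have h2 : 2 * (min ε₁ τ / 2) ≤ τ := by linarith [min_le_right ε₁ τ]
  have hlt : min ε₁ τ / 2 < ε₁ := by linarith
  have hflow := hbox.isSurgeryFlowBox hε hlt
  refine ⟨Φ, min ε₁ τ / 2, ε₁, τ, hflow, fun q hq g hg => ?_⟩
  have hςq : 0 ≤ ς * q := by
    rcases hq with ⟨h3, h4⟩ | ⟨h3, h4⟩
    · rw [eq_of_isContactAt hς (by norm_num) (hβc (K 1)) ((isPositiveContactForm_iff.1 h3).2 (K 1)),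
        one_mul]
      exact_mod_cast h4
    · rw [eq_of_isContactAt hς (by norm_num) (hβc (K 1)) ((isNegativeContactForm_iff.1 h3).2 (K 1)),
        neg_one_mul, neg_nonneg]
      exact_mod_cast h4
  let I : SurgeryInput M := ⟨Φ, min ε₁ τ / 2, ε₁, τ, q, g, hε, hlt, hτ, hbox.source_eq, hg⟩
  obtain ⟨α', β', hα', hβ', hαc', hβc', hli', hX', hout⟩ := SurgeryInput.exists_new_forms (I := I)
    hbox hς hςq hα hβ hαc hβc hbi.2 hX
  have hsource : ∀ x ∉ Φ.target, x ∉ I.Φ.annulus I.ε := fun x hx hC => hx (I.annulus_subset hC)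
  refine ⟨I.Surgered, inferInstance, inferInstance, inferInstance, inferInstance,
    I.gluing.secondCountable, I.outer, I.inner, I.orient o, α', β', I.field X, I.isShearSurgery,
    SurgeryInput.preservesOrientation_outer,
    SurgeryInput.isContactFramedDehnSurgery h1 h2 hbox.oriented hbox.core hflow.contact_framing,
    isBiContact_of_isContactAt hς hα' hβ' hαc' hβc' hli',
    isPositiveContactForm_iff_of_isContactAt hς hβ hβ' hβc hβc' (K 1) (K 1 : M), hX',
    fun x hx => SurgeryInput.outer_field hx, fun x hx v => ?_, fun hM => ?_⟩
  · have h3 := congrArg (fun L : E3 →L[ℝ] E3 => L v) (I.mfderiv_outer (hsource x hx))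
    obtain ⟨h4, h5⟩ := hout x hx
    have k4 : (α' (I.outer x) : E3 →L[ℝ] ℝ) (mfderiv (𝓡 3) (𝓡 3) I.outer x v) = α x v :=
      (congrArg (α' (I.outer x) : E3 →L[ℝ] ℝ) h3).trans
        (congrArg (fun L : E3 →L[ℝ] ℝ => L v) h4)
    have k5 : (β' (I.outer x) : E3 →L[ℝ] ℝ) (mfderiv (𝓡 3) (𝓡 3) I.outer x v) = β x v :=
      (congrArg (β' (I.outer x) : E3 →L[ℝ] ℝ) h3).trans
        (congrArg (fun L : E3 →L[ℝ] ℝ => L v) h5)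
    exact ⟨Eq.congr k4 rfl, Eq.congr k5 rfl⟩
  · have := I.compactSpace
    exact ⟨this, isProjectivelyAnosov_of_contact hα' hβ' hαc' hβc' hli' hX'⟩
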